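/- Let $k$ be a commutative ring. **Words and trees.** $F_2S(n)$ is the free $k$-module on the words $W$ over $\{1,\dots,n\}$ in which every letter occurs, no letter is immediately repeated, and no pattern $\dots u\dots v\dots u\dots v\dots$ with $u\neq v$ occurs; $\deg W=|W|-n$. A letter $a$ is *interposed* in $W$ if $W=\dots ba\dots b\dots$. The composition is $W\circ_iW'=\sum_X\operatorname{sgn}(X)X$ over the words $X$ of degree $\deg W+\deg W'$ such that, up to relabelling and deletion of immediate repetitions, $W'$ is the restriction of $X$ to the inserted letters and $W$ arises from $X$ by collapsing the inserted letters to $i$; $\operatorname{sgn}(X)$ is the sign of the shuffle of the interposed letters of $W$ and $W'$ into those of $X$, ordered by first occurrence. The boundary is $\partial W=\sum_j\pm\partial_jW$, where $\partial_j$ deletes the $j$-th letter (and is $0$ if that letter occurs only once), with sign $(-1)^s$ if the $j$-th letter is the $s$-th caesura (non-last occurrence) of $W$, and $(-1)^{s+1}$ if it is a last occurrence whose previous occurrence is the $s$-th caesura. $\mathrm{Brace}(n)$ is the free $k$-module on planar rooted trees $T$ with vertex set $\{1,\dots,n\}$, with $T\circ_iT'$ the sum of all trees containing $T'$ as a subtree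 whose contraction to $i$ gives $T$. Write $<$ for the vertical order (root smallest) and $\lhd$ for the left-to-right order of vertices. $\mathrm{Quilt}(n)\subseteq F_2S(n)\otimes \mathrm{Brace}(n)$ is spanned by the $(W,T)$ such that $W=\dots u\dots v\dots$ implies $v\not<_Tu$, and $W=\dots u\dots v\dots u\dots$ with $u\ne v$ implies $v\lhd_Tu$; its grading is $\deg W$, and $\partial(W,T)=(\partial W,T)$. **Patchworks.** $\mathrm{NSOp}$ is the $\mathbb N$-coloured operad whose operations in $\mathrm{NSOp}(p_1,\dots,p_n;p)$ are the planar rooted trees with vertex set $\{1,\dots,n\}$, $n\geq1$, in which vertex $a$ has $p_a$ ordered inputs, every input being free or the place of a child, with $p$ free inputs in all. $\mathrm{mNSOp}$ is generated by $\mathrm{NSOp}$ and $m\in \mathrm{mNSOp}(\,;2)$ subject to associativity of $m$. $\mathrm{Patch}((q_1,p_1),\dots,(q_n,p_n);(q,p))$ is the set of the $(X,J)\in \mathrm{mNSOp}(q_1,\dots,q_n;q)\times \mathrm{NSOp}(p_1,\dots,p_n;p)$ such that $a<_Jb\Rightarrow a\lhd_Xb$ and $a<_Xb\Rightarrow b\lhd_Ja$;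 its degree is $\sum_a(q_a+p_a-1)-(q+p-1)$. $\mathrm{Patch}_s(n)$ is the submodule of the product over all colours of the free modules on these sets that is generated by the families of constant degree. Its composition is that of the coloured operad ($0$ if colours do not match), and composition and symmetric group actions carry the Koszul signs for inputs of degrees $q_a+p_a-1$. With $D_q=m\circ_2\mathrm{id}_q+\sum_{i=1}^q(-1)^i\,\mathrm{id}_q\circ_im+(-1)^{q+1}m\circ_1\mathrm{id}_q$ and $(D,1)=(D_q,\mathrm{id}_p)_{q,p}\in \mathrm{Patch}_s(1)$, put $\partial_{(D,1)}x=(D,1)\circ_1x-(-1)^{|x|}\sum_ix\circ_i(D,1)$. **Colourings.** $I\in \mathrm{NSOp}(p_1,\dots,p_n;p)$ is a colouring of the tree $T$ if its underlying planar tree is $T$. $X\in \mathrm{mNSOp}(q_1,\dots,q_n;q)$ is a colouring of the word $W$ if each vertex plugged by $m$ has exactly two children and $W$ is the word of $X$: walk around the tree from left to right, starting and ending at the root, writing a vertex at every visit ($a\,W(T_1)\,a\cdots a\,W(T_s)\,a$ for root $a$ and branches $T_1,\dots,T_s$), and omit the vertices plugged by $m$. For a vertex $a$ let $\zeta_a(t)$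 be the number of free inputs of the whole tree to the left of the $t$-th gap between the inputs of $a$ (gaps numbered from $0$). For the signs, colours $q_a$ or $p_a$ equal to $0$ are replaced by $2$. Then $\operatorname{sgn}_T(I)$ is the sign of the rearrangement of the letters $i_a$, $1\le i\le p_a-1$, from lexicographic order (first in $a$, then in $i$) to the order of the positions $\zeta_a(i)$; and $\operatorname{sgn}_W(X)$ is the sign of the rearrangement of the letters $i_a$, $0\le i\le q_a-1$, from lexicographic order to the word which begins with the $0_a$, $a$ interposed, in reverse order of first occurrence in $W$, followed by the other letters in the order of the positions $\zeta_a(i)$. Finally $(-1)^\sigma$ is the Koszul sign of $q_1,\dots,q_n,p_1-1,\dots,p_n-1\leadsto q_1,p_1-1,\dots,q_n,p_n-1$. **Proposition.** $(\mathrm{Quilt},\partial)$ and $(\mathrm{Patch}_s,\partial_{(D,1)})$ are dg operads. The linear maps $\bar\phi\otimes_H\phi$ on $F_2S(n)\otimes \mathrm{Brace}(n)$ which send $(W,T)$ to the family $$\sum_{X,I}\operatorname{sgn}_W(X)\operatorname{sgn}_T(I)(-1)^{\sigma}\,(X,I),$$ the sum over the colourings $X$ of $W$ and $I$ of $T$ of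 the given colours, map $\mathrm{Quilt}(n)$ into $\mathrm{Patch}_s(n)$, and their restriction is a morphism of dg operads $$\bar\phi\otimes_H\phi:(\mathrm{Quilt},\partial)\longrightarrow(\mathrm{Patch}_s,\partial_{(D,1)}),$$ that is, it preserves degrees, the unit, partial compositions, symmetric group actions and differentials. -/

import Mathlib

/-!
# Quilts, patchworks, and the colouring map between them

Conventions. All operads are operads of `k`-modules in partial-composition form; the arity-`n` inputs
are the elements of `Fin n`. If `x` has arity `n` and `y` has arity `m`, then `x ∘ᵢ y` has arity `r` with
`r + 1 = n + m`. Gradings are homological (the differential lowers the degree by one).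
-/

noncomputable section

namespace QuiltPatch

universe u

/-! ## Relabelling of inputs in a partial composition -/

/-- The inputs of the inserted operation are placed consecutively, starting at `i`. -/
def inner {n m r : ℕ} (h : r + 1 = n + m) (i : Fin n) (b : Fin m) : Fin r :=
  ⟨i.1 + b.1, by have := i.2; have := b.2; omega⟩

/-- The inputs of the outer operation different from `i`: those after `i` are shifted by `m - 1`. -/
def outer {n m r : ℕ} (h : r + 1 = n + m) (i c : Fin n) (hc : c ≠ i) : Fin r :=
  ⟨if c.1 < i.1 then c.1 else c.1 + m - 1, by
    have h1 := i.2
    have h2 := c.2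
    have h3 : c.1 ≠ i.1 := fun e => hc (Fin.ext e)
    split_ifs <;> omega⟩

/-- The contraction of the block of inserted inputs to the single input `i`. -/
def contract {n m r : ℕ} (h : r + 1 = n + m) (i : Fin n) (v : Fin r) : Fin n :=
  ⟨if v.1 < i.1 then v.1 else if v.1 < i.1 + m then i.1 else v.1 + 1 - m, by
    have h1 := i.2
    have h2 := v.2
    split_ifs <;> omega⟩

/-! ## Differential graded operads -/

/-- The raw operations of a dg operad over `k` : graded pieces, unit, partial compositions, right
actions of the symmetric groups, differential. The laws are in `IsDGOperad`. -/
structure DGOperadData (k : Type u) [CommRing k] where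
  obj : ℕ → Type u
  [addCommGroup : ∀ n, AddCommGroup (obj n)]
  [module : ∀ n, Module k (obj n)]
  gr : ∀ n, ℤ → Submodule k (obj n)
  one : obj 1
  comp : ∀ {n m r : ℕ}, r + 1 = n + m → Fin n → obj n → obj m → obj r
  act : ∀ {n : ℕ}, Equiv.Perm (Fin n) → obj n → obj n
  d : ∀ {n : ℕ}, obj n → obj n

attribute [instance] DGOperadData.addCommGroup DGOperadData.module

/-- The submodules `S n ⊆ O(n)` are closed under the operations of `O` and form with these
operations a dg operad. -/
structure IsDGOperad {k : Type u} [CommRing k] (O : DGOperadData k)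
    (S : ∀ n, Submodule k (O.obj n)) : Prop where
  iSup_gr : ∀ n, ⨆ e, (S n ⊓ O.gr n e) = S n
  indep_gr : ∀ n, iSupIndep (fun e => S n ⊓ O.gr n e)
  one_mem : O.one ∈ S 1
  one_gr : O.one ∈ O.gr 1 0
  comp_mem : ∀ {n m r : ℕ} (h : r + 1 = n + m) (i : Fin n), ∀ x ∈ S n, ∀ y ∈ S m,
    O.comp h i x y ∈ S r
  comp_gr : ∀ {n m r : ℕ} (h : r + 1 = n + m) (i : Fin n) (e f : ℤ),
    ∀ x ∈ S n ⊓ O.gr n e, ∀ y ∈ S m ⊓ O.gr m f, O.comp h i x y ∈ O.gr r (e + f)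
  comp_linear_left : ∀ {n m r : ℕ} (h : r + 1 = n + m) (i : Fin n) (a : k),
    ∀ x ∈ S n, ∀ x' ∈ S n, ∀ y ∈ S m,
      O.comp h i (a • x + x') y = a • O.comp h i x y + O.comp h i x' y
  comp_linear_right : ∀ {n m r : ℕ} (h : r + 1 = n + m) (i : Fin n) (a : k),
    ∀ x ∈ S n, ∀ y ∈ S m, ∀ y' ∈ S m,
      O.comp h i x (a • y + y') = a • O.comp h i x y + O.comp h i x y'
  one_comp : ∀ {m : ℕ} (h : m + 1 = 1 + m), ∀ x ∈ S m, O.comp h 0 O.one x = x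
  comp_one : ∀ {n : ℕ} (h : n + 1 = n + 1) (i : Fin n), ∀ x ∈ S n, O.comp h i x O.one = x
  assoc_seq : ∀ {n m l r s t : ℕ} (h₁ : r + 1 = n + m) (h₂ : t + 1 = r + l) (h₃ : s + 1 = m + l)
    (h₄ : t + 1 = n + s) (i : Fin n) (j : Fin m), ∀ x ∈ S n, ∀ y ∈ S m, ∀ z ∈ S l,
      O.comp h₂ (inner h₁ i j) (O.comp h₁ i x y) z = O.comp h₄ i x (O.comp h₃ j y z)
  assoc_par : ∀ {n m l r s t : ℕ} (h₁ : r + 1 = n + m) (h₂ : t + 1 = r + l) (h₃ : s + 1 = n + l)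
    (h₄ : t + 1 = s + m) (i j : Fin n) (hij : i ≠ j) (e f : ℤ),
    ∀ x ∈ S n, ∀ y ∈ S m ⊓ O.gr m e, ∀ z ∈ S l ⊓ O.gr l f,
      O.comp h₂ (outer h₁ i j hij.symm) (O.comp h₁ i x y) z =
        (e * f).negOnePow • O.comp h₄ (outer h₃ j i hij) (O.comp h₃ j x z) y
  act_mem : ∀ {n : ℕ} (σ : Equiv.Perm (Fin n)), ∀ x ∈ S n, O.act σ x ∈ S n
  act_gr : ∀ {n : ℕ} (σ : Equiv.Perm (Fin n)) (e : ℤ), ∀ x ∈ S n ⊓ O.gr n e, O.act σ x ∈ O.gr n e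
  act_linear : ∀ {n : ℕ} (σ : Equiv.Perm (Fin n)) (a : k), ∀ x ∈ S n, ∀ x' ∈ S n,
    O.act σ (a • x + x') = a • O.act σ x + O.act σ x'
  act_one : ∀ {n : ℕ}, ∀ x ∈ S n, O.act 1 x = x
  act_mul : ∀ {n : ℕ} (σ τ : Equiv.Perm (Fin n)), ∀ x ∈ S n,
    O.act (σ * τ) x = O.act τ (O.act σ x)
  /-- `ρ` is the permutation that permutes the block of inserted inputs by `τ` and the inputs of
  the outer operation, with the block in place of `i`, by `σ`. -/
  comp_act : ∀ {n m r : ℕ} (h : r + 1 = n + m) (i : Fin n) (σ : Equiv.Perm (Fin n))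
    (τ : Equiv.Perm (Fin m)) (ρ : Equiv.Perm (Fin r)),
    (∀ b, ρ (inner h i b) = inner h (σ i) (τ b)) →
    (∀ c (hc : c ≠ i), ρ (outer h i c hc) = outer h (σ i) (σ c) (fun e => hc (σ.injective e))) →
    ∀ x ∈ S n, ∀ y ∈ S m,
      O.comp h i (O.act σ x) (O.act τ y) = O.act ρ (O.comp h (σ i) x y)
  d_mem : ∀ {n : ℕ}, ∀ x ∈ S n, O.d x ∈ S n
  d_gr : ∀ {n : ℕ} (e : ℤ), ∀ x ∈ S n ⊓ O.gr n e, O.d x ∈ O.gr n (e - 1)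
  d_linear : ∀ {n : ℕ} (a : k), ∀ x ∈ S n, ∀ x' ∈ S n, O.d (a • x + x') = a • O.d x + O.d x'
  d_d : ∀ {n : ℕ}, ∀ x ∈ S n, O.d (O.d x) = 0
  d_act : ∀ {n : ℕ} (σ : Equiv.Perm (Fin n)), ∀ x ∈ S n, O.d (O.act σ x) = O.act σ (O.d x)
  d_comp : ∀ {n m r : ℕ} (h : r + 1 = n + m) (i : Fin n) (e : ℤ), ∀ x ∈ S n ⊓ O.gr n e, ∀ y ∈ S m,
    O.d (O.comp h i x y) = O.comp h i (O.d x) y + e.negOnePow • O.comp h i x (O.d y)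

/-- The linear maps `F n : O(n) → P(n)` restrict to maps `S n → R n` which preserve degree, unit,
partial compositions, symmetric group actions and differential. -/
structure IsDGOperadHom {k : Type u} [CommRing k] (O : DGOperadData k)
    (S : ∀ n, Submodule k (O.obj n)) (P : DGOperadData k) (R : ∀ n, Submodule k (P.obj n))
    (F : ∀ n, O.obj n →ₗ[k] P.obj n) : Prop where
  map_mem : ∀ n, ∀ x ∈ S n, F n x ∈ R n
  map_gr : ∀ n (e : ℤ), ∀ x ∈ S n ⊓ O.gr n e, F n x ∈ P.gr n e
  map_one : F 1 O.one = P.one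
  map_comp : ∀ {n m r : ℕ} (h : r + 1 = n + m) (i : Fin n), ∀ x ∈ S n, ∀ y ∈ S m,
    F r (O.comp h i x y) = P.comp h i (F n x) (F m y)
  map_act : ∀ {n : ℕ} (σ : Equiv.Perm (Fin n)), ∀ x ∈ S n, F n (O.act σ x) = P.act σ (F n x)
  map_d : ∀ {n : ℕ}, ∀ x ∈ S n, F n (O.d x) = P.d (F n x)

/-! ## Planar rooted trees and the operad `Brace` -/

/-- A planar rooted tree with vertex set `Fin n`, given by its vertical order (`lt a b`: `a` lies
strictly below `b`, i.e. on the path from the root to `b`) and its horizontal order (`left a b`).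
The order on vertices above a fixed one is inherited, and distinct vertices are comparable in
exactly one of the two orders (exclusivity, and the fact that the vertices below a given vertex form
a chain, follow from the fields). -/
@[ext]
structure PTree (n : ℕ) where
  lt : Fin n → Fin n → Prop
  left : Fin n → Fin n → Prop
  lt_irrefl : ∀ a, ¬ lt a a
  lt_trans : ∀ a b c, lt a b → lt b c → lt a c
  left_irrefl : ∀ a, ¬ left a a
  left_trans : ∀ a b c, left a b → left b c → left a c
  exists_root : ∃ r, ∀ v, v ≠ r → lt r v
  left_of_left_of_lt : ∀ a b c, left a b → lt a c → left c b
  left_of_left_of_lt' : ∀ a b c, left a b → lt b c → left a c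
  total : ∀ a b, a ≠ b → lt a b ∨ lt b a ∨ left a b ∨ left b a

namespace PTree

/-- `b` is a child of `a`. -/
def Edge {n : ℕ} (T : PTree n) (a b : Fin n) : Prop :=
  T.lt a b ∧ ∀ c, ¬ (T.lt a c ∧ T.lt c b)

instance finite (n : ℕ) : Finite (PTree n) :=
  Finite.of_injective (fun T : PTree n => (T.lt, T.left)) (by
    intro S T hST
    have h := Prod.mk.inj hST
    exact PTree.ext h.1 h.2)

instance fintype (n : ℕ) : Fintype (PTree n) := Fintype.ofFinite _

/-- The right action: vertex `a` of `T ^ σ` is vertex `σ a` of `T`. -/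
def act {n : ℕ} (σ : Equiv.Perm (Fin n)) (T : PTree n) : PTree n where
  lt a b := T.lt (σ a) (σ b)
  left a b := T.left (σ a) (σ b)
  lt_irrefl a := T.lt_irrefl _
  lt_trans a b c := T.lt_trans _ _ _
  left_irrefl a := T.left_irrefl _
  left_trans a b c := T.left_trans _ _ _
  exists_root := by
    obtain ⟨r, hr⟩ := T.exists_root
    refine ⟨σ.symm r, fun v hv => ?_⟩
    rw [Equiv.apply_symm_apply]
    exact hr _ (fun e => hv (by rw [← e, Equiv.symm_apply_apply]))
  left_of_left_of_lt a b c := T.left_of_left_of_lt _ _ _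
  left_of_left_of_lt' a b c := T.left_of_left_of_lt' _ _ _
  total a b hab := T.total _ _ (fun e => hab (σ.injective e))

/-- `U` extends `T` by `T'` at `i`: the tree `T'` is a planar subtree of `U`, and contracting it to
the vertex `i` gives the planar tree `T`. -/
def IsExt {n m r : ℕ} (h : r + 1 = n + m) (i : Fin n) (T : PTree n) (T' : PTree m) (U : PTree r) :
    Prop :=
  (∀ a b, T'.Edge a b ↔ U.Edge (inner h i a) (inner h i b)) ∧
  (∀ a b, T'.left a b ↔ U.left (inner h i a) (inner h i b)) ∧
  (∀ x y, x ≠ y → (T.Edge x y ↔ ∃ u v, contract h i u = x ∧ contract h i v = y ∧ U.Edge u v)) ∧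
  (∀ u v, T.left (contract h i u) (contract h i v) → U.left u v)

/-- The tree with one vertex. -/
def one : PTree 1 where
  lt _ _ := False
  left _ _ := False
  lt_irrefl _ := id
  lt_trans _ _ _ := fun h _ => h
  left_irrefl _ := id
  left_trans _ _ _ := fun h _ => h
  exists_root := ⟨0, fun _ hv => (hv (Subsingleton.elim _ _)).elim⟩
  left_of_left_of_lt _ _ _ := fun h _ => h
  left_of_left_of_lt' _ _ _ := fun h _ => h
  total _ _ hab := (hab (Subsingleton.elim _ _)).elim

end PTree

/-! ## Words and the operad `F₂S` -/

/-- The words spanning `F₂S(n)`: every letter occurs, no letter is immediately repeated, and no two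
letters are interlaced. -/
def IsFSWord {n : ℕ} (w : List (Fin n)) : Prop :=
  (∀ a, a ∈ w) ∧ (∀ u, ¬ [u, u] <:+: w) ∧ ∀ u v, u ≠ v → ¬ [u, v, u, v].Sublist w

def Word (n : ℕ) : Type := {w : List (Fin n) // IsFSWord w}

namespace Word

/-- There are finitely many words: no two letters are followed by each other twice. -/
instance finite (n : ℕ) : Finite (Word n) := by
  have key : ∀ w : List (Fin n), IsFSWord w → w.length ≤ n * n + 1 := by
    intro w hw
    obtain ⟨-, h1, h2⟩ := hw
    let f : Fin (w.length - 1) → Fin n × Fin n :=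
      fun j => (w[j.1]'(by have := j.2; omega), w[j.1 + 1]'(by have := j.2; omega))
    have hne : ∀ j (hj : j + 1 < w.length), w[j] ≠ w[j + 1] := by
      intro j hj e
      refine h1 w[j] ⟨w.take j, w.drop (j + 2), ?_⟩
      have e1 : w.drop j = w[j] :: w[j + 1] :: w.drop (j + 2) := by
        rw [List.drop_eq_getElem_cons (by omega), List.drop_eq_getElem_cons (by omega)]
      calc w.take j ++ [w[j], w[j]] ++ w.drop (j + 2)
          = w.take j ++ (w[j] :: w[j] :: w.drop (j + 2)) := by simp
        _ = w.take j ++ w.drop j := by rw [e1, ← e]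
        _ = w := List.take_append_drop _ _
    have hlt : ∀ a b : Fin (w.length - 1), a.1 < b.1 → f a ≠ f b := by
      intro a b hab e
      have hb := b.2
      have e0 : w[a.1] = w[b.1] := (Prod.mk.inj e).1
      have e1 : w[a.1 + 1] = w[b.1 + 1] := (Prod.mk.inj e).2
      have hab' : a.1 + 1 < b.1 := by
        rcases Nat.lt_or_ge (a.1 + 1) b.1 with h | h
        · exact h
        · exfalso
          have hb1 : b.1 = a.1 + 1 := by omega
          apply hne a.1 (by omega)
          rw [e0]
          simp only [hb1]
      refine h2 w[a.1] w[a.1 + 1] (hne a.1 (by omega)) ?_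
      have s1 : w.drop b.1 = w[b.1] :: w[b.1 + 1] :: w.drop (b.1 + 2) := by
        rw [List.drop_eq_getElem_cons (by omega), List.drop_eq_getElem_cons (by omega)]
      have s2 : w.drop a.1 = w[a.1] :: w[a.1 + 1] :: w.drop (a.1 + 2) := by
        rw [List.drop_eq_getElem_cons (by omega), List.drop_eq_getElem_cons (by omega)]
      have s3 : [w[a.1], w[a.1 + 1]].Sublist (w.drop b.1) := by
        rw [s1, e0, e1]
        exact ((List.nil_sublist _).cons_cons _).cons_cons _
      have s4 : (w.drop b.1).Sublist (w.drop (a.1 + 2)) :=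
        List.drop_sublist_drop_left w (by omega)
      have s5 : [w[a.1], w[a.1 + 1], w[a.1], w[a.1 + 1]].Sublist (w.drop a.1) := by
        rw [s2]
        exact ((s3.trans s4).cons_cons _).cons_cons _
      exact s5.trans (List.drop_sublist _ _)
    have hinj : Function.Injective f := by
      intro a b e
      rcases lt_trichotomy a.1 b.1 with h | h | h
      · exact (hlt a b h e).elim
      · exact Fin.ext h
      · exact (hlt b a h e.symm).elim
    have hc := Fintype.card_le_of_injective f hinj
    simp only [Fintype.card_fin, Fintype.card_prod] at hc
    omega
  have hfin : {w : List (Fin n) | IsFSWord w}.Finite :=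
    (List.finite_length_le (Fin n) (n * n + 1)).subset (fun w hw => key w hw)
  exact hfin.to_subtype

instance fintype (n : ℕ) : Fintype (Word n) := Fintype.ofFinite _

def deg {n : ℕ} (W : Word n) : ℤ := (W.1.length : ℤ) - n

/-- The right action: relabelling by `σ⁻¹`. -/
def act {n : ℕ} (σ : Equiv.Perm (Fin n)) (W : Word n) : Word n :=
  ⟨W.1.map σ.symm, by
    obtain ⟨w, h0, h1, h2⟩ := W
    have hmap : (w.map σ.symm).map σ = w := by simp
    refine ⟨fun a => ?_, fun u hu => ?_, fun u v huv hs => ?_⟩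
    · exact List.mem_map.2 ⟨σ a, h0 _, by simp⟩
    · have h := hu.map σ
      rw [hmap] at h
      exact h1 (σ u) h
    · have h := hs.map σ
      rw [hmap] at h
      exact h2 (σ u) (σ v) (fun e => huv (σ.injective e)) h⟩

/-- `a` is interposed in `W`: `W = … b a … b …`. -/
def Interposed {n : ℕ} (W : Word n) (a : Fin n) : Prop :=
  ∃ b l₁ l₂, W.1 = l₁ ++ b :: a :: l₂ ∧ b ∈ l₂

/-- `X` extends `W` by `W'` at `i`: up to relabelling and deletion of repetitions, `W'` is the
subword of `X` on the inserted letters, `W` is obtained from `X` by collapsing the inserted letters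
to `i`, and the degree of `X` is the sum of the degrees of `W` and `W'`. -/
def IsExt {n m r : ℕ} (h : r + 1 = n + m) (i : Fin n) (W : Word n) (W' : Word m) (X : Word r) :
    Prop :=
  (X.1.filter (fun v => contract h i v = i)).destutter (· ≠ ·) = W'.1.map (inner h i) ∧
  (X.1.map (contract h i)).destutter (· ≠ ·) = W.1 ∧
  X.deg = W.deg + W'.deg

open Classical in
/-- The sign of the shuffle by which the interposed letters of `X`, in the order of their first
occurrences, are made of the interposed letters of `W`, followed by those of `W'` : it counts the
pairs (`u` of `W`, `v` of `W'`) for which the letter of `X` given by `v` occurs first. The letter of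
`X` given by `u` is the first one in `X` which is contracted to `u` (if `u = i`, it is the one given
by the first letter of `W'`). -/
def extSign {n m r : ℕ} (h : r + 1 = n + m) (i : Fin n) (W : Word n) (W' : Word m) (X : Word r) :
    ℤˣ :=
  (-1) ^ (Finset.univ.filter (fun p : Fin n × Fin m => W.Interposed p.1 ∧ W'.Interposed p.2 ∧
    X.1.idxOf (inner h i p.2) < (X.1.map (contract h i)).idxOf p.1)).card

/-- The `j`-th letter (counted from `0`) is a caesura: it occurs again later. -/
def IsCaesura {n : ℕ} (W : Word n) (j : ℕ) : Prop :=
  ∃ l, j < l ∧ l < W.1.length ∧ W.1[l]? = W.1[j]?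

open Classical in
/-- The number of caesurae at positions `≤ j`. If position `j` is a caesura, then it is the
`caesuraRank j`-th one. -/
def caesuraRank {n : ℕ} (W : Word n) (j : ℕ) : ℕ :=
  ((Finset.range (j + 1)).filter (fun c => W.IsCaesura c)).card

/-- The position of the previous occurrence of the `j`-th letter. -/
def prevOcc {n : ℕ} (W : Word n) (j : ℕ) : ℕ :=
  Nat.findGreatest (fun p => p < j ∧ W.1[p]? = W.1[j]?) j

open Classical in
/-- The sign of the deletion of the `j`-th letter. -/
def delSign {n : ℕ} (W : Word n) (j : ℕ) : ℤˣ :=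
  if W.IsCaesura j then (-1) ^ W.caesuraRank j else (-1) ^ (W.caesuraRank (W.prevOcc j) + 1)

open Classical in
/-- The word obtained by deleting the `j`-th letter, as a basis element of `F₂S(n)`. It is `0` if
this is not a word of `F₂S(n)`, which is the case precisely when the letter is not repeated. -/
def del (k : Type u) [CommRing k] {n : ℕ} (W : Word n) (j : ℕ) : Word n →₀ k :=
  if h : IsFSWord (W.1.eraseIdx j) then Finsupp.single ⟨W.1.eraseIdx j, h⟩ 1 else 0

/-- The boundary of a word. -/
def boundary (k : Type u) [CommRing k] {n : ℕ} (W : Word n) : Word n →₀ k :=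
  ∑ j ∈ Finset.range W.1.length, W.delSign j • W.del k j

/-- The word `1`. -/
def one : Word 1 := ⟨[0], by
  refine ⟨fun a => by simp [Subsingleton.elim a 0], fun u hu => ?_, fun _ _ huv => ?_⟩
  · have := hu.length_le
    simp at this
  · exact (huv (Subsingleton.elim _ _)).elim⟩

end Word

/-! ## The Hadamard product `F₂S ⊗ Brace` and its suboperad `Quilt` -/

section Quilt

variable (k : Type u) [CommRing k]

/-- `F₂S(n) ⊗ Brace(n)`, the free `k`-module on the pairs of a word and a tree. -/
abbrev FSBraceObj (n : ℕ) : Type u := (Word n × PTree n) →₀ k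

open Classical in
/-- `(W, T) ∘ᵢ (W', T') = (W ∘ᵢ W') ⊗ (T ∘ᵢ T')`, the product of the signed sum of all extensions of
words and the sum of all extensions of trees. -/
def fsBraceCompBasis {n m r : ℕ} (h : r + 1 = n + m) (i : Fin n) (Q : Word n × PTree n)
    (Q' : Word m × PTree m) : FSBraceObj k r :=
  ∑ X ∈ Finset.univ.filter (fun X : Word r => Word.IsExt h i Q.1 Q'.1 X),
    ∑ U ∈ Finset.univ.filter (fun U : PTree r => PTree.IsExt h i Q.2 Q'.2 U),
      Word.extSign h i Q.1 Q'.1 X • Finsupp.single (X, U) (1 : k)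

/-- The dg operad `F₂S ⊗ Brace`, with the grading and the differential of `F₂S`. -/
def FSBrace : DGOperadData k where
  obj n := FSBraceObj k n
  gr n e :=
    { carrier := {x | ∀ Q, x Q ≠ 0 → Q.1.deg = e}
      add_mem' := by
        intro x y hx hy Q hQ
        by_contra hne
        have h1 : x Q = 0 := by
          by_contra h1
          exact hne (hx Q h1)
        have h2 : y Q = 0 := by
          by_contra h2
          exact hne (hy Q h2)
        exact hQ (by simp [h1, h2])
      zero_mem' := by
        intro Q hQ
        simp at hQ
      smul_mem' := by
        intro a x hx Q hQ
        exact hx Q (fun e => hQ (by simp [e])) }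
  one := Finsupp.single (Word.one, PTree.one) 1
  comp h i x y := x.sum fun Q a => y.sum fun Q' b => (a * b) • fsBraceCompBasis k h i Q Q'
  act σ x := x.mapDomain fun Q => (Q.1.act σ, Q.2.act σ)
  d x := x.sum fun Q a => a • (Q.1.boundary k).mapDomain fun W => (W, Q.2)

/-- The pairs `(W, T)` which are quilts. -/
def IsQuilt {n : ℕ} (W : Word n) (T : PTree n) : Prop :=
  (∀ u v, [u, v].Sublist W.1 → ¬ T.lt v u) ∧
  (∀ u v, u ≠ v → [u, v, u].Sublist W.1 → T.left v u)

/-- `Quilt(n)`, the span of the quilts in `F₂S(n) ⊗ Brace(n)`. -/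
def Quilt (n : ℕ) : Submodule k ((FSBrace k).obj n) :=
  Submodule.span k {x : FSBraceObj k n | ∃ W T, IsQuilt W T ∧ x = Finsupp.single (W, T) 1}

end Quilt

/-! ## Terms: planar trees with inputs, and with plugged-in multiplications -/

/-- Planar trees with free inputs: `leaf` is a free input, `node a q c` is a vertex labelled `a` with
`q` ordered inputs into which the trees `c j` are plugged, and `mul l r` is a vertex with two inputs
which is plugged with the multiplication `m`. -/
inductive Term (α : Type) : Type
  | leaf : Term α
  | node (a : α) (q : ℕ) (c : Fin q → Term α) : Term α
  | mul (l r : Term α) : Term α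

namespace Term

variable {α β : Type}

/-- The number of free inputs. -/
def leaves : Term α → ℕ
  | leaf => 1
  | node _ _ c => ∑ j, (c j).leaves
  | mul l r => l.leaves + r.leaves

open Classical in
/-- The number of vertices labelled `a`. -/
def count (a : α) : Term α → ℕ
  | leaf => 0
  | node b _ c => (if b = a then 1 else 0) + ∑ j, (c j).count a
  | mul l r => l.count a + r.count a

open Classical in
/-- The number of inputs of the vertex labelled `a`, if there is exactly one. -/
def arity (a : α) : Term α → ℕ
  | leaf => 0
  | node b q c => (if b = a then q else 0) + ∑ j, (c j).arity a
  | mul l r => l.arity a + r.arity a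

/-- The vertical order: vertex `a` lies strictly below vertex `b`. -/
def lt (a b : α) : Term α → Prop
  | leaf => False
  | node x _ c => (x = a ∧ ∃ j, 0 < (c j).count b) ∨ ∃ j, (c j).lt a b
  | mul l r => l.lt a b ∨ r.lt a b

/-- The horizontal order: vertex `a` lies to the left of vertex `b`. -/
def left (a b : α) : Term α → Prop
  | leaf => False
  | node _ _ c => (∃ i j, i < j ∧ 0 < (c i).count a ∧ 0 < (c j).count b) ∨ ∃ j, (c j).left a b
  | mul l r => (0 < l.count a ∧ 0 < r.count b) ∨ l.left a b ∨ r.left a b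

/-- The map `ζ_a` from the gaps between the inputs of the vertex `a` to the gaps between the free
inputs of the tree (both numbered from left to right, starting with `0`): `ζ_a t` is the number of
free inputs to the left of the `t`-th gap of `a`. -/
def zeta (a : α) (t : ℕ) : Term α → ℕ
  | leaf => 0
  | node x q c =>
    open Classical in
    if x = a then ∑ j : Fin q, if j.1 < t then (c j).leaves else 0
    else ∑ j : Fin q, if 0 < (c j).count a
      then (∑ i : Fin q, if i < j then (c i).leaves else 0) + (c j).zeta a t else 0
  | mul l r => if 0 < l.count a then l.zeta a t else l.leaves + r.zeta a t

open Classical in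
/-- The word traced out by a walk around the tree from left to right, starting and ending at the
root: a vertex `a` with children `T₁, …, T_s` contributes `a W(T₁) a W(T₂) a … a W(T_s) a`. The
letters of the vertices plugged with a multiplication are deleted. -/
def word : Term α → List α
  | leaf => []
  | node a _ c => a :: (List.ofFn fun j => if c j = leaf then [] else (c j).word ++ [a]).flatten
  | mul l r => l.word ++ r.word

/-- No multiplication is plugged in. -/
def NoMul : Term α → Prop
  | leaf => True
  | node _ _ c => ∀ j, (c j).NoMul
  | mul _ _ => False

/-- Every vertex plugged with a multiplication has exactly two children (no free input). -/
def MulFull : Term α → Prop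
  | leaf => True
  | node _ _ c => ∀ j, (c j).MulFull
  | mul l r => l ≠ leaf ∧ r ≠ leaf ∧ l.MulFull ∧ r.MulFull

/-- Vertices without inputs are given two free inputs. -/
def fill : Term α → Term α
  | leaf => leaf
  | node a q c => if q = 0 then node a 2 (fun _ => leaf) else node a q (fun j => (c j).fill)
  | mul l r => mul l.fill r.fill

/-- Relabelling of the vertices. -/
def map (f : α → β) : Term α → Term β
  | leaf => leaf
  | node a q c => node (f a) q (fun j => (c j).map f)
  | mul l r => mul (l.map f) (r.map f)

/-- The `j`-th free input (from left to right, starting with `0`) is replaced by `f j`. -/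
def graft : Term α → (ℕ → Term α) → Term α
  | leaf, f => f 0
  | node a q c, f =>
    node a q (fun j => (c j).graft (fun t => f ((∑ i : Fin q, if i < j then (c i).leaves else 0) + t)))
  | mul l r, f => mul (l.graft f) (r.graft (fun t => f (l.leaves + t)))

open Classical in
/-- The vertex labelled `i` is replaced by the tree `s`, into whose free inputs the trees plugged
into that vertex are grafted. The other labels are changed by `g`. -/
def subst (i : α) (s : Term β) (g : ∀ c, c ≠ i → β) : Term α → Term β
  | leaf => leaf
  | node a q c =>
    if h : a = i then s.graft (fun j => if hj : j < q then subst i s g (c ⟨j, hj⟩) else leaf)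
    else node (g a h) q (fun j => subst i s g (c j))
  | mul l r => mul (subst i s g l) (subst i s g r)

/-- Operadic composition `x ∘ᵢ y` (meaningful if `y` has as many free inputs as the vertex `i`). -/
def plug {n m r : ℕ} (h : r + 1 = n + m) (i : Fin n) (x : Term (Fin n)) (y : Term (Fin m)) :
    Term (Fin r) :=
  subst i (y.map (inner h i)) (outer h i) x

/-- The congruence generated by the associativity of the multiplication. -/
inductive Assoc : Term α → Term α → Prop
  | assoc (a b c : Term α) : Assoc (mul (mul a b) c) (mul a (mul b c))
  | node (a : α) (q : ℕ) (c c' : Fin q → Term α) : (∀ j, Assoc (c j) (c' j)) →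
      Assoc (Term.node a q c) (Term.node a q c')
  | mul (l l' r r' : Term α) : Assoc l l' → Assoc r r' → Assoc (Term.mul l r) (Term.mul l' r')
  | refl (t : Term α) : Assoc t t
  | symm (t t' : Term α) : Assoc t t' → Assoc t' t
  | trans (t t' t'' : Term α) : Assoc t t' → Assoc t' t'' → Assoc t t''

/-- At least one vertex, and every label occurs exactly once. -/
def Valid (t : Term α) : Prop := t ≠ leaf ∧ ∀ a, t.count a = 1


section Invariance

open Classical

theorem Assoc.leaves_eq {t t' : Term α} (h : Assoc t t') : t.leaves = t'.leaves := by
  induction h with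
  | assoc a b c => simp only [leaves]; omega
  | node a q c c' _ ih => simp only [leaves, ih]
  | mul l l' r r' _ _ ih1 ih2 => simp only [leaves, ih1, ih2]
  | refl t => rfl
  | symm t t' _ ih => exact ih.symm
  | trans t t' t'' _ _ ih1 ih2 => exact ih1.trans ih2

theorem Assoc.count_eq {t t' : Term α} (h : Assoc t t') (a : α) : t.count a = t'.count a := by
  induction h with
  | assoc x y z => simp only [count]; omega
  | node x q c c' _ ih => simp only [count, ih]
  | mul l l' r r' _ _ ih1 ih2 => simp only [count, ih1, ih2]
  | refl t => rfl
  | symm t t' _ ih => exact ih.symm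
  | trans t t' t'' _ _ ih1 ih2 => exact ih1.trans ih2

theorem Assoc.arity_eq {t t' : Term α} (h : Assoc t t') (a : α) : t.arity a = t'.arity a := by
  induction h with
  | assoc x y z => simp only [arity]; omega
  | node x q c c' _ ih => simp only [arity, ih]
  | mul l l' r r' _ _ ih1 ih2 => simp only [arity, ih1, ih2]
  | refl t => rfl
  | symm t t' _ ih => exact ih.symm
  | trans t t' t'' _ _ ih1 ih2 => exact ih1.trans ih2

theorem Assoc.lt_iff {t t' : Term α} (h : Assoc t t') (a b : α) : t.lt a b ↔ t'.lt a b := by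
  induction h with
  | assoc x y z => simp only [lt]; tauto
  | node x q c c' hc ih => simp only [lt, ih, (hc _).count_eq]
  | mul l l' r r' _ _ ih1 ih2 => simp only [lt, ih1, ih2]
  | refl t => exact Iff.rfl
  | symm t t' _ ih => exact ih.symm
  | trans t t' t'' _ _ ih1 ih2 => exact ih1.trans ih2

theorem Assoc.left_iff {t t' : Term α} (h : Assoc t t') (a b : α) : t.left a b ↔ t'.left a b := by
  induction h with
  | assoc x y z => simp only [left, count, Nat.add_pos_iff_pos_or_pos]; tauto
  | node x q c c' hc ih => simp only [left, ih, (hc _).count_eq]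
  | mul l l' r r' h1 h2 ih1 ih2 => simp only [left, ih1, ih2, h1.count_eq, h2.count_eq]
  | refl t => exact Iff.rfl
  | symm t t' _ ih => exact ih.symm
  | trans t t' t'' _ _ ih1 ih2 => exact ih1.trans ih2

theorem Assoc.zeta_eq {t t' : Term α} (h : Assoc t t') (a : α) (i : ℕ) :
    t.zeta a i = t'.zeta a i := by
  induction h with
  | assoc x y z =>
    simp only [zeta, count, leaves, Nat.add_pos_iff_pos_or_pos]
    by_cases h1 : 0 < count a x
    · simp only [h1, true_or, if_true]
    · by_cases h2 : 0 < count a y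
      · simp only [h1, h2, or_true, if_true, if_false]
      · simp only [h1, h2, or_self, if_false, Nat.add_assoc]
  | node x q c c' hc ih => simp only [zeta, ih, (hc _).count_eq, (hc _).leaves_eq]
  | mul l l' r r' h1 _ ih1 ih2 => simp only [zeta, ih1, ih2, h1.count_eq, h1.leaves_eq]
  | refl t => rfl
  | symm t t' _ ih => exact ih.symm
  | trans t t' t'' _ _ ih1 ih2 => exact ih1.trans ih2

theorem Assoc.fill {t t' : Term α} (h : Assoc t t') : Assoc t.fill t'.fill := by
  induction h with
  | assoc x y z => exact Assoc.assoc _ _ _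
  | node x q c c' _ ih =>
    simp only [Term.fill]
    split_ifs
    · exact Assoc.refl _
    · exact Assoc.node _ _ _ _ ih
  | mul l l' r r' _ _ ih1 ih2 => exact Assoc.mul _ _ _ _ ih1 ih2
  | refl t => exact Assoc.refl _
  | symm t t' _ ih => exact Assoc.symm _ _ ih
  | trans t t' t'' _ _ ih1 ih2 => exact Assoc.trans _ _ _ ih1 ih2

theorem Assoc.map {t t' : Term α} (h : Assoc t t') (f : α → β) : Assoc (t.map f) (t'.map f) := by
  induction h with
  | assoc x y z => exact Assoc.assoc _ _ _
  | node x q c c' _ ih => exact Assoc.node _ _ _ _ ih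
  | mul l l' r r' _ _ ih1 ih2 => exact Assoc.mul _ _ _ _ ih1 ih2
  | refl t => exact Assoc.refl _
  | symm t t' _ ih => exact Assoc.symm _ _ ih
  | trans t t' t'' _ _ ih1 ih2 => exact Assoc.trans _ _ _ ih1 ih2

theorem Assoc.eq_leaf_iff {t t' : Term α} (h : Assoc t t') : t = leaf ↔ t' = leaf := by
  induction h with
  | assoc x y z => simp
  | node x q c c' _ _ => simp
  | mul l l' r r' _ _ _ _ => simp
  | refl t => exact Iff.rfl
  | symm t t' _ ih => exact ih.symm
  | trans t t' t'' _ _ ih1 ih2 => exact ih1.trans ih2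

theorem Assoc.mulFull_iff {t t' : Term α} (h : Assoc t t') : t.MulFull ↔ t'.MulFull := by
  induction h with
  | assoc x y z =>
    simp only [MulFull, ne_eq, reduceCtorEq, not_false_eq_true, true_and]
    tauto
  | node x q c c' _ ih => simp only [MulFull, ih]
  | mul l l' r r' h1 h2 ih1 ih2 =>
    simp only [MulFull, ih1, ih2, ne_eq, h1.eq_leaf_iff, h2.eq_leaf_iff]
  | refl t => exact Iff.rfl
  | symm t t' _ ih => exact ih.symm
  | trans t t' t'' _ _ ih1 ih2 => exact ih1.trans ih2

theorem Assoc.word_eq {t t' : Term α} (h : Assoc t t') : t.word = t'.word := by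
  induction h with
  | assoc x y z => simp only [word, List.append_assoc]
  | node x q c c' hc ih => simp only [word, ih, (hc _).eq_leaf_iff]
  | mul l l' r r' _ _ ih1 ih2 => simp only [word, ih1, ih2]
  | refl t => rfl
  | symm t t' _ ih => exact ih.symm
  | trans t t' t'' _ _ ih1 ih2 => exact ih1.trans ih2

theorem count_map (e : α ≃ β) (b : β) (t : Term α) : (t.map e).count b = t.count (e.symm b) := by
  induction t with
  | leaf => rfl
  | node a q c ih => simp only [map, count, ih, Equiv.eq_symm_apply]
  | mul l r ih1 ih2 => simp only [map, count, ih1, ih2]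

theorem Valid.map {t : Term α} (ht : t.Valid) (e : α ≃ β) : (t.map e).Valid := by
  refine ⟨fun h => ht.1 ?_, fun b => by rw [count_map, ht.2]⟩
  cases t with
  | leaf => rfl
  | node a q c => simp [Term.map] at h
  | mul l r => simp [Term.map] at h

theorem NoMul.map {t : Term α} (ht : t.NoMul) (f : α → β) : (t.map f).NoMul := by
  induction t with
  | leaf => trivial
  | node a q c ih => exact fun j => ih j (ht j)
  | mul l r _ _ => exact ht.elim

end Invariance

/-- The tree with one vertex and `q` free inputs. -/
def corolla (q : ℕ) : Term (Fin 1) := node 0 q (fun _ => leaf)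

end Term

/-! ## The coloured operads `NSOp` and `mNSOp` -/

/-- The operations of arity `n` of `NSOp`, of all colours: indexed trees with vertex set `Fin n`.
The index of an edge is the input of the lower vertex into which the upper vertex is plugged. -/
def NSOp (n : ℕ) : Type := {t : Term (Fin n) // t.Valid ∧ t.NoMul}

/-- Representatives of the operations of arity `n` of `mNSOp` : indexed trees some of whose vertices
are plugged with `m`, the others being labelled by `Fin n`. -/
def PreMNSOp (n : ℕ) : Type := {t : Term (Fin n) // t.Valid}

instance PreMNSOp.setoid (n : ℕ) : Setoid (PreMNSOp n) where
  r x y := Term.Assoc x.1 y.1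
  iseqv := ⟨fun _ => Term.Assoc.refl _, fun h => Term.Assoc.symm _ _ h,
    fun h h' => Term.Assoc.trans _ _ _ h h'⟩

/-- The operations of arity `n` of `mNSOp`, of all colours: the coloured operad generated by `NSOp`
and an element `m` of arity `0` and output colour `2`, with the relation that `m` is associative. -/
def MNSOp (n : ℕ) : Type := Quotient (PreMNSOp.setoid n)

namespace NSOp

variable {n : ℕ}

/-- The `a`-th input colour. -/
def color (J : NSOp n) (a : Fin n) : ℕ := J.1.arity a

/-- The output colour. -/
def out (J : NSOp n) : ℕ := J.1.leaves

/-- Relabelling of the vertices. -/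
def relabel (σ : Equiv.Perm (Fin n)) (J : NSOp n) : NSOp n :=
  ⟨J.1.map σ, J.2.1.map σ, J.2.2.map σ⟩

/-- `L = J ∘ᵢ K` (in particular, the colours match). -/
def IsComp {m r : ℕ} (h : r + 1 = n + m) (i : Fin n) (J : NSOp n) (K : NSOp m) (L : NSOp r) :
    Prop :=
  K.out = J.color i ∧ L.1 = Term.plug h i J.1 K.1

/-- The identity of some colour. -/
def IsId (J : NSOp 1) : Prop := ∃ p, J.1 = Term.corolla p

end NSOp

namespace MNSOp

variable {n : ℕ}

/-- `t` is a representative of `X`. -/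
def Rep (X : MNSOp n) (t : Term (Fin n)) : Prop :=
  ∃ x : PreMNSOp n, Quotient.mk _ x = X ∧ x.1 = t

/-- The `a`-th input colour. -/
def color (X : MNSOp n) (a : Fin n) : ℕ :=
  Quotient.lift (fun x : PreMNSOp n => x.1.arity a) (fun _ _ h => Term.Assoc.arity_eq h a) X

/-- The output colour. -/
def out (X : MNSOp n) : ℕ :=
  Quotient.lift (fun x : PreMNSOp n => x.1.leaves) (fun _ _ h => Term.Assoc.leaves_eq h) X

/-- The vertical order on `Fin n`. -/
def lt (X : MNSOp n) (a b : Fin n) : Prop :=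
  Quotient.lift (fun x : PreMNSOp n => x.1.lt a b) (fun _ _ h => propext (Term.Assoc.lt_iff h a b)) X

/-- The horizontal order on `Fin n`. -/
def left (X : MNSOp n) (a b : Fin n) : Prop :=
  Quotient.lift (fun x : PreMNSOp n => x.1.left a b) (fun _ _ h => propext (Term.Assoc.left_iff h a b)) X

/-- The word of `X`. -/
def word (X : MNSOp n) : List (Fin n) :=
  Quotient.lift (fun x : PreMNSOp n => x.1.word) (fun _ _ h => Term.Assoc.word_eq h) X

/-- Every vertex plugged with `m` has exactly two children. -/
def MulFull (X : MNSOp n) : Prop :=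
  Quotient.lift (fun x : PreMNSOp n => x.1.MulFull) (fun _ _ h => propext (Term.Assoc.mulFull_iff h)) X

/-- The map `ζ_{X,a}`, computed after replacing the input colours `0` by `2`. -/
def zeta (X : MNSOp n) (a : Fin n) (t : ℕ) : ℕ :=
  Quotient.lift (fun x : PreMNSOp n => x.1.fill.zeta a t) (fun _ _ h => (Term.Assoc.fill h).zeta_eq a t) X

/-- Relabelling of the vertices. -/
def relabel (σ : Equiv.Perm (Fin n)) (X : MNSOp n) : MNSOp n :=
  Quotient.map (fun x : PreMNSOp n => (⟨x.1.map σ, x.2.map σ⟩ : PreMNSOp n))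
    (fun _ _ h => Term.Assoc.map h σ) X

/-- `Z = X ∘ᵢ Y` (in particular, the colours match). -/
def IsComp {m r : ℕ} (h : r + 1 = n + m) (i : Fin n) (X : MNSOp n) (Y : MNSOp m) (Z : MNSOp r) :
    Prop :=
  Y.out = X.color i ∧ ∃ x y, X.Rep x ∧ Y.Rep y ∧ Z.Rep (Term.plug h i x y)

/-- The identity of some colour. -/
def IsId (X : MNSOp 1) : Prop := ∃ q, X.Rep (Term.corolla q)

open Classical in
/-- The coefficients of `D = (D_q)_q`, where
`D_q = m ∘₂ id_q + ∑_{i=1}^{q} (-1)^i id_q ∘_i m + (-1)^{q+1} m ∘₁ id_q`. -/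
def hochschild (X : MNSOp 1) : ℤ :=
  (if X.Rep (Term.mul Term.leaf (Term.corolla (X.color 0))) then 1 else 0) +
  (∑ i : Fin (X.color 0), if X.Rep (Term.node 0 (X.color 0)
    (fun j => if j = i then Term.mul Term.leaf Term.leaf else Term.leaf))
      then (-1) ^ (i.1 + 1) else 0) +
  (if X.Rep (Term.mul (Term.corolla (X.color 0)) Term.leaf) then (-1) ^ (X.color 0 + 1) else 0)

end MNSOp

/-! ## The operad of patchworks -/

/-- Pairs of operations of `mNSOp` and `NSOp` of arity `n`, of all colours. -/
abbrev PatchPair (n : ℕ) : Type := MNSOp n × NSOp n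

namespace PatchPair

variable {n : ℕ}

/-- The pairs which belong to the coloured operad `Patch`. -/
def IsPatch (Z : PatchPair n) : Prop :=
  (∀ a b, Z.2.1.lt a b → Z.1.left a b) ∧ (∀ a b, Z.1.lt a b → Z.2.1.left b a)

/-- The suspended degree `q_a + p_a - 1` of the `a`-th input colour `(q_a, p_a)`. -/
def inDeg (Z : PatchPair n) (a : Fin n) : ℤ := (Z.1.color a : ℤ) + Z.2.color a - 1

/-- The degree `∑ (q_a + p_a - 1) - (q + p - 1)`. -/
def deg (Z : PatchPair n) : ℤ := ∑ a, Z.inDeg a - ((Z.1.out : ℤ) + Z.2.out - 1)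

/-- `Z = X ∘ᵢ Y` in both components. -/
def IsComp {m r : ℕ} (h : r + 1 = n + m) (i : Fin n) (X : PatchPair n) (Y : PatchPair m)
    (Z : PatchPair r) : Prop :=
  MNSOp.IsComp h i X.1 Y.1 Z.1 ∧ NSOp.IsComp h i X.2 Y.2 Z.2

/-- The exponent of the Koszul sign for the permutation of the inputs of `Z` by `σ`. -/
def koszul (σ : Equiv.Perm (Fin n)) (Z : PatchPair n) : ℤ :=
  ∑ a, ∑ b, if a < b ∧ σ b < σ a then Z.inDeg a * Z.inDeg b else 0

end PatchPair

section Patch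

variable (k : Type u) [CommRing k]

/-- Formal sums of pairs. As in the totalization every colour is allowed, these are just the families
of coefficients; `PatchS` cuts out those which belong to `Patch_s`. -/
abbrev PairObj (n : ℕ) : Type u := PatchPair n → k

open Classical in
/-- Partial composition: bilinear extension of the composition of coloured operads, which is zero if
the colours do not match, with the Koszul sign for moving the inserted operation past the inputs
before `i`. -/
def pairComp {n m r : ℕ} (h : r + 1 = n + m) (i : Fin n) (f : PairObj k n) (g : PairObj k m) :
    PairObj k r := fun Z =>
  ∑ᶠ c : PatchPair n × PatchPair m,
    if PatchPair.IsComp h i c.1 c.2 Z then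
      (c.2.deg * ∑ j, if j < i then c.1.inDeg j else 0).negOnePow • (f c.1 * g c.2)
    else 0

open Classical in
/-- The element `(D, 1)` of arity `1` and degree `-1`. -/
def pairD : PairObj k 1 := fun Z => if Z.2.IsId then (Z.1.hochschild : k) else 0

open Classical in
/-- The graded operad of pairs, with the signs of the suspended degrees and the differential
`∂_{(D,1)} x = (D,1) ∘₁ x - (-1)^{|x|} ∑ᵢ x ∘ᵢ (D,1)`. -/
def PairOp : DGOperadData k where
  obj n := PairObj k n
  gr n e :=
    { carrier := {f | ∀ Z, f Z ≠ 0 → Z.deg = e}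
      add_mem' := by
        intro x y hx hy Q hQ
        by_contra hne
        have h1 : x Q = 0 := by
          by_contra h1
          exact hne (hx Q h1)
        have h2 : y Q = 0 := by
          by_contra h2
          exact hne (hy Q h2)
        exact hQ (by simp [h1, h2])
      zero_mem' := by
        intro Q hQ
        simp at hQ
      smul_mem' := by
        intro a x hx Q hQ
        exact hx Q (fun e => hQ (by simp [e])) }
  one := fun Z => if Z.1.IsId ∧ Z.2.IsId then 1 else 0
  comp h i f g := pairComp k h i f g
  act σ f := fun Z => (Z.koszul σ).negOnePow • f (Z.1.relabel σ, Z.2.relabel σ)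
  d {n} f := pairComp k (Nat.add_comm n 1) 0 (pairD k) f -
    ∑ i : Fin n, pairComp k rfl i (fun Z => Z.deg.negOnePow • f Z) (pairD k)

/-- Families in the product over all colours of the free `k`-modules on the operations of `Patch` of
these colours: the coefficients vanish outside of `Patch`, and finitely many of given colours are
nonzero. -/
def patchFamilies (n : ℕ) : Submodule k ((PairOp k).obj n) where
  carrier := {f : PairObj k n | (∀ Z, f Z ≠ 0 → Z.IsPatch) ∧
    ∀ (q p : Fin n → ℕ) (q' p' : ℕ),
      {Z : PatchPair n | f Z ≠ 0 ∧ Z.1.color = q ∧ Z.2.color = p ∧ Z.1.out = q' ∧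
        Z.2.out = p'}.Finite}
  add_mem' := by
    rintro (f : PairObj k n) (g : PairObj k n) ⟨hf, hf'⟩ ⟨hg, hg'⟩
    have key : ∀ Z : PatchPair n, (f + g) Z ≠ 0 → f Z ≠ 0 ∨ g Z ≠ 0 := by
      intro Z hZ
      by_contra hne
      push Not at hne
      exact hZ (by simp [hne.1, hne.2])
    refine ⟨fun Z hZ => (key Z hZ).elim (hf Z) (hg Z), fun q p q' p' => ?_⟩
    refine ((hf' q p q' p').union (hg' q p q' p')).subset ?_
    rintro Z ⟨hZ, h⟩
    exact (key Z hZ).imp (fun hz => ⟨hz, h⟩) (fun hz => ⟨hz, h⟩)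
  zero_mem' := by
    refine ⟨fun Z hZ => (hZ rfl).elim, fun q p q' p' => ?_⟩
    refine Set.finite_empty.subset ?_
    rintro Z ⟨hZ, -⟩
    exact hZ rfl
  smul_mem' := by
    rintro a (f : PairObj k n) ⟨hf, hf'⟩
    have key : ∀ Z : PatchPair n, (a • f) Z ≠ 0 → f Z ≠ 0 := by
      intro Z hZ e
      exact hZ (by simp [e])
    refine ⟨fun Z hZ => hf Z (key Z hZ), fun q p q' p' => ?_⟩
    refine (hf' q p q' p').subset ?_
    rintro Z ⟨hZ, h⟩
    exact ⟨key Z hZ, h⟩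

/-- `Patch_s(n)`, generated by the families of constant degree. -/
def PatchS (n : ℕ) : Submodule k ((PairOp k).obj n) :=
  ⨆ e : ℤ, (patchFamilies k n ⊓ (PairOp k).gr n e)

end Patch

/-! ## Colourings and their signs -/

/-- The sign of the rearrangement of the word with letters `i_a` (`⟨a, i⟩ ∈ L`), in lexicographic
order, to the word in which the letters are ordered by the position `pos a i`. -/
def shuffleSign {n : ℕ} (L : Finset (Σ _ : Fin n, ℕ)) (pos : Fin n → ℕ → ℤ) : ℤˣ :=
  (-1) ^ ((L ×ˢ L).filter (fun x : (Σ _ : Fin n, ℕ) × (Σ _ : Fin n, ℕ) =>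
    (x.1.1 < x.2.1 ∨ (x.1.1 = x.2.1 ∧ x.1.2 < x.2.2)) ∧
      pos x.2.1 x.2.2 < pos x.1.1 x.1.2)).card

/-- `I` is a colouring of the tree `T` : its underlying planar tree is `T`. -/
def IsTreeColoring {n : ℕ} (T : PTree n) (I : NSOp n) : Prop :=
  (∀ a b, I.1.lt a b ↔ T.lt a b) ∧ ∀ a b, I.1.left a b ↔ T.left a b

/-- The sign of a colouring of a tree, with colours `0` replaced by `2`. The letters are `i_a` with
`1 ≤ i ≤ p_a - 1`, and `i_a` is moved to position `ζ_a(i)`. -/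
def treeSign {n : ℕ} (I : NSOp n) : ℤˣ :=
  shuffleSign (Finset.univ.sigma fun a : Fin n =>
      Finset.Ico 1 (if I.color a = 0 then 2 else I.color a))
    (fun a i => (I.1.fill.zeta a i : ℤ))

/-- `X` is a colouring of the word `W` : every vertex plugged with `m` has exactly two children, and
`W` is the word of `X`. In particular, `u` lies below `v` in `X` iff `W = … u … v … u …`, and `u` lies
to the left of `v` iff all occurrences of `u` in `W` precede those of `v`; but these two orders alone
do not determine the word (`1213141`, `121341` and `123141` have the same ones). -/
def IsWordColoring {n : ℕ} (W : Word n) (X : MNSOp n) : Prop :=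
  X.MulFull ∧ X.word = W.1

open Classical in
/-- The sign of a colouring of a word, with colours `0` replaced by `2`. The letters are `i_a` with
`0 ≤ i ≤ q_a - 1`. The letters `0_a` with `a` interposed are moved to the front, in reverse order of
first occurrence in `W` ; they are followed by the other letters `i_a`, in position `ζ_a(i)`. -/
def wordSign {n : ℕ} (W : Word n) (X : MNSOp n) : ℤˣ :=
  shuffleSign (Finset.univ.sigma fun a : Fin n =>
      Finset.range (if X.color a = 0 then 2 else X.color a))
    (fun a i => if i = 0 ∧ W.Interposed a then -1 - (W.1.idxOf a : ℤ) else (X.zeta a i : ℤ))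

open Classical in
/-- The coefficients of `φ(T) = ∑_I sgn_T(I) I`, the sum over the colourings of `T`. -/
def phiCoeff {n : ℕ} (T : PTree n) (I : NSOp n) : ℤ :=
  if IsTreeColoring T I then (treeSign I : ℤ) else 0

open Classical in
/-- The coefficients of `φ̄(W) = ∑_X sgn_W(X) X`, the sum over the colourings of `W`. -/
def phiBarCoeff {n : ℕ} (W : Word n) (X : MNSOp n) : ℤ :=
  if IsWordColoring W X then (wordSign W X : ℤ) else 0

/-- The exponent of the Koszul sign of the rearrangement of degrees
`q_1, …, q_n, p_1 - 1, …, p_n - 1` to `q_1, p_1 - 1, …, q_n, p_n - 1`. -/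
def hadamardExp {n : ℕ} (Z : PatchPair n) : ℤ :=
  ∑ i, ∑ j, if i < j then ((Z.2.color i : ℤ) - 1) * Z.1.color j else 0

/-- The map `φ̄ ⊗ φ` on `F₂S ⊗ Brace`. -/
def phi (k : Type u) [CommRing k] (n : ℕ) : (FSBrace k).obj n →ₗ[k] (PairOp k).obj n :=
  Finsupp.linearCombination k (fun Q : Word n × PTree n => (fun Z : PatchPair n =>
    (((hadamardExp Z).negOnePow * (phiBarCoeff Q.1 Z.1 * phiCoeff Q.2 Z.2) : ℤ) : k)))

end QuiltPatch

end

noncomputable section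

namespace QuiltPatch

universe u

namespace Term
variable {α β γ : Type}

/-- The traversal of a tree with inputs: every vertex is written at each visit, flagged at the first
one, and free inputs are written as `none`. -/
def encF : Term α → List (Option (α × Bool))
  | leaf => [none]
  | node a _ c => some (a, true) :: (List.ofFn fun j => (c j).encF ++ [some (a, false)]).flatten
  | mul l r => l.encF ++ r.encF

/-- The traversal of a tree with inputs. -/
def enc : Term α → List (Option α)
  | leaf => [none]
  | node a _ c => some a :: (List.ofFn fun j => (c j).enc ++ [some a]).flatten
  | mul l r => l.enc ++ r.enc

lemma map_encF (t : Term α) : t.encF.map (Option.map Prod.fst) = t.enc := by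
  induction t with
  | leaf => rfl
  | node a q c ih => simp [encF, enc, Function.comp_def, ih]
  | mul l r ih1 ih2 => grind [encF, enc]

lemma enc_ne_nil (t : Term α) : t.enc ≠ [] := by
  induction t with
  | leaf => simp [enc]
  | node a q c _ => simp [enc]
  | mul l r ih _ => simp [enc, ih]

lemma enc_map (f : α → β) (t : Term α) : (t.map f).enc = t.enc.map (Option.map f) := by
  induction t with
  | leaf => rfl
  | node a q c ih => simp [Term.map, enc, Function.comp_def, ih]
  | mul l r ih1 ih2 => grind [Term.map, enc]

lemma encF_map (f : α → β) (t : Term α) :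
    (t.map f).encF = t.encF.map (Option.map (Prod.map f id)) := by
  induction t with
  | leaf => rfl
  | node a q c ih => simp [Term.map, encF, Function.comp_def, ih]
  | mul l r ih1 ih2 => grind [Term.map, encF]

lemma Assoc.enc_eq {t : Term α} (h : Assoc t t') : t.enc = t'.enc := by
  induction h with
  | assoc x y z => grind [enc]
  | node x q c c' hc ih => simp [enc, ih]
  | mul l l' r r' _ _ ih1 ih2 => grind [enc]
  | refl t => rfl
  | symm t t' _ ih => exact ih.symm
  | trans t t' t'' _ _ ih1 ih2 => exact ih1.trans ih2

lemma countP_encF_none (t : Term α) : t.encF.countP (·.isNone) = t.leaves := by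
  induction t with
  | leaf => rfl
  | node a q c ih =>
    simp [encF, leaves, ih, List.sum_ofFn]
  | mul l r ih1 ih2 => grind [encF, leaves]

lemma countP_enc_none (t : Term α) : t.enc.countP (·.isNone) = t.leaves := by
  rw [← countP_encF_none, ← map_encF, List.countP_map]
  congr 1
  grind

lemma count_encF_true [DecidableEq α] (t : Term α) a :
    t.encF.count (some (a, true)) = t.count a := by
  induction t with
  | leaf => rfl
  | node b q c ih =>
    simp [encF, count, List.count_cons, List.count_flatten, List.map_ofFn, List.sum_ofFn, Prod.mk.injEq]
    grind
  | mul l r ih1 ih2 => grind [encF, count]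

lemma count_encF_false [DecidableEq α] (t : Term α) a :
    t.encF.count (some (a, false)) = t.arity a := by
  induction t with
  | leaf => rfl
  | node b q c ih =>
    simp only [encF, arity, List.count_cons, List.count_flatten, List.map_ofFn, Function.comp_def,
      List.count_append, ih, List.sum_ofFn, Finset.sum_add_distrib]
    simp
    split_ifs <;> omega
  | mul l r ih1 ih2 => grind [encF, arity]

lemma count_enc [DecidableEq α] (t : Term α) a :
    t.enc.count (some a) = t.arity a + t.count a := by
  rw [← count_encF_true, ← count_encF_false, ← map_encF]
  induction t.encF with
  | nil => rfl
  | cons s l ih =>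
    rw [List.map_cons, List.count_cons, List.count_cons, List.count_cons, ih]
    rcases s with _ | ⟨b, _ | _⟩
    all_goals grind

lemma some_mem_enc (t : Term α) a : some a ∈ t.enc ↔ 0 < t.count a := by
  induction t with
  | leaf => simp [enc, count]
  | node b q c ih =>
    simp only [enc, count, List.mem_cons, List.mem_flatten, List.mem_ofFn, Option.some.injEq]
    constructor
    · rintro (h | ⟨l, ⟨j, rfl⟩, h⟩)
      · simp [h]
      rw [List.mem_append, ih] at h
      rcases h with h | h
      · have := Finset.single_le_sum (f := fun j => (c j).count a) (fun _ _ => Nat.zero_le _)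
          (Finset.mem_univ j)
        omega
      grind
    intro h
    by_cases hb : b = a
    · exact Or.inl hb.symm
    · rw [if_neg hb, zero_add] at h
      obtain ⟨j, -, hj⟩ := Finset.exists_ne_zero_of_sum_ne_zero h.ne'
      grind
  | mul l r ih1 ih2 =>
    grind [enc, count]

/-- The number of vertices. -/
def nodes : Term α → ℕ
  | leaf => 0
  | node _ _ c => 1 + ∑ j, (c j).nodes
  | mul l r => l.nodes + r.nodes

/-- The number of vertices plugged with the multiplication. -/
def muls : Term α → ℕ
  | leaf => 0
  | node _ _ c => ∑ j, (c j).muls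
  | mul l r => l.muls + r.muls + 1

lemma length_enc (t : Term α) : t.enc.length + 1 + t.muls = 2 * (t.nodes + t.leaves) := by
  induction t with
  | leaf => rfl
  | node b q c ih =>
    simp [enc, muls, nodes, leaves, List.length_cons, List.length_flatten, List.map_ofFn,
      Function.comp_def, List.length_append, List.sum_ofFn, List.length_nil]
    have h := Finset.sum_congr (rfl : Finset.univ = _) (fun j _ => ih j)
    simp [Finset.sum_add_distrib, ← Finset.mul_sum, zero_add] at h ⊢
    omega
  | mul l r ih1 ih2 =>
    grind [enc, muls, nodes, leaves]

lemma sum_count (t : Term (Fin n)) : ∑ a, t.count a = t.nodes := by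
  induction t with
  | leaf => simp [count, nodes]
  | node b q c ih =>
    simp [count, Finset.sum_add_distrib]
    rw [Finset.sum_comm, Finset.sum_congr rfl fun j _ => ih j]
    refine congrArg (· + _) ((Finset.sum_eq_single_of_mem b (Finset.mem_univ b) fun x _ hx => if_neg hx.symm).trans
      (if_pos rfl))
  | mul l r ih1 ih2 => simp_all [Finset.sum_add_distrib, count, nodes]

lemma noMul_iff (t : Term α) : t.NoMul ↔ t.muls = 0 := by
  induction t with
  | leaf => simp [NoMul, muls]
  | node b q c ih => simp [NoMul, muls, ih]
  | mul l r _ _ => simp [NoMul, muls]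

lemma Assoc.muls_eq {t : Term α} (h : Assoc t t') : t.muls = t'.muls := by
  induction h with
  | assoc x y z => simp [muls]; omega
  | node x q c c' hc ih => simp [muls, ih]
  | mul l l' r r' _ _ ih1 ih2 => grind [muls]
  | refl t => rfl
  | symm t t' _ ih => exact ih.symm
  | trans t t' t'' _ _ ih1 ih2 => exact ih1.trans ih2

lemma Assoc.eq_of_muls {t : Term α} (h : Assoc t t') (h0 : t.muls = 0) : t = t' := by
  induction h with
  | assoc x y z => simp [muls] at h0
  | node x q c c' hc ih =>
    simp [muls, true_implies] at h0
    aesop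
  | mul l l' r r' _ _ ih1 ih2 => simp [muls] at h0
  | refl t => rfl
  | symm t t' h ih => exact (ih (h.muls_eq.trans h0)).symm
  | trans t t' t'' h _ ih1 ih2 => grind

/-- The labels of the vertices are distinct. -/
def Linear (t : Term α) : Prop := ∀ a, t.count a ≤ 1

lemma Valid.linear {t : Term α} (h : t.Valid) : t.Linear := fun a => (h.2 a).le

lemma Linear.left_of_mul {l : Term α} (h : (mul l r).Linear) : l.Linear := fun a => by
  have := h a
  grind [count]

lemma Linear.right_of_mul {l : Term α} (h : (mul l r).Linear) : r.Linear := fun a => by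
  have := h a
  grind [count]

lemma Linear.disjoint_of_mul (h : (mul l r).Linear) {a : α} (h1 : some a ∈ l.enc)
    (h2 : some a ∈ r.enc) : False := by
  have := h a
  grind [some_mem_enc, count]

lemma Linear.child {a : α} {c} (h : (node a q c).Linear) j : (c j).Linear := fun b => by
  have := h b
  simp [count] at this
  have := Finset.single_le_sum (f := fun j => (c j).count b) (fun _ _ => Nat.zero_le _)
            (Finset.mem_univ j)
  omega

lemma Linear.notMem_child {a : α} {c} (h : (node a q c).Linear) j : some a ∉ (c j).enc := by
  rw [some_mem_enc]
  have h1 := h a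
  simp_all [count]

lemma Linear.eq_of_mem_child {c} (h : (node a q c).Linear) {b : α} {j} (hi : some b ∈ (c i).enc)
    (hj : some b ∈ (c j).enc) : i = j := by
  rw [some_mem_enc] at hi hj
  have h1 := h b
  simp [count] at h1
  have := Finset.sum_le_sum_of_subset (f := fun j => (c j).count b) (Finset.subset_univ {i, j})
  grind

end Term

/-- No letter is immediately repeated, and no two letters are interlaced. -/
structure IsTrav {α : Type} (l : List (Option α)) : Prop where
  no_rep : ∀ a, ¬ [some a, some a] <:+: l
  no_cross : ∀ u v, u ≠ v → ¬ [some u, some v, some u, some v].Sublist l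

section Split

variable {β : Type} (x : β)

lemma exists_split [DecidableEq β] l : ∃ (L : List _) (R : List β),
    l = (L.map (· ++ [x])).flatten ++ R ∧ (∀ E ∈ L, x ∉ E) ∧ x ∉ R := by
  induction l with
  | nil => exact ⟨[], [], by simp⟩
  | cons y l ih =>
    obtain ⟨L, R, rfl, hL, hR⟩ := ih
    by_cases hy : y = x
    · subst hy
      exact ⟨[] :: L, R, by simp, by simpa using hL, hR⟩
    rcases L with _ | ⟨E, L⟩
    · exact ⟨[], y :: R, by simp, by simp, by simp [hR, Ne.symm hy]⟩
    · refine ⟨(y :: E) :: L, R, by simp, ?_, hR⟩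
      grind

lemma split_unique {L : List _}
    (h : (L.map (· ++ [x])).flatten ++ R = (L'.map (· ++ [x])).flatten ++ R')
    (hL : ∀ E ∈ L, x ∉ E) (hL' : ∀ E ∈ L', x ∉ E) (hR : x ∉ R) (hR' : x ∉ R') :
    L = L' ∧ R = R' := by
  induction L generalizing L' with
  | nil =>
    rcases L' with _ | ⟨E, L'⟩
    · simpa using h
    simp_all
  | cons E L ih =>
    rcases L' with _ | ⟨E', L'⟩
    · aesop
    · simp at hL hL'
      have key : E = E' ∧ (L.map (· ++ [x])).flatten ++ R = (L'.map (· ++ [x])).flatten ++ R' := by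
        induction E generalizing E' with
        | nil =>
          rcases E' with _ | ⟨y, E'⟩
          · simpa using h
          grind
        | cons z E ihE =>
          rcases E' with _ | ⟨y, E'⟩
          · grind
          grind
      grind

end Split

namespace IsTrav

variable {α β : Type}

lemma mono {l : List (Option α)} (h : IsTrav l) (hl : l' <:+: l) : IsTrav l' :=
  ⟨fun a ha => h.no_rep a (ha.trans hl), fun u v huv hs => h.no_cross u v huv (hs.trans hl.sublist)⟩

lemma append {l : List (Option α)} (hl : IsTrav l) (hr : IsTrav r)
    (hd : ∀ a, some a ∈ l → some a ∉ r) : IsTrav (l ++ r) := by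
  refine ⟨fun a ha => ?_, fun u v huv hs => ?_⟩
  · rw [List.infix_append_iff] at ha
    rcases ha with h | h | ⟨p, s, h, hp, hs⟩
    · exact hl.no_rep a h
    · exact hr.no_rep a h
    · rcases p with _ | ⟨b, p⟩
      · exact hr.no_rep a (by rw [h]; exact hs.isInfix)
      rcases s with _ | ⟨b', s⟩
      · simp only [List.append_nil] at h
        exact hl.no_rep a (by rw [h]; exact hp.isInfix)
      · have e1 : b = some a := by grind
        have e2 : some a ∈ b' :: s := by
          rcases p with _ | ⟨c, p⟩
          · grind
          · simp at h
        exact hd a (hp.subset (by simp [e1])) (hs.subset e2)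
  · rw [List.sublist_append_iff] at hs
    obtain ⟨p, s, h, hp, hs⟩ := hs
    rcases p with _ | ⟨p1, _ | ⟨p2, _ | ⟨p3, _ | ⟨p4, p5⟩⟩⟩⟩ <;> simp at h
    · grind [IsTrav.no_cross]
    · grind
    · grind
    · grind
    grind [IsTrav.no_cross]

end IsTrav

namespace Term

variable {α : Type}

lemma isTrav_node {a : α} (L : List _) (h : ∀ E ∈ L, IsTrav E)
    (h0 : ∀ E ∈ L, E ≠ []) (ha : ∀ E ∈ L, some a ∉ E)
    (hd : L.Pairwise fun E E' => ∀ b, some b ∈ E → some b ∉ E') :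
    IsTrav (some a :: (L.map (· ++ [some a])).flatten) ∧
      ∀ v, v ≠ a → ¬ [some v, some a, some v].Sublist (some a :: (L.map (· ++ [some a])).flatten) := by
  induction L with
  | nil =>
    refine ⟨⟨fun b hb => ?_, fun u v huv hs => ?_⟩, fun v _ hs => ?_⟩
    · simpa using hb.length_le
    · aesop
    aesop
  | cons E L ih =>
    simp at h h0 ha hd
    obtain ⟨ih1, ih2⟩ := ih h.2 h0.2 ha.2 hd.2
    have e : some a :: ((E :: L).map (· ++ [some a])).flatten =
        (some a :: E) ++ (some a :: (L.map (· ++ [some a])).flatten) := by simp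
    rw [e]
    set G := some a :: (L.map _).flatten with hG
    have dis : ∀ b, some b ∈ some a :: E → some b ∈ G → b = a := by
      aesop
    have h3 : ∀ v, v ≠ a → ¬ [some v, some a, some v].Sublist ((some a :: E) ++ G) := by
      intro v hv hs
      rw [List.sublist_append_iff] at hs
      obtain ⟨p, s, h', hp, hs⟩ := hs
      rcases p with _ | ⟨p1, _ | ⟨p2, _ | ⟨p3, p4⟩⟩⟩ <;> simp at h'
      · grind
      · grind
      · grind
      obtain ⟨rfl, rfl, rfl, rfl, rfl⟩ := h'
      rw [List.sublist_cons_iff] at hp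
      rcases hp with hp | ⟨r, hr, hp⟩
      · exact ha.1 (hp.subset (by simp))
      grind
    refine ⟨⟨fun b hb => ?_, fun u v huv hs => ?_⟩, h3⟩
    · rw [List.infix_append_iff] at hb
      have hE : ∀ b, ¬ [some b, some b] <:+: some a :: E := by
        intro b hb
        rw [List.infix_cons_iff] at hb
        rcases hb with hb | hb
        · grind
        · exact h.1.no_rep b hb
      rcases hb with hb | hb | ⟨p, s, h', hp, hs⟩
      · exact hE b hb
      · exact ih1.no_rep b hb
      · rcases s with _ | ⟨s1, _ | ⟨s2, s3⟩⟩
        · grind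
        · have e1 : p = [some b] ∧ s1 = some b := by
            rcases p with _ | ⟨p1, _ | ⟨p2, p⟩⟩ <;> simp at h'
            grind
          obtain ⟨t, ht⟩ := hp
          rcases List.eq_nil_or_concat' E with rfl | ⟨E', y, rfl⟩
          · exact h0.1 rfl
          grind [List.append_inj_right']
        have : p = [] := by
          have := congrArg List.length h'
          grind [List.length_eq_zero_iff]
        grind [IsTrav.no_rep]
    · rw [List.sublist_append_iff] at hs
      obtain ⟨p, s, h', hp, hs⟩ := hs
      rcases p with _ | ⟨p1, _ | ⟨p2, _ | ⟨p3, _ | ⟨p4, p5⟩⟩⟩⟩ <;> simp at h'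
      · grind [IsTrav.no_cross]
      · grind
      · grind
      · grind
      obtain ⟨rfl, rfl, rfl, rfl, rfl, rfl⟩ := h'
      rw [List.sublist_cons_iff] at hp
      rcases hp with hp | ⟨r, hr, hp⟩
      · exact h.1.no_cross u v huv hp
      grind

lemma enc_node (a : α) q c :
    (node a q c).enc = some a :: ((List.ofFn fun j => (c j).enc).map (· ++ [some a])).flatten := by
  aesop

lemma Linear.isTrav {t : Term α} (h : t.Linear) : IsTrav t.enc := by
  induction t with
  | leaf =>
    refine ⟨fun a ha => ?_, fun u v huv hs => ?_⟩
    · simpa [enc] using ha.length_le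
    · simpa [enc] using hs.length_le
  | node a q c ih =>
    rw [enc_node]
    refine (isTrav_node _ ?_ ?_ ?_ ?_).1
    · simp
      exact fun j => ih j (h.child j)
    · grind [enc_ne_nil]
    · simp_all [Term.Linear.notMem_child]
    rw [List.pairwise_ofFn]
    intro i j hij b hi hj
    exact hij.ne (h.eq_of_mem_child hi hj)
  | mul l r ih1 ih2 =>
    exact (ih1 h.left_of_mul).append (ih2 h.right_of_mul) fun a => h.disjoint_of_mul

/-- A term that is not a product. -/
def Item : Term α → Prop
  | mul _ _ => False
  | _ => True

lemma exists_head (t : Term α) : t.Item ∨ ∃ h r, h.Item ∧ Assoc t (mul h r) := by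
  induction t with
  | leaf => exact Or.inl trivial
  | node a q c _ => exact Or.inl trivial
  | mul l r ih1 _ =>
    right
    rcases ih1 with hl | ⟨h, r', hh, ha⟩
    · exact ⟨l, r, hl, Assoc.refl _⟩
    exact ⟨h, mul r' r, hh, Assoc.trans _ _ _ (Assoc.mul _ _ _ _ ha (Assoc.refl _))
      (Assoc.assoc _ _ _)⟩

lemma Assoc.linear {t : Term α} (h : Assoc t t') (ht : t.Linear) : t'.Linear :=
  fun a => (h.count_eq a) ▸ ht a

lemma exists_head' (t : Term α) (ht : t.Linear) : ∃ h, h.Item ∧ h.Linear ∧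
    ((Assoc t h ∧ t.enc = h.enc) ∨ ∃ r, Assoc t (mul h r) ∧ r.Linear ∧ t.enc = h.enc ++ r.enc ∧
      ∀ a, some a ∈ h.enc → some a ∉ r.enc) := by
  rcases exists_head t with h | ⟨h, r, hh, ha⟩
  · exact ⟨t, h, ht, Or.inl ⟨Assoc.refl _, rfl⟩⟩
  have hl := ha.linear ht
  exact ⟨h, hh, hl.left_of_mul, Or.inr ⟨r, ha, hl.right_of_mul, ha.enc_eq,
    fun a => hl.disjoint_of_mul⟩⟩

lemma assoc_of_enc_eq {t : Term α} (ht : t.Linear) (ht' : t'.Linear) (h : t.enc = t'.enc) :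
    Assoc t t' := by
  obtain ⟨N, hN⟩ : ∃ N, t.enc.length ≤ N := ⟨_, le_rfl⟩
  induction N generalizing t t' with
  | zero => grind [enc_ne_nil]
  | succ N ih =>
    obtain ⟨g, hg, hgl, hr⟩ := exists_head' t ht
    obtain ⟨g', hg', hgl', hr'⟩ := exists_head' t' ht'
    have rem : ∀ {s k : Term α}, ((Assoc s k ∧ s.enc = k.enc) ∨ ∃ r, Assoc s (mul k r) ∧
        r.Linear ∧ s.enc = k.enc ++ r.enc ∧ ∀ a, some a ∈ k.enc → some a ∉ r.enc) →
        ∃ R, s.enc = k.enc ++ R ∧ (∀ a, some a ∈ k.enc → some a ∉ R) ∧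
          ((R = [] ∧ Assoc s k) ∨ ∃ r, Assoc s (mul k r) ∧ r.Linear ∧ R = r.enc) := by
      rintro s k (⟨h0, h1⟩ | ⟨r, h0, h3, h1, h2⟩)
      · exact ⟨[], by simp [h1], by simp, Or.inl ⟨rfl, h0⟩⟩
      grind
    obtain ⟨R, hR, hRd, hr⟩ := rem hr
    obtain ⟨R', hR', hRd', hr'⟩ := rem hr'
    have hlen : t.enc.length = g.enc.length + R.length := by rw [hR, List.length_append]
    have key : Assoc g g' ∧ R = R' := by
      rw [hR, hR'] at h
      rcases g with _ | ⟨a, q, c⟩ | ⟨l, r⟩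
      · rcases g' with _ | ⟨a', q', c'⟩ | ⟨l', r'⟩
        · exact ⟨Assoc.refl _, by simpa using h⟩
        · simp [enc] at h
        · exact hg'.elim
      · rcases g' with _ | ⟨a', q', c'⟩ | ⟨l', r'⟩
        · simp [enc] at h
        · have ea : a = a' := by grind [enc]
          subst ea
          rw [enc_node, enc_node, List.cons_append, List.cons_append, List.cons.injEq] at h
          obtain ⟨h1, h2⟩ := split_unique _ h.2
            (by simp; exact fun j => hgl.notMem_child j)
            (by simp; exact fun j => hgl'.notMem_child j)
            (hRd a (by simp [enc])) (hRd' a (by simp [enc]))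
          have eq := by simpa using congrArg List.length h1
          subst eq
          refine ⟨Assoc.node _ _ _ _ fun j => ih (hgl.child j) (hgl'.child j) (congrFun (List.ofFn_injective h1) j) ?_, h2⟩
          have : (c j).enc.length < (node a q c).enc.length := by
            rw [enc_node, List.length_cons, Nat.lt_succ_iff]
            refine List.Sublist.length_le ?_
            refine (List.sublist_append_left _ _).trans (List.sublist_flatten_of_mem (List.mem_map.2 ⟨_, List.mem_ofFn.2 ⟨j, rfl⟩, rfl⟩))
          omega
        · exact hg'.elim
      · exact hg.elim
    obtain ⟨hgg, rfl⟩ := key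
    have hgpos := List.length_pos_iff.2 (enc_ne_nil g)
    rcases hr with ⟨h1, h2⟩ | ⟨r, h1, h2, h3⟩ <;> rcases hr' with ⟨k1, k2⟩ | ⟨r', k1, k2, k3⟩
    · exact Assoc.trans _ _ _ h2 (Assoc.trans _ _ _ hgg (Assoc.symm _ _ k2))
    · grind [enc_ne_nil]
    · grind [enc_ne_nil]
    have := ih h2 k2 (h3.symm.trans k3) (by rw [← h3]; omega)
    exact Assoc.trans _ _ _ h1 (Assoc.trans _ _ _ (Assoc.mul _ _ _ _ hgg this)
      (Assoc.symm _ _ k1))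

lemma exists_enc_eq (h : IsTrav l) (h0 : l ≠ []) :
    ∃ t : Term α, t.Linear ∧ t.enc = l := by
  classical
  obtain ⟨N, hN⟩ : ∃ N, l.length ≤ N := ⟨_, le_rfl⟩
  induction N generalizing l with
  | zero => grind
  | succ N ih =>
    have glue : ∀ (t : Term α) (R : List _), t.Linear → l = t.enc ++ R →
        (∀ a, some a ∈ t.enc → some a ∉ R) → ∃ t : Term α, t.Linear ∧ t.enc = l := by
      intro t R ht hR hd
      by_cases hR0 : R = []
      · grind
      have := List.length_pos_iff.2 (enc_ne_nil t)
      obtain ⟨r, hr, rfl⟩ := ih (h.mono (by grind [List.suffix_append])) hR0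
        (by grind)
      refine ⟨mul t r, fun a => ?_, by rw [hR]; rfl⟩
      have h1 := ht a
      have h2 := hr a
      have h3 := hd a
      grind [some_mem_enc, count]
    rcases l with _ | ⟨_ | a, l⟩
    · exact (h0 rfl).elim
    · exact glue leaf l (fun a => by simp [count]) rfl (fun a => by simp [enc])
    obtain ⟨L, R, rfl, hL, hR⟩ := exists_split (some a) l
    have hmem : ∀ E ∈ L, E ++ [some a] <:+: some a :: ((L.map (· ++ [some a])).flatten ++ R) := by
      intro E hE
      have : E ++ [some a] ∈ L.map (· ++ [some a]) := List.mem_map.2 ⟨E, hE, rfl⟩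
      obtain ⟨s, t, ht⟩ := List.append_of_mem this
      grind
    have hE0 : ∀ E ∈ L, E ≠ [] := by
      rintro E hE rfl
      obtain ⟨s, t, ht⟩ := List.append_of_mem hE
      apply h.no_rep a
      rw [ht]
      rcases List.eq_nil_or_concat' s with rfl | ⟨s', y, rfl⟩
      · exact ⟨[], (t.map (· ++ [some a])).flatten ++ R, by simp⟩
      grind [List.map]
    have hlen : ∀ E ∈ L, E.length ≤ N := by
      grind
    have hex : ∀ j : Fin L.length, ∃ t : Term α, t.Linear ∧ t.enc = L.get j := fun j =>
      ih (h.mono (((List.prefix_append _ _).isInfix).trans (hmem _ (List.get_mem L j))))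
        (hE0 _ (List.get_mem L j)) (hlen _ (List.get_mem L j))
    choose c hc1 hc2 using hex
    have henc : (node a L.length c).enc = some a :: (L.map (· ++ [some a])).flatten := by
      rw [enc_node]
      congr 3
      simp only [hc2]
      exact List.ofFn_get L
    have hsplit : ∀ (b : α) (s t : List (List (Option α))) (E : List (Option α)),
        L = s ++ E :: t → some b ∈ E → some b ∉ (t.map (· ++ [some a])).flatten ++ R := by
      intro b s t E hst hb hb'
      have hba : b ≠ a := by
        grind
      apply h.no_cross a b hba.symm
      have h1 : [some b].Sublist E := List.singleton_sublist.2 hb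
      have h2 : [some b].Sublist ((t.map (· ++ [some a])).flatten ++ R) :=
        List.singleton_sublist.2 hb'
      rw [hst]
      simp only [List.map_append, List.map_cons, List.flatten_append, List.flatten_cons,
        List.append_assoc, List.cons_append, List.nil_append]
      refine List.Sublist.cons_cons _ ?_
      grind
    refine glue (node a L.length c) R ?_ (by rw [henc]; rfl) ?_
    · intro b
      simp only [count]
      by_cases hb : ∃ j, some b ∈ (c j).enc
      · obtain ⟨j, hj⟩ := hb
        have hab : a ≠ b := by
          grind
        rw [if_neg hab, Finset.sum_eq_single_of_mem j (Finset.mem_univ j), zero_add]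
        · exact hc1 j b
        · intro i _ hij
          by_contra hi
          have hi' := (some_mem_enc _ _).2 (Nat.pos_of_ne_zero hi)
          rw [hc2] at hi' hj
          have key : ∀ i j : Fin L.length, i < j → some b ∈ L.get i → some b ∈ L.get j → False := by
            intro i j hij hi hj
            refine hsplit b (L.take i) (L.drop (i + 1)) (L.get i) ?_ hi ?_
            · simp
            · rw [List.mem_append, List.mem_flatten]
              refine Or.inl ⟨L.get j ++ [some a], List.mem_map.2 ⟨L.get j, ?_, rfl⟩, List.mem_append_left _ hj⟩
              rw [List.mem_iff_getElem]
              refine ⟨j - (i + 1), by simp; omega, ?_⟩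
              have : (i : ℕ) + 1 + (j - (i + 1)) = j := by omega
              simp [this]
          grind
      · push Not at hb
        have : ∑ j, (c j).count b = 0 := by
          grind [Finset.sum_eq_zero, some_mem_enc]
        grind
    · intro b hb
      rw [henc, List.mem_cons, List.mem_flatten] at hb
      by_cases hba : b = a
      · grind
      · rcases hb with hb | ⟨E', hE', hb⟩
        · grind
        · obtain ⟨E, hE, rfl⟩ := List.mem_map.1 hE'
          have hb : some b ∈ E := by simpa [hba] using hb
          obtain ⟨s, t, hst⟩ := List.append_of_mem hE
          grind

end Term

section LComp

variable {α β γ δ ε : Type}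

/-- The letters before the first free input. -/
def seg : List (Option β) → List β
  | [] => []
  | none :: _ => []
  | some b :: y => b :: seg y

/-- What follows the first free input. -/
def rest : List (Option β) → List (Option β)
  | [] => []
  | none :: y => y
  | some _ :: y => rest y

/-- The letters `a` with `φ a = none` are replaced by the successive segments of `y`, the others are
relabelled by `φ`. -/
def lcomp (φ : α → Option γ) (ψ : β → γ) : List (Option α) → List (Option β) → List (Option γ)
  | [], _ => []
  | none :: x, y => none :: lcomp φ ψ x y
  | some a :: x, y => (φ a).elim ((seg y).map (fun b => some (ψ b)) ++ lcomp φ ψ x (rest y))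
      (fun c => some c :: lcomp φ ψ x y)

/-- The number of letters `a` with `φ a = none`. -/
def hits (φ : α → Option γ) (x : List (Option α)) : ℕ :=
  x.countP (Option.any fun a => (φ a).isNone)

/-- The number of free inputs. -/
def nones (y : List (Option β)) : ℕ := y.countP (·.isNone)

@[simp] theorem nones_nil : nones ([] : List (Option β)) = 0 := rfl

@[simp] theorem nones_none (y : List (Option β)) : nones (none :: y) = nones y + 1 := by
  simp [nones]

@[simp] theorem nones_some (b : β) y : nones (some b :: y) = nones y := by
  simp [nones]

@[simp] theorem nones_append (y z : List (Option β)) : nones (y ++ z) = nones y + nones z := by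
  simp [nones]

@[simp] theorem nones_map_option (f : β → γ) y :
    nones (y.map (Option.map f)) = nones y := by
  rw [nones, List.countP_map]
  congr 1
  grind

@[simp] theorem nones_map_some (f : δ → β) (l : List δ) :
    nones (l.map fun b => some (f b)) = 0 := by
  simp [nones, List.countP_map]

variable {φ : α → Option γ} {ψ : β → γ}

lemma lcomp_hit (h : φ a = none) x y :
    lcomp φ ψ (some a :: x) y = (seg y).map (fun b => some (ψ b)) ++ lcomp φ ψ x (rest y) := by
  simp [lcomp, h]

lemma lcomp_some (h : φ a = some c) x y :
    lcomp φ ψ (some a :: x) y = some c :: lcomp φ ψ x y := by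
  simp [lcomp, h]

lemma hits_hit (h : φ a = none) x :
    hits φ (some a :: x) = hits φ x + 1 := by
  simp [hits, h]

lemma hits_some (h : φ a = some c) x :
    hits φ (some a :: x) = hits φ x := by
  simp [hits, h]

@[simp] theorem hits_nil : hits φ [] = 0 := rfl

@[simp] theorem hits_none x : hits φ (none :: x) = hits φ x := by
  simp [hits]

@[simp] theorem hits_append x x' :
    hits φ (x ++ x') = hits φ x + hits φ x' := by
  simp [hits]

/-- Case analysis on the head of the outer list. -/
lemma lcomp_induction {P : List _ → List (Option β) → Prop} (φ : α → Option γ)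
    (nil : ∀ y, P [] y) (none : ∀ x y, P x y → P (none :: x) y)
    (hit : ∀ a x y, φ a = Option.none → P x (rest y) → P (some a :: x) y)
    (keep : ∀ a c x y, φ a = some c → P x y → P (some a :: x) y) x
    y : P x y := by
  induction x generalizing y with
  | nil => exact nil y
  | cons s x ih =>
    rcases s with _ | a
    · exact none x y (ih y)
    cases h : φ a with
    | none => grind
    | some c => grind

lemma lcomp_append u v y :
    lcomp φ ψ (u ++ v) y = lcomp φ ψ u y ++ lcomp φ ψ v (rest^[hits φ u] y) := by
  induction u, y using lcomp_induction φ with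
  | nil y => rfl
  | none x y ih => simp [lcomp, ih]
  | hit a x y h ih => simp_all [lcomp_hit, hits_hit]
  | keep a c x y h ih => grind [lcomp_some, hits_some]

lemma lcomp_congr_of_hits_eq_zero (h : hits φ x = 0)
    y y' : lcomp φ ψ x y = lcomp φ ψ x y' := by
  induction x, y using lcomp_induction φ with
  | nil y => rfl
  | none x y ih => simp_all [lcomp]
  | hit a x y h' ih => grind [hits_hit]
  | keep a c x y h' ih => grind [lcomp_some, hits_some]

lemma seg_map (f : β → γ) y : seg (y.map (Option.map f)) = (seg y).map f := by
  induction y with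
  | nil => rfl
  | cons s y ih => cases s <;> simp [seg, ih]

lemma rest_map (f : β → γ) y :
    rest (y.map (Option.map f)) = (rest y).map (Option.map f) := by
  induction y with
  | nil => rfl
  | cons s y ih => cases s <;> simp [rest, ih]

lemma lcomp_map_right (f : β → δ) ψ x y :
    lcomp φ ψ x (y.map (Option.map f)) = lcomp φ (ψ ∘ f) x y := by
  induction x, y using lcomp_induction φ with
  | nil y => rfl
  | none x y ih => simp [lcomp, ih]
  | hit a x y h ih => simp [lcomp_hit h, ih, seg_map, rest_map]
  | keep a c x y h ih => simp [lcomp_some h, ih]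

/-- Compatibility with relabelling of all letters. -/
lemma map_lcomp (p : α → α') (q : β → β') (s : γ → γ') {φ'}
    (hφ : ∀ a, φ' (p a) = (φ a).map s) (hψ : ∀ b, ψ' (q b) = s (ψ b))
    x y :
    (lcomp φ ψ x y).map (Option.map s) =
      lcomp φ' ψ' (x.map (Option.map p)) (y.map (Option.map q)) := by
  induction x, y using lcomp_induction φ with
  | nil y => rfl
  | none x y ih => simp [lcomp, ih]
  | hit a x y h ih =>
    simp_all [lcomp_hit, seg_map, rest_map]
  | keep a c x y h ih =>
    grind [lcomp_some]

lemma seg_append (l : List β) y : seg (l.map some ++ y) = l ++ seg y := by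
  induction l with
  | nil => rfl
  | cons b l ih => simp [seg, ih]

lemma rest_append (l : List β) y : rest (l.map some ++ y) = rest y := by
  induction l with
  | nil => rfl
  | cons b l ih => simp [rest, ih]

lemma nones_rest (y : List (Option β)) : nones (rest y) = nones y - 1 := by
  induction y with
  | nil => rfl
  | cons s y ih => cases s <;> simp [rest, ih]

lemma rest_iterate_eq_nil (y : List (Option β)) (hk : nones y < k) :
    rest^[k] y = [] := by
  have hnil : ∀ k, rest^[k] ([] : List (Option β)) = [] := fun k => by
    induction k with
    | zero => rfl
    | succ k ih => exact ih
  induction y generalizing k with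
  | nil => exact hnil k
  | cons s y ih =>
    obtain ⟨k, rfl⟩ := Nat.exists_eq_succ_of_ne_zero (by omega : k ≠ 0)
    rcases s with _ | b
    · aesop
    · exact ih (k := k + 1) (by simpa using hk)

lemma nones_lcomp x y :
    nones (lcomp φ ψ x y) = nones x := by
  induction x, y using lcomp_induction φ with
  | nil y => rfl
  | none x y ih => simp [lcomp, ih]
  | hit a x y h ih => simp [lcomp_hit h, ih]
  | keep a c x y h ih => simp [lcomp_some h, ih]

lemma countP_seg_add (p : β → Bool) y :
    (seg y).countP p + (rest y).countP (Option.any p) = y.countP (Option.any p) := by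
  induction y with
  | nil => rfl
  | cons s y ih =>
    cases s
    · simp [seg, rest]
    grind [seg, rest]

lemma countP_lcomp_add p x y :
    (lcomp φ ψ x y).countP (Option.any p) +
        (rest^[hits φ x] y).countP (Option.any fun b => p (ψ b)) =
      x.countP (Option.any fun a => (φ a).any p) + y.countP (Option.any fun b => p (ψ b)) := by
  induction x, y using lcomp_induction φ with
  | nil y => simp [lcomp]
  | none x y ih => simpa [lcomp] using ih
  | hit a x y h ih =>
    rw [hits_hit h, lcomp_hit h, Function.iterate_succ_apply, List.countP_append, add_assoc, ih,
      ← countP_seg_add _ y]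
    simp only [List.countP_cons, List.countP_map, Option.any_some, h, Function.comp_def]
    simp
    omega
  | keep a c x y h ih =>
    grind [hits_some, lcomp_some]

lemma countP_lcomp p
    (h : hits φ x = nones y + 1) : (lcomp φ ψ x y).countP (Option.any p) =
      x.countP (Option.any fun a => (φ a).any p) + y.countP (Option.any fun b => p (ψ b)) := by
  rw [← countP_lcomp_add, h, rest_iterate_eq_nil y (Nat.lt_succ_self _)]
  simp

lemma lcomp_assoc {φ₂ : γ → Option μ} {ψ₂}
    {φ₃ : β → Option κ} {ψ₃ : δ → κ} {φ₄ : α → Option μ} {ψ₄}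
    (h1 : ∀ a, φ₁ a = none → φ₄ a = none)
    (h1' : ∀ a c, φ₁ a = some c → ∃ d, φ₂ c = some d ∧ φ₄ a = some d)
    (h2 : ∀ b, φ₂ (ψ₁ b) = (φ₃ b).map ψ₄) (h3 : ∀ c, ψ₂ c = ψ₄ (ψ₃ c))
    x y z :
    lcomp φ₂ ψ₂ (lcomp φ₁ ψ₁ x y) z = lcomp φ₄ ψ₄ x (lcomp φ₃ ψ₃ y z) := by
  induction x, y using lcomp_induction φ₁ generalizing z with
  | nil y => rfl
  | none x y ih => simp [lcomp, ih]
  | hit a x y h ih =>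
    rw [lcomp_hit h, lcomp_hit (h1 a h), lcomp_append]
    have key : ∀ z, lcomp φ₂ ψ₂ ((seg y).map fun b => some (ψ₁ b)) z =
        (seg (lcomp φ₃ ψ₃ y z)).map (fun b => some (ψ₄ b)) ∧
        lcomp φ₃ ψ₃ (rest y) (rest^[hits φ₂ ((seg y).map fun b => some (ψ₁ b))] z) =
        rest (lcomp φ₃ ψ₃ y z) := by
      intro z
      induction y generalizing z with
      | nil => simp [seg, rest, lcomp]
      | cons s y ih =>
        rcases s with _ | b
        · simp [seg, rest, lcomp]
        · cases hb : φ₃ b with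
          | none =>
            have e : (seg z).map (fun b => some (ψ₃ b)) = ((seg z).map ψ₃).map some := by simp
            rw [lcomp_hit hb, e, seg_append, rest_append]
            simp_all [lcomp_hit, hits_hit, seg, rest]
          | some d =>
            grind [lcomp_some, hits_some, seg, rest]
    grind
  | keep a c x y h ih =>
    grind [lcomp_some]

lemma lcomp_comm {φ₂ : γ → Option μ} {ψ₂}
    {φ₃ : α → Option κ} {ψ₃ : δ → κ} {φ₄} {ψ₄ : β → μ}
    (h1 : ∀ a, φ₁ a = none → ∃ c, φ₃ a = some c ∧ φ₄ c = none)
    (h1' : ∀ a c, φ₁ a = some c → (φ₂ c = none ∧ φ₃ a = none) ∨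
      ∃ d e, φ₂ c = some d ∧ φ₃ a = some e ∧ φ₄ e = some d)
    (h2 : ∀ b, φ₂ (ψ₁ b) = some (ψ₄ b)) (h3 : ∀ c, φ₄ (ψ₃ c) = some (ψ₂ c))
    x y z :
    lcomp φ₂ ψ₂ (lcomp φ₁ ψ₁ x y) z = lcomp φ₄ ψ₄ (lcomp φ₃ ψ₃ x z) y := by
  have keep : ∀ {κ μ β δ : Type} (φ : κ → Option μ) (ψ : δ → μ) (f : β → κ) (g : β → μ)
      (_ : ∀ b, φ (f b) = some (g b)) (l : List β) (w : List _) (z : List _),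
      lcomp φ ψ (l.map (fun b => some (f b)) ++ w) z =
        l.map (fun b => some (g b)) ++ lcomp φ ψ w z := by
    intro κ μ β δ φ ψ f g hfg l w z
    induction l with
    | nil => rfl
    | cons b l ih => grind [lcomp_some]
  induction x, y using lcomp_induction φ₁ generalizing z with
  | nil y => rfl
  | none x y ih => simp [lcomp, ih]
  | hit a x y h ih =>
    obtain ⟨c, hc, hc'⟩ := h1 a h
    rw [lcomp_hit h, lcomp_some hc, lcomp_hit hc', keep _ _ _ _ h2, ih]
  | keep a c x y h ih =>
    rw [lcomp_some h]
    rcases h1' a c h with ⟨h4, h5⟩ | ⟨d, e, h4, h5, h6⟩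
    · rw [lcomp_hit h4, lcomp_hit h5, keep _ _ _ _ h3, ih]
    · rw [lcomp_some h4, lcomp_some h5, lcomp_some h6, ih]

lemma map_sublist_lcomp x y :
    ∀ (l : List β), (l.map some).Sublist y → rest^[hits φ x] y = [] →
      (l.map fun b => some (ψ b)).Sublist (lcomp φ ψ x y) := by
  induction x, y using lcomp_induction φ with
  | nil y =>
    aesop
  | none x y ih => exact fun l hl hy => (ih l hl (by simpa using hy)).cons _
  | hit a x y h ih =>
    intro l hl hy
    rw [lcomp_hit h]
    rw [hits_hit h, Function.iterate_succ_apply] at hy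
    have split : ∀ y, ∀ l : List β, (l.map some).Sublist y → ∃ l₁ l₂, l = l₁ ++ l₂ ∧
        l₁.Sublist (seg y) ∧ (l₂.map some).Sublist (rest y) := by
      intro y
      induction y with
      | nil =>
        simp_all
      | cons s y ihy =>
        intro l hl
        rcases s with _ | b
        · rw [List.sublist_cons_iff] at hl
          rcases hl with hl | ⟨r, hr, -⟩
          · aesop
          · cases l <;> simp at hr
        rw [List.sublist_cons_iff] at hl
        rcases hl with hl | ⟨r, hr, hl⟩
        · obtain ⟨l₁, l₂, h1, h2, h3⟩ := ihy l hl
          exact ⟨l₁, l₂, h1, h2.cons _, h3⟩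
        · rcases l with _ | ⟨b', l⟩ <;> simp at hr
          obtain ⟨rfl, rfl⟩ := hr
          obtain ⟨l₁, l₂, h1, h2, h3⟩ := ihy l hl
          exact ⟨b' :: l₁, l₂, by simp [h1], h2.cons_cons _, h3⟩
    grind
  | keep a c x y h ih =>
    grind [lcomp_some, hits_some]

lemma sublist_of_map_sublist_lcomp {ρ : γ → Option β} (hψ : ∀ b, ρ (ψ b) = some b)
    (hφ : ∀ a c, φ a = some c → ρ c = none) x y (l : List β)
    (hl : (l.map fun b => some (ψ b)).Sublist (lcomp φ ψ x y)) : (l.map some).Sublist y := by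
  have h1 := hl.filterMap (fun s => s.bind ρ)
  have e1 : (l.map fun b => some (ψ b)).filterMap (fun s => s.bind ρ) = l := by
    simp_all
  rw [e1] at h1
  have h2 : ∀ (x : List _) (y : List _),
      (((lcomp φ ψ x y).filterMap (fun s => s.bind ρ)).map some).Sublist y := by
    intro x y
    induction x, y using lcomp_induction φ with
    | nil y => simp [lcomp]
    | none x y ih => simpa [lcomp] using ih
    | hit a x y h ih =>
      rw [lcomp_hit h, List.filterMap_append, List.map_append]
      have e : ((seg y).map fun b => some (ψ b)).filterMap (fun s => s.bind ρ) = seg y := by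
        simp_all
      rw [e]
      have h3 : ∀ y w : List (Option β), w.Sublist (rest y) → ((seg y).map some ++ w).Sublist y := by
        intro y
        induction y with
        | nil => intro w hw; exact hw
        | cons s y ihy =>
          intro w hw
          cases s
          · exact hw.cons _
          · exact (ihy w hw).cons_cons _
      exact h3 y _ ih
    | keep a c x y h ih =>
      rw [lcomp_some h]
      grind
  exact (h1.map some).trans (h2 x y)

lemma sublist_of_sublist_map_lcomp (hψ : ∀ b, π (ψ b) = i)
    (hφ : ∀ a c, φ a = some c → π c = a) (hi : ∀ a, φ a = none → a = i) x
    y (l : List α) (hc : l.IsChain (· ≠ ·))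
    (hl : (l.map some).Sublist ((lcomp φ ψ x y).map (Option.map π))) : (l.map some).Sublist x := by
  induction x, y using lcomp_induction φ generalizing l with
  | nil y => simpa [lcomp] using hl
  | none x y ih =>
    simp [lcomp, List.map_cons] at hl
    grind
  | hit a x y h ih =>
    rw [lcomp_hit h, List.map_append, List.map_map] at hl
    have h3 : ∀ S : List β, ∀ l, l.IsChain (· ≠ ·) → ∀ w,
        (l.map some).Sublist (S.map (Option.map π ∘ fun b => some (ψ b)) ++ w) →
        (l.map some).Sublist w ∨ ∃ l', l = i :: l' ∧ (l'.map some).Sublist w := by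
      intro S
      induction S with
      | nil => grind
      | cons b S ihS =>
        intro l hc w hw
        rw [List.map_cons, List.cons_append, List.sublist_cons_iff] at hw
        rcases hw with hw | ⟨r, hr, hw⟩
        · exact ihS l hc w hw
        rcases l with _ | ⟨b', l⟩ <;> simp [hψ] at hr
        obtain ⟨rfl, rfl⟩ := hr
        rcases ihS l hc.tail w hw with h | ⟨l', rfl, -⟩
        · grind
        · simp at hc
    rcases h3 _ l hc _ hl with h4 | ⟨l', rfl, h4⟩
    · grind
    rw [← hi a h]
    exact (ih l' hc.tail h4).cons_cons _
  | keep a c x y h ih =>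
    rw [lcomp_some h, List.map_cons, List.sublist_cons_iff] at hl
    rcases hl with hl | ⟨r, hr, hl⟩
    · grind
    rcases l with _ | ⟨b', l⟩ <;> simp [hφ a c h] at hr
    obtain ⟨rfl, rfl⟩ := hr
    exact (ih l hc.tail hl).cons_cons _

end LComp

namespace Term

variable {α β γ : Type}

lemma nones_encF (t : Term α) : nones t.encF = t.leaves := countP_encF_none t

lemma nones_enc (t : Term α) : nones t.enc = t.leaves := countP_enc_none t

/-- The free inputs are replaced by the lists `f 0`, `f 1`, … -/
def lgraft : List (Option β) → (ℕ → List (Option β)) → List (Option β)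
  | [], _ => []
  | none :: l, f => f 0 ++ lgraft l fun t => f (t + 1)
  | some b :: l, f => some b :: lgraft l f

lemma lgraft_append (u v : List (Option β)) f :
    lgraft (u ++ v) f = lgraft u f ++ lgraft v fun t => f (nones u + t) := by
  induction u generalizing f with
  | nil => simp [lgraft]
  | cons s u ih =>
    cases s
    · simp [lgraft, ih, Nat.add_assoc, Nat.add_comm 1]
    · simp [lgraft, ih]

lemma lgraft_flatten (E : Fin q → List (Option β)) f :
    lgraft (List.ofFn E).flatten f = (List.ofFn fun j => lgraft (E j) fun t =>
      f ((∑ i, if i < j then nones (E i) else 0) + t)).flatten := by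
  induction q generalizing f with
  | zero => simp [lgraft]
  | succ q ih =>
    simp_all [lgraft_append, Fin.sum_univ_succ, Nat.add_assoc]

lemma encF_graft (t : Term β) f :
    (t.graft f).encF = lgraft t.encF fun j => (f j).encF := by
  induction t generalizing f with
  | leaf => simp [graft, encF, lgraft]
  | node a q c ih =>
    simp_all [lgraft_flatten, lgraft_append, nones_encF, graft, encF, lgraft]
  | mul l r ih1 ih2 =>
    grind [lgraft_append, nones_encF, graft, encF]

open Classical in
/-- The relabelling of the flagged letters different from `i`. -/
def relF (i : α) (g : ∀ c, c ≠ i → γ) (s : α × Bool) : Option (γ × Bool) :=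
  if h : s.1 = i then none else some (g s.1 h, s.2)

lemma lcomp_flatten {ψ : β → γ} (E : Fin q → List (Option α))
    (h : ∀ i j, hits φ (E i) ≠ 0 → hits φ (E j) ≠ 0 → i = j) y :
    lcomp φ ψ (List.ofFn E).flatten y = (List.ofFn fun j => lcomp φ ψ (E j) y).flatten := by
  induction q with
  | zero => simp [lcomp]
  | succ q ih =>
    rw [List.ofFn_succ, List.flatten_cons, lcomp_append, List.ofFn_succ, List.flatten_cons,
      ← ih _ fun i j hi hj => Fin.succ_injective _ (h _ _ hi hj)]
    by_cases h0 : hits φ (E 0) = 0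
    · rw [h0, Function.iterate_zero, id]
    congr 1
    apply lcomp_congr_of_hits_eq_zero
    have key : ∀ L : List (List (Option α)), (∀ l ∈ L, hits φ l = 0) → hits φ L.flatten = 0 := by
      intro L hL
      induction L with
      | nil => rfl
      | cons l L ih =>
        simp_all
    grind

lemma hits_relF [DecidableEq α] i (g : ∀ c, c ≠ i → γ) (t : Term α) :
    hits (relF i g) t.encF = t.arity i + t.count i := by
  rw [← count_encF_true, ← count_encF_false]
  induction t.encF with
  | nil => rfl
  | cons s l ih =>
    rcases s with _ | ⟨b, f⟩
    · simpa using ih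
    by_cases hb : b = i
    · have : relF i g (b, f) = none := by simp [relF, hb]
      rw [hits_hit this, ih, List.count_cons, List.count_cons]
      cases f <;> simp [hb] <;> omega
    simp_all [hits_some, relF]

lemma encF_subst [DecidableEq α] (i : α) (s : Term γ) g {t}
    (ht : t.Linear) (hm : hits (relF i g) t.encF ≠ 0 → hits (relF i g) t.encF = s.leaves + 1) :
    (subst i s g t).encF = lcomp (relF i g) id t.encF s.encF := by
  induction t with
  | leaf => aesop
  | node a q c ih =>
    have hsub : ∀ j, hits (relF i g) (c j).encF ≤ hits (relF i g) (node a q c).encF := by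
      intro j
      refine List.Sublist.countP_le ?_
      refine List.Sublist.cons _ ?_
      refine (List.sublist_append_left _ _).trans (List.sublist_flatten_of_mem (List.mem_ofFn.2 ⟨j, rfl⟩))
    have hmem : ∀ j, hits (relF i g) (c j).encF ≠ 0 → some i ∈ (c j).enc := by
      intro j hj
      rw [hits_relF] at hj
      have h1 := count_enc (c j) i
      grind [List.count_eq_zero_of_not_mem]
    by_cases h : a = i
    · subst h
      have hz : ∀ j, hits (relF a g) (c j).encF = 0 := by
        simp_all [Term.Linear.notMem_child]
      have ihj : ∀ j y, (subst a s g (c j)).encF = lcomp (relF a g) id (c j).encF y := by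
        intro j y
        rw [ih j (ht.child j) fun h => (h (hz j)).elim]
        grind [lcomp_congr_of_hits_eq_zero]
      have hrel : ∀ f, relF a g (a, f) = none := fun f => by simp [relF]
      have hq : s.leaves = q := by
        have h1 := hits_hit (hrel true) (List.ofFn fun j => (c j).encF ++ [some (a, false)]).flatten
        have h2 : hits (relF a g) (List.ofFn fun j => (c j).encF ++ [some (a, false)]).flatten = q := by
          rw [hits, List.countP_flatten, List.map_ofFn, List.sum_ofFn]
          have : ∀ j, ((List.countP (Option.any fun a_1 => (relF a g a_1).isNone)) ∘
              fun j => (c j).encF ++ [some (a, false)]) j = 1 := by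
            grind [hits]
          simp only [this]
          simp
        grind [encF]
      rw [subst, dif_pos rfl, encF_graft]
      have e : ∀ j, (if hj : j < q then subst a s g (c ⟨j, hj⟩) else leaf).encF =
          if hj : j < q then lcomp (relF a g) id (c ⟨j, hj⟩).encF [] else [none] := by
        intro j
        split_ifs with hj
        · exact ihj _ _
        · rfl
      simp [e]
      rw [← nones_encF] at hq
      have key : ∀ (q : ℕ) (E : Fin q → List _) (f : Bool)
          (_ : ∀ j, hits (relF a g) (E j) = 0) (y : List _) (_ : nones y = q),
          lgraft y (fun j => if hj : j < q then lcomp (relF a g) id (E ⟨j, hj⟩) [] else [none]) =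
            lcomp (relF a g) id
              (some (a, f) :: (List.ofFn fun j => E j ++ [some (a, false)]).flatten) y := by
        intro q
        induction q with
        | zero =>
          intro E f _ y hy
          rw [lcomp_hit (hrel f)]
          simp [List.ofFn_zero, List.flatten_nil, lcomp, id]
          induction y with
          | nil => rfl
          | cons b y ihy =>
            cases b
            · simp at hy
            simp_all [lgraft, seg]
        | succ q ihq =>
          intro E f hE y hy
          induction y with
          | nil => simp at hy
          | cons b y ihy =>
            rcases b with _ | b
            · rw [lcomp_hit (hrel f)]
              simp only [lgraft, seg, rest, List.nil_append, List.ofFn_succ,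
                List.flatten_cons, List.append_assoc]
              rw [lcomp_append, hE 0, dif_pos (Nat.succ_pos q)]
              simp only [Function.iterate_zero, id]
              rw [Fin.zero_eta, lcomp_congr_of_hits_eq_zero (hE 0) [] y, List.cons_append, List.nil_append,
                ← ihq _ _ (fun j => hE _) y (by simpa using hy)]
              grind
            simp only [lgraft]
            rw [ihy (by simpa using hy), lcomp_hit (hrel f), lcomp_hit (hrel f)]
            simp [seg, rest]
      exact key q _ true hz _ hq
    · have hrel : ∀ f, relF i g (a, f) = some (g a h, f) := fun f => by simp [relF, h]
      have hone :=
        fun j k hj hk => ht.eq_of_mem_child (hmem j hj) (hmem k hk)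
      have htot : ∀ j, hits (relF i g) (c j).encF ≠ 0 →
          hits (relF i g) (c j).encF = hits (relF i g) (node a q c).encF := by
        intro j hj
        simp [encF]
        rw [hits_some (hrel true), hits, hits, List.countP_flatten, List.map_ofFn, List.sum_ofFn,
          Finset.sum_eq_single_of_mem j (Finset.mem_univ j)]
        · simp [hrel]
        grind [hits]
      have ihj : ∀ j, (subst i s g (c j)).encF = lcomp (relF i g) id (c j).encF s.encF := by
        intro j
        refine ih j (ht.child j) fun hj => ?_
        grind
      rw [subst, dif_neg h]
      simp [encF]
      rw [lcomp_some (hrel true), lcomp_flatten]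
      · grind [lcomp_append, lcomp]
      intro j k hj hk
      refine hone j k ?_ ?_
      · simp_all [hits_some]
      simp_all [hits_some]
  | mul l r ih1 ih2 =>
    simp [subst, encF, hits_append] at hm ⊢
    have hd : hits (relF i g) l.encF = 0 ∨ hits (relF i g) r.encF = 0 := by
      by_contra hne
      rw [hits_relF, hits_relF, ← count_enc, ← count_enc] at hne
      grind [Term.Linear.disjoint_of_mul]
    rw [ih1 ht.left_of_mul (by omega), ih2 ht.right_of_mul (by omega), lcomp_append]
    rcases hd with hd | hd
    · rw [hd]; rfl
    · rw [lcomp_congr_of_hits_eq_zero hd]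

end Term

section Labels

variable {n m r : ℕ} (h : r + 1 = n + m) (i : Fin n)

lemma inner_injective : Function.Injective (inner h i) := fun a b e => by
  grind [inner]

lemma outer_ne_inner c hc b : outer h i c hc ≠ inner h i b := by
  grind [inner, outer]

lemma contract_inner b : contract h i (inner h i b) = i := by
  grind [contract, inner]

lemma contract_outer c hc : contract h i (outer h i c hc) = c := by
  grind [outer, contract]

lemma outer_injective {hc'}
    (e : outer h i c hc = outer h i c' hc') : c = c' := by
  grind [contract_outer]

lemma eq_inner_of_contract (hv : contract h i v = i) : ∃ b, v = inner h i b := by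
  simp [contract] at hv
  refine ⟨⟨v.1 - i.1, ?_⟩, ?_⟩
  · grind
  grind [inner]

lemma eq_outer_of_contract (hv : contract h i v = c) hc :
    v = outer h i c hc := by
  grind [contract, outer]

lemma inner_or_outer v : (∃ b, v = inner h i b) ∨ ∃ c hc, v = outer h i c hc := by
  by_cases hv : contract h i v = i
  · simp_all [eq_inner_of_contract]
  · exact Or.inr ⟨_, hv, eq_outer_of_contract h i rfl hv⟩

/-- The letters different from `i` are relabelled as inputs of a composition. -/
def rel (a : Fin n) : Option (Fin r) := if ha : a = i then none else some (outer h i a ha)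

lemma rel_self : rel h i i = none := by simp [rel]

lemma rel_of_ne ha : rel h i a = some (outer h i a ha) := by simp [rel, ha]

lemma eq_of_rel_eq_none (ha : rel h i a = none) : a = i := by
  grind [rel]

lemma contract_of_rel (ha : rel h i a = some c) :
    contract h i c = a := by
  grind [contract_outer, rel]

lemma hits_rel x : hits (rel h i) x = x.count (some i) := by
  rw [hits, List.count]
  congr 1
  funext s
  rcases s with _ | a
  · simp
  grind [rel]

/-- Composition of traversals of trees with labelled vertices. -/
def lc (x : List (Option (Fin n))) (y : List (Option (Fin m))) : List (Option (Fin r)) :=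
  lcomp (rel h i) (inner h i) x y

end Labels

namespace Term

variable {α : Type}

lemma exists_concat (a : Option α) (M : List _) :
    ∃ u, a :: (M.map (· ++ [a])).flatten = u ++ [a] := by
  rcases List.eq_nil_or_concat M with rfl | ⟨M, E, rfl⟩
  · exact ⟨[], rfl⟩
  · exact ⟨a :: ((M.map (· ++ [a])).flatten ++ E), by simp⟩

lemma enc_node_split {a : α} c j :
    ∃ u v, (node a q c).enc = u ++ (c j).enc ++ v ∧ some a ∈ u ∧ some a ∈ v ∧
      (∀ b, some b ∈ u → b = a ∨ ∃ k, k < j ∧ some b ∈ (c k).enc) ∧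
      (∀ b, some b ∈ v → b = a ∨ ∃ k, j < k ∧ some b ∈ (c k).enc) ∧ (∃ u', u = u' ++ [some a]) ∧
      ∃ v', v = some a :: v' := by
  set L := List.ofFn fun j => (c j).enc ++ [some a] with hL
  have hj : j.1 < L.length := by simp [hL]
  have e : L = L.take j ++ ((c j).enc ++ [some a]) :: L.drop (j + 1) := by
    conv_lhs => rw [← List.take_append_drop j L, List.drop_eq_getElem_cons hj]
    simp [hL]
  refine ⟨some a :: (L.take j).flatten, some a :: (L.drop (j + 1)).flatten, ?_, by simp, by simp,
    ?_, ?_, ?_, _, rfl⟩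
  · grind [enc]
  · grind [List.mem_flatten, List.mem_take_iff_getElem]
  · grind [List.mem_flatten, List.mem_drop_iff_getElem]
  · obtain ⟨u', hu⟩ := exists_concat _ _
    refine ⟨u', ?_⟩
    rw [← hu, hL, List.map_take, List.map_ofFn]
    rfl

lemma pair_sublist_append {β : Type} {b a : β} {u v} (h : [b, a].Sublist (u ++ v)) :
    [b, a].Sublist u ∨ (b ∈ u ∧ a ∈ v) ∨ [b, a].Sublist v := by
  rw [List.sublist_append_iff] at h
  obtain ⟨p, s, h', hp, hs⟩ := h
  rcases p with _ | ⟨p1, _ | ⟨p2, p3⟩⟩ <;> simp at h'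
  · grind
  · grind
  grind

lemma Linear.of_lt {t : Term α} (ht : t.Linear) (h : t.lt a b) :
    a ≠ b ∧ [some a, some b, some a].Sublist t.enc := by
  induction t with
  | leaf => exact h.elim
  | node x q c ih =>
    rcases h with ⟨rfl, j, hj⟩ | ⟨j, hj⟩
    · obtain ⟨u, v, e, h1, h2, -, -⟩ := enc_node_split (a := x) c j
      have hb := (some_mem_enc _ _).2 hj
      refine ⟨?_, ?_⟩
      · rintro rfl
        exact ht.notMem_child j hb
      grind
    obtain ⟨u, v, e, -, -, -, -⟩ := enc_node_split (a := x) c j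
    obtain ⟨h1, h2⟩ := ih j (ht.child j) hj
    grind
  | mul l r ih1 ih2 =>
    rcases h with h | h
    · obtain ⟨h1, h2⟩ := ih1 ht.left_of_mul h
      exact ⟨h1, h2.trans (List.sublist_append_left _ _)⟩
    obtain ⟨h1, h2⟩ := ih2 ht.right_of_mul h
    exact ⟨h1, h2.trans (List.sublist_append_right _ _)⟩

lemma Linear.of_left {t : Term α} (ht : t.Linear) (h : t.left a b) :
    some a ∈ t.enc ∧ some b ∈ t.enc ∧ a ≠ b ∧ ¬ [some b, some a].Sublist t.enc := by
  induction t with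
  | leaf => exact h.elim
  | node x q c ih =>
    rcases h with ⟨i, j, hij, hi, hj⟩ | ⟨j, hj⟩
    · rw [← some_mem_enc] at hi hj
      obtain ⟨u, v, e, h1, h2, h3, h4, -⟩ := enc_node_split c j
      obtain ⟨u', v', e', -⟩ := enc_node_split c i
      have hax : a ≠ x := by
        rintro rfl
        exact ht.notMem_child _ hi
      have hbx : b ≠ x := by
        rintro rfl
        exact ht.notMem_child _ hj
      have hu : some b ∉ u := fun hb => by
        rcases h3 b hb with h | ⟨k, hk, h⟩
        · exact hbx h
        · exact hk.ne (ht.eq_of_mem_child h hj)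
      have hv : some a ∉ (c j).enc ++ v := fun ha => by
        rcases List.mem_append.1 ha with ha | ha
        · exact hij.ne (ht.eq_of_mem_child hi ha)
        rcases h4 a ha with h | ⟨k, hk, h⟩
        · exact hax h
        · exact (hij.trans hk).ne (ht.eq_of_mem_child hi h)
      refine ⟨by rw [e']; simp [hi], by rw [e]; simp [hj], ?_, fun hs => ?_⟩
      · grind
      rw [e, List.append_assoc] at hs
      rcases pair_sublist_append hs with h | h | h
      · exact hu (h.subset (by simp))
      · exact hu h.1
      grind
    obtain ⟨h1, h2, h3, h4⟩ := ih j (ht.child j) hj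
    obtain ⟨u, v, e, -, -, h5, h6, -⟩ := enc_node_split (a := x) c j
    have key : ∀ b, some b ∈ (c j).enc → some b ∉ u ∧ some b ∉ v := by
      intro b hb
      have hbx : b ≠ x := by
        rintro rfl
        exact ht.notMem_child _ hb
      constructor
      · intro hu
        rcases h5 b hu with h | ⟨k, hk, h⟩
        · exact hbx h
        · exact hk.ne (ht.eq_of_mem_child h hb)
      · intro hu
        rcases h6 b hu with h | ⟨k, hk, h⟩
        · exact hbx h
        · exact hk.ne (ht.eq_of_mem_child hb h)
    refine ⟨by rw [e]; simp [h1], by rw [e]; simp [h2], h3, fun hs => ?_⟩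
    rw [e] at hs
    rcases pair_sublist_append hs with h | h | h
    · rcases pair_sublist_append h with h | h | h
      · grind
      · exact (key b h2).1 h.1
      · exact h4 h
    · exact (key a h1).2 h.2
    grind
  | mul l r ih1 ih2 =>
    have hd := fun a => ht.disjoint_of_mul (a := a)
    simp [enc, List.mem_append]
    rcases h with ⟨h1, h2⟩ | h | h
    · rw [← some_mem_enc] at h1 h2
      refine ⟨Or.inl h1, Or.inr h2, ?_, fun hs => ?_⟩
      · grind
      rcases pair_sublist_append hs with h | h | h
      · grind
      · exact hd b h.1 h2
      grind
    · grind [Term.Linear.left_of_mul, pair_sublist_append]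
    grind [Term.Linear.right_of_mul, pair_sublist_append]

lemma lt_or_left (t : Term α) (hab : a ≠ b) (ha : some a ∈ t.enc)
    (hb : some b ∈ t.enc) : t.lt a b ∨ t.lt b a ∨ t.left a b ∨ t.left b a := by
  rw [some_mem_enc] at ha hb
  induction t with
  | leaf => simp [count] at ha
  | node x q c ih =>
    have hex : ∀ b, b ≠ x → 0 < (node x q c).count b → ∃ j, 0 < (c j).count b := by
      intro b hbx hb
      rw [← some_mem_enc, enc_node, List.mem_cons, List.mem_flatten] at hb
      grind [some_mem_enc]
    simp [lt, left]
    by_cases hax : a = x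
    · grind
    grind
  | mul l r ih1 ih2 =>
    grind [lt, left, Term.count]

lemma pair_sublist_or {β : Type} {a b : β} {l} (ha : a ∈ l) (hb : b ∈ l)
    (hab : a ≠ b) : [a, b].Sublist l ∨ [b, a].Sublist l := by
  obtain ⟨s, t, rfl⟩ := List.append_of_mem ha
  rcases List.mem_append.1 hb with hb | hb
  · grind
  aesop

lemma triple_of_pairs {β : Type} {a b : β} {l} (hab : a ≠ b) (h1 : [a, b].Sublist l)
    (h2 : [b, a].Sublist l) : [a, b, a].Sublist l ∨ [b, a, b].Sublist l := by
  induction l with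
  | nil => simp at h1
  | cons x l ih =>
    grind

end Term

/-- The relation `a < b` read off from a traversal. -/
def LLt {α : Type} (l : List (Option α)) (a b : α) : Prop :=
  a ≠ b ∧ [some a, some b, some a].Sublist l

/-- The relation `a ◁ b` read off from a traversal. -/
def LLeft {α : Type} (l : List (Option α)) (a b : α) : Prop :=
  a ≠ b ∧ ¬ [some b, some a].Sublist l

lemma IsTrav.not_lt_of_lt {l} (h : IsTrav l) {a : α}
    (hab : LLt l a b) : ¬ LLt l b a := by
  rintro ⟨-, hba⟩
  obtain ⟨hne, hab⟩ := hab
  have key : ∀ (l : List _) (a b : α), a ≠ b → [some a, some b, some a].Sublist l →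
      [some b, some a, some b].Sublist l → [some a, some b, some a, some b].Sublist l ∨
        [some b, some a, some b, some a].Sublist l := by
    intro l a b hne h1 h2
    induction l with
    | nil => simp at h1
    | cons x l ih =>
      grind
  grind [IsTrav.no_cross]

namespace Term

lemma Valid.isTrav {t : Term (Fin n)} (ht : t.Valid) : IsTrav t.enc := ht.linear.isTrav

lemma Valid.mem_enc {t : Term (Fin n)} (ht : t.Valid) a : some a ∈ t.enc := by
  rw [some_mem_enc, ht.2 a]
  exact Nat.one_pos

lemma Valid.lt_iff {t : Term (Fin n)} (ht : t.Valid) a b :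
    t.lt a b ↔ LLt t.enc a b := by
  refine ⟨ht.linear.of_lt, fun h => ?_⟩
  rcases lt_or_left t h.1 (ht.mem_enc a) (ht.mem_enc b) with h1 | h1 | h1 | h1
  · exact h1
  · exact (ht.isTrav.not_lt_of_lt h (ht.linear.of_lt h1)).elim
  · exact ((ht.linear.of_left h1).2.2.2 ((List.sublist_cons_self _ _).trans h.2)).elim
  refine ((ht.linear.of_left h1).2.2.2 (List.Sublist.trans ?_ h.2)).elim
  grind

lemma Valid.left_iff {t : Term (Fin n)} (ht : t.Valid) a b :
    t.left a b ↔ LLeft t.enc a b := by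
  refine ⟨fun h => (ht.linear.of_left h).2.2, fun h => ?_⟩
  rcases lt_or_left t h.1 (ht.mem_enc a) (ht.mem_enc b) with h1 | h1 | h1 | h1
  · exact (h.2 ((List.sublist_cons_self _ _).trans (ht.linear.of_lt h1).2)).elim
  · refine (h.2 (List.Sublist.trans ?_ (ht.linear.of_lt h1).2)).elim
    grind
  · exact h1
  rcases pair_sublist_or (ht.mem_enc a) (ht.mem_enc b) (by simpa using h.1) with h2 | h2
  · exact ((ht.linear.of_left h1).2.2.2 h2).elim
  · exact (h.2 h2).elim

lemma Valid.nodes_eq {t : Term (Fin n)} (ht : t.Valid) : t.nodes = n := by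
  rw [← sum_count]
  simp [ht.2]

lemma Valid.length_enc {t : Term (Fin n)} (ht : t.Valid) :
    t.enc.length + 1 + t.muls = 2 * (n + nones t.enc) := by
  rw [Term.length_enc, ht.nodes_eq, nones_enc]

lemma Valid.count_enc {t : Term (Fin n)} (ht : t.Valid) a :
    t.enc.count (some a) = t.arity a + 1 := by
  rw [Term.count_enc, ht.2 a]

variable {n m r : ℕ} (h : r + 1 = n + m) (i : Fin n)

lemma encF_plug (hx : x.Valid)
    (hm : y.leaves = x.arity i) : (plug h i x y).encF =
      lcomp (relF i (outer h i)) (Prod.map (inner h i) id) x.encF y.encF := by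
  rw [plug, encF_subst i _ _ hx.linear, encF_map, lcomp_map_right]
  · rfl
  intro _
  rw [hits_relF, hx.2 i, ← hm, ← nones_encF, ← nones_encF, encF_map, nones_map_option]

lemma enc_plug (hx : x.Valid)
    (hm : y.leaves = x.arity i) : (plug h i x y).enc = lc h i x.enc y.enc := by
  rw [← map_encF, encF_plug h i hx hm, ← map_encF x, ← map_encF y, lc]
  grind [map_lcomp, rel, relF]

lemma count_plug (hx : x.Valid) (hy : y.Valid)
    (hm : y.leaves = x.arity i) c : (plug h i x y).count c = 1 := by
  have hit : hits (relF i (outer h i)) x.encF = nones y.encF + 1 := by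
    rw [hits_relF, hx.2 i, ← hm, nones_encF]
  have e : ∀ (k : ℕ) (t : Term _) (a : Fin k),
      t.encF.count (some (a, true)) = t.encF.countP (Option.any (· == (a, true))) := by
    intro k t a
    rw [List.count]
    congr 1
    funext s
    cases s <;> simp
  rw [← count_encF_true, e, encF_plug h i hx hm, countP_lcomp _ hit]
  rcases inner_or_outer h i c with ⟨b, rfl⟩ | ⟨c, hc, rfl⟩
  · rw [List.countP_eq_zero.2, zero_add, ← hy.2 b, ← count_encF_true, e]
    · grind [inner_injective]
    rintro (_ | ⟨a, f⟩) -
    · simp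
    grind [outer_ne_inner, relF]
  have e2 : y.encF.countP (Option.any fun b => Prod.map (inner h i) id b ==
      (outer h i c hc, true)) = 0 := by
    rw [List.countP_eq_zero]
    rintro (_ | ⟨a, f⟩) -
    · simp
    grind [outer_ne_inner]
  rw [e2, add_zero, ← hx.2 c, ← count_encF_true, e]
  grind [relF, outer]

lemma Valid.plug (hx : x.Valid) (hy : y.Valid)
    (hm : y.leaves = x.arity i) (hr : 0 < r) : (plug h i x y).Valid := by
  refine ⟨fun e => ?_, count_plug h i hx hy hm⟩
  have := count_plug h i hx hy hm ⟨0, hr⟩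
  grind [count]

lemma muls_plug (hx : x.Valid) (hy : y.Valid)
    (hm : y.leaves = x.arity i) (hr : 0 < r) :
    (Term.plug h i x y).muls = x.muls + y.muls := by
  have hz := (hx.plug h i hy hm hr).length_enc
  have h1 := hx.length_enc
  have h2 := hy.length_enc
  have hit : hits (rel h i) x.enc = nones y.enc + 1 := by
    rw [hits_rel, hx.count_enc, ← hm, nones_enc]
  have len : ∀ (k : ℕ) (l : List (Option (Fin k))),
      l.length = l.countP (Option.any fun _ => true) + nones l := by
    intro k l
    induction l with
    | nil => rfl
    | cons s l ih => cases s <;> simp <;> omega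
  have h3 := countP_lcomp (ψ := inner h i) (fun _ => true) hit
  have h4 : x.enc.countP (Option.any fun _ => true) =
      x.enc.countP (Option.any fun a => (rel h i a).any fun _ => true) + hits (rel h i) x.enc := by
    rw [hits]
    induction x.enc with
    | nil => rfl
    | cons s l ih =>
      rcases s with _ | a
      · simpa using ih
      grind [rel]
  grind [enc_plug, nones_lcomp, lc]

end Term

/-- `a` followed by `s` repetitions, with free inputs in between. -/
def run {α : Type} (a : α) (s : ℕ) : List (Option α) :=
  some a :: (List.replicate s [none, some a]).flatten

lemma enc_corolla q : (Term.corolla q).enc = run 0 q := by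
  simp [Term.corolla, Term.enc, run]

lemma corolla_valid q : (Term.corolla q).Valid := by
  refine ⟨by simp [Term.corolla], fun a => ?_⟩
  simp [Term.corolla, Term.count, Subsingleton.elim a 0]

namespace MNSOp

variable {n : ℕ}

/-- The traversal. -/
def list (X : MNSOp n) : List (Option (Fin n)) :=
  Quotient.lift (fun x : PreMNSOp n => x.1.enc) (fun _ _ h => Term.Assoc.enc_eq h) X

lemma rep_iff (X : MNSOp n) t : X.Rep t ↔ t.Valid ∧ X.list = t.enc := by
  constructor
  · rintro ⟨x, rfl, rfl⟩
    exact ⟨x.2, rfl⟩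
  rintro ⟨ht, he⟩
  obtain ⟨x, rfl⟩ := Quotient.exists_rep X
  exact ⟨⟨t, ht⟩, Quotient.sound (Term.assoc_of_enc_eq ht.linear x.2.linear he.symm), rfl⟩

lemma exists_rep (X : MNSOp n) : ∃ t, t.Valid ∧ X.list = t.enc ∧ X.Rep t := by
  obtain ⟨x, rfl⟩ := Quotient.exists_rep X
  exact ⟨x.1, x.2, rfl, x, rfl, rfl⟩

lemma list_injective : Function.Injective (list (n := n)) := by
  intro X Y e
  obtain ⟨x, rfl⟩ := Quotient.exists_rep X
  obtain ⟨y, rfl⟩ := Quotient.exists_rep Y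
  exact Quotient.sound (Term.assoc_of_enc_eq x.2.linear y.2.linear e)

lemma isTrav (X : MNSOp n) : IsTrav X.list := by
  obtain ⟨t, ht, e, -⟩ := X.exists_rep
  exact e ▸ ht.isTrav

lemma mem_list (X : MNSOp n) a : some a ∈ X.list := by
  obtain ⟨t, ht, e, -⟩ := X.exists_rep
  exact e ▸ ht.mem_enc a

lemma count_list (X : MNSOp n) a : X.list.count (some a) = X.color a + 1 := by
  obtain ⟨x, rfl⟩ := Quotient.exists_rep X
  exact x.2.count_enc a

lemma nones_list (X : MNSOp n) : nones X.list = X.out := by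
  obtain ⟨x, rfl⟩ := Quotient.exists_rep X
  exact Term.nones_enc _

lemma lt_iff (X : MNSOp n) a b : X.lt a b ↔ LLt X.list a b := by
  obtain ⟨x, rfl⟩ := Quotient.exists_rep X
  exact x.2.lt_iff a b

lemma left_iff (X : MNSOp n) a b : X.left a b ↔ LLeft X.list a b := by
  obtain ⟨x, rfl⟩ := Quotient.exists_rep X
  exact x.2.left_iff a b

lemma list_relabel σ (X : MNSOp n) :
    (X.relabel σ).list = X.list.map (Option.map σ) := by
  obtain ⟨x, rfl⟩ := Quotient.exists_rep X
  exact Term.enc_map _ _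

lemma length_list_le (X : MNSOp n) : X.list.length + 1 ≤ 2 * (n + nones X.list) := by
  obtain ⟨t, ht, e, -⟩ := X.exists_rep
  have := ht.length_enc
  grind

lemma exists_list (hn : 0 < n) (hl : IsTrav l)
    (hm : ∀ a, some a ∈ l) : ∃ X : MNSOp n, X.list = l := by
  obtain ⟨t, ht, rfl⟩ := Term.exists_enc_eq hl (List.ne_nil_of_mem (hm ⟨0, hn⟩))
  refine ⟨Quotient.mk _ ⟨t, ?_, fun a => le_antisymm (ht a) ((Term.some_mem_enc _ _).1 (hm a))⟩, rfl⟩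
  rintro rfl
  have := hm ⟨0, hn⟩
  simp [Term.enc] at this

lemma isId_iff (X : MNSOp 1) : X.IsId ↔ ∃ q, X.list = run 0 q := by
  simp_all [rep_iff, enc_corolla, corolla_valid, IsId]

end MNSOp

namespace NSOp

variable {n : ℕ}

/-- The traversal. -/
def list (X : NSOp n) : List (Option (Fin n)) := X.1.enc

lemma list_injective : Function.Injective (list (n := n)) := by
  intro X Y e
  have h := Term.assoc_of_enc_eq X.2.1.linear Y.2.1.linear e
  exact Subtype.ext (h.eq_of_muls ((Term.noMul_iff _).1 X.2.2))

lemma isTrav (X : NSOp n) : IsTrav X.list := X.2.1.isTrav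

lemma mem_list (X : NSOp n) a : some a ∈ X.list := X.2.1.mem_enc a

lemma count_list (X : NSOp n) a : X.list.count (some a) = X.color a + 1 :=
  X.2.1.count_enc a

lemma nones_list (X : NSOp n) : nones X.list = X.out := Term.nones_enc _

lemma lt_iff (X : NSOp n) a b : X.1.lt a b ↔ LLt X.list a b := X.2.1.lt_iff a b

lemma left_iff (X : NSOp n) a b : X.1.left a b ↔ LLeft X.list a b :=
  X.2.1.left_iff a b

lemma list_relabel σ (X : NSOp n) :
    (X.relabel σ).list = X.list.map (Option.map σ) := Term.enc_map _ _

lemma length_list (X : NSOp n) : X.list.length + 1 = 2 * (n + nones X.list) := by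
  have := X.2.1.length_enc
  rw [(Term.noMul_iff _).1 X.2.2] at this
  exact this

lemma pos (X : NSOp n) : 0 < n := by
  rcases n with _ | n
  · obtain ⟨t, ht⟩ := X
    rcases t with _ | ⟨a, -, -⟩ | ⟨l, r⟩
    · exact (ht.1.1 rfl).elim
    · exact a.elim0
    · exact ht.2.elim
  · exact n.succ_pos

lemma exists_list (hn : 0 < n) (hl : IsTrav l)
    (hm : ∀ a, some a ∈ l) (hlen : l.length + 1 = 2 * (n + nones l)) : ∃ X : NSOp n, X.list = l := by
  obtain ⟨t, ht, rfl⟩ := Term.exists_enc_eq hl (List.ne_nil_of_mem (hm ⟨0, hn⟩))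
  have hv : t.Valid := by
    refine ⟨?_, fun a => le_antisymm (ht a) ((Term.some_mem_enc _ _).1 (hm a))⟩
    rintro rfl
    simp_all [Term.enc]
  refine ⟨⟨t, hv, (Term.noMul_iff _).2 ?_⟩, rfl⟩
  have := hv.length_enc
  omega

lemma isId_iff (X : NSOp 1) : X.IsId ↔ ∃ q, X.list = run 0 q := by
  refine exists_congr fun q => ?_
  rw [← enc_corolla]
  constructor
  · grind [list]
  intro e
  exact (Term.assoc_of_enc_eq X.2.1.linear (corolla_valid q).linear e).eq_of_muls
    ((Term.noMul_iff _).1 X.2.2)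

end NSOp

/-- `z` is the composition of the traversals `x` and `y` at `i`. -/
def LComp {n m r : ℕ} (h : r + 1 = n + m) (i : Fin n) (x : List (Option (Fin n)))
    (y : List (Option (Fin m))) (z : List (Option (Fin r))) : Prop :=
  x.count (some i) = nones y + 1 ∧ z = lc h i x y

section Comp

variable {n m r : ℕ} (h : r + 1 = n + m) (i : Fin n)

lemma MNSOp.isComp_iff (hr : 0 < r) X Y Z :
    MNSOp.IsComp h i X Y Z ↔ LComp h i X.list Y.list Z.list := by
  rw [IsComp, LComp, ← nones_list, count_list, Nat.add_right_cancel_iff, eq_comm]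
  refine and_congr_right fun hm => ?_
  constructor
  · rintro ⟨x, y, hx, hy, hz⟩
    rw [rep_iff] at hx hy hz
    have e := by
      have h1 := X.count_list i
      rw [hx.2, hx.1.count_enc, hm, hy.2, Term.nones_enc] at h1
      omega
    grind [Term.enc_plug]
  intro hZ
  obtain ⟨x, hx, ex, rx⟩ := X.exists_rep
  obtain ⟨y, hy, ey, ry⟩ := Y.exists_rep
  have e : y.leaves = x.arity i := by
    have h1 := X.count_list i
    grind [Term.Valid.count_enc, Term.nones_enc]
  exact ⟨x, y, rx, ry, (rep_iff _ _).2 ⟨hx.plug h i hy e hr, by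
    grind [Term.enc_plug]⟩⟩

lemma MNSOp.exists_comp (hr : 0 < r) (X : MNSOp n) (Y : MNSOp m)
    (hm : X.list.count (some i) = nones Y.list + 1) : ∃ Z : MNSOp r, Z.list = lc h i X.list Y.list := by
  obtain ⟨x, hx, ex, rx⟩ := X.exists_rep
  obtain ⟨y, hy, ey, ry⟩ := Y.exists_rep
  have e : y.leaves = x.arity i := by
    grind [Term.Valid.count_enc, Term.nones_enc]
  exact ⟨Quotient.mk _ ⟨_, hx.plug h i hy e hr⟩, by
    rw [ex, ey, ← Term.enc_plug h i hx e]
    rfl⟩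

lemma NSOp.exists_comp (X : NSOp n) (Y : NSOp m) (hm : Y.out = X.color i) :
    ∃ Z : NSOp r, Z.1 = Term.plug h i X.1 Y.1 ∧ Z.list = lc h i X.list Y.list := by
  have hr : 0 < r := by
    have := X.pos
    have := Y.pos
    omega
  refine ⟨⟨_, X.2.1.plug h i Y.2.1 hm hr, ?_⟩, rfl, Term.enc_plug h i X.2.1 hm⟩
  rw [Term.noMul_iff, Term.muls_plug h i X.2.1 Y.2.1 hm hr, (Term.noMul_iff _).1 X.2.2,
    (Term.noMul_iff _).1 Y.2.2]

lemma NSOp.isComp_iff X Y Z :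
    NSOp.IsComp h i X Y Z ↔ LComp h i X.list Y.list Z.list := by
  rw [IsComp, LComp, NSOp.nones_list, NSOp.count_list, Nat.add_right_cancel_iff, eq_comm]
  refine and_congr_right fun hm => ?_
  obtain ⟨Z', e1, e2⟩ := NSOp.exists_comp h i X Y hm.symm
  rw [← e1, ← e2]
  exact ⟨fun e => congrArg Term.enc e, fun e => congrArg _ (list_injective e)⟩

lemma inner_lt_inner : inner h i b < inner h i b' ↔ b < b' := by
  grind [inner]

lemma outer_lt_inner {hc} :
    outer h i c hc < inner h i b ↔ c < i := by
  grind [outer, inner]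

lemma inner_lt_outer {hc} :
    inner h i b < outer h i c hc ↔ i < c := by
  grind [outer, inner]

lemma outer_lt_outer {hc} {hc'} (hm : 0 < m) :
    outer h i c hc < outer h i c' hc' ↔ c < c' := by
  grind [outer]

/-- The inputs of a composition. -/
def labelEquiv : Fin m ⊕ {c : Fin n // c ≠ i} ≃ Fin r :=
  Equiv.ofBijective (Sum.elim (inner h i) fun c => outer h i c.1 c.2) <| by
    constructor
    · rintro (b | c) (b' | c') e
      · grind [inner_injective]
      · grind [outer_ne_inner]
      · grind [outer_ne_inner]
      grind [outer_injective]
    · intro v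
      rcases inner_or_outer h i v with ⟨b, rfl⟩ | ⟨c, hc, rfl⟩
      · simp_all
      aesop

lemma sum_labels {M} [AddCommMonoid M] (f : Fin r → M) :
    ∑ v, f v = ∑ b, f (inner h i b) + ∑ c : {c : Fin n // c ≠ i}, f (outer h i c.1 c.2) := by
  rw [← (labelEquiv h i).sum_comp, Fintype.sum_sum_type]
  rfl

lemma sum_ne {M} [AddCommMonoid M] (f : Fin n → M) :
    ∑ c, f c = f i + ∑ c : {c : Fin n // c ≠ i}, f c := by
  rw [← Finset.add_sum_erase _ _ (Finset.mem_univ i)]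
  grind [Finset.sum_subtype]

lemma count_lc_inner
    (hm : x.count (some i) = nones y + 1) b :
    (lc h i x y).count (some (inner h i b)) = y.count (some b) := by
  have e : ∀ (k : ℕ) (l : List _) (a : Fin k),
      l.count (some a) = l.countP (Option.any (· == a)) := by
    intro k l a
    rw [List.count]
    congr 1
    funext s
    cases s <;> simp
  rw [← hits_rel h] at hm
  rw [e, lc, countP_lcomp _ hm, List.countP_eq_zero.2, zero_add, e]
  · grind [inner_injective]
  rintro (_ | a) -
  · simp
  grind [outer_ne_inner, rel]

lemma count_lc_outer
    (hm : x.count (some i) = nones y + 1) c hc :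
    (lc h i x y).count (some (outer h i c hc)) = x.count (some c) := by
  have e : ∀ (k : ℕ) (l : List _) (a : Fin k),
      l.count (some a) = l.countP (Option.any (· == a)) := by
    intro k l a
    rw [List.count]
    congr 1
    funext s
    cases s <;> simp
  rw [← hits_rel h] at hm
  have e2 : y.countP (Option.any fun b => inner h i b == outer h i c hc) = 0 := by
    rw [List.countP_eq_zero]
    rintro (_ | a) -
    · simp
    grind [outer_ne_inner]
  grind [countP_lcomp, lc, rel, outer]

lemma nones_lc x y :
    nones (lc h i x y) = nones x := nones_lcomp _ _

end Comp

section Assoc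

variable {n m l r s t : ℕ}

lemma lc_assoc h₁ (h₂ : t + 1 = r + l) h₃
    (h₄ : t + 1 = n + s) i (j : Fin m) x
    y z :
    lc h₂ (inner h₁ i j) (lc h₁ i x y) z = lc h₄ i x (lc h₃ j y z) := by
  refine lcomp_assoc (fun a ha => ?_) (fun a c ha => ?_) (fun b => ?_) (fun c => ?_) x y z
  · grind [eq_of_rel_eq_none, rel_self]
  · by_cases hai : a = i
    · simp [rel, hai] at ha
    rw [rel_of_ne _ _ hai] at ha ⊢
    grind [rel_of_ne, outer, inner]
  · grind [rel_self, rel_of_ne, inner, outer]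
  grind [inner]

lemma lc_comm h₁ (h₂ : t + 1 = r + l) h₃
    (h₄ : t + 1 = s + m) (i j : Fin n) hij x
    y z (hm : 0 < m) (hl : 0 < l) :
    lc h₂ (outer h₁ i j hij.symm) (lc h₁ i x y) z = lc h₄ (outer h₃ j i hij) (lc h₃ j x z) y := by
  refine lcomp_comm (fun a ha => ?_) (fun a c ha => ?_) (fun b => ?_) (fun c => ?_) x y z
  · obtain rfl := eq_of_rel_eq_none h₁ i ha
    simp_all [rel_of_ne, rel_self]
  · by_cases hai : a = i
    · simp [rel, hai] at ha
    · rw [rel_of_ne _ _ hai] at ha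
      by_cases haj : a = j
      · grind [rel_self]
      · have n1 : outer h₁ i a hai ≠ outer h₁ i j hij.symm := fun e => haj (outer_injective _ _ e)
        grind [rel_of_ne, outer]
  · grind [rel_of_ne, outer, inner]
  grind [rel_of_ne, outer, inner]

end Assoc

namespace PatchPair

variable {n m l r s t : ℕ}

lemma pos (Z : PatchPair n) : 0 < n := Z.2.pos

lemma ext_list {Z : PatchPair n} (h1 : Z.1.list = Z'.1.list) (h2 : Z.2.list = Z'.2.list) :
    Z = Z' := Prod.ext (MNSOp.list_injective h1) (NSOp.list_injective h2)

lemma isComp_iff h (i : Fin n) X (Y : PatchPair m)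
    (Z : PatchPair r) : IsComp h i X Y Z ↔
      LComp h i X.1.list Y.1.list Z.1.list ∧ LComp h i X.2.list Y.2.list Z.2.list := by
  rw [IsComp, MNSOp.isComp_iff h i Z.pos, NSOp.isComp_iff]

/-- The colours of `Y` and of the `i`-th input of `X` match. -/
def Matches (i : Fin n) (X : PatchPair n) (Y : PatchPair m) : Prop :=
  X.1.list.count (some i) = nones Y.1.list + 1 ∧ X.2.list.count (some i) = nones Y.2.list + 1

lemma exists_comp (h : r + 1 = n + m)
    (hm : Matches i X Y) : ∃ Z, IsComp h i X Y Z := by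
  have hr : 0 < r := by
    have := X.pos
    have := Y.pos
    omega
  obtain ⟨Z1, e1⟩ := MNSOp.exists_comp h i hr X.1 Y.1 hm.1
  have h2 := hm.2
  rw [NSOp.count_list, NSOp.nones_list] at h2
  obtain ⟨Z2, -, e2⟩ := NSOp.exists_comp h i X.2 Y.2 (by omega)
  exact ⟨(Z1, Z2), (isComp_iff ..).2 ⟨⟨hm.1, e1⟩, hm.2, e2⟩⟩

lemma IsComp.matches {i : Fin n} {Y : PatchPair m}
    {Z : PatchPair r} (hc : IsComp h i X Y Z) : Matches i X Y := by
  rw [isComp_iff] at hc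
  exact ⟨hc.1.1, hc.2.1⟩

lemma IsComp.list_fst {i : Fin n} {Y : PatchPair m}
    {Z : PatchPair r} (hc : IsComp h i X Y Z) : Z.1.list = lc h i X.1.list Y.1.list := by
  rw [isComp_iff] at hc
  exact hc.1.2

lemma IsComp.list_snd {i : Fin n} {Y : PatchPair m}
    {Z : PatchPair r} (hc : IsComp h i X Y Z) : Z.2.list = lc h i X.2.list Y.2.list := by
  rw [isComp_iff] at hc
  exact hc.2.2

lemma isComp_of_list {i : Fin n} {Y : PatchPair m}
    {Z : PatchPair r} (hm : Matches i X Y) (h1 : Z.1.list = lc h i X.1.list Y.1.list)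
    (h2 : Z.2.list = lc h i X.2.list Y.2.list) : IsComp h i X Y Z :=
  (isComp_iff ..).2 ⟨⟨hm.1, h1⟩, hm.2, h2⟩

lemma IsComp.unique {h : r + 1 = n + m}
    (hc : IsComp h i X Y Z) (hc' : IsComp h i X Y Z') : Z = Z' :=
  ext_list (hc.list_fst.trans hc'.list_fst.symm) (hc.list_snd.trans hc'.list_snd.symm)

section

variable {h : r + 1 = n + m} {i : Fin n} {X : PatchPair n} {Y : PatchPair m} {Z : PatchPair r}

lemma IsComp.color_inner (hc : IsComp h i X Y Z) b :
    Z.1.color (inner h i b) = Y.1.color b ∧ Z.2.color (inner h i b) = Y.2.color b := by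
  have h1 := Z.1.count_list (inner h i b)
  have h2 := Z.2.count_list (inner h i b)
  rw [hc.list_fst, count_lc_inner h i hc.matches.1, MNSOp.count_list] at h1
  rw [hc.list_snd, count_lc_inner h i hc.matches.2, NSOp.count_list] at h2
  omega

lemma IsComp.color_outer (hc : IsComp h i X Y Z) c hci :
    Z.1.color (outer h i c hci) = X.1.color c ∧ Z.2.color (outer h i c hci) = X.2.color c := by
  have h1 := Z.1.count_list (outer h i c hci)
  have h2 := Z.2.count_list (outer h i c hci)
  rw [hc.list_fst, count_lc_outer h i hc.matches.1, MNSOp.count_list] at h1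
  rw [hc.list_snd, count_lc_outer h i hc.matches.2, NSOp.count_list] at h2
  omega

lemma IsComp.out_eq (hc : IsComp h i X Y Z) : Z.1.out = X.1.out ∧ Z.2.out = X.2.out := by
  rw [← MNSOp.nones_list, ← NSOp.nones_list, hc.list_fst, hc.list_snd, nones_lc, nones_lc,
    MNSOp.nones_list, NSOp.nones_list]
  exact ⟨rfl, rfl⟩

lemma Matches.color_eq (hm : Matches i X Y) :
    X.1.color i = Y.1.out ∧ X.2.color i = Y.2.out := by
  have h1 := hm.1
  have h2 := hm.2
  grind [MNSOp.count_list, MNSOp.nones_list, NSOp.count_list, NSOp.nones_list]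

lemma IsComp.inDeg_inner (hc : IsComp h i X Y Z) b :
    Z.inDeg (inner h i b) = Y.inDeg b := by
  grind [PatchPair.IsComp.color_inner, inDeg]

lemma IsComp.inDeg_outer (hc : IsComp h i X Y Z) c hci :
    Z.inDeg (outer h i c hci) = X.inDeg c := by
  grind [PatchPair.IsComp.color_outer, inDeg]

lemma sum_inDeg_eq (hc : Matches i X Y) : ∑ b, Y.inDeg b = Y.deg + X.inDeg i := by
  grind [PatchPair.Matches.color_eq, deg, inDeg]

lemma IsComp.deg_eq (hc : IsComp h i X Y Z) : Z.deg = X.deg + Y.deg := by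
  have h1 := sum_inDeg_eq hc.matches
  rw [deg, sum_labels h i, hc.out_eq.1, hc.out_eq.2]
  simp [hc.inDeg_inner, hc.inDeg_outer]
  have h2 := sum_ne i X.inDeg
  have h3 : X.deg = ∑ a, X.inDeg a - (X.1.out + X.2.out - 1) := rfl
  linarith

end

lemma IsComp.assoc h₃
    (h₄ : t + 1 = n + s) {j : Fin m}
    {V : PatchPair l} {A : PatchPair r} (hA : IsComp h₁ i X Y A)
    (hW : IsComp h₂ (inner h₁ i j) A V W) : ∃ B, IsComp h₃ j Y V B ∧ IsComp h₄ i X B W := by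
  have hYV := by
    have := hW.matches
    rwa [Matches, hA.list_fst, hA.list_snd, count_lc_inner _ _ hA.matches.1,
      count_lc_inner _ _ hA.matches.2] at this
  obtain ⟨B, hB⟩ := exists_comp h₃ hYV
  grind [isComp_of_list, PatchPair.IsComp.list_fst, PatchPair.IsComp.list_snd, nones_lc, PatchPair.IsComp.matches, lc_assoc, Matches]

lemma IsComp.assoc' h₁ (h₂ : t + 1 = r + l)
    {i : Fin n} {j : Fin m}
    {B : PatchPair s} (hB : IsComp h₃ j Y V B)
    (hW : IsComp h₄ i X B W) : ∃ A, IsComp h₁ i X Y A ∧ IsComp h₂ (inner h₁ i j) A V W := by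
  have hXY := by
    have := hW.matches
    rwa [Matches, hB.list_fst, hB.list_snd, nones_lc, nones_lc] at this
  obtain ⟨A, hA⟩ := exists_comp h₁ hXY
  grind [isComp_of_list, PatchPair.IsComp.list_fst, PatchPair.IsComp.list_snd, count_lc_inner, PatchPair.IsComp.matches, lc_assoc, Matches]

lemma IsComp.comm h₃
    (h₄ : t + 1 = s + m) {j : Fin n} hij
    {V : PatchPair l} {A : PatchPair r} (hA : IsComp h₁ i X Y A)
    (hW : IsComp h₂ (outer h₁ i j hij.symm) A V W) :
    ∃ B, IsComp h₃ j X V B ∧ IsComp h₄ (outer h₃ j i hij) B Y W := by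
  have hXV := by
    have := hW.matches
    rwa [Matches, hA.list_fst, hA.list_snd, count_lc_outer _ _ hA.matches.1,
      count_lc_outer _ _ hA.matches.2] at this
  obtain ⟨B, hB⟩ := exists_comp h₃ hXV
  refine ⟨B, hB, isComp_of_list ?_ ?_ ?_⟩
  · rw [Matches, hB.list_fst, hB.list_snd, count_lc_outer _ _ hB.matches.1,
      count_lc_outer _ _ hB.matches.2]
    exact hA.matches
  · rw [hW.list_fst, hA.list_fst, hB.list_fst, lc_comm h₁ h₂ h₃ h₄ i j hij _ _ _ Y.pos V.pos]
  · rw [hW.list_snd, hA.list_snd, hB.list_snd, lc_comm h₁ h₂ h₃ h₄ i j hij _ _ _ Y.pos V.pos]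

/-- There are finitely many decompositions. -/
lemma finite_isComp h i (Z : PatchPair r) :
    {c : PatchPair n × PatchPair m | IsComp h i c.1 c.2 Z}.Finite := by
  let f : PatchPair n × PatchPair m →
      (List _ × List _) ×
        (List _ × List _) :=
    fun c => ((c.1.1.list, c.1.2.list), (c.2.1.list, c.2.2.list))
  have hf : Function.Injective f := by
    rintro ⟨X, Y⟩ ⟨X', Y'⟩ e
    grind [ext_list]
  -- bounds on the lengths of traversals
  have bound : ∀ (x : List _) (y : List _) (z : List _),
      LComp h i x y z → x.length + 1 ≤ 2 * (n + nones x) → y.length + 1 ≤ 2 * (m + nones y) →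
      x.length ≤ 2 * (n + z.length) ∧ y.length ≤ 2 * (m + 2 * (n + z.length)) := by
    rintro x y z ⟨hm, rfl⟩ hx hy
    grind [nones_lc, nones]
  have fin : ∀ (k N : ℕ), {l : List (Option (Fin k)) | l.length ≤ N}.Finite :=
    fun k N => List.finite_length_le _ _
  refine Set.Finite.of_finite_image ?_ hf.injOn
  refine Set.Finite.subset (((fin n (2 * (n + Z.1.list.length))).prod
    (fin n (2 * (n + Z.2.list.length)))).prod
    ((fin m (2 * (m + 2 * (n + Z.1.list.length)))).prod
    (fin m (2 * (m + 2 * (n + Z.2.list.length)))))) ?_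
  rintro _ ⟨⟨X, Y⟩, hc, rfl⟩
  rw [Set.mem_ofPred_eq, isComp_iff] at hc
  have b1 := bound _ _ _ hc.1 X.1.length_list_le Y.1.length_list_le
  have b2 := bound _ _ _ hc.2 X.2.length_list.le Y.2.length_list.le
  grind

end PatchPair

section Patterns

variable {n m r : ℕ} {h : r + 1 = n + m} {i : Fin n} {x : List (Option (Fin n))}
  {y : List (Option (Fin m))}

lemma pattern_of_lc {l : List _} (hl : (l.map some).Sublist (lc h i x y))
    (hc : (l.map (contract h i)).IsChain (· ≠ ·)) : ((l.map (contract h i)).map some).Sublist x := by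
  refine sublist_of_sublist_map_lcomp (contract_inner h i) (fun a c => contract_of_rel h i)
    (fun a => eq_of_rel_eq_none h i) x y _ hc ?_
  have := hl.map (Option.map (contract h i))
  aesop

lemma pattern_of_lc_inner {l : List _}
    (hl : (l.map fun b => some (inner h i b)).Sublist (lc h i x y)) : (l.map some).Sublist y := by
  refine sublist_of_map_sublist_lcomp
    (fun b => Function.partialInv_left (inner_injective h i) b) (fun a c ha => ?_) x y l hl
  refine dif_neg ?_
  grind [outer_ne_inner, rel]

lemma pattern_inner {l : List _} (hm : x.count (some i) = nones y + 1)
    (hl : (l.map some).Sublist y) : (l.map fun b => some (inner h i b)).Sublist (lc h i x y) := by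
  refine map_sublist_lcomp x y l hl (rest_iterate_eq_nil y ?_)
  grind [hits_rel]

lemma LLt.contract (hl : LLt (lc h i x y) u v)
    (hc : QuiltPatch.contract h i u ≠ QuiltPatch.contract h i v) :
    LLt x (QuiltPatch.contract h i u) (QuiltPatch.contract h i v) :=
  ⟨hc, pattern_of_lc (l := [u, v, u]) hl.2 (by simp [hc, hc.symm])⟩

lemma LLeft.of_contract (hl : LLeft x (contract h i u) (contract h i v)) :
    LLeft (lc h i x y) u v :=
  ⟨fun e => hl.1 (by rw [e]), fun hs => hl.2 (pattern_of_lc (l := [v, u]) hs (by simp [hl.1.symm]))⟩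

lemma LLt.of_inner (hl : LLt (lc h i x y) (inner h i b) (inner h i b')) :
    LLt y b b' :=
  ⟨fun e => hl.1 (by rw [e]), pattern_of_lc_inner (l := [b, b', b]) hl.2⟩

lemma LLeft.inner (hl : LLeft y b b') :
    LLeft (lc h i x y) (inner h i b) (QuiltPatch.inner h i b') :=
  ⟨fun e => hl.1 (inner_injective h i e), fun hs => hl.2 (pattern_of_lc_inner (l := [b', b]) hs)⟩

lemma eq_inner_of_contract_eq (huv : u ≠ v)
    (hc : contract h i u = contract h i v) : ∃ b b', u = inner h i b ∧ v = inner h i b' := by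
  by_cases hu : contract h i u = i
  · obtain ⟨b, rfl⟩ := eq_inner_of_contract h i hu
    obtain ⟨b', rfl⟩ := eq_inner_of_contract h i (hc ▸ hu)
    grind
  have e1 := eq_outer_of_contract h i rfl hu
  grind [eq_outer_of_contract]

/-- A relation between the orders of two traversals is inherited by compositions. -/
lemma patch_lc
    (hx : ∀ a b, LLt x a b → LLeft x' a b) (hy : ∀ a b, LLt y a b → LLeft y' a b) u v
    (huv : LLt (lc h i x y) u v) : LLeft (lc h i x' y') u v := by
  by_cases hc : contract h i u = contract h i v
  · obtain ⟨b, b', rfl, rfl⟩ := eq_inner_of_contract_eq huv.1 hc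
    exact (hy _ _ huv.of_inner).inner
  · exact (hx _ _ (huv.contract hc)).of_contract

lemma patch_lc'
    (hx : ∀ a b, LLt x a b → LLeft x' b a) (hy : ∀ a b, LLt y a b → LLeft y' b a) u v
    (huv : LLt (lc h i x y) u v) : LLeft (lc h i x' y') v u := by
  by_cases hc : contract h i u = contract h i v
  · obtain ⟨b, b', rfl, rfl⟩ := eq_inner_of_contract_eq huv.1 hc
    exact (hy _ _ huv.of_inner).inner
  · exact (hx _ _ (huv.contract hc)).of_contract

end Patterns

section DoubleSum

variable {n m r : ℕ} (h : r + 1 = n + m) (i : Fin n)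

lemma double_sum_labels {kz : Fin r → Fin r → ℤ} {kx : Fin n → Fin n → ℤ}
    {ky : Fin m → Fin m → ℤ} (hi : kx i i = 0)
    (h1 : ∀ b b', kz (inner h i b) (inner h i b') = ky b b')
    (h2 : ∀ b c hc, kz (inner h i b) (outer h i c hc) = kx i c)
    (h3 : ∀ b c hc, kz (outer h i c hc) (inner h i b) = kx c i)
    (h4 : ∀ c hc c' hc', kz (outer h i c hc) (outer h i c' hc') = kx c c')
    {z z' : Fin r → ℤ} {x x' : Fin n → ℤ} {y y' : Fin m → ℤ}
    (ho : ∀ c hc, z (outer h i c hc) = x c) (ho' : ∀ c hc, z' (outer h i c hc) = x' c)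
    (hin : ∀ b, z (inner h i b) = y b) (hin' : ∀ b, z' (inner h i b) = y' b) :
    ∑ u, ∑ v, kz u v * (z u * z' v) = ∑ a, ∑ b, kx a b * (x a * x' b) +
      ∑ a, ∑ b, ky a b * (y a * y' b) + (∑ b, y b - x i) * ∑ c, kx i c * x' c +
      (∑ b, y' b - x' i) * ∑ c, kx c i * x c := by
  simp [sum_labels h i, sum_ne i, h1, h2, h3, h4, ho, ho', hin, hin', Finset.sum_add_distrib, hi,
    zero_mul]
  have e1 : ∀ f : {c : Fin n // c ≠ i} → ℤ, ∀ g : {c : Fin n // c ≠ i} → ℤ,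
      ∑ b, ∑ c, f c * (y b * g c) = (∑ b, y b) * ∑ c, f c * g c := by
    intro f g
    rw [Finset.sum_mul_sum]
    grind
  have e2 : ∀ f : {c : Fin n // c ≠ i} → ℤ, ∀ g : {c : Fin n // c ≠ i} → ℤ,
      ∑ c, ∑ b, f c * (g c * y' b) = (∑ b, y' b) * ∑ c, f c * g c := by
    intro f g
    rw [Finset.sum_comm, Finset.sum_mul_sum]
    grind
  rw [e1 _ _, e2 _ _]
  have e3 : ∑ c : {c : Fin n // c ≠ i}, kx i c * (x i * x' c) =
      x i * ∑ c : {c : Fin n // c ≠ i}, kx i c * x' c := by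
    grind [Finset.mul_sum]
  have e4 : ∑ c : {c : Fin n // c ≠ i}, kx c i * (x c * x' i) =
      x' i * ∑ c : {c : Fin n // c ≠ i}, kx c i * x c := by
    rw [Finset.mul_sum]
    grind
  rw [e3, e4]
  ring

end DoubleSum

lemma MNSOp.color_relabel σ (X : MNSOp n) a :
    (X.relabel σ).color a = X.color (σ.symm a) := by
  have h1 := (X.relabel σ).count_list a
  have h2 := List.count_map_of_injective X.list _
    (Option.map_injective σ.injective) (some (σ.symm a))
  rw [Option.map_some, Equiv.apply_symm_apply, X.count_list] at h2
  rw [list_relabel, h2] at h1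
  omega

lemma NSOp.color_relabel σ (X : NSOp n) a :
    (X.relabel σ).color a = X.color (σ.symm a) := by
  have h1 := (X.relabel σ).count_list a
  have h2 := List.count_map_of_injective X.list _
    (Option.map_injective σ.injective) (some (σ.symm a))
  rw [Option.map_some, Equiv.apply_symm_apply, X.count_list] at h2
  rw [list_relabel, h2] at h1
  omega

lemma MNSOp.out_relabel σ (X : MNSOp n) :
    (X.relabel σ).out = X.out := by
  rw [← nones_list, ← nones_list, list_relabel, nones_map_option]

lemma NSOp.out_relabel σ (X : NSOp n) :
    (X.relabel σ).out = X.out := by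
  rw [← nones_list, ← nones_list, list_relabel, nones_map_option]

lemma sublist_map_option {α β : Type} (e : α ≃ β) l (p : List _) :
    p.Sublist (l.map (Option.map e)) ↔ (p.map (Option.map e.symm)).Sublist l := by
  constructor
  · intro hp
    simpa using hp.map (Option.map e.symm)
  · intro hp
    simpa using hp.map (Option.map e)

lemma LLt.map_iff (e : α ≃ β) l a b :
    LLt (l.map (Option.map e)) a b ↔ LLt l (e.symm a) (e.symm b) := by
  grind [sublist_map_option, LLt]

lemma LLeft.map_iff (e : α ≃ β) l a b :
    LLeft (l.map (Option.map e)) a b ↔ LLeft l (e.symm a) (e.symm b) := by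
  grind [sublist_map_option, LLeft]

namespace PatchPair

variable {n m r : ℕ}

/-- Relabelling of both components. -/
def relabel (σ : Equiv.Perm (Fin n)) (Z : PatchPair n) : PatchPair n :=
  (Z.1.relabel σ, Z.2.relabel σ)

lemma relabel_relabel σ τ (Z : PatchPair n) :
    (Z.relabel τ).relabel σ = Z.relabel (σ * τ) := by
  refine ext_list ?_ ?_ <;>
  simp [relabel, MNSOp.list_relabel, NSOp.list_relabel]

lemma relabel_one (Z : PatchPair n) : Z.relabel 1 = Z := by
  refine ext_list ?_ ?_ <;>
  simp [relabel, MNSOp.list_relabel, NSOp.list_relabel]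

lemma relabel_inv_relabel σ (Z : PatchPair n) :
    (Z.relabel σ).relabel σ⁻¹ = Z := by
  rw [relabel_relabel, inv_mul_cancel, relabel_one]

lemma relabel_relabel_inv σ (Z : PatchPair n) :
    (Z.relabel σ⁻¹).relabel σ = Z := by
  rw [relabel_relabel, mul_inv_cancel, relabel_one]

lemma inDeg_relabel σ (Z : PatchPair n) a :
    (Z.relabel σ).inDeg a = Z.inDeg (σ.symm a) := by
  grind [MNSOp.color_relabel, NSOp.color_relabel, inDeg, relabel]

lemma deg_relabel σ (Z : PatchPair n) : (Z.relabel σ).deg = Z.deg := by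
  have : ∑ a, (Z.relabel σ).inDeg a = ∑ a, Z.inDeg a := by
    simp [inDeg_relabel]
    exact Equiv.sum_comp _ _
  grind [MNSOp.out_relabel, NSOp.out_relabel, deg, relabel]

lemma isPatch_iff (Z : PatchPair n) : Z.IsPatch ↔
    (∀ a b, LLt Z.2.list a b → LLeft Z.1.list a b) ∧
      ∀ a b, LLt Z.1.list a b → LLeft Z.2.list b a := by
  simp [IsPatch, MNSOp.lt_iff, MNSOp.left_iff, NSOp.lt_iff, NSOp.left_iff]

lemma isPatch_relabel σ (Z : PatchPair n) :
    (Z.relabel σ).IsPatch ↔ Z.IsPatch := by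
  simp [isPatch_iff, relabel, MNSOp.list_relabel, NSOp.list_relabel, LLt.map_iff,
    LLeft.map_iff]
  constructor
  · rintro ⟨h1, h2⟩
    exact ⟨fun a b => by simpa using h1 (σ a) (σ b), fun a b => by simpa using h2 (σ a) (σ b)⟩
  grind

lemma IsPatch.comp {i : Fin n} {Y : PatchPair m}
    {Z : PatchPair r} (hX : X.IsPatch) (hY : Y.IsPatch) (hc : IsComp h i X Y Z) : Z.IsPatch := by
  rw [isPatch_iff] at *
  rw [hc.list_fst, hc.list_snd]
  grind [patch_lc, patch_lc']

lemma isComp_relabel {i : Fin n}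

    (h1 : ∀ b, ρ (inner h i b) = inner h (σ i) (τ b))
    (h2 : ∀ c hc, ρ (outer h i c hc) = outer h _ _ (fun e => hc (σ.injective e)))
    X (Y : PatchPair m) (Z : PatchPair r) :
    IsComp h (σ i) (X.relabel σ) (Y.relabel τ) (Z.relabel ρ) ↔ IsComp h i X Y Z := by
  have key : ∀ (x : List _) (y : List _) (z : List _),
      LComp h (σ i) (x.map (Option.map σ)) (y.map (Option.map τ)) (z.map (Option.map ρ)) ↔
        LComp h i x y z := by
    intro x y z
    have e1 := List.count_map_of_injective x _
      (Option.map_injective σ.injective) (some i)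
    rw [Option.map_some] at e1
    rw [LComp, LComp, e1, nones_map_option]
    have e2 : (lc h i x y).map (Option.map ρ) =
        lc h (σ i) (x.map (Option.map σ)) (y.map (Option.map τ)) := by
      refine map_lcomp σ τ ρ (fun a => ?_) (fun b => (h1 b).symm) x y
      grind [rel_self, rel_of_ne]
    grind [List.map_injective_iff, Option.map_injective, Equiv.injective]
  grind [isComp_iff, MNSOp.list_relabel, NSOp.list_relabel, relabel]

end PatchPair

section Eps

variable (k : Type u) [CommRing k]

/-- The sign `(-1)^e` in `k`. -/
def eps (e : ℤ) : k := ((e.negOnePow : ℤ) : k)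

variable {k}

lemma negOnePow_smul e x : e.negOnePow • x = eps k e * x := by
  rw [Units.smul_def, zsmul_eq_mul, eps]

lemma eps_add a b : eps k (a + b) = eps k a * eps k b := by
  simp_all [Int.negOnePow_add, eps]

lemma eps_congr (hab : Even (a - b)) : eps k a = eps k b := by
  grind [Int.negOnePow_eq_iff, eps]

@[simp] theorem eps_zero : eps k 0 = 1 := by simp [eps]

lemma eps_mul_self a : eps k a * eps k a = 1 := by
  rw [← eps_add, eps_congr, eps_zero]
  grind

lemma eps_sub a b : eps k (a - b) = eps k a * eps k b := by
  grind [eps_add, eps_congr]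

lemma eps_succ a : eps k (a + 1) = - eps k a := by
  simp_all [Int.negOnePow_succ, eps]

lemma eps_pred a : eps k (a - 1) = - eps k a := by
  have := eps_succ (k := k) (a - 1)
  grind

end Eps

lemma sum_eq_of_image {ι κ τ M} [AddCommMonoid M] {s : Finset ι} {u : Finset κ}
    {p} {q} (hp : Set.InjOn p s) (hq : Set.InjOn q u)
    (h1 : ∀ x ∈ s, ∃ y ∈ u, q y = p x) (h2 : ∀ y ∈ u, ∃ x ∈ s, p x = q y) (F : τ → M) :
    ∑ x ∈ s, F (p x) = ∑ y ∈ u, F (q y) := by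
  classical
  rw [← Finset.sum_image hp, ← Finset.sum_image hq]
  congr 1
  grind

lemma sum_sum_eq_of_image {ι κ ι' κ' τ M : Type*} [AddCommMonoid M] {s}
    {u : ι → Finset κ} {s'} {u' : ι' → Finset κ'} {p : ι → κ → τ} {q : ι' → κ' → τ}
    (hp : ∀ x ∈ s, ∀ y ∈ u x, ∀ x' ∈ s, ∀ y' ∈ u x', p x y = p x' y' → x = x' ∧ y = y')
    (hq : ∀ x ∈ s', ∀ y ∈ u' x, ∀ x' ∈ s', ∀ y' ∈ u' x', q x y = q x' y' → x = x' ∧ y = y')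
    (h1 : ∀ x ∈ s, ∀ y ∈ u x, ∃ x' ∈ s', ∃ y' ∈ u' x', q x' y' = p x y)
    (h2 : ∀ x ∈ s', ∀ y ∈ u' x, ∃ x' ∈ s, ∃ y' ∈ u x', p x' y' = q x y) (F : τ → M) :
    ∑ x ∈ s, ∑ y ∈ u x, F (p x y) = ∑ x ∈ s', ∑ y ∈ u' x, F (q x y) := by
  rw [Finset.sum_sigma', Finset.sum_sigma']
  refine sum_eq_of_image
    ?_ ?_ ?_ ?_ F
  · rintro ⟨x, y⟩ hc ⟨x', y'⟩ hc' e
    grind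
  · rintro ⟨x, y⟩ hc ⟨x', y'⟩ hc' e
    grind
  · rintro ⟨x, y⟩ hc
    rw [Finset.mem_sigma] at hc
    obtain ⟨x', hx, y', hy, e⟩ := h1 x hc.1 y hc.2
    exact ⟨⟨x', y'⟩, Finset.mem_sigma.2 ⟨hx, hy⟩, e⟩
  rintro ⟨x, y⟩ hc
  rw [Finset.mem_sigma] at hc
  obtain ⟨x', hx, y', hy, e⟩ := h2 x hc.1 y hc.2
  exact ⟨⟨x', y'⟩, Finset.mem_sigma.2 ⟨hx, hy⟩, e⟩

section PairComp

open PatchPair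

variable {n m l r s t : ℕ}

/-- The decompositions of a pair. -/
def decomp (h : r + 1 = n + m) (i : Fin n) (Z : PatchPair r) :
    Finset (PatchPair n × PatchPair m) := (finite_isComp h i Z).toFinset

@[simp] theorem mem_decomp {h : r + 1 = n + m}
    : c ∈ decomp h i Z ↔ IsComp h i c.1 c.2 Z := by
  simp [decomp]

/-- The total degree of the inputs before `i`. -/
def below (i : Fin n) (X : PatchPair n) : ℤ := ∑ j, if j < i then X.inDeg j else 0

variable {k : Type u} [CommRing k]

lemma pairComp_apply h (i : Fin n) f (g : PairObj k m)
    (Z : PatchPair r) : pairComp k h i f g Z =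
      ∑ c ∈ decomp h i Z, eps k (c.2.deg * below i c.1) * (f c.1 * g c.2) := by
  classical
  rw [pairComp, finsum_eq_sum_of_support_subset (s := decomp h i Z)]
  · grind [Finset.sum_congr, mem_decomp, negOnePow_smul, below]
  simp_all

lemma below_inner {i : Fin n}
    {A : PatchPair r} (hA : IsComp h i X Y A) (j : Fin m) :
    below (inner h i j) A = below i X + below j Y := by
  rw [below, sum_labels h i, below, below, sum_ne i, if_neg (lt_irrefl i), zero_add, add_comm]
  grind [outer_lt_inner, PatchPair.IsComp.inDeg_outer, inner_lt_inner, PatchPair.IsComp.inDeg_inner]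

lemma below_outer {Y : PatchPair m}
    {A : PatchPair r} (hA : IsComp h i X Y A) (j : Fin n) hj :
    below (outer h i j hj) A = below j X + if i < j then Y.deg else 0 := by
  rw [below, sum_labels h i, below, sum_ne i]
  simp [outer_lt_outer h i Y.pos, hA.inDeg_outer, inner_lt_outer, hA.inDeg_inner]
  split_ifs
  · rw [sum_inDeg_eq hA.matches]
    ring
  · simp

lemma pairComp_assoc h₁ (h₂ : t + 1 = r + l) (h₃ : s + 1 = m + l)
    h₄ (i : Fin n) j x y
    z : pairComp k h₂ (inner h₁ i j) (pairComp k h₁ i x y) z =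
      pairComp k h₄ i x (pairComp k h₃ j y z) := by
  funext W
  rw [pairComp_apply, pairComp_apply]
  obtain ⟨F, hF⟩ : ∃ F : PatchPair n × PatchPair m × PatchPair l → k, F = fun T =>
    eps k (T.2.1.deg * below i T.1 + T.2.2.deg * (below i T.1 + below j T.2.1)) *
      (x T.1 * y T.2.1 * z T.2.2) := ⟨_, rfl⟩
  have e1 : ∀ c ∈ decomp h₂ (inner h₁ i j) W,
      eps k (c.2.deg * below (inner h₁ i j) c.1) * (pairComp k h₁ i x y c.1 * z c.2) =
        ∑ b ∈ decomp h₁ i c.1, F (b.1, b.2, c.2) := by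
    intro c _
    rw [pairComp_apply, Finset.sum_mul, Finset.mul_sum]
    grind [Finset.sum_congr, mem_decomp, below_inner, eps_add]
  have e2 : ∀ c ∈ decomp h₄ i W,
      eps k (c.2.deg * below i c.1) * (x c.1 * pairComp k h₃ j y z c.2) =
        ∑ b ∈ decomp h₃ j c.2, F (c.1, b.1, b.2) := by
    intro c _
    rw [pairComp_apply, Finset.mul_sum, Finset.mul_sum]
    refine Finset.sum_congr rfl fun b hb => ?_
    rw [mem_decomp] at hb
    have : b.1.deg * below i c.1 + b.2.deg * (below i c.1 + below j b.1) =
      c.2.deg * below i c.1 + b.2.deg * below j b.1 := by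
      rw [hb.deg_eq]
      ring
    grind [eps_add]
  rw [Finset.sum_congr rfl e1, Finset.sum_congr rfl e2]
  refine sum_sum_eq_of_image
    ?_ ?_ ?_ ?_ F
  · intro c hc b hb c' hc' b' hb' e
    rw [mem_decomp] at hb hb'
    grind [PatchPair.IsComp.unique]
  · intro c hc b hb c' hc' b' hb' e
    rw [mem_decomp] at hb hb'
    grind [PatchPair.IsComp.unique]
  · intro c hc b hb
    rw [mem_decomp] at hc hb
    obtain ⟨B, hB, hW⟩ := hb.assoc h₃ h₄ hc
    exact ⟨(b.1, B), mem_decomp.2 hW, (b.2, c.2), mem_decomp.2 hB, rfl⟩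
  intro c hc b hb
  rw [mem_decomp] at hc hb
  obtain ⟨A, hA, hW⟩ := hb.assoc' h₁ h₂ hc
  exact ⟨(A, b.2), mem_decomp.2 hW, (c.1, b.1), mem_decomp.2 hA, rfl⟩

lemma pairComp_comm h₁ (h₂ : t + 1 = r + l) (h₃ : s + 1 = n + l)
    h₄ i j hij x (y y' : PairObj k m)
    z
    (hy : ∀ Y V, z V ≠ 0 → eps k (Y.deg * V.deg) * y Y = y' Y) :
    pairComp k h₂ (outer h₁ i j hij.symm) (pairComp k h₁ i x y) z =
      pairComp k h₄ (outer h₃ j i hij) (pairComp k h₃ j x z) y' := by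
  funext W
  rw [pairComp_apply, pairComp_apply]
  obtain ⟨F, hF⟩ : ∃ F : PatchPair n × PatchPair m × PatchPair l → k, F = fun T =>
    eps k (T.2.1.deg * below i T.1 + T.2.2.deg * (below j T.1 + if i < j then T.2.1.deg else 0)) *
      (x T.1 * y T.2.1 * z T.2.2) := ⟨_, rfl⟩
  have e1 : ∀ c ∈ decomp h₂ (outer h₁ i j hij.symm) W,
      eps k (c.2.deg * below (outer h₁ i j hij.symm) c.1) * (pairComp k h₁ i x y c.1 * z c.2) =
        ∑ b ∈ decomp h₁ i c.1, F (b.1, b.2, c.2) := by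
    intro c _
    rw [pairComp_apply, Finset.sum_mul, Finset.mul_sum]
    grind [Finset.sum_congr, mem_decomp, below_outer, eps_add]
  have e2 : ∀ c ∈ decomp h₄ (outer h₃ j i hij) W,
      eps k (c.2.deg * below (outer h₃ j i hij) c.1) * (pairComp k h₃ j x z c.1 * y' c.2) =
        ∑ b ∈ decomp h₃ j c.1, F (b.1, c.2, b.2) := by
    intro c _
    rw [pairComp_apply, Finset.sum_mul, Finset.mul_sum]
    refine Finset.sum_congr rfl fun b hb => ?_
    rw [mem_decomp] at hb
    rw [hF]
    by_cases hz : z b.2 = 0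
    · simp [hz]
    rw [← hy c.2 b.2 hz, below_outer hb]
    have : ∀ u v w, eps k (c.2.deg * (below i b.1 + if j < i then b.2.deg else 0)) *
        (eps k (b.2.deg * below j b.1) * (u * v) * (eps k (c.2.deg * b.2.deg) * w)) =
        (eps k (c.2.deg * (below i b.1 + if j < i then b.2.deg else 0)) *
        eps k (b.2.deg * below j b.1) * eps k (c.2.deg * b.2.deg)) * (u * w * v) := by
      intro u v w
      ring
    rw [this, ← eps_add, ← eps_add]
    grind [eps_congr]
  rw [Finset.sum_congr rfl e1, Finset.sum_congr rfl e2]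
  refine sum_sum_eq_of_image
    ?_ ?_ ?_ ?_ F
  · intro c hc b hb c' hc' b' hb' e
    rw [mem_decomp] at hb hb'
    grind [PatchPair.IsComp.unique]
  · intro c hc b hb c' hc' b' hb' e
    rw [mem_decomp] at hb hb'
    grind [PatchPair.IsComp.unique]
  · intro c hc b hb
    rw [mem_decomp] at hc hb
    obtain ⟨B, hB, hW⟩ := hb.comm h₃ h₄ hij hc
    exact ⟨(B, b.2), mem_decomp.2 hW, (b.1, c.2), mem_decomp.2 hB, rfl⟩
  intro c hc b hb
  rw [mem_decomp] at hc hb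
  obtain ⟨A, hA, hW⟩ := hb.comm h₁ h₂ hij.symm hc
  exact ⟨(A, b.2), mem_decomp.2 hW, (b.1, c.2), mem_decomp.2 hA, rfl⟩

lemma koszul_eq σ (Z : PatchPair n) : Z.koszul σ =
    ∑ a, ∑ b, (if a < b ∧ σ b < σ a then 1 else 0) * (Z.inDeg a * Z.inDeg b) := by
  grind [koszul]

lemma koszul_comp {i : Fin n}

    (h1 : ∀ b, ρ (inner h i b) = inner h (σ i) (τ b))
    (h2 : ∀ c hc, ρ (outer h i c hc) = outer h _ _ (fun e => hc (σ.injective e)))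
    {Y : PatchPair m} {Z : PatchPair r} (hc : IsComp h i X Y Z) :
    Even (Z.koszul ρ + Y.deg * below (σ i) (X.relabel σ) -
      (X.koszul σ + Y.koszul τ + Y.deg * below i X)) := by
  have e0 : below (σ i) (X.relabel σ) = ∑ a, if σ a < σ i then X.inDeg a else 0 := by
    rw [below, ← Equiv.sum_comp σ]
    grind [inDeg_relabel]
  rw [koszul_eq, koszul_eq, koszul_eq, double_sum_labels h i
    (kx := fun a b => if a < b ∧ σ b < σ a then 1 else 0)
    (ky := fun a b => if a < b ∧ τ b < τ a then 1 else 0) (by simp)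
    (fun b b' => by grind [inner_lt_inner]) (fun b c hc => by
      grind [inner_lt_outer, outer_lt_inner])
    (fun b c hc => by grind [inner_lt_outer, outer_lt_inner])
    (fun c hc c' hc' => by simp [h2, outer_lt_outer _ _ Y.pos]) hc.inDeg_outer hc.inDeg_outer
    hc.inDeg_inner hc.inDeg_inner, sum_inDeg_eq hc.matches, add_sub_cancel_right, e0, below]
  have key : ∀ a, Even ((if i < a ∧ σ a < σ i then 1 else 0) * X.inDeg a +
      (if a < i ∧ σ i < σ a then 1 else 0) * X.inDeg a + (if σ a < σ i then X.inDeg a else 0) -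
      if a < i then X.inDeg a else 0) := by
    grind
  have key2 := (Finset.even_sum (s := Finset.univ) _ (fun a _ => key a)).mul_left Y.deg
  rw [Finset.sum_sub_distrib, Finset.sum_add_distrib, Finset.sum_add_distrib] at key2
  grind

lemma pairComp_act {i : Fin n}

    (h1 : ∀ b, ρ (inner h i b) = inner h (σ i) (τ b))
    (h2 : ∀ c hc, ρ (outer h i c hc) = outer h _ _ (fun e => hc (σ.injective e)))
    x (y : PairObj k m) (Z : PatchPair r) :
    pairComp k h i (fun X => eps k (X.koszul σ) * x (X.relabel σ))
      (fun Y => eps k (Y.koszul τ) * y (Y.relabel τ)) Z =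
      eps k (Z.koszul ρ) * pairComp k h (σ i) x y (Z.relabel ρ) := by
  rw [pairComp_apply, pairComp_apply, Finset.mul_sum]
  refine Finset.sum_nbij' (fun c => (c.1.relabel σ, c.2.relabel τ))
    (fun c => (c.1.relabel σ⁻¹, c.2.relabel τ⁻¹)) ?_ ?_ ?_ ?_ ?_
  · grind [mem_decomp, isComp_relabel]
  · grind [mem_decomp, isComp_relabel, relabel_relabel_inv]
  · grind [relabel_inv_relabel]
  · grind [relabel_relabel_inv]
  intro c hc
  rw [mem_decomp] at hc
  have := koszul_comp h1 h2 hc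
  have e : ∀ a b u v w : k, a * ((b * u) * (v * w)) = (b * v * a) * (u * w) := by
    intros
    ring
  rw [e, ← eps_add, ← eps_add, ← mul_assoc (eps k (Z.koszul ρ)), ← eps_add, deg_relabel]
  grind [eps_congr]

end PairComp

section Ins

variable {α β γ : Type}

/-- Insertion of a free input: at the beginning for `0`, behind the `i`-th free input, or at the end
if there are less than `i` of them. -/
def ins : ℕ → List (Option α) → List (Option α)
  | 0, l => none :: l
  | _ + 1, [] => [none]
  | i + 1, some a :: l => some a :: ins (i + 1) l
  | i + 1, none :: l => none :: ins i l

lemma ins_nil i : ins i ([] : List (Option α)) = [none] := by cases i <;> rfl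

lemma ins_zero (l : List (Option α)) : ins 0 l = none :: l := by rw [ins]

lemma ins_ins i j (hij : i ≤ j) (l : List (Option α)) :
    ins (j + 1) (ins i l) = ins i (ins j l) := by
  induction l generalizing i j with
  | nil =>
    cases i with
    | zero => grind [ins]
    | succ i => grind [ins_nil, ins]
  | cons s l ih =>
    cases i with
    | zero => grind [ins]
    | succ i =>
      obtain ⟨j, rfl⟩ : ∃ j', j = j' + 1 := ⟨j - 1, by omega⟩
      cases s with
      | none => grind [ins]
      | some a => grind [ins]

lemma nones_ins i (l : List (Option α)) : nones (ins i l) = nones l + 1 := by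
  induction l generalizing i with
  | nil => simp [ins_nil]
  | cons s l ih =>
    cases i with
    | zero => simp [ins]
    | succ i => cases s <;> simp [ins, ih]

lemma length_ins i (l : List (Option α)) : (ins i l).length = l.length + 1 := by
  induction l generalizing i with
  | nil => simp [ins_nil]
  | cons s l ih =>
    cases i with
    | zero => simp [ins]
    | succ i => cases s <;> simp [ins, ih]

lemma count_ins [DecidableEq α] i l (a : α) :
    (ins i l).count (some a) = l.count (some a) := by
  induction l generalizing i with
  | nil => simp [ins_nil]
  | cons s l ih =>
    cases i with
    | zero => simp [ins]
    | succ i => cases s <;> simp [ins, ih, List.count_cons]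

lemma ins_nones (l : List (Option α)) : ins (nones l + 1) l = l ++ [none] := by
  induction l with
  | nil => rfl
  | cons s l ih =>
    cases s with
    | none => grind [nones_none, ins]
    | some a => grind [nones_some, ins]

lemma ins_map_append i (l : List α) w :
    ins (i + 1) (l.map some ++ w) = l.map some ++ ins (i + 1) w := by
  induction l with
  | nil => rfl
  | cons a l ih => simp [ins, ih]

lemma lcomp_ins {ψ : β → γ} i (x : List (Option α))
    y : lcomp φ ψ (ins i x) y = ins i (lcomp φ ψ x y) := by
  induction x generalizing i y with
  | nil => grind [ins_nil, lcomp]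
  | cons s x ih =>
    cases i with
    | zero => grind [ins_zero, lcomp]
    | succ i =>
      rcases s with _ | a
      · simp [ins, lcomp, ih]
      rw [ins]
      cases hφ : φ a with
      | none =>
        have := ins_map_append i ((seg y).map ψ) (lcomp φ ψ x (rest y))
        rw [List.map_map] at this
        rw [lcomp_hit hφ, lcomp_hit hφ, ih]
        exact this.symm
      | some c => grind [lcomp_some, ins]

/-- Deletion of the `t`-th occurrence of `a`. -/
def er [DecidableEq α] (a : α) : ℕ → List (Option α) → List (Option α)
  | _, [] => []
  | 0, s :: l => if s = some a then l else s :: er a 0 l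
  | t + 1, s :: l => if s = some a then s :: er a t l else s :: er a (t + 1) l

lemma er_self_zero [DecidableEq α] (a : α) l : er a 0 (some a :: l) = l := by
  simp [er]

lemma er_self_succ [DecidableEq α] (a : α) t l :
    er a (t + 1) (some a :: l) = some a :: er a t l := by
  simp [er]

lemma er_of_ne [DecidableEq α] {a : α} {s} (hs : s ≠ some a) t
    l : er a t (s :: l) = s :: er a t l := by
  cases t <;> simp [er, hs]

lemma run_succ (a : α) s : run a (s + 1) = some a :: none :: run a s := by
  aesop

lemma run_zero (a : α) : run a 0 = [some a] := by simp [run]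

lemma run_eq_cons (a : α) s : ∃ w, run a s = some a :: w := ⟨_, rfl⟩

lemma nones_run (a : α) s : nones (run a s) = s := by
  induction s with
  | zero => simp [run_zero]
  | succ s ih => simp [run_succ, ih]

lemma count_run [DecidableEq α] (a : α) s : (run a s).count (some a) = s + 1 := by
  induction s with
  | zero => simp [run_zero]
  | succ s ih => simp [run_succ, ih]

lemma seg_eq_self {y : List (Option β)} (hy : nones y = 0) : (seg y).map some = y := by
  induction y with
  | nil => rfl
  | cons s y ih =>
    cases s with
    | none => simp at hy
    | some b => simp_all [seg]

lemma seg_append_rest {y : List (Option β)} (hy : nones y = q + 1) :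
    (seg y).map some ++ none :: rest y = y := by
  induction y with
  | nil => simp at hy
  | cons s y ih =>
    cases s with
    | none => rfl
    | some b => simp_all [seg, rest]

end Ins

section Units

variable {n : ℕ}

lemma inner_zero {h : n + 1 = 1 + n} b : inner h 0 b = b := Fin.ext (by simp [inner])

lemma inner_unit (i : Fin n) (b : Fin 1) : inner h i b = i :=
  Fin.ext (by grind [inner])

lemma outer_unit {h : n + 1 = n + 1} i c hc : outer h i c hc = c :=
  Fin.ext (by simp [outer])

lemma lc_run_left {h : n + 1 = 1 + n} (hy : nones y = q) :
    lc h 0 (run 0 q) y = y := by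
  have e : ∀ y, ((seg y).map fun b => some (inner h 0 b)) =
      (seg y).map some := by
    simp_all [inner_zero]
  induction q generalizing y with
  | zero => rw [run_zero, lc, lcomp_hit (rel_self h 0), e, seg_eq_self hy]; simp [lcomp]
  | succ q ih =>
    have h1 : nones (rest y) = q := by grind [nones_rest]
    rw [run_succ, lc, lcomp_hit (rel_self h 0), e, lcomp]
    simp_all [seg_append_rest, lc]

lemma rel_unit {h : n + 1 = n + 1} (ha : a ≠ i) : rel h i a = some a := by
  grind [rel_of_ne, outer_unit]

lemma lc_of_count_eq_zero {h : n + 1 = n + 1}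
    y (hx : x.count (some i) = 0) : lc h i x y = x := by
  induction x with
  | nil => rfl
  | cons s x ih =>
    rcases s with _ | a
    · grind [lc, lcomp]
    grind [lcomp_some, rel_unit, lc]

lemma lc_run_right {h : n + 1 = n + 1}
    (hx : x.count (some i) = q + 1) : lc h i x (run 0 q) = x := by
  induction x generalizing q with
  | nil => simp at hx
  | cons s x ih =>
    rcases s with _ | a
    · grind [lc, lcomp]
    by_cases ha : a = i
    · subst ha
      rw [List.count_cons_self, Nat.add_right_cancel_iff] at hx
      rw [lc, lcomp_hit (rel_self h a)]
      cases q with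
      | zero =>
        rw [run_zero, ← lc, lc_of_count_eq_zero _ hx]
        simp [seg, inner_unit]
      | succ q =>
        grind [run_succ, inner_unit, seg, rest, lc]
    grind [lcomp_some, rel_unit, lc]

lemma lc_nil_right {h : n + 1 = n + 1}
    (hx : x.count (some i) = 1) : lc h i x [] = er i 0 x := by
  induction x with
  | nil => rfl
  | cons s x ih =>
    rcases s with _ | a
    · grind [er_of_ne, lc, lcomp]
    by_cases ha : a = i
    · subst ha
      rw [List.count_cons_self, Nat.add_eq_right] at hx
      rw [er_self_zero, lc, lcomp_hit (rel_self h a), ← lc, lc_of_count_eq_zero _ hx]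
      rfl
    grind [er_of_ne, lcomp_some, rel_unit, lc]

lemma lc_ins_run_right {h : n + 1 = n + 1}
    (hx : x.count (some i) = q + 2) (ht : t ≤ q + 1) : lc h i x (ins t (run 0 q)) = er i t x := by
  induction x generalizing q t with
  | nil => simp at hx
  | cons s x ih =>
    rcases s with _ | a
    · grind [er_of_ne, lc, lcomp]
    · by_cases ha : a = i
      · subst ha
        rw [List.count_cons_self, Nat.add_right_cancel_iff] at hx
        rw [lc, lcomp_hit (rel_self h a)]
        rcases t with _ | t
        · rw [er_self_zero, ins]
          exact lc_run_right hx
        rw [er_self_succ]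
        rcases q with _ | q
        · obtain rfl : t = 0 := by omega
          rw [run_zero]
          simp only [ins, seg, rest, List.map_cons, List.map_nil, inner_unit]
          rw [← lc, lc_nil_right (by simpa using hx)]
          rfl
        grind [run_succ, inner_unit, ins, seg, rest, lc]
      grind [er_of_ne, lcomp_some, rel_unit, lc]

end Units

/-- The terms of `D_q`, in the order of their signs. -/
def dterm (q i : ℕ) : Term (Fin 1) :=
  if i = 0 then Term.mul Term.leaf (Term.corolla q)
  else if i = q + 1 then Term.mul (Term.corolla q) Term.leaf
  else Term.node 0 q fun j => if j.1 + 1 = i then Term.mul Term.leaf Term.leaf else Term.leaf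

lemma ins_flatten_ofFn (a : α) (hi : i < q) :
    (List.ofFn fun j : Fin q => (if j.1 = i then [none, none] else [none]) ++ [some a]).flatten =
      ins (i + 1) (List.replicate q [none, some a]).flatten := by
  induction q generalizing i with
  | zero => omega
  | succ q ih =>
    rw [List.ofFn_succ, List.flatten_cons, List.replicate_succ, List.flatten_cons]
    rcases i with _ | i
    · grind [List.ofFn_const, ins]
    grind [ins]

lemma enc_dterm (hi : i < q + 2) : (dterm q i).enc = ins i (run 0 q) := by
  rw [dterm]
  split_ifs with h1 h2
  · subst h1
    rw [Term.enc, enc_corolla]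
    rfl
  · grind [ins_nones, nones_run, enc_corolla, Term.enc]
  obtain ⟨i, rfl⟩ : ∃ i', i = i' + 1 := ⟨i - 1, by omega⟩
  grind [ins_flatten_ofFn, run, ins, Term.enc]

lemma dterm_valid q i : (dterm q i).Valid := by
  rw [dterm]
  split_ifs with h1 h2
  · refine ⟨by simp, fun a => ?_⟩
    simp [Term.corolla, Term.count, Subsingleton.elim a 0]
  · refine ⟨by simp, fun a => ?_⟩
    simp [Term.corolla, Term.count, Subsingleton.elim a 0]
  refine ⟨by simp, fun a => ?_⟩
  have : ∀ j : Fin q, (if j.1 + 1 = i then Term.mul Term.leaf Term.leaf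
      else Term.leaf : Term (Fin 1)).count 0 = 0 := by
    aesop
  simp [Term.count, Subsingleton.elim a 0, this]

lemma exists_dlist (hi : i < q + 2) : ∃ X : MNSOp 1, X.list = ins i (run 0 q) :=
  ⟨Quotient.mk _ ⟨dterm q i, dterm_valid q i⟩, enc_dterm hi⟩

lemma hochschild_eq (X : MNSOp 1) : X.hochschild = ∑ i ∈ Finset.range (X.color 0 + 2),
    if X.list = ins i (run 0 (X.color 0)) then (-1) ^ i else 0 := by
  classical
  have e : ∀ i < X.color 0 + 2, X.Rep (dterm (X.color 0) i) ↔
      X.list = ins i (run 0 (X.color 0)) := by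
    grind [MNSOp.rep_iff, enc_dterm, dterm_valid]
  have h0 := e 0 (by omega)
  have h1 := e (X.color 0 + 1) (by omega)
  rw [dterm, if_pos rfl] at h0
  rw [dterm, if_neg (by omega), if_pos rfl] at h1
  rw [Finset.sum_range_succ, Finset.sum_range_succ', MNSOp.hochschild]
  simp [h1]
  rw [add_comm (∑ k ∈ Finset.range _, _)]
  rw [← Fin.sum_univ_eq_sum_range _]
  grind [dterm]

/-- The identity of colour `p`. -/
def NSOp.id (p : ℕ) : NSOp 1 := ⟨Term.corolla p, corolla_valid p, fun _ => trivial⟩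

lemma NSOp.list_id p : (NSOp.id p).list = run 0 p := enc_corolla p

lemma NSOp.isId_iff_eq X : X.IsId ↔ X = NSOp.id (X.color 0) := by
  constructor
  · rintro ⟨p, hp⟩
    have e : X = NSOp.id p := Subtype.ext hp
    have h1 := X.count_list 0
    grind [NSOp.list_id, count_run]
  · intro e
    exact ⟨_, congrArg _ e⟩

/-- The identity of colour `q`. -/
def MNSOp.id (q : ℕ) : MNSOp 1 := Quotient.mk _ ⟨Term.corolla q, corolla_valid q⟩

lemma MNSOp.list_id p : (MNSOp.id p).list = run 0 p := enc_corolla p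

lemma MNSOp.isId_iff_eq X : X.IsId ↔ X = MNSOp.id (X.color 0) := by
  rw [isId_iff]
  constructor
  · rintro ⟨p, hp⟩
    have h1 := X.count_list 0
    rw [hp, count_run] at h1
    obtain rfl : p = X.color 0 := by omega
    exact list_injective (hp.trans (list_id _).symm)
  intro e
  exact ⟨_, (congrArg list e).trans (list_id _)⟩

section

open PatchPair

variable {k : Type u} [CommRing k] {n m r : ℕ}

/-- Partial composition as a bilinear map. -/
def compL (k : Type u) [CommRing k] {n m r : ℕ} (h : r + 1 = n + m) (i : Fin n) :
    PairObj k n →ₗ[k] PairObj k m →ₗ[k] PairObj k r :=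
  LinearMap.mk₂ k (pairComp k h i)
    (fun f f' g => by
      funext Z
      simp only [pairComp_apply, Pi.add_apply, ← Finset.sum_add_distrib]
      grind)
    (fun a f g => by
      funext Z
      simp only [pairComp_apply, Pi.smul_apply, smul_eq_mul, Finset.mul_sum]
      grind)
    (fun f g g' => by
      funext Z
      simp only [pairComp_apply, Pi.add_apply, ← Finset.sum_add_distrib]
      grind)
    (fun a f g => by
      funext Z
      simp only [pairComp_apply, Pi.smul_apply, smul_eq_mul, Finset.mul_sum]
      grind)

lemma compL_apply (h : r + 1 = n + m) i f g :
    compL k h i f g = pairComp k h i f g := rfl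

lemma exists_of_pairComp_ne_zero {i : Fin n}
    {g : PairObj k m} {Z : PatchPair r} (hZ : pairComp k h i f g Z ≠ 0) :
    ∃ X Y, IsComp h i X Y Z ∧ f X ≠ 0 ∧ g Y ≠ 0 := by
  rw [pairComp_apply] at hZ
  obtain ⟨c, hc, hne⟩ := Finset.exists_ne_zero_of_sum_ne_zero hZ
  grind [mem_decomp]

/-- Multiplication by the sign of the degree. -/
def hat : PairObj k n →ₗ[k] PairObj k n where
  toFun f := fun Z => Z.deg.negOnePow • f Z
  map_add' f g := by
    funext Z
    simp
  map_smul' a f := by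
    funext Z
    simp [negOnePow_smul, mul_left_comm]

lemma hat_apply (f : PairObj k n) Z : hat f Z = eps k Z.deg * f Z :=
  negOnePow_smul _ _

lemma hat_hat (f : PairObj k n) : hat (hat f) = f := by
  grind [hat_apply, eps_mul_self]

lemma hat_comp (h : r + 1 = n + m) i f g :
    hat (compL k h i f g) = compL k h i (hat f) (hat g) := by
  funext Z
  rw [hat_apply, compL_apply, compL_apply, pairComp_apply, pairComp_apply, Finset.mul_sum]
  refine Finset.sum_congr rfl fun c hc => ?_
  rw [mem_decomp] at hc
  rw [hat_apply, hat_apply, hc.deg_eq, eps_add]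
  ring

lemma pairD_apply Z (hZ : Z.2.IsId) : pairD k Z = ∑ i ∈ Finset.range (Z.1.color 0 + 2),
    if Z.1.list = ins i (run 0 (Z.1.color 0)) then (-1) ^ i else 0 := by
  classical
  simp_all [hochschild_eq, pairD]

lemma pairD_ne_zero (hZ : pairD k Z ≠ 0) : Z.2.IsId ∧
    ∃ i < Z.1.color 0 + 2, Z.1.list = ins i (run 0 (Z.1.color 0)) := by
  have h1 : Z.2.IsId := by
    by_contra h1
    exact hZ (if_neg h1)
  rw [pairD_apply _ h1] at hZ
  obtain ⟨i, hi, hne⟩ := Finset.exists_ne_zero_of_sum_ne_zero hZ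
  grind

lemma NSOp.IsId.out_eq {X : NSOp 1} (hX : X.IsId) : X.out = X.color 0 := by
  grind [NSOp.nones_list, NSOp.isId_iff_eq, NSOp.list_id, nones_run]

lemma deg_of_pairD_ne_zero (hZ : pairD k Z ≠ 0) : Z.deg = -1 := by
  obtain ⟨h1, i, -, e⟩ := pairD_ne_zero hZ
  have h2 := Z.1.nones_list
  grind [nones_ins, nones_run, Fin.sum_univ_one, NSOp.IsId.out_eq, deg, inDeg]

lemma hat_pairD : hat (pairD k) = - pairD k := by
  funext Z
  rw [hat_apply, Pi.neg_apply]
  by_cases hZ : pairD k Z = 0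
  · rw [hZ]
    simp
  rw [deg_of_pairD_ne_zero hZ, ← zero_sub, eps_pred, eps_zero]
  ring

/-- The elements of `mNSOp` whose traversal has length `N`. -/
def ofLength (n N : ℕ) : Finset (MNSOp n) := Set.Finite.toFinset (s := {X | X.list.length = N}) (by
  refine Set.Finite.of_finite_image (f := MNSOp.list) ?_ MNSOp.list_injective.injOn
  refine (List.finite_length_le (Option (Fin n)) N).subset ?_
  grind)

@[simp] theorem mem_ofLength : X ∈ ofLength n N ↔ X.list.length = N := by
  simp [ofLength]

lemma NSOp.isComp_id_left (hI : I.IsId) (J K : NSOp n) :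
    NSOp.IsComp h 0 I J K ↔ K = J ∧ I = NSOp.id J.out := by
  rw [I.isId_iff_eq] at hI
  rw [isComp_iff, LComp, hI, NSOp.list_id, count_run, Nat.add_right_cancel_iff, J.nones_list]
  constructor
  · rintro ⟨e1, e2⟩
    rw [lc_run_left (by rw [J.nones_list, e1])] at e2
    exact ⟨list_injective e2, by rw [e1]⟩
  grind [NSOp.list_id, nones_run, lc_run_left, NSOp.nones_list]

lemma NSOp.isComp_id_right (hI : I.IsId)
    (J K : NSOp n) : NSOp.IsComp h i J I K ↔ K = J ∧ I = NSOp.id (J.color i) := by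
  rw [I.isId_iff_eq] at hI
  rw [isComp_iff, LComp, J.count_list, hI, NSOp.list_id, nones_run, Nat.add_right_cancel_iff]
  constructor
  · rintro ⟨e1, e2⟩
    rw [lc_run_right (by rw [J.count_list, e1])] at e2
    exact ⟨list_injective e2, by rw [e1]⟩
  grind [NSOp.list_id, nones_run, lc_run_right, NSOp.count_list]

lemma sum_filter_eq_of_image {ι κ τ M : Type*} [AddCommMonoid M] {s} {u}
    {P} [DecidablePred P] {Q} [DecidablePred Q]
    {p : ι → τ} {q : κ → τ} {f : ι → M} {g : κ → M} (F : τ → M)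
    (hp : ∀ x ∈ s, P x → ∀ y ∈ s, P y → p x = p y → x = y)
    (hq : ∀ x ∈ u, Q x → ∀ y ∈ u, Q y → q x = q y → x = y)
    (h1 : ∀ x ∈ s, P x → ∃ y ∈ u, Q y ∧ q y = p x) (h2 : ∀ y ∈ u, Q y → ∃ x ∈ s, P x ∧ p x = q y)
    (hf : ∀ x ∈ s, P x → f x = F (p x)) (hg : ∀ x ∈ u, Q x → g x = F (q x)) :
    (∑ x ∈ s, if P x then f x else 0) = ∑ y ∈ u, if Q y then g y else 0 := by
  rw [← Finset.sum_filter, ← Finset.sum_filter, Finset.sum_congr rfl fun x hx => hf x (Finset.mem_filter.1 hx).1 (Finset.mem_filter.1 hx).2,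
    Finset.sum_congr rfl fun x hx => hg x (Finset.mem_filter.1 hx).1 (Finset.mem_filter.1 hx).2]
  refine sum_eq_of_image ?_ ?_ ?_ ?_ F
  · intro x hx y hy
    grind
  · intro x hx y hy
    grind
  · grind
  grind

lemma below_zero (X : PatchPair (n + 1)) : below 0 X = 0 := by
  simp [below]

lemma pairD_comp h f Z :
    pairComp k h 0 (pairD k) f Z = ∑ Y ∈ ofLength n (Z.1.list.length - 1),
      ∑ i ∈ Finset.range (Y.out + 2), if ins i Y.list = Z.1.list then (-1) ^ i * f (Y, Z.2) else 0 := by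
  classical
  rw [pairComp_apply]
  have e1 : ∀ c ∈ decomp h 0 Z, eps k (c.2.deg * below 0 c.1) * (pairD k c.1 * f c.2) =
      ∑ i ∈ Finset.range (c.1.1.color 0 + 2),
        if c.1.2.IsId ∧ c.1.1.list = ins i (run 0 (c.1.1.color 0)) then (-1) ^ i * f c.2 else 0 := by
    intro c _
    rw [below_zero, mul_zero, eps_zero, one_mul]
    by_cases hc : c.1.2.IsId
    · grind [pairD_apply, Finset.sum_mul]
    simp_all [pairD]
  rw [Finset.sum_congr rfl e1, Finset.sum_sigma', Finset.sum_sigma']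
  refine sum_filter_eq_of_image (p := fun c => (c.1.2.1, c.2))
    (q := fun c => (c.1, c.2)) (fun T => (-1) ^ T.2 * f (T.1, Z.2)) ?_ ?_ ?_ ?_
    ?_ ?_
  · rintro ⟨⟨X, Y⟩, i⟩ h1 ⟨h2, h3⟩ ⟨⟨X', Y'⟩, i'⟩ h1' ⟨h2', h3'⟩ e
    simp at h1 h1'
    have e2 := (Prod.mk.inj e).2
    obtain ⟨e3, e4⟩ := (NSOp.isComp_id_left h2 _ _).1 h1.1.2
    obtain ⟨e3', e4'⟩ := (NSOp.isComp_id_left h2' _ _).1 h1'.1.2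
    have e5 := Prod.ext (Prod.mk.inj e).1 (e3.symm.trans e3')
    have e6 := h1.1.matches.color_eq.1
    have e6' := h1'.1.matches.color_eq.1
    grind [MNSOp.list_injective]
  · grind
  · rintro ⟨⟨X, Y⟩, i⟩ h1 ⟨h2, h3⟩
    simp at h1
    have e6 := h1.1.matches.color_eq.1
    have e7 : ins i Y.1.list = Z.1.list := by
      rw [h1.1.list_fst, h3, lc, lcomp_ins, ← lc, lc_run_left (by rw [e6, MNSOp.nones_list])]
    refine ⟨⟨Y.1, i⟩, ?_, e7, rfl⟩
    grind [mem_ofLength, length_ins]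
  · rintro ⟨Y, i⟩ h1 h2
    rw [Finset.mem_sigma, Finset.mem_range] at h1
    obtain ⟨X, hX⟩ := exists_dlist h1.2
    have e1 : X.color 0 = Y.out := by
      have := X.count_list 0
      grind [count_ins, count_run]
    refine ⟨⟨((X, NSOp.id Z.2.out), (Y, Z.2)), i⟩, ?_, ⟨⟨_, rfl⟩, by simp [e1, hX]⟩, rfl⟩
    rw [Finset.mem_sigma, mem_decomp, Finset.mem_range]
    refine ⟨⟨(MNSOp.isComp_iff _ _ Z.pos _ _ _).2 ⟨?_, ?_⟩, (NSOp.isComp_id_left ⟨_, rfl⟩ _ _).2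
      ⟨rfl, rfl⟩⟩, by grind⟩
    · grind [MNSOp.count_list, MNSOp.nones_list]
    · rw [← h2, hX, lc, lcomp_ins, ← lc, lc_run_left (Y.nones_list)]
  · rintro ⟨⟨X, Y⟩, i⟩ h1 ⟨h2, h3⟩
    simp at h1
    obtain ⟨e3, e4⟩ := (NSOp.isComp_id_left h2 _ _).1 h1.1.2
    rw [e3]
  grind

lemma comp_pairD h a f Z :
    pairComp k h a f (pairD k) Z = ∑ X ∈ ofLength n (Z.1.list.length + 1),
      ∑ t ∈ Finset.range (X.color a + 1), if 0 < X.color a ∧ er a t X.list = Z.1.list then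
        (-1) ^ t * (eps k (below a (X, Z.2)) * f (X, Z.2)) else 0 := by
  classical
  rw [pairComp_apply]
  have e1 : ∀ c ∈ decomp h a Z, eps k (c.2.deg * below a c.1) * (f c.1 * pairD k c.2) =
      ∑ i ∈ Finset.range (c.2.1.color 0 + 2),
        if c.2.2.IsId ∧ c.2.1.list = ins i (run 0 (c.2.1.color 0)) then
          (-1) ^ i * (eps k (below a c.1) * f c.1) else 0 := by
    intro c _
    by_cases hc : c.2.2.IsId
    · have e : eps k (c.2.deg * below a c.1) * (f c.1 * pairD k c.2) =
          pairD k c.2 * (eps k (below a c.1) * f c.1) := by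
        by_cases hD : pairD k c.2 = 0
        · simp [hD]
        rw [deg_of_pairD_ne_zero hD, show (-1) * below a c.1 = 0 - below a c.1 by ring, eps_sub,
          eps_zero]
        ring
      grind [pairD_apply, Finset.sum_mul]
    simp_all [pairD]
  rw [Finset.sum_congr rfl e1, Finset.sum_sigma', Finset.sum_sigma']
  refine sum_filter_eq_of_image (p := fun c => (c.1.1.1, c.2))
    (q := fun c => (c.1, c.2))
    (fun T => (-1) ^ T.2 * (eps k (below a (T.1, Z.2)) * f (T.1, Z.2))) ?_ ?_ ?_ ?_
    ?_ ?_
  · rintro ⟨⟨X, Y⟩, i⟩ h1 ⟨h2, h3⟩ ⟨⟨X', Y'⟩, i'⟩ h1' ⟨h2', h3'⟩ e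
    simp at h1 h1'
    have e2 := (Prod.mk.inj e).2
    obtain ⟨e3, e4⟩ := (NSOp.isComp_id_right h2 _ _).1 h1.1.2
    obtain ⟨e3', e4'⟩ := (NSOp.isComp_id_right h2' _ _).1 h1'.1.2
    have e5 := Prod.ext (Prod.mk.inj e).1 (e3.symm.trans e3')
    have e6 := h1.1.matches.color_eq.1
    have e6' := h1'.1.matches.color_eq.1
    have e8 : Y.1.color 0 = Y'.1.color 0 := by
      have h5 := Y.1.nones_list
      have h5' := Y'.1.nones_list
      grind [nones_ins, nones_run]
    grind [MNSOp.list_injective]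
  · grind
  · rintro ⟨⟨X, Y⟩, i⟩ h1 ⟨h2, h3⟩
    simp at h1
    simp at h3
    have e6 := h1.1.matches.color_eq.1
    have h5 := Y.1.nones_list
    rw [h3, nones_ins, nones_run] at h5
    have h4 : X.1.list.count (some a) = Y.1.color 0 + 2 := by
      rw [X.1.count_list, e6, ← h5]
    have e7 : er a i X.1.list = Z.1.list := by
      rw [h1.1.list_fst, h3, lc_ins_run_right h4 (by omega)]
    refine ⟨⟨X.1, i⟩, ?_, ⟨by simp only; omega, e7⟩, rfl⟩
    rw [Finset.mem_sigma, mem_ofLength, Finset.mem_range, h1.1.list_fst, h3]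
    have e8 : ∀ (x : List _) (t : ℕ), t < x.count (some a) →
        x.length = (er a t x).length + 1 := by
      intro x
      induction x with
      | nil => intro t ht; simp at ht
      | cons s x ih =>
        intro t ht
        by_cases hs : s = some a
        · subst hs
          rcases t with _ | t
          · rw [er_self_zero]; rfl
          grind [er_self_succ]
        grind [er_of_ne]
    grind [lc_ins_run_right]
  · rintro ⟨X, i⟩ h1 ⟨h2, h3⟩
    rw [Finset.mem_sigma, Finset.mem_range] at h1
    simp at h1 h2 h3
    obtain ⟨q, hq⟩ : ∃ q, X.color a = q + 1 := ⟨X.color a - 1, by omega⟩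
    obtain ⟨Y, hY⟩ := exists_dlist (q := q) (i := i) (by omega)
    have e1 : Y.color 0 = q := by
      have := Y.count_list 0
      grind [count_ins, count_run]
    refine ⟨⟨((X, Z.2), (Y, NSOp.id (Z.2.color a))), i⟩, ?_, ⟨⟨_, rfl⟩, by simp [e1, hY]⟩, rfl⟩
    rw [Finset.mem_sigma, mem_decomp, Finset.mem_range]
    refine ⟨⟨(MNSOp.isComp_iff _ _ Z.pos _ _ _).2 ⟨?_, ?_⟩, (NSOp.isComp_id_right ⟨_, rfl⟩ _ _).2
      ⟨rfl, rfl⟩⟩, by simp; omega⟩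
    · grind [MNSOp.count_list, nones_ins, nones_run]
    grind [lc_ins_run_right, MNSOp.count_list]
  · rintro ⟨⟨X, Y⟩, i⟩ h1 ⟨h2, h3⟩
    simp at h1
    obtain ⟨e3, e4⟩ := (NSOp.isComp_id_right h2 _ _).1 h1.1.2
    rw [e3]
  grind

lemma sum_ins_ins {M} [AddCommGroup M] N (F : ℕ → ℕ → M)
    (hF : ∀ i j, i ≤ j → F (j + 1) i = - F i j) :
    ∑ i ∈ Finset.range (N + 1), ∑ j ∈ Finset.range N, F i j = 0 := by
  classical
  rw [← Finset.sum_product', ← Finset.sum_filter_add_sum_filter_not _ (fun c => c.1 ≤ c.2), add_eq_zero_iff_eq_neg, ← Finset.sum_neg_distrib]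
  refine Finset.sum_nbij' (fun c => (c.2 + 1, c.1)) (fun c => (c.2, c.1 - 1)) ?_ ?_ ?_ ?_ ?_
  · grind
  · grind
  · grind
  · grind
  grind

lemma pairD_comp_pairD (h : 1 + 1 = 1 + 1) : pairComp k h 0 (pairD k) (pairD k) = 0 := by
  classical
  funext Z
  rw [pairD_comp, Pi.zero_apply]
  by_cases hZ : Z.2.IsId
  swap
  · grind [Finset.sum_eq_zero, pairD]
  obtain ⟨q, hq⟩ : ∃ q, Z.1.color 0 = q := ⟨_, rfl⟩
  have hqZ := Z.1.count_list 0
  have key : ∀ Y ∈ ofLength 1 (Z.1.list.length - 1), (∑ i ∈ Finset.range (Y.out + 2),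
      if ins i Y.list = Z.1.list then (-1) ^ i * pairD k (Y, Z.2) else 0) =
      ∑ i ∈ Finset.range (q + 3), ∑ j ∈ Finset.range (q + 2),
        if Y.list = ins j (run 0 q) then
          if ins i (ins j (run 0 q)) = Z.1.list then (-1) ^ (i + j) else 0 else 0 := by
    intro Y hY
    by_cases hY2 : Y.color 0 = q
    swap
    · grind [Finset.sum_eq_zero, MNSOp.count_list, count_ins]
    by_cases hY3 : ∃ j < q + 2, Y.list = ins j (run 0 q)
    swap
    · have hD : pairD k (Y, Z.2) = 0 := by
        by_contra hne
        obtain ⟨-, j, hj, e⟩ := pairD_ne_zero hne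
        grind
      grind [Finset.sum_eq_zero]
    have hout : Y.out = q + 1 := by
      grind [MNSOp.nones_list, nones_ins, nones_run]
    rw [hout]
    refine Finset.sum_congr rfl fun i _ => ?_
    rw [pairD_apply (Y, Z.2) hZ]
    split_ifs with hi
    · grind [Finset.mul_sum]
    grind [Finset.sum_eq_zero]
  rw [Finset.sum_congr rfl key, Finset.sum_comm]
  have key2 : ∀ i ∈ Finset.range (q + 3), (∑ Y ∈ ofLength 1 (Z.1.list.length - 1),
      ∑ j ∈ Finset.range (q + 2), if Y.list = ins j (run 0 q) then
          if ins i (ins j (run 0 q)) = Z.1.list then (-1) ^ (i + j) else 0 else 0) =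
      ∑ j ∈ Finset.range (q + 2),
        if ins i (ins j (run 0 q)) = Z.1.list then (-1) ^ (i + j) else (0 : k) := by
    intro i _
    rw [Finset.sum_comm]
    refine Finset.sum_congr rfl fun j hj => ?_
    obtain ⟨Y, hY⟩ := exists_dlist (Finset.mem_range.1 hj)
    rw [Finset.sum_eq_single Y]
    · rw [if_pos hY]
    · grind [MNSOp.list_injective]
    grind [mem_ofLength, length_ins]
  rw [Finset.sum_congr rfl key2]
  refine sum_ins_ins _ _ fun i j hij => ?_
  grind [ins_ins]

end

open PatchPair

section Formal

variable {k : Type u} [CommRing k] {n m r : ℕ}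

/-- Composition with the Hochschild differential at the root. -/
def leftD (k : Type u) [CommRing k] (n : ℕ) : PairObj k n →ₗ[k] PairObj k n :=
  compL k (Nat.add_comm n 1) 0 (pairD k)

/-- Composition with the Hochschild differential at the input `i`. -/
def rightD (k : Type u) [CommRing k] {n : ℕ} (i : Fin n) : PairObj k n →ₗ[k] PairObj k n :=
  (compL k (n := n) (m := 1) rfl i).flip (pairD k)

lemma compL_assoc h₁ (h₂ : t + 1 = r + l) (h₃ : s + 1 = m + l)
    h₄ (i : Fin n) j x y
    z : compL k h₂ (inner h₁ i j) (compL k h₁ i x y) z =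
      compL k h₄ i x (compL k h₃ j y z) :=
  pairComp_assoc h₁ h₂ h₃ h₄ i j x y z

lemma leftD_leftD f : leftD k n (leftD k n f) = 0 := by
  have := compL_assoc rfl (Nat.add_comm n 1) (Nat.add_comm n 1)
    (Nat.add_comm n 1) 0 0 (pairD k) (pairD k) f
  have e : compL k rfl 0 _ _ = 0 := pairD_comp_pairD rfl
  aesop

lemma rightD_rightD_self (i : Fin n) f : rightD k i (rightD k i f) = 0 := by
  have := compL_assoc rfl rfl rfl rfl i 0 f (pairD k) (pairD k)
  have e : compL k rfl 0 _ _ = 0 := pairD_comp_pairD rfl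
  rw [e, map_zero, inner_unit] at this
  exact this

lemma leftD_rightD i f :
    leftD k n (rightD k i f) = rightD k i (leftD k n f) := by
  have := compL_assoc (Nat.add_comm n 1) rfl rfl
    (Nat.add_comm n 1) 0 i (pairD k) f (pairD k)
  rw [inner_zero] at this
  exact this.symm

lemma rightD_rightD_of_ne {i : Fin n} (hij : i ≠ j) f :
    rightD k j (rightD k i f) = - rightD k i (rightD k j f) := by
  have := pairComp_comm rfl rfl rfl rfl i j hij f (pairD k)
    (-pairD k) _ (by
      intro Y V hV
      rw [deg_of_pairD_ne_zero hV, Pi.neg_apply]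
      by_cases hY : pairD k Y = 0
      · simp [hY]
      · rw [deg_of_pairD_ne_zero hY, show -1 * -1 = 0 + 1 by ring, eps_succ, eps_zero]
        ring)
  rw [outer_unit, outer_unit] at this
  exact this.trans (map_neg (compL k rfl i _) _)

lemma hat_leftD f : hat (leftD k n f) = - leftD k n (hat f) := by
  rw [leftD, hat_comp, hat_pairD, map_neg, LinearMap.neg_apply]

lemma hat_rightD (i : Fin n) f :
    hat (rightD k i f) = - rightD k i (hat f) := by
  grind [LinearMap.flip_apply, hat_comp, hat_pairD, rightD]

lemma leftD_comp h i x (y : PairObj k m) :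
    leftD k r (compL k h i x y) = compL k h i (leftD k n x) y := by
  have := compL_assoc (Nat.add_comm n 1) h h
    (Nat.add_comm r 1) 0 i (pairD k) x y
  rw [inner_zero] at this
  exact this.symm

lemma rightD_inner_comp (h : r + 1 = n + m) i b x
    y : rightD k (inner h i b) (compL k h i x y) = compL k h i x (rightD k b y) :=
  compL_assoc h rfl rfl h i b x y _

lemma rightD_outer_comp (h : r + 1 = n + m) i c hc x
    y : rightD k (outer h i c hc) (compL k h i x y) =
      compL k h i (rightD k c x) (hat y) := by
  have := pairComp_comm h rfl rfl h i c hc.symm x y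
    (hat y) _ (by
      intro Y V hV
      rw [deg_of_pairD_ne_zero hV, hat_apply, show Y.deg * -1 = 0 - Y.deg by ring, eps_sub, eps_zero,
        one_mul])
  rw [outer_unit] at this
  exact this

lemma rightD_self_comp (h : r + 1 = n + m) i x
    y : compL k h i (rightD k i x) y = compL k h i x (leftD k m y) := by
  have := compL_assoc rfl h (Nat.add_comm m 1) h i 0 x (pairD k) y
  aesop

/-- The differential of the operad of pairs. -/
def pairDiff (k : Type u) [CommRing k] (n : ℕ) : PairObj k n →ₗ[k] PairObj k n where
  toFun f := leftD k n f - ∑ i, rightD k i (hat f)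
  map_add' f g := by
    simp only [map_add, Finset.sum_add_distrib]
    abel
  map_smul' a f := by
    grind [map_smul, Finset.smul_sum, RingHom.id_apply, smul_sub]

lemma pairDiff_apply f :
    pairDiff k n f = leftD k n f - ∑ i, rightD k i (hat f) := rfl

lemma sum_antisymm {ι M} [Fintype ι] [AddCommGroup M] (g : ι → ι → M)
    (h0 : ∀ i, g i i = 0) (h1 : ∀ i j, i ≠ j → g i j = - g j i) : ∑ i, ∑ j, g i j = 0 := by
  classical
  rw [← Finset.sum_product']
  refine Finset.sum_involution (fun c _ => (c.2, c.1)) ?_ ?_ ?_ ?_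
  · rintro ⟨i, j⟩ -
    by_cases hij : i = j
    · grind
    grind
  · grind
  · simp
  · simp

lemma pairDiff_pairDiff f : pairDiff k n (pairDiff k n f) = 0 := by
  have e : hat (pairDiff k n f) = - leftD k n (hat f) + ∑ i, rightD k i f := by
    simp_all [pairDiff_apply, hat_leftD, hat_rightD, hat_hat]
  rw [pairDiff_apply _, e, pairDiff_apply]
  simp only [map_sub, map_add, map_sum, leftD_leftD, leftD_rightD, Finset.sum_add_distrib]
  rw [sum_antisymm _ (fun i => rightD_rightD_self i f)
    (fun i j hij => rightD_rightD_of_ne hij.symm f)]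
  simp

lemma pairDiff_comp h i x y :
    pairDiff k r (compL k h i x y) =
      compL k h i (pairDiff k n x) y + compL k h i (hat x) (pairDiff k m y) := by
  rw [pairDiff_apply, pairDiff_apply, pairDiff_apply, hat_comp, sum_labels h i, leftD_comp,
    sum_ne i _]
  simp [rightD_inner_comp, rightD_outer_comp, hat_hat, map_sub, map_add, map_sum,
    LinearMap.sub_apply, LinearMap.add_apply, LinearMap.sum_apply, rightD_self_comp]
  abel

/-- The right action on pairs. -/
def pairAct (k : Type u) [CommRing k] {n : ℕ} (σ : Equiv.Perm (Fin n)) :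
    PairObj k n →ₗ[k] PairObj k n where
  toFun f := fun Z => (Z.koszul σ).negOnePow • f (Z.relabel σ)
  map_add' f g := by
    funext Z
    simp
  map_smul' a f := by
    funext Z
    simp [negOnePow_smul, mul_left_comm]

lemma pairAct_apply σ (f : PairObj k n) Z :
    pairAct k σ f Z = eps k (Z.koszul σ) * f (Z.relabel σ) := negOnePow_smul _ _

lemma compL_act {h : r + 1 = n + m}

    (h1 : ∀ b, ρ (inner h i b) = inner h (σ i) (τ b))
    (h2 : ∀ c hc, ρ (outer h i c hc) = outer h _ _ (fun e => hc (σ.injective e)))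
    x y :
    compL k h i (pairAct k σ x) (pairAct k τ y) = pairAct k ρ (compL k h (σ i) x y) := by
  funext Z
  have e : ∀ (l : ℕ) (σ : Equiv.Perm _) (f : PairObj k l),
      pairAct k σ f = fun Z => eps k _ * f _ :=
    fun l σ f => funext fun Z => pairAct_apply σ f Z
  rw [e, e, e, compL_apply, compL_apply]
  exact pairComp_act h1 h2 x y Z

lemma koszul_one (Z : PatchPair n) : Z.koszul 1 = 0 := by
  refine Finset.sum_eq_zero fun a _ => Finset.sum_eq_zero fun b _ => if_neg ?_
  simp_all [lt_asymm]

lemma pairAct_one (f : PairObj k n) : pairAct k 1 f = f := by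
  grind [pairAct_apply, koszul_one, eps_zero, relabel_one]

lemma koszul_mul σ τ (Z : PatchPair n) :
    Even (Z.koszul (σ * τ) - (Z.koszul τ + (Z.relabel τ).koszul σ)) := by
  have e : (Z.relabel τ).koszul σ = ∑ a, ∑ b,
      if τ a < τ b ∧ σ (τ b) < σ (τ a) then Z.inDeg a * Z.inDeg b else 0 := by
    rw [koszul, ← Equiv.sum_comp τ]
    refine Finset.sum_congr rfl fun a _ => ?_
    rw [← Equiv.sum_comp τ]
    grind [inDeg_relabel]
  -- symmetrize the sum over the pairs
  have e2 : (Z.relabel τ).koszul σ = ∑ a, ∑ b, if a < b then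
      (if τ a < τ b ∧ σ (τ b) < σ (τ a) then Z.inDeg a * Z.inDeg b else 0) +
        (if τ b < τ a ∧ σ (τ a) < σ (τ b) then Z.inDeg b * Z.inDeg a else 0) else 0 := by
    rw [e]
    have key : ∀ f : Fin n → Fin n → ℤ, (∀ a, f a a = 0) → ∑ a, ∑ b, f a b =
        ∑ a, ∑ b, if a < b then f a b + f b a else 0 := by
      intro f hf
      have e3 : ∑ a, ∑ b, f a b = ∑ a, ∑ b, ((if a < b then f a b else 0) +
          if b < a then f a b else 0) := by
        refine Finset.sum_congr rfl fun a _ => Finset.sum_congr rfl fun b _ => ?_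
        grind
      rw [e3]
      simp [Finset.sum_add_distrib]
      rw [Finset.sum_comm (f := fun a b => if b < a then f a b else 0), ← Finset.sum_add_distrib]
      refine Finset.sum_congr rfl fun a _ => ?_
      rw [← Finset.sum_add_distrib]
      refine Finset.sum_congr rfl fun b _ => ?_
      split_ifs <;> simp
    exact key _ fun a => if_neg fun h => lt_irrefl _ h.1
  rw [e2, koszul, koszul, ← Finset.sum_add_distrib, ← Finset.sum_sub_distrib]
  refine Finset.even_sum _ fun a _ => ?_
  rw [← Finset.sum_add_distrib, ← Finset.sum_sub_distrib]
  refine Finset.even_sum _ fun b _ => ?_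
  grind [Equiv.Perm.mul_apply, Equiv.injective]

lemma pairAct_mul σ τ (f : PairObj k n) :
    pairAct k (σ * τ) f = pairAct k τ (pairAct k σ f) := by
  funext Z
  rw [pairAct_apply, pairAct_apply, pairAct_apply, relabel_relabel, ← mul_assoc, ← eps_add,
    eps_congr (koszul_mul σ τ Z)]

lemma hat_pairAct σ (f : PairObj k n) :
    hat (pairAct k σ f) = pairAct k σ (hat f) := by
  grind [hat_apply, pairAct_apply, deg_relabel]

lemma leftD_pairAct σ f :
    leftD k n (pairAct k σ f) = pairAct k σ (leftD k n f) := by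
  have := compL_act (h := Nat.add_comm n 1) (i := 0) (σ := 1) (τ := σ)
    (ρ := σ) (fun b => by grind [inner_zero, Equiv.Perm.one_apply])
    (fun c hc => (hc (Subsingleton.elim _ _)).elim) (pairD k) f
  rw [pairAct_one] at this
  exact this

lemma rightD_pairAct (i : Fin n) σ f :
    rightD k i (pairAct k σ f) = pairAct k σ (rightD k (σ i) f) := by
  have := compL_act (h := rfl) (i := i) (σ := σ) (τ := 1)
    (ρ := σ) (fun b => by simp [inner_unit])
    (fun c hc => by simp [outer_unit]) f (pairD k)
  rw [pairAct_one] at this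
  exact this

lemma pairDiff_pairAct σ f :
    pairDiff k n (pairAct k σ f) = pairAct k σ (pairDiff k n f) := by
  rw [pairDiff_apply, pairDiff_apply, leftD_pairAct, hat_pairAct, map_sub, map_sum]
  simp [rightD_pairAct]
  rw [Equiv.sum_comp σ (fun i => pairAct k σ (rightD k i _))]

end Formal

section Units

variable (k : Type u) [CommRing k] {n : ℕ}

open Classical in
/-- The unit. -/
def pairOne : PairObj k 1 := fun Z => if Z.1.IsId ∧ Z.2.IsId then 1 else 0

variable {k}

lemma pairOne_comp h (f : PairObj k n) :
    pairComp k h 0 (pairOne k) f = f := by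
  classical
  funext Z
  rw [pairComp_apply, Finset.sum_eq_single ((MNSOp.id Z.1.out, NSOp.id Z.2.out), Z)]
  · grind [below_zero, eps_zero, MNSOp.isId_iff, MNSOp.list_id, NSOp.isId_iff, NSOp.list_id, pairOne]
  · rintro ⟨X, Y⟩ hc hne
    rw [mem_decomp] at hc
    by_cases hX : X.1.IsId ∧ X.2.IsId
    swap
    · grind [pairOne]
    rw [MNSOp.isId_iff_eq, NSOp.isId_iff_eq] at hX
    have h1 := hc.matches.color_eq
    have e1 : Z = Y := by
      refine ext_list ?_ ?_
      · rw [hc.list_fst, hX.1, MNSOp.list_id, lc_run_left (by rw [MNSOp.nones_list, h1.1])]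
      · rw [hc.list_snd, hX.2, NSOp.list_id, lc_run_left (by rw [NSOp.nones_list, h1.2])]
    grind
  intro hn
  refine (hn ?_).elim
  rw [mem_decomp]
  refine isComp_of_list ⟨?_, ?_⟩ ?_ ?_
  · rw [MNSOp.list_id, count_run, MNSOp.nones_list]
  · rw [NSOp.list_id, count_run, NSOp.nones_list]
  · rw [MNSOp.list_id, lc_run_left (MNSOp.nones_list _)]
  · rw [NSOp.list_id, lc_run_left (NSOp.nones_list _)]

lemma deg_eq_zero_of_isId {Z : PatchPair 1} (h1 : Z.1.IsId) (h2 : Z.2.IsId) : Z.deg = 0 := by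
  have e1 := Z.1.nones_list
  rw [Z.1.isId_iff_eq.1 h1, MNSOp.list_id, nones_run, ← Z.1.isId_iff_eq.1 h1] at e1
  grind [Fin.sum_univ_one, NSOp.IsId.out_eq, deg, inDeg]

lemma comp_pairOne h (i : Fin n) f :
    pairComp k h i f (pairOne k) = f := by
  classical
  funext Z
  rw [pairComp_apply, Finset.sum_eq_single (Z, (MNSOp.id (Z.1.color i), NSOp.id (Z.2.color i)))]
  · grind [MNSOp.isId_iff, MNSOp.list_id, NSOp.isId_iff, NSOp.list_id, deg_eq_zero_of_isId, eps_zero, pairOne]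
  · rintro ⟨Y, X⟩ hc hne
    rw [mem_decomp] at hc
    by_cases hX : X.1.IsId ∧ X.2.IsId
    swap
    · grind [pairOne]
    rw [MNSOp.isId_iff_eq, NSOp.isId_iff_eq] at hX
    have h1 := hc.matches
    simp [Matches] at h1
    rw [hX.1, hX.2, MNSOp.list_id, NSOp.list_id, nones_run, nones_run, MNSOp.count_list,
      NSOp.count_list] at h1
    have e1 : Z = Y := by
      refine ext_list ?_ ?_
      · rw [hc.list_fst, hX.1, MNSOp.list_id, lc_run_right (by rw [MNSOp.count_list, h1.1])]
      · rw [hc.list_snd, hX.2, NSOp.list_id, lc_run_right (by rw [NSOp.count_list, h1.2])]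
    grind
  intro hn
  refine (hn ?_).elim
  rw [mem_decomp]
  refine isComp_of_list ⟨?_, ?_⟩ ?_ ?_
  · rw [MNSOp.list_id, nones_run, MNSOp.count_list]
  · rw [NSOp.list_id, nones_run, NSOp.count_list]
  · rw [MNSOp.list_id, lc_run_right (MNSOp.count_list _ _)]
  grind [NSOp.list_id, lc_run_right, NSOp.count_list]

end Units

section

open PatchPair

variable {k : Type u} [CommRing k] {n m r : ℕ}

lemma length_eq_sum_count (l : List (Option (Fin n))) :
    l.length = nones l + ∑ a, l.count (some a) := by
  induction l with
  | nil => simp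
  | cons s l ih =>
    cases s with
    | none =>
      grind [nones_none]
    | some b =>
      rw [List.length_cons, ih, nones_some]
      simp [List.count_cons, Finset.sum_add_distrib]
      simp [add_assoc]

lemma MNSOp.length_list_eq (X : MNSOp n) : X.list.length = X.out + ∑ a, (X.color a + 1) := by
  rw [length_eq_sum_count, X.nones_list]
  simp [X.count_list]

lemma NSOp.length_list_eq (X : NSOp n) : X.list.length = X.out + ∑ a, (X.color a + 1) := by
  grind [length_eq_sum_count, NSOp.nones_list, NSOp.count_list]

/-- There are finitely many pairs of given colours. -/
lemma finite_colors q p q' p' : {Z : PatchPair n | Z.1.color = q ∧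
    Z.2.color = p ∧ Z.1.out = q' ∧ Z.2.out = p'}.Finite := by
  have hf : Function.Injective fun Z : PatchPair n => (Z.1.list, Z.2.list) := by
    intro Z Z' e
    grind [ext_list]
  refine Set.Finite.of_finite_image ?_ hf.injOn
  refine Set.Finite.subset ((List.finite_length_le _ (q' + ∑ a, (q a + 1))).prod
    (List.finite_length_le _ (p' + ∑ a, (p a + 1)))) ?_
  rintro _ ⟨Z, ⟨rfl, rfl, rfl, rfl⟩, rfl⟩
  exact ⟨Z.1.length_list_eq.le, Z.2.length_list_eq.le⟩

lemma mem_patchFamilies {f : PairObj k n} :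
    f ∈ patchFamilies k n ↔ ∀ Z, f Z ≠ 0 → Z.IsPatch :=
  ⟨fun h => h.1, fun h => ⟨h, fun q p q' p' => (finite_colors q p q' p').subset fun _ hZ => hZ.2⟩⟩

/-- The submodule `Patch_s(n)` of the families of coefficients. -/
def patchSub (k : Type u) [CommRing k] (n : ℕ) : Submodule k (PairObj k n) := PatchS k n

lemma patchS_le : PatchS k n ≤ patchFamilies k n := iSup_le fun _ => inf_le_left

lemma patchS_inf_gr e :
    PatchS k n ⊓ (PairOp k).gr n e = patchFamilies k n ⊓ (PairOp k).gr n e :=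
  le_antisymm (inf_le_inf_right _ patchS_le)
    (le_inf (le_iSup (fun e => patchFamilies k n ⊓ (PairOp k).gr n e) e) inf_le_right)

lemma mem_patchS_of (h1 : ∀ Z, f Z ≠ 0 → Z.IsPatch)
    (h2 : ∀ Z, f Z ≠ 0 → Z.deg = e) : f ∈ patchSub k n :=
  (le_iSup (fun e => patchFamilies k n ⊓ (PairOp k).gr n e) e) ⟨mem_patchFamilies.2 h1, h2⟩

lemma patchS_induction {P : PairObj k n → Prop} (hf : f ∈ patchSub k n)
    (zero : P 0) (add : ∀ f g, P f → P g → P (f + g))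
    (homogeneous : ∀ e f, (∀ Z, f Z ≠ 0 → Z.IsPatch) → (∀ Z, f Z ≠ 0 → Z.deg = e) → P f) : P f :=
  Submodule.iSup_induction _ (motive := P) hf
    (fun e f hf => homogeneous e f (mem_patchFamilies.1 hf.1) hf.2) zero add

/-- Homogeneous submodules of different degrees are independent. -/
lemma iSupIndep_of_support {M ι : Type*} [AddCommGroup M] [Module k M] (ev : ι → M →ₗ[k] k)
    (hev : ∀ x, (∀ i, ev i x = 0) → x = 0) (deg : ι → ℤ) (G : ℤ → Submodule k M)
    (hG : ∀ e, ∀ x ∈ G e, ∀ i, ev i x ≠ 0 → deg i = e) : iSupIndep G := by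
  intro e
  rw [Submodule.disjoint_def]
  intro x hx hx'
  let N := ⨅ i : {i // deg i = e}, LinearMap.ker (ev i)
  have hN : ⨆ j, ⨆ (_ : j ≠ e), G j ≤ N := by
    refine iSup_le fun j => iSup_le fun hj y hy => ?_
    rw [Submodule.mem_iInf]
    rintro ⟨i, hi⟩
    by_contra hne
    exact hj ((hG j y hy i hne).symm.trans hi)
  refine hev x fun i => ?_
  by_contra hne
  have h1 := hN hx'
  rw [Submodule.mem_iInf] at h1
  exact hne (h1 ⟨i, hG e x hx i hne⟩)

lemma comp_homogeneous {h : r + 1 = n + m}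
    (hf : ∀ Z, f Z ≠ 0 → Z.deg = e) (hg : ∀ Z, g Z ≠ 0 → Z.deg = e') :
    ∀ Z, pairComp k h i f g Z ≠ 0 → Z.deg = e + e' := by
  intro Z hZ
  obtain ⟨X, Y, hc, hX, hY⟩ := exists_of_pairComp_ne_zero hZ
  rw [hc.deg_eq, hf X hX, hg Y hY]

lemma comp_isPatch {h : r + 1 = n + m}
    (hf : ∀ Z, f Z ≠ 0 → Z.IsPatch) (hg : ∀ Z, g Z ≠ 0 → Z.IsPatch) :
    ∀ Z, pairComp k h i f g Z ≠ 0 → Z.IsPatch := by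
  intro Z hZ
  obtain ⟨X, Y, hc, hX, hY⟩ := exists_of_pairComp_ne_zero hZ
  exact (hf X hX).comp (hg Y hY) hc

lemma comp_mem_patchS h i
    (hf : f ∈ patchSub k n) (hg : g ∈ patchSub k m) : compL k h i f g ∈ patchSub k r := by
  refine patchS_induction (P := fun f => compL k h i f g ∈ patchSub k r) hf ?_ ?_ ?_
  · simp_all
  · simp_all [Submodule.add_mem]
  · intro e f h1 h2
    refine patchS_induction (P := fun g => compL k h i f g ∈ patchSub k r) hg ?_ ?_ fun e' g h3 h4 => mem_patchS_of (comp_isPatch h1 h3) (comp_homogeneous h2 h4)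
    · rw [map_zero]
      exact Submodule.zero_mem _
    · intro g g' h3 h4
      grind [Submodule.add_mem]

lemma isPatch_one (Z : PatchPair 1) : Z.IsPatch := by
  rw [isPatch_iff]
  exact ⟨fun a b h => (h.1 (Subsingleton.elim _ _)).elim,
    fun a b h => (h.1 (Subsingleton.elim _ _)).elim⟩

lemma pairD_mem : pairD k ∈ patchSub k 1 :=
  mem_patchS_of (fun Z _ => isPatch_one Z) (fun _ h => deg_of_pairD_ne_zero h)

lemma pairOne_homogeneous Z (hZ : pairOne k Z ≠ 0) : Z.deg = 0 := by
  have : Z.1.IsId ∧ Z.2.IsId := by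
    by_contra hn
    exact hZ (if_neg hn)
  grind [deg_eq_zero_of_isId]

lemma hat_apply_ne_zero {f : PairObj k n} (h : hat f Z ≠ 0) : f Z ≠ 0 := by
  grind [hat_apply]

lemma hat_mem (hf : f ∈ patchSub k n) : hat f ∈ patchSub k n := by
  refine patchS_induction (P := fun f => hat f ∈ patchSub k n) hf ?_ ?_ fun e f h1 h2 => mem_patchS_of (fun Z hZ => h1 Z (hat_apply_ne_zero hZ))
      (fun Z hZ => h2 Z (hat_apply_ne_zero hZ))
  · aesop
  · grind [Submodule.add_mem]

lemma pairAct_homogeneous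
    (hf : ∀ Z, f Z ≠ 0 → Z.deg = e) (Z : PatchPair n) (hZ : pairAct k σ f Z ≠ 0) : Z.deg = e := by
  grind [pairAct_apply, deg_relabel]

lemma pairAct_mem σ (hf : f ∈ patchSub k n) :
    pairAct k σ f ∈ patchSub k n := by
  refine patchS_induction (P := fun f => pairAct k σ f ∈ patchSub k n) hf ?_ ?_ ?_
  · aesop
  · grind [Submodule.add_mem]
  intro e f h1 h2
  refine mem_patchS_of (fun Z hZ => ?_) (pairAct_homogeneous h2)
  grind [pairAct_apply, isPatch_relabel]

lemma pairDiff_mem (hf : f ∈ patchSub k n) : pairDiff k n f ∈ patchSub k n := by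
  exact Submodule.sub_mem _ (comp_mem_patchS _ _ pairD_mem hf)
    (Submodule.sum_mem _ fun i _ => comp_mem_patchS _ _ (hat_mem hf) pairD_mem)

/-- The pairs of a given degree. -/
def grSub (k : Type u) [CommRing k] (n : ℕ) (e : ℤ) : Submodule k (PairObj k n) := (PairOp k).gr n e

lemma pairDiff_homogeneous (hf : ∀ Z, f Z ≠ 0 → Z.deg = e) :
    pairDiff k n f ∈ grSub k n (e - 1) := by
  refine Submodule.sub_mem _ ?_ (Submodule.sum_mem _ fun i _ => fun Z hZ => comp_homogeneous (fun Z hZ => hf Z (hat_apply_ne_zero hZ))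
      (fun _ h => deg_of_pairD_ne_zero h) Z hZ)
  · intro Z hZ
    rw [comp_homogeneous (fun _ h => deg_of_pairD_ne_zero h) hf Z hZ]
    ring

lemma hat_eq_smul {f : PairObj k n} (hf : ∀ Z, f Z ≠ 0 → Z.deg = e) :
    hat f = eps k e • f := by
  funext Z
  rw [hat_apply, Pi.smul_apply, smul_eq_mul]
  by_cases hZ : f Z = 0
  · grind
  · rw [hf Z hZ]

lemma units_smul_eq e (f : PairObj k n) : e.negOnePow • f = eps k e • f := by
  exact negOnePow_smul _ _

lemma compL_comm (h₁ : r + 1 = n + m) (h₂ : t + 1 = r + l) (h₃ : s + 1 = n + l)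
    h₄ i j hij x
    (hy : ∀ Z, y Z ≠ 0 → Z.deg = e) {z} (hz : ∀ Z, z Z ≠ 0 → Z.deg = f) :
    compL k h₂ (outer h₁ i j hij.symm) (compL k h₁ i x y) z =
      (e * f).negOnePow • compL k h₄ (outer h₃ j i hij) (compL k h₃ j x z) y := by
  rw [units_smul_eq, ← map_smul]
  refine pairComp_comm h₁ h₂ h₃ h₄ i j hij x y _ z fun Y V hV => ?_
  rw [Pi.smul_apply, smul_eq_mul]
  by_cases hY : y Y = 0
  · grind
  grind

lemma pairDiff_comp_homogeneous h i
    (hx : ∀ Z, x Z ≠ 0 → Z.deg = e) y : pairDiff k r (compL k h i x y) =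
      compL k h i (pairDiff k n x) y + e.negOnePow • compL k h i x (pairDiff k m y) := by
  rw [pairDiff_comp, hat_eq_smul hx, units_smul_eq, map_smul, LinearMap.smul_apply]

lemma map_smul_add {M N} [AddCommGroup M] [Module k M] [AddCommGroup N] [Module k N]
    (F : M →ₗ[k] N) (a : k) x y : F (a • x + y) = a • F x + F y := by
  rw [map_add, map_smul]

/-- The patchworks form a dg operad. -/
lemma isDGOperad_patchS : IsDGOperad (PairOp k) (PatchS k) where
  iSup_gr n := by
    simp only [patchS_inf_gr]
    rfl
  indep_gr n := by
    refine iSupIndep_of_support (k := k) (M := PairObj k n) (fun Z => LinearMap.proj Z)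
      (fun x hx => funext hx) PatchPair.deg _ ?_
    intro e x hx Z hZ
    exact hx.2 Z hZ
  one_mem := mem_patchS_of (fun Z _ => isPatch_one Z) pairOne_homogeneous
  one_gr := pairOne_homogeneous
  comp_mem h i x hx y hy := comp_mem_patchS h i hx hy
  comp_gr h i e f x hx y hy := comp_homogeneous hx.2 hy.2
  comp_linear_left h i a x _ x' _ y _ := map_smul_add ((compL k h i).flip y) a x x'
  comp_linear_right h i a x _ y _ y' _ := map_smul_add (compL k h i x) a y y'
  one_comp h x _ := pairOne_comp h x
  comp_one h i x _ := comp_pairOne h i x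
  assoc_seq h₁ h₂ h₃ h₄ i j x _ y _ z _ := compL_assoc h₁ h₂ h₃ h₄ i j x y z
  assoc_par h₁ h₂ h₃ h₄ i j hij e f x _ y hy z hz :=
    compL_comm h₁ h₂ h₃ h₄ i j hij x hy.2 hz.2
  act_mem σ x hx := pairAct_mem σ hx
  act_gr σ e x hx := pairAct_homogeneous (σ := σ) hx.2
  act_linear σ a x _ x' _ := map_smul_add (pairAct k σ) a x x'
  act_one x _ := pairAct_one x
  act_mul σ τ x _ := pairAct_mul σ τ x
  comp_act h i σ τ ρ h1 h2 x _ y _ := compL_act h1 h2 x y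
  d_mem x hx := pairDiff_mem hx
  d_gr e x hx := pairDiff_homogeneous hx.2
  d_linear a x _ x' _ := map_smul_add (pairDiff k _) a x x'
  d_d x _ := pairDiff_pairDiff x
  d_act σ x _ := pairDiff_pairAct σ x
  d_comp h i e x hx y _ := pairDiff_comp_homogeneous h i hx.2 y

end

section Dst

variable {α β : Type}

open Classical in
/-- Deletion of immediate repetitions. -/
def dst : List α → List α
  | [] => []
  | [a] => [a]
  | a :: b :: l => if a = b then dst (b :: l) else a :: dst (b :: l)

lemma dst_self (a : α) l : dst (a :: a :: l) = dst (a :: l) := by simp [dst]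

lemma dst_of_ne {b : α} (hab : a ≠ b) l : dst (a :: b :: l) = a :: dst (b :: l) := by
  simp [dst, hab]

lemma destutter_eq_dst [DecidableEq α] (l : List α) : l.destutter (· ≠ ·) = dst l := by
  rcases l with _ | ⟨a, l⟩
  · rfl
  rw [List.destutter_cons']
  induction l generalizing a with
  | nil => rfl
  | cons b l ih =>
    grind [List.destutter'_cons, dst_self, dst_of_ne]

lemma exists_dst_cons (a : α) l : ∃ m, dst (a :: l) = a :: m := by
  induction l generalizing a with
  | nil => exact ⟨[], rfl⟩
  | cons b l ih =>
    by_cases hab : a = b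
    · simp_all [dst_self]
    simp_all [dst_of_ne]

lemma dst_cons_dst (a : α) l : dst (a :: dst l) = dst (a :: l) := by
  induction l generalizing a with
  | nil => rfl
  | cons b l ih =>
    have hb : dst (dst (b :: l)) = dst (b :: l) := by
      rcases l with _ | ⟨c, l⟩
      · rfl
      · by_cases hbc : b = c
        · obtain ⟨m, hm⟩ := exists_dst_cons b l
          grind [dst_self]
        grind [dst_of_ne]
    obtain ⟨m, hm⟩ := exists_dst_cons b l
    by_cases hab : a = b
    · grind [dst_self]
    grind [dst_of_ne]

lemma dst_filter p (l : List α) : dst ((dst l).filter p) = dst (l.filter p) := by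
  induction l with
  | nil => rfl
  | cons a l ih =>
    rcases l with _ | ⟨b, l⟩
    · rfl
    by_cases hab : a = b
    · grind [dst_self]
    · rw [dst_of_ne hab]
      by_cases hp : p a
      · rw [List.filter_cons_of_pos hp, List.filter_cons_of_pos hp, ← dst_cons_dst, ih, dst_cons_dst]
      grind

lemma dst_map (f : α → β) l : dst ((dst l).map f) = dst (l.map f) := by
  induction l with
  | nil => rfl
  | cons a l ih =>
    rcases l with _ | ⟨b, l⟩
    · rfl
    by_cases hab : a = b
    · grind [dst_self]
    grind [dst_of_ne, dst_cons_dst]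

lemma dst_map_of_injective {f : α → β} (hf : Function.Injective f) l :
    dst (l.map f) = (dst l).map f := by
  induction l with
  | nil => rfl
  | cons a l ih =>
    rcases l with _ | ⟨b, l⟩
    · rfl
    by_cases hab : a = b
    · grind [dst_self]
    grind [dst_of_ne]

lemma isChain_dst (l : List α) : (dst l).IsChain (· ≠ ·) := by
  induction l with
  | nil => exact List.IsChain.nil
  | cons a l ih =>
    rcases l with _ | ⟨b, l⟩
    · exact List.IsChain.singleton _
    by_cases hab : a = b
    · grind [dst_self]
    · rw [dst_of_ne hab]
      obtain ⟨m, hm⟩ := exists_dst_cons b l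
      grind

lemma dst_of_isChain {l : List α} (hl : l.IsChain (· ≠ ·)) : dst l = l := by
  induction l with
  | nil => rfl
  | cons a l ih =>
    rcases l with _ | ⟨b, l⟩
    · rfl
    grind [dst_of_ne]

lemma dst_sublist (l : List α) : (dst l).Sublist l := by
  classical
  rw [← destutter_eq_dst]
  exact List.destutter_sublist _ _

lemma sublist_dst {c : List α} (hc : c.IsChain (· ≠ ·)) (hl : c.Sublist l) :
    c.Sublist (dst l) := by
  induction l generalizing c with
  | nil => exact hl
  | cons a l ih =>
    rcases l with _ | ⟨b, l⟩
    · exact hl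
    by_cases hab : a = b
    · grind [dst_self]
    · rw [dst_of_ne hab]
      rw [List.sublist_cons_iff] at hl
      rcases hl with hl | ⟨c', rfl, hl⟩
      · exact (ih hc hl).cons _
      · exact (ih hc.tail hl).cons_cons _

lemma mem_dst {a : α} : a ∈ dst l ↔ a ∈ l :=
  ⟨fun h => (dst_sublist l).subset h, fun h => List.singleton_sublist.1
    (sublist_dst (List.IsChain.singleton a) (List.singleton_sublist.2 h))⟩

lemma isChain_iff_infix {l : List α} : l.IsChain (· ≠ ·) ↔ ∀ u, ¬ [u, u] <:+: l := by
  constructor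
  · intro h u hu
    have := h.infix hu
    simp at this
  intro h
  induction l with
  | nil => exact List.IsChain.nil
  | cons a l ih =>
    have ih' := ih (fun u hu => h u (hu.trans (List.suffix_cons a l).isInfix))
    rcases l with _ | ⟨b, l⟩
    · grind
    · refine ih'.cons_cons ?_
      rintro rfl
      exact h a ⟨[], l, rfl⟩

end Dst

section Full

variable {α : Type}

/-- Every free input lies between two occurrences of the same letter. -/
inductive FullL : List (Option α) → Prop
  | nil : FullL []
  | letter (a : α) (l : List (Option α)) : FullL l → FullL (some a :: l)
  | gap (a : α) (l : List (Option α)) : FullL (some a :: l) → FullL (some a :: none :: some a :: l)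

/-- The traversal with given runs. -/
def unrun (σ : List (α × ℕ)) : List (Option α) := σ.flatMap fun p => run p.1 p.2

lemma unrun_nil : unrun ([] : List (α × ℕ)) = [] := rfl

lemma unrun_cons (a : α) s σ : unrun ((a, s) :: σ) = run a s ++ unrun σ := by
  simp [unrun]

lemma unrun_append (σ τ : List (α × ℕ)) : unrun (σ ++ τ) = unrun σ ++ unrun τ := by simp [unrun]

lemma run_zero' (a : α) l : run a 0 ++ l = some a :: l := by simp [run_zero]

lemma fullL_run (a : α) s (hl : FullL l) : FullL (run a s ++ l) := by
  induction s with
  | zero => exact FullL.letter _ _ hl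
  | succ s ih =>
    obtain ⟨w, hw⟩ := run_eq_cons a s
    exact FullL.gap _ _ ih

lemma fullL_iff {l : List (Option α)} : FullL l ↔ ∃ σ, l = unrun σ := by
  constructor
  · intro h
    induction h with
    | nil => exact ⟨[], rfl⟩
    | letter a l _ ih =>
      obtain ⟨σ, rfl⟩ := ih
      exact ⟨(a, 0) :: σ, by aesop⟩
    | gap a l _ ih =>
      obtain ⟨σ, hσ⟩ := ih
      rcases σ with _ | ⟨⟨b, s⟩, σ⟩
      · simp [unrun] at hσ
      · have hb : a = b := by
          obtain ⟨w, hw⟩ := run_eq_cons b s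
          grind [unrun_cons]
        exact ⟨(a, s + 1) :: σ, by grind [unrun_cons, run_succ]⟩
  rintro ⟨σ, rfl⟩
  induction σ with
  | nil => exact FullL.nil
  | cons p σ ih =>
    grind [unrun_cons, fullL_run]

/-- The word of a traversal. -/
def wd (l : List (Option α)) : List α := dst l.reduceOption

lemma wd_letter_none (a : α) l :
    wd (some a :: none :: some a :: l) = wd (some a :: l) := by
  simp [wd, dst_self]

lemma wd_unrun (σ : List (α × ℕ)) : wd (unrun σ) = dst (σ.map Prod.fst) := by
  induction σ with
  | nil => rfl
  | cons p σ ih =>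
    obtain ⟨a, s⟩ := p
    rw [unrun_cons]
    induction s with
    | zero =>
      rw [wd] at ih
      rw [run_zero', wd, List.reduceOption_cons_of_some, ← dst_cons_dst, ih, dst_cons_dst,
        List.map_cons]
    | succ s ih' =>
      rw [run_succ]
      obtain ⟨w, hw⟩ := run_eq_cons a s
      grind [wd_letter_none]

lemma isChain_of_unrun {σ : List (α × ℕ)} (h : ∀ a, ¬ [some a, some a] <:+: unrun σ) :
    (σ.map Prod.fst).IsChain (· ≠ ·) := by
  induction σ with
  | nil => exact List.IsChain.nil
  | cons p σ ih =>
    obtain ⟨a, s⟩ := p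
    have ih' := ih (fun u hu => h u (hu.trans (List.suffix_append _ _).isInfix))
    rcases σ with _ | ⟨⟨b, t⟩, σ⟩
    · grind
    refine ih'.cons_cons ?_
    rintro rfl
    obtain ⟨u, hu⟩ : ∃ u, run a s = u ++ [some a] := by
      induction s with
      | zero => simp_all [run_zero]
      | succ s _ =>
        refine ⟨run a s ++ [none], ?_⟩
        simp [run, List.replicate_succ']
    obtain ⟨w, hw⟩ := run_eq_cons a t
    refine h a ⟨u, w ++ unrun σ, ?_⟩
    grind [unrun_cons]

lemma wd_unrun_of_isTrav {σ : List (α × ℕ)} (h : IsTrav (unrun σ)) :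
    wd (unrun σ) = σ.map Prod.fst := by
  rw [wd_unrun, dst_of_isChain (isChain_of_unrun h.no_rep)]

lemma length_unrun (σ : List (α × ℕ)) :
    (unrun σ).length = σ.length + 2 * nones (unrun σ) := by
  induction σ with
  | nil => rfl
  | cons p σ ih =>
    have : (run p.1 p.2).length = 1 + 2 * p.2 := by simp [run]; ring
    grind [unrun_cons, nones_append, nones_run]

lemma FullL.length_wd {l : List (Option α)} (hl : FullL l) (ht : IsTrav l) :
    l.length = (wd l).length + 2 * nones l := by
  grind [fullL_iff, wd_unrun_of_isTrav, length_unrun]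

lemma sublist_wd {c : List α} (hc : c.IsChain (· ≠ ·))
    (h : (c.map some).Sublist l) : c.Sublist (wd l) := by
  refine sublist_dst hc ?_
  have := h.filterMap id
  simp_all [List.reduceOption]

lemma map_reduceOption_sublist (l : List (Option α)) : (l.reduceOption.map some).Sublist l := by
  induction l with
  | nil => aesop
  | cons s l ih =>
    rcases s with _ | a
    · exact ih.cons _
    · exact ih.cons_cons _

lemma map_sublist_of_wd {c : List α} (h : c.Sublist (wd l)) :
    (c.map some).Sublist l :=
  ((h.trans (dst_sublist _)).map some).trans (map_reduceOption_sublist l)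

lemma mem_wd {a : α} : a ∈ wd l ↔ some a ∈ l := by
  rw [wd, mem_dst, List.reduceOption_mem_iff]

/-- The words of traversals are words of `F₂S` and vice versa. -/
lemma isTrav_of_wd {l : List (Option (Fin n))} (h : IsFSWord (wd l))
    (hr : ∀ a, ¬ [some a, some a] <:+: l) : IsTrav l := by
  refine ⟨hr, fun u v huv hs => h.2.2 u v huv (sublist_wd ?_ hs)⟩
  simp [huv, huv.symm]

lemma unrun_no_rep (h : (σ.map Prod.fst).IsChain (· ≠ ·)) (a : α) :
    ¬ [some a, some a] <:+: unrun σ := by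
  have key : (unrun σ).IsChain (fun x y => ¬ (x = some a ∧ y = some a)) := by
    induction σ with
    | nil => exact List.IsChain.nil
    | cons p σ ih =>
      obtain ⟨b, s⟩ := p
      rw [unrun_cons]
      induction s with
      | zero =>
        rw [run_zero']
        rcases σ with _ | ⟨⟨c, t⟩, σ⟩
        · exact List.IsChain.singleton _
        obtain ⟨w, hw⟩ := run_eq_cons c t
        grind [unrun_cons]
      | succ s ih2 =>
        rw [run_succ]
        obtain ⟨w, hw⟩ := run_eq_cons b s
        grind
  intro hu
  have := key.infix hu
  simp at this

lemma isTrav_unrun {σ : List (Fin n × ℕ)} (h : IsFSWord (σ.map Prod.fst)) :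
    IsTrav (unrun σ) := by
  have hc := isChain_iff_infix.2 h.2.1
  grind [isTrav_of_wd, unrun_no_rep, wd_unrun, dst_of_isChain]

lemma isFSWord_wd {l : List (Option (Fin n))} (h : IsTrav l) (hm : ∀ a, some a ∈ l) :
    IsFSWord (wd l) :=
  ⟨fun a => mem_wd.2 (hm a), isChain_iff_infix.1 (isChain_dst _),
    fun u v huv hs => h.no_cross u v huv (map_sublist_of_wd hs)⟩

lemma FullL.append {m : List (Option α)} (hl : FullL l) (hm : FullL m) : FullL (l ++ m) := by
  obtain ⟨σ, rfl⟩ := fullL_iff.1 hl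
  obtain ⟨τ, rfl⟩ := fullL_iff.1 hm
  exact fullL_iff.2 ⟨σ ++ τ, (unrun_append σ τ).symm⟩

lemma FullL.eq_of_split {u : List (Option α)} (h : FullL (u ++ none :: v)) :
    ∃ a u' v', u = u' ++ [some a] ∧ v = some a :: v' := by
  generalize hl : u ++ none :: v = l at h
  induction h generalizing u with
  | nil => simp at hl
  | letter a l _ ih =>
    rcases u with _ | ⟨s, u⟩
    · simp at hl
    · grind
  | gap a l _ ih =>
    rcases u with _ | ⟨s, u⟩
    · simp at hl
    · simp at hl
      rcases u with _ | ⟨s', u⟩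
      · simp_all
      · grind

end Full

namespace Term

variable {α : Type}

lemma exists_unrun (t : Term α) (h0 : t ≠ leaf) (ht : t.MulFull) :
    ∃ σ, t.enc = unrun σ ∧ σ.map Prod.fst = t.word := by
  induction t with
  | leaf => exact (h0 rfl).elim
  | node a q c ih =>
    have key : ∀ L : List _, (∀ u ∈ L, u ∈ List.ofFn c) → ∀ (σ : List _) (s : ℕ),
        ∃ τ, unrun (σ ++ [(a, s)]) ++ (L.map fun u => u.enc ++ [some a]).flatten = unrun τ ∧
          τ.map Prod.fst = σ.map Prod.fst ++ a :: (L.map fun u => open Classical in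
            if u = leaf then [] else u.word ++ [a]).flatten := by
      intro L
      induction L with
      | nil => aesop
      | cons u L ihL =>
        intro hL σ s
        have ihL' := ihL (fun v hv => hL v (List.mem_cons_of_mem _ hv))
        by_cases hu : u = leaf
        · obtain ⟨τ, h1, h2⟩ := ihL' σ (s + 1)
          refine ⟨τ, ?_, by rw [h2]; simp [hu]⟩
          simp_all [List.replicate_succ', unrun, run, enc]
        obtain ⟨j, rfl⟩ := (List.mem_ofFn).1 (hL u (by simp))
        obtain ⟨ρ, h1, h2⟩ := ih j hu (ht j)
        obtain ⟨τ, h3, h4⟩ := ihL' (σ ++ (a, s) :: ρ) 0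
        refine ⟨τ, ?_, by grind⟩
        grind [run_zero, unrun]
    obtain ⟨τ, h1, h2⟩ := key _ (fun u hu => hu) [] 0
    grind [enc_node, run_zero, Function.comp_def, unrun, word]
  | mul l r ih1 ih2 =>
    obtain ⟨σ, h1, h2⟩ := ih1 ht.1 ht.2.2.1
    obtain ⟨τ, h3, h4⟩ := ih2 ht.2.1 ht.2.2.2
    exact ⟨σ ++ τ, by rw [unrun_append, ← h1, ← h3]; rfl, by aesop⟩

end Term

namespace Term

variable {α : Type}

lemma enc_concat (a : α) q c :
    ∃ u v, (node a q c).enc = u ++ [some a] ∧ (node a q c).enc = some a :: v := by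
  obtain ⟨u, hu⟩ := exists_concat (some a) (List.ofFn fun j => (c j).enc)
  grind [enc_node]

lemma Linear.mulFull {t : Term α} (ht : t.Linear) P Q
    (hf : FullL (P ++ t.enc ++ Q)) (hP : ∀ a u, P = u ++ [some a] → some a ∉ t.enc)
    (hQ : ∀ a v, Q = some a :: v → some a ∉ t.enc) : t.MulFull := by
  induction t generalizing P Q with
  | leaf => trivial
  | node a q c ih =>
    intro j
    obtain ⟨_, _, h, -, -, -, -, ⟨u, rfl⟩, v, rfl⟩ := enc_node_split (a := a) c j
    refine ih j (ht.child j) (P ++ u ++ [some a]) (some a :: v ++ Q) ?_ ?_ ?_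
    · grind
    · intro b w hw
      have := List.append_inj_right' hw rfl
      simp at this
      rw [← this]
      exact ht.notMem_child j
    · intro b w hw
      simp at hw
      rw [← hw.1]
      exact ht.notMem_child j
  | mul l r ih1 ih2 =>
    have e : P ++ (mul l r).enc ++ Q = P ++ l.enc ++ (r.enc ++ Q) := by simp [enc]
    rw [e] at hf
    have hl : ∀ {a}, some a ∈ l.enc → some a ∈ (mul l r).enc := fun h => List.mem_append_left _ h
    have hr : ∀ {a}, some a ∈ r.enc → some a ∈ (mul l r).enc := fun h => List.mem_append_right _ h
    refine ⟨?_, ?_, ih1 ht.left_of_mul P _ hf (fun a u hu ha => hP a u hu (hl ha)) ?_,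
      ih2 ht.right_of_mul (P ++ l.enc) Q (by simpa using hf) ?_
        (fun a u hu ha => hQ a u hu (hr ha))⟩
    · rintro rfl
      obtain ⟨a, u', v', h1, h2⟩ := FullL.eq_of_split (by simpa [enc] using hf)
      obtain ⟨s, w, hw⟩ := List.exists_cons_of_ne_nil (enc_ne_nil r)
      grind
    · rintro rfl
      obtain ⟨a, u', v', h1, h2⟩ := FullL.eq_of_split (u := P ++ l.enc)
        (by simpa [enc] using hf)
      rcases List.eq_nil_or_concat _ with h | ⟨w, s, hw⟩
      · exact enc_ne_nil l h
      grind [List.append_inj_right']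
    · obtain ⟨s, w, hw⟩ := List.exists_cons_of_ne_nil (enc_ne_nil r)
      grind [Term.Linear.disjoint_of_mul]
    intro a u hu ha
    rcases List.eq_nil_or_concat l.enc with h | ⟨w, s, hw⟩
    · exact enc_ne_nil l h
    grind [List.append_inj_right', Term.Linear.disjoint_of_mul]

lemma NoMul.mulFull {t : Term α} (ht : t.NoMul) : t.MulFull := by
  induction t with
  | leaf => trivial
  | node a q c ih => exact fun j => ih j (ht j)
  | mul l r _ _ => exact ht.elim

end Term

lemma isWordColoring_iff (W : Word n) X :
    IsWordColoring W X ↔ FullL X.list ∧ wd X.list = W.1 := by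
  obtain ⟨⟨t, ht⟩, rfl⟩ := Quotient.exists_rep X
  change t.MulFull ∧ t.word = W.1 ↔ FullL t.enc ∧ wd t.enc = W.1
  constructor
  · rintro ⟨h1, h2⟩
    obtain ⟨σ, h3, h4⟩ := t.exists_unrun ht.1 h1
    rw [h3, fullL_iff, wd_unrun, h4, h2]
    exact ⟨⟨σ, rfl⟩, dst_of_isChain (isChain_iff_infix.2 W.2.2.1)⟩
  rintro ⟨h1, h2⟩
  have h0 := ht.linear.mulFull [] [] (by simpa using h1) (by simp) (by simp)
  obtain ⟨σ, h3, h4⟩ := t.exists_unrun ht.1 h0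
  grind [Term.Valid.isTrav, wd_unrun_of_isTrav]

lemma NSOp.fullL (J : NSOp n) : FullL J.list := by
  obtain ⟨σ, h, -⟩ := J.1.exists_unrun J.2.1.1 J.2.2.mulFull
  exact fullL_iff.2 ⟨σ, h⟩

/-- The root is visited first and last. -/
lemma NSOp.exists_root_list (J : NSOp n) :
    ∃ r u v, J.list = u ++ [some r] ∧ J.list = some r :: v := by
  obtain ⟨t, ht, hm⟩ := J
  cases t with
  | leaf => exact (ht.1 rfl).elim
  | node a q c =>
    obtain ⟨u, v, h⟩ := Term.enc_concat a q c
    exact ⟨a, u, v, h⟩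
  | mul l r => exact hm.elim

section Contract

variable {n m r : ℕ} (h : r + 1 = n + m) (i : Fin n)

/-- The traversal begins with an inserted letter. -/
def StartsIn (z : List (Option (Fin r))) : Prop := ∃ b z', z = some (inner h i b) :: z'

open Classical in
/-- Every block of inserted letters is replaced by `i`. -/
def con : List (Option (Fin r)) → List (Option (Fin n))
  | [] => []
  | none :: z => none :: con z
  | some v :: z => if contract h i v = i ∧ StartsIn h i z then con z
      else some (contract h i v) :: con z

open Classical in
/-- The blocks of inserted letters, separated by free inputs. -/
def ex : List (Option (Fin r)) → List (Option (Fin m))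
  | [] => []
  | none :: z => ex z
  | some v :: z => if hv : contract h i v = i then
      some (eq_inner_of_contract h i hv).choose ::
        if StartsIn h i z ∨ ex z = [] then ex z else none :: ex z
      else ex z

variable {h i}

lemma con_outer hc z :
    con h i (some (outer h i c hc) :: z) = some c :: con h i z := by
  simp [con, contract_outer, hc]

lemma con_inner_of_startsIn b (hz : StartsIn h i z) :
    con h i (some (inner h i b) :: z) = con h i z := by
  simp [con, contract_inner, hz]

lemma con_inner b (hz : ¬ StartsIn h i z) :
    con h i (some (inner h i b) :: z) = some i :: con h i z := by
  simp [con, contract_inner, hz]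

lemma ex_outer hc z :
    ex h i (some (outer h i c hc) :: z) = ex h i z := by
  simp [ex, contract_outer, hc]

lemma ex_inner_aux b z :
    ∃ w, ex h i (some (inner h i b) :: z) = some b :: w := by
  have hv := contract_inner h i b
  have := inner_injective h i (eq_inner_of_contract h i hv).choose_spec
  have e : ∀ c, b = c → ∀ w, some c :: w = some b :: w := by
    rintro c rfl w
    rfl
  rw [ex, dif_pos hv]
  exact ⟨_, e _ this _⟩

lemma ex_inner_of_startsIn b (hz : StartsIn h i z) :
    ex h i (some (inner h i b) :: z) = some b :: ex h i z := by
  obtain ⟨w, hw⟩ := ex_inner_aux (h := h) (i := i) b z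
  grind [contract_inner, ex]

lemma ex_inner_of_eq_nil b (hz : ex h i z = []) :
    ex h i (some (inner h i b) :: z) = [some b] := by
  obtain ⟨w, hw⟩ := ex_inner_aux (h := h) (i := i) b z
  grind [ex]

lemma ex_inner b (hz : ¬ StartsIn h i z)
    (hz' : ex h i z ≠ []) :
    ex h i (some (inner h i b) :: z) = some b :: none :: ex h i z := by
  obtain ⟨w, hw⟩ := ex_inner_aux (h := h) (i := i) b z
  grind [contract_inner, ex]

lemma ex_head z :
    ex h i z = [] ∨ ∃ b w, ex h i z = some b :: w := by
  induction z with
  | nil => exact Or.inl rfl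
  | cons s z ih =>
    rcases s with _ | v
    · exact ih
    rcases inner_or_outer h i v with ⟨b, rfl⟩ | ⟨c, hc, rfl⟩
    · obtain ⟨w, hw⟩ := ex_inner_aux (h := h) (i := i) b z
      grind
    grind [ex_outer]

lemma con_head z :
    (con h i z).head? = z.head?.map (Option.map (contract h i)) := by
  induction z with
  | nil => rfl
  | cons s z ih =>
    rcases s with _ | v
    · rfl
    rcases inner_or_outer h i v with ⟨b, rfl⟩ | ⟨c, hc, rfl⟩
    · grind [con_inner_of_startsIn, contract_inner, con_inner, StartsIn]
    grind [con_outer, contract_outer]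

lemma StartsIn.con (hz : StartsIn h i z) :
    ∃ w, con h i z = some i :: w := by
  have := con_head (h := h) (i := i) z
  obtain ⟨b, z', rfl⟩ := hz
  rcases hc : QuiltPatch.con h i _ with _ | ⟨s, w⟩
  · grind
  grind [contract_inner]

/-- Case distinction along a traversal of a composition. -/
lemma con_induction {P : List _ → Prop} (nil : P [])
    (none : ∀ z, P z → P (none :: z))
    (outer : ∀ c hc z, P z → P (some (QuiltPatch.outer h i c hc) :: z))
    (mid : ∀ b b' z, P (some (inner h i b') :: z) →
      P (some (inner h i b) :: some (inner h i b') :: z))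
    (fin : ∀ b z, ¬ StartsIn h i z → P z → P (some (inner h i b) :: z))
    z : P z := by
  induction z with
  | nil => exact nil
  | cons s z ih =>
    rcases s with _ | v
    · exact none z ih
    rcases inner_or_outer h i v with ⟨b, rfl⟩ | ⟨c, hc, rfl⟩
    · grind [StartsIn]
    grind

lemma startsIn_cons b z :
    StartsIn h i (some (inner h i b) :: z) := ⟨b, z, rfl⟩

lemma lc_con_ex z : lc h i (con h i z) (ex h i z) = z := by
  induction z using con_induction (h := h) (i := i) with
  | nil => rfl
  | none z ih => grind [con, ex, lc, lcomp]
  | outer c hc z ih =>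
    grind [con_outer, ex_outer, lcomp_some, rel_of_ne, lc]
  | mid b b' z ih =>
    rw [con_inner_of_startsIn b (startsIn_cons b' z), ex_inner_of_startsIn b (startsIn_cons b' z)]
    obtain ⟨w, hw⟩ := (startsIn_cons (h := h) (i := i) b' z).con
    grind [lcomp_hit, rel_self, lc, seg, rest]
  | fin b z hz ih =>
    rw [con_inner b hz]
    by_cases he : ex h i z = []
    · grind [ex_inner_of_eq_nil, lcomp_hit, rel_self, lc, seg, rest]
    grind [ex_inner, lcomp_hit, rel_self, lc, seg, rest]

lemma count_con z :
    (con h i z).count (some i) = if ex h i z = [] then 0 else nones (ex h i z) + 1 := by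
  induction z using con_induction (h := h) (i := i) with
  | nil => rfl
  | none z ih => aesop
  | outer c hc z ih =>
    grind [con_outer, ex_outer]
  | mid b b' z ih =>
    rw [con_inner_of_startsIn b (startsIn_cons b' z), ex_inner_of_startsIn b (startsIn_cons b' z), ih]
    obtain ⟨w, hw⟩ := ex_inner_aux (h := h) (i := i) b' z
    simp [hw]
  | fin b z hz ih =>
    rw [con_inner b hz]
    by_cases he : ex h i z = []
    · simp_all [ex_inner_of_eq_nil]
    simp_all [ex_inner]

lemma fullL_con (hz : FullL z) : FullL (con h i z) := by
  induction hz with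
  | nil => exact FullL.nil
  | letter v z _ ih =>
    rw [con]
    split_ifs
    · exact ih
    · exact FullL.letter _ _ ih
  | gap v z _ ih =>
    rw [con, if_neg (by rintro ⟨-, b, z', h⟩; simp at h), con]
    have := con_head (h := h) (i := i) (some v :: z)
    rcases hc : con h i _ with _ | ⟨s, w⟩
    · grind
    rw [hc] at this ih
    simp at this
    rw [this] at ih ⊢
    exact FullL.gap _ _ ih

lemma wd_con z :
    wd (con h i z) = dst (z.reduceOption.map (contract h i)) := by
  induction z using con_induction (h := h) (i := i) with
  | nil => rfl
  | none z ih => simp_all [con, wd]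
  | outer c hc z ih =>
    rw [wd] at ih
    rw [con_outer, wd, List.reduceOption_cons_of_some, ← dst_cons_dst, ih, dst_cons_dst,
      List.reduceOption_cons_of_some, List.map_cons, contract_outer]
  | mid b b' z ih =>
    simp_all [con_inner_of_startsIn, startsIn_cons, contract_inner, dst_self]
  | fin b z hz ih =>
    rw [wd] at ih
    rw [con_inner b hz, wd, List.reduceOption_cons_of_some, ← dst_cons_dst, ih, dst_cons_dst,
      List.reduceOption_cons_of_some, List.map_cons, contract_inner]

lemma map_reduceOption_ex z :
    (ex h i z).reduceOption.map (inner h i) =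
      z.reduceOption.filter (fun v => contract h i v = i) := by
  induction z using con_induction (h := h) (i := i) with
  | nil => rfl
  | none z ih => simpa [ex] using ih
  | outer c hc z ih => simp_all [ex_outer, contract_outer]
  | mid b b' z ih =>
    grind [ex_inner_of_startsIn, startsIn_cons, List.reduceOption_cons_of_some, contract_inner]
  | fin b z hz ih =>
    by_cases he : ex h i z = []
    · simp_all [ex_inner_of_eq_nil, contract_inner]
    simp_all [ex_inner, contract_inner]

lemma ex_ne_nil (hm : 0 < m) (hz : ∀ v, some v ∈ z) :
    ex h i z ≠ [] := by
  have := map_reduceOption_ex (h := h) (i := i) z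
  have h2 : inner h i ⟨0, hm⟩ ∈ z.reduceOption.filter (fun v => contract h i v = i) := by
    grind [List.reduceOption_mem_iff, contract_inner]
  aesop

lemma wd_ex_map z :
    (wd (ex h i z)).map (inner h i) = dst ((wd z).filter (fun v => contract h i v = i)) := by
  grind [dst_map_of_injective, inner_injective, map_reduceOption_ex, dst_filter, wd]

lemma wd_con' z :
    wd (con h i z) = dst ((wd z).map (contract h i)) := by
  rw [wd_con, wd, dst_map]

/-- No letter is immediately repeated. -/
def NoRep {α : Type} (l : List (Option α)) : Prop := l.IsChain (fun x y => x = y → x = none)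

lemma noRep_iff {l : List (Option α)} :
    NoRep l ↔ ∀ a, ¬ [some a, some a] <:+: l := by
  constructor
  · intro hl a ha
    have := List.IsChain.infix hl ha
    simp at this
  intro hl
  induction l with
  | nil => exact List.IsChain.nil
  | cons s l ih =>
    have ih' := ih (fun u hu => hl u (hu.trans (List.suffix_cons s l).isInfix))
    rcases l with _ | ⟨t, l⟩
    · exact List.IsChain.singleton _
    · refine List.IsChain.cons_cons ?_ ih'
      rintro rfl
      rcases s with _ | a
      · rfl
      · exact (hl a ⟨[], l, rfl⟩).elim

lemma noRep_cons {s : Option α} {l} :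
    NoRep (s :: l) ↔ NoRep l ∧ ∀ a, s = some a → l.head? ≠ some (some a) := by
  rcases l with _ | ⟨t, l⟩
  · simp [NoRep]
  · simp [NoRep, ne_eq]
    aesop

lemma noRep_con (hz : NoRep z) : NoRep (con h i z) := by
  induction z using con_induction (h := h) (i := i) with
  | nil => exact List.IsChain.nil
  | none z ih => exact noRep_cons.2 ⟨ih (noRep_cons.1 hz).1, by simp⟩
  | outer c hc z ih =>
    obtain ⟨h1, h2⟩ := noRep_cons.1 hz
    rw [con_outer]
    refine noRep_cons.2 ⟨ih h1, ?_⟩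
    intro a ha
    rw [con_head]
    intro e
    rcases z with _ | ⟨s | v, z⟩
    · simp at e
    · simp at e
    grind [eq_outer_of_contract]
  | mid b b' z ih =>
    grind [con_inner_of_startsIn, startsIn_cons, noRep_cons]
  | fin b z hz' ih =>
    obtain ⟨h1, h2⟩ := noRep_cons.1 hz
    rw [con_inner b hz']
    refine noRep_cons.2 ⟨ih h1, ?_⟩
    intro a ha
    obtain rfl := Option.some.inj ha
    rw [con_head]
    intro e
    rcases z with _ | ⟨s | v, z⟩
    · simp at e
    · simp at e
    · simp at e
      obtain ⟨b', rfl⟩ := eq_inner_of_contract h i e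
      grind [startsIn_cons]

lemma noRep_ex (hz : NoRep z) : NoRep (ex h i z) := by
  induction z using con_induction (h := h) (i := i) with
  | nil => exact List.IsChain.nil
  | none z ih => exact ih (noRep_cons.1 hz).1
  | outer c hc z ih => grind [ex_outer, noRep_cons]
  | mid b b' z ih =>
    obtain ⟨h1, h2⟩ := noRep_cons.1 hz
    rw [ex_inner_of_startsIn b (startsIn_cons b' z)]
    refine noRep_cons.2 ⟨ih h1, ?_⟩
    obtain ⟨w, hw⟩ := ex_inner_aux (h := h) (i := i) b' z
    grind
  | fin b z hz' ih =>
    grind [noRep_cons, ex]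

lemma wd_cons_of_ne {a : α} (hab : a ≠ b) l :
    wd (some a :: some b :: l) = a :: wd (some b :: l) := by
  simp [wd, dst_of_ne hab]

lemma length_ex_le (hz : NoRep z) :
    (ex h i z).length ≤ (wd (ex h i z)).length + 2 * nones (ex h i z) ∧
      ((ex h i z).length = (wd (ex h i z)).length + 2 * nones (ex h i z) → FullL (ex h i z)) := by
  induction z using con_induction (h := h) (i := i) with
  | nil => exact ⟨by simp [ex], fun _ => FullL.nil⟩
  | none z ih => exact ih (noRep_cons.1 hz).1
  | outer c hc z ih => grind [ex_outer, noRep_cons]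
  | mid b b' z ih =>
    obtain ⟨h1, h2⟩ := noRep_cons.1 hz
    obtain ⟨i1, i2⟩ := ih h1
    rw [ex_inner_of_startsIn b (startsIn_cons b' z)]
    obtain ⟨w, hw⟩ := ex_inner_aux b' z
    rw [hw] at i1 i2 ⊢
    have hb : b ≠ b' := by
      grind
    rw [wd_cons_of_ne hb]
    simp at i1 i2 ⊢
    exact ⟨by omega, fun e => FullL.letter _ _ (i2 (by omega))⟩
  | fin b z hz' ih =>
    obtain ⟨i1, i2⟩ := ih (noRep_cons.1 hz).1
    by_cases he : ex h i z = []
    · rw [ex_inner_of_eq_nil b he]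
      exact ⟨by simp [wd, dst], fun _ => FullL.letter _ _ FullL.nil⟩
    · rw [ex_inner b hz' he]
      obtain ⟨b', w, hw⟩ := (ex_head z).resolve_left he
      rw [hw] at i1 i2 ⊢
      by_cases hb : b = b'
      · subst hb
        rw [wd_letter_none]
        simp at i1 i2 ⊢
        exact ⟨by omega, fun e => FullL.gap _ _ (i2 (by omega))⟩
      have : wd (some b :: none :: some b' :: w) = b :: wd (some b' :: w) := by
        simp [wd, dst_of_ne hb]
      grind [nones_some, nones_none]

lemma length_lc
    (hm : x.count (some i) = nones y + 1) :
    (lc h i x y).length + 2 * nones y + 1 = x.length + y.length := by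
  have h1 := countP_lcomp (ψ := inner h i) (fun _ => true) ((hits_rel h i x).trans hm)
  have h2 : ∀ {α : Type} (l : List (Option α)), l.countP (Option.any fun _ => true) + nones l =
      l.length := by
    intro α l
    induction l with
    | nil => rfl
    | cons s l ih => rcases s with _ | a <;> simp at ih ⊢ <;> omega
  have h3 : x.countP (Option.any fun a => (rel h i a).any fun _ => true) + x.count (some i) =
      x.countP (Option.any fun _ => true) := by
    clear hm h1
    induction x with
    | nil => rfl
    | cons s x ih =>
      rcases s with _ | a
      · simpa using ih
      grind [rel]
  grind [nones_lc, lc]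

/-- A traversal whose word is an extension is a composition. -/
lemma lcomp_of_ext (hm : 0 < m) (hz : FullL z) (ht : IsTrav z)
    (hv : ∀ v, some v ∈ z)
    (hl : (wd z).length + 1 = (wd (con h i z)).length + (wd (ex h i z)).length) :
    LComp h i (con h i z) (ex h i z) z ∧ FullL (con h i z) ∧ FullL (ex h i z) ∧
      NoRep (con h i z) ∧ NoRep (ex h i z) := by
  have hr := noRep_iff.2 ht.no_rep
  have hc : (con h i z).count (some i) = nones (ex h i z) + 1 := by
    grind [count_con, ex_ne_nil]
  have h0 := lc_con_ex (h := h) (i := i) z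
  have hn : nones (con h i z) = nones z := by
    grind [nones_lc]
  refine ⟨⟨hc, h0.symm⟩, fullL_con hz, ?_, noRep_con hr, noRep_ex hr⟩
  obtain ⟨h1, h2⟩ := length_ex_le (h := h) (i := i) hr
  have h3 := length_lc (h := h) hc
  grind [fullL_iff, fullL_con, noRep_iff, noRep_con, wd_unrun, dst_of_isChain, isChain_of_unrun, length_unrun]

lemma FullL.rest_cons {y : List (Option (Fin m))} (hy : FullL y) (h0 : nones y ≠ 0) :
    ∃ b w, rest y = some b :: w ∧ FullL (rest y) ∧ ∃ u, seg y = u ++ [b] := by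
  induction hy with
  | nil => simp at h0
  | letter a l hl ih =>
    obtain ⟨b, w, h1, h2, u, h3⟩ := ih (by simpa using h0)
    exact ⟨b, w, h1, h2, a :: u, by simp [seg, h3]⟩
  | gap a l hl _ => exact ⟨a, l, rfl, hl, [], rfl⟩

lemma seg_ne_nil {y : List (Option (Fin m))} (hy : FullL y) (h0 : y ≠ []) : seg y ≠ [] := by
  cases hy <;> simp_all [seg]

lemma rest_eq_nil {y : List (Option (Fin m))} (h0 : nones y = 0) : rest y = [] := by
  have := rest_iterate_eq_nil y (k := 1) (by omega)
  simpa using this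

lemma fullL_map_letters {α : Type} (f : α → β) (l : List α) {w} (hw : FullL w) :
    FullL (l.map (fun b => some (f b)) ++ w) := by
  induction l with
  | nil => exact hw
  | cons a l ih => exact FullL.letter _ _ ih

lemma fullL_lc (hx : FullL x) (hy : FullL y)
    (hc : x.count (some i) ≤ nones y + 1) : FullL (lc h i x y) := by
  have hrest : ∀ {y : List (Option (Fin m))}, FullL y → FullL (rest y) := by
    intro y hy
    by_cases h0 : nones y = 0
    · rw [rest_eq_nil h0]; exact FullL.nil
    obtain ⟨-, -, -, h2, -⟩ := hy.rest_cons h0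
    exact h2
  induction hx generalizing y with
  | nil => exact FullL.nil
  | letter a x _ ih =>
    by_cases ha : a = i
    · subst ha
      rw [lc, lcomp_hit (rel_self h a)]
      refine fullL_map_letters _ _ (ih (hrest hy) ?_)
      grind [nones_rest]
    rw [lc, lcomp_some (rel_of_ne h i ha)]
    exact FullL.letter _ _ (ih hy (by simpa [ha] using hc))
  | gap a x _ ih =>
    by_cases ha : a = i
    · subst ha
      have h0 : nones y ≠ 0 := by
        grind
      obtain ⟨b, w, h1, h2, u, h3⟩ := hy.rest_cons h0
      have h4 := ih h2 (by grind [nones_rest])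
      rw [lc, lcomp_hit (rel_self h a), h3, List.map_append, List.append_assoc]
      refine fullL_map_letters _ _ ?_
      rw [lc, h1, lcomp_hit (rel_self h a)] at h4
      rw [lcomp, h1, lcomp_hit (rel_self h a)]
      exact FullL.gap _ _ h4
    have h4 := ih hy (by simpa [ha] using hc)
    rw [lc, lcomp_some (rel_of_ne h i ha)] at h4 ⊢
    rw [lcomp, lcomp_some (rel_of_ne h i ha)]
    exact FullL.gap _ _ h4

lemma con_ex_block l (hl : l ≠ [])
    (hw : ¬ StartsIn h i w) :
    con h i (l.map (fun b => some (inner h i b)) ++ w) = some i :: con h i w ∧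
      ex h i (l.map (fun b => some (inner h i b)) ++ w) = l.map some ++
        if ex h i w = [] then [] else none :: ex h i w := by
  induction l with
  | nil => exact (hl rfl).elim
  | cons b l ih =>
    rcases l with _ | ⟨b', l⟩
    · grind [con_inner, ex_inner_of_eq_nil, ex]
    grind [con_inner_of_startsIn, startsIn_cons, ex_inner_of_startsIn]

lemma con_ex_lc (hx : NoRep x)
    (hy : FullL y) (hc : x.count (some i) = nones y + 1 ∧ y ≠ [] ∨ x.count (some i) = 0 ∧ y = []) :
    con h i (lc h i x y) = x ∧ ex h i (lc h i x y) = y := by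
  rw [lc]
  induction x generalizing y with
  | nil =>
    aesop
  | cons s x ih =>
    obtain ⟨h1, h2⟩ := noRep_cons.1 hx
    rcases s with _ | a
    · grind [lcomp, con, ex]
    · by_cases ha : a = i
      · subst ha
        simp at hc
        have hw : ¬ StartsIn h a (lcomp (rel h a) (inner h a) x (rest y)) := by
          rintro ⟨b, z', e⟩
          rcases x with _ | ⟨_ | c, x⟩
          · simp [lcomp] at e
          · simp [lcomp] at e
          grind [lcomp_some, rel_of_ne, outer_ne_inner]
        obtain ⟨b1, b2⟩ := con_ex_block _ (seg_ne_nil hy hc.2) hw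
        rw [lcomp_hit (rel_self h a), b1, b2]
        by_cases h0 : nones y = 0
        · obtain ⟨i1, i2⟩ := ih h1 (by rw [rest_eq_nil h0]; exact FullL.nil)
            (Or.inr ⟨by rw [hc.1, h0], rest_eq_nil h0⟩)
          grind [rest_eq_nil, seg_eq_self]
        obtain ⟨b, w, h3, h4, -⟩ := hy.rest_cons h0
        have h5 : rest y ≠ [] := by simp [h3]
        obtain ⟨i1, i2⟩ := ih h1 h4 (Or.inl ⟨by grind [nones_rest], h5⟩)
        rw [i1, i2, if_neg h5, seg_append_rest (q := nones y - 1) (by omega)]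
        exact ⟨rfl, rfl⟩
      simp_all [lcomp_some, rel_of_ne, con_outer, ex_outer]

end Contract

section Patterns

variable {β : Type}

lemma sublist_left {x : β} (h : (l ++ [x]).Sublist (p ++ q)) (hx : x ∉ q) :
    (l ++ [x]).Sublist p := by
  obtain ⟨l₁, l₂, e, h1, h2⟩ := List.sublist_append_iff.1 h
  rcases List.eq_nil_or_concat l₂ with rfl | ⟨w, y, rfl⟩
  · aesop
  grind [List.append_inj_right']

lemma sublist_right {x : β} (h : (x :: l).Sublist (p ++ q)) (hx : x ∉ p) :
    (x :: l).Sublist q := by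
  obtain ⟨l₁, l₂, e, h1, h2⟩ := List.sublist_append_iff.1 h
  rcases l₁ with _ | ⟨y, w⟩
  · rwa [e]
  grind

lemma exists_last_split [DecidableEq β] {a : β} {l} (h : a ∈ l) :
    ∃ p q, l = p ++ a :: q ∧ a ∉ q := by
  obtain ⟨p, q, e, hp⟩ := List.eq_append_cons_of_mem (List.mem_reverse.2 h)
  grind [List.reverse_reverse]

lemma exists_pair_split {a : β} (h : [a, b].Sublist l) :
    ∃ p q, l = p ++ a :: q ∧ b ∈ q := by
  grind [List.append_of_mem]

lemma pair_sublist {a : β} (ha : a ∈ p) (hb : b ∈ q) : [a, b].Sublist (p ++ q) :=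
  (List.singleton_sublist.2 ha).append (List.singleton_sublist.2 hb)

lemma pair_sublist_insert {c : β} (h : [c, a].Sublist l) (hb : b ∈ l) :
    [b, a].Sublist l ∨ [c, b].Sublist l := by
  grind

end Patterns

section Orders

variable {α : Type} {l : List (Option α)} {a b c : α}

lemma LLt.mem_left (h : LLt l a b) (hl : IsTrav l) (e : l = p ++ q)
    (hb : some b ∈ p) : some a ∈ p := by
  by_contra ha
  have h1 := h.2
  refine hl.no_cross b a h.1.symm ?_
  grind [sublist_right]

lemma LLt.mem_right (h : LLt l a b) (hl : IsTrav l) (e : l = p ++ q)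
    (hb : some b ∈ q) : some a ∈ q := by
  by_contra ha
  have h1 := h.2
  rw [e] at h1
  refine hl.no_cross a b h.1 ?_
  rw [e]
  exact (sublist_left (l := [some a, some b]) h1 ha).append (List.singleton_sublist.2 hb)

lemma LLt.pair_right (h : LLt l a b) (hl : IsTrav l) (hbc : [some b, some c].Sublist l) :
    [some a, some c].Sublist l := by
  grind [LLt.mem_left]

lemma LLt.pair_left (h : LLt l a b) (hl : IsTrav l) (hbc : [some c, some b].Sublist l) :
    [some c, some a].Sublist l := by
  grind [LLt.mem_right]

lemma LLt.trans (h : LLt l a b) (h' : LLt l b c) (hl : IsTrav l) : LLt l a c := by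
  have hac : a ≠ c := by
    grind [IsTrav.not_lt_of_lt]
  obtain ⟨p, q, e, h1, h2⟩ := List.cons_sublist_iff.1 h'.2
  obtain ⟨p', q', rfl, h3⟩ := exists_pair_split h2
  have e1 := e
  have e2 : l = (p ++ p' ++ [some c]) ++ q' := by simp [e]
  refine ⟨hac, ?_⟩
  rw [e1]
  refine (List.singleton_sublist.2 (h.mem_left hl e1 h1)).append ?_
  grind [LLt.mem_right]

lemma LLeft.trans (h : LLeft l a b) (h' : LLeft l b c) (ha : some a ∈ l) (hb : some b ∈ l) :
    LLeft l a c := by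
  refine ⟨?_, fun hca => ?_⟩
  · rintro rfl
    rcases Term.pair_sublist_or ha hb (by simpa using h.1) with h1 | h1
    · exact h'.2 h1
    · exact h.2 h1
  rcases pair_sublist_insert hca hb with h1 | h1
  · exact h.2 h1
  · exact h'.2 h1

lemma LLeft.of_lt (h : LLeft l a b) (h' : LLt l a c) (hl : IsTrav l) : LLeft l c b := by
  refine ⟨?_, fun hbc => h.2 (h'.pair_left hl hbc)⟩
  · rintro rfl
    exact h.2 ((List.sublist_cons_self _ _).trans h'.2)

lemma LLeft.of_lt' (h : LLeft l a b) (h' : LLt l b c) (hl : IsTrav l) : LLeft l a c := by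
  have h1 := (List.sublist_append_left [some b, some c] _).trans h'.2
  refine ⟨?_, fun hca => h.2 (h'.pair_right hl hca)⟩
  · rintro rfl
    exact h.2 h1

lemma lt_or_left_of_ne (hab : a ≠ b) :
    LLt l a b ∨ LLt l b a ∨ LLeft l a b ∨ LLeft l b a := by
  by_cases h1 : [some b, some a].Sublist l
  · by_cases h2 : [some a, some b].Sublist l
    · rcases Term.triple_of_pairs (by simpa using hab) h2 h1 with h3 | h3
      · exact Or.inl ⟨hab, h3⟩
      · exact Or.inr (Or.inl ⟨hab.symm, h3⟩)
    · exact Or.inr (Or.inr (Or.inr ⟨hab.symm, h2⟩))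
  · exact Or.inr (Or.inr (Or.inl ⟨hab, h1⟩))

end Orders

/-- The underlying planar tree. -/
def NSOp.tree {n : ℕ} (J : NSOp n) : PTree n where
  lt a b := LLt J.list a b
  left a b := LLeft J.list a b
  lt_irrefl a h := h.1 rfl
  lt_trans a b c h h' := h.trans h' J.isTrav
  left_irrefl a h := h.1 rfl
  left_trans a b c h h' := h.trans h' (J.mem_list a) (J.mem_list b)
  exists_root := by
    obtain ⟨r, u, v, h1, h2⟩ := J.exists_root_list
    refine ⟨r, fun w hw => ⟨hw.symm, ?_⟩⟩
    have hm := J.mem_list w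
    rw [h2, List.mem_cons] at hm
    rcases hm with hm | hm
    · grind
    · rcases List.eq_nil_or_concat v with rfl | ⟨v', s, rfl⟩
      · simp at hm
      grind [List.append_inj_right']
  left_of_left_of_lt a b c h h' := h.of_lt h' J.isTrav
  left_of_left_of_lt' a b c h h' := h.of_lt' h' J.isTrav
  total a b hab := lt_or_left_of_ne hab

namespace PTree

variable {n : ℕ} (T : PTree n)

lemma lt_asymm (h : T.lt a b) : ¬ T.lt b a := fun h' =>
  T.lt_irrefl _ (T.lt_trans _ _ _ h h')

lemma not_lt_of_left (h : T.left a b) : ¬ T.lt a b := fun h' =>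
  T.left_irrefl _ (T.left_of_left_of_lt _ _ _ h h')

lemma not_lt_of_left' (h : T.left a b) : ¬ T.lt b a := fun h' =>
  T.left_irrefl _ (T.left_of_left_of_lt' _ _ _ h h')

lemma left_asymm (h : T.left a b) : ¬ T.left b a := fun h' =>
  T.left_irrefl _ (T.left_trans _ _ _ h h')

lemma lt_or_lt (h : T.lt a c) (h' : T.lt b c) (hab : a ≠ b) :
    T.lt a b ∨ T.lt b a := by
  grind [PTree.total, PTree.not_lt_of_left, PTree.left_of_left_of_lt']

lemma eq_of_le {T : PTree n} (h1 : ∀ a b, T.lt a b → T'.lt a b)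
    (h2 : ∀ a b, T.left a b → T'.left a b) : T = T' := by
  refine PTree.ext (funext fun a => funext fun b => propext ⟨h1 a b, fun h => ?_⟩)
    (funext fun a => funext fun b => propext ⟨h2 a b, fun h => ?_⟩)
  · grind [PTree.total, PTree.lt_asymm, PTree.not_lt_of_left, PTree.not_lt_of_left']
  · rcases T.total a b fun e => T'.left_irrefl _ (e ▸ h) with h3 | h3 | h3 | h3
    · grind [PTree.not_lt_of_left]
    · grind [PTree.not_lt_of_left']
    · exact h3
    grind [PTree.left_asymm]

lemma exists_max_lt (p : Fin n → Prop) (hp : ∃ a, p a) : ∃ a, p a ∧ ∀ b, p b → ¬ T.lt a b := by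
  have : IsTrans _ (fun a b => T.lt b a) := ⟨fun a b c h h' => T.lt_trans _ _ _ h' h⟩
  have : Std.Irrefl _ := ⟨fun a => T.lt_irrefl a⟩
  have := Finite.wellFounded_of_trans_of_irrefl (fun a b => T.lt b a)
  obtain ⟨a, ha, hm⟩ := this.has_min {a | p a} hp
  grind

lemma exists_edge (h : T.lt a b) : ∃ c, T.Edge c b ∧ (c = a ∨ T.lt a c) := by
  obtain ⟨c, hc, hm⟩ := T.exists_max_lt (fun c => T.lt c b) ⟨a, h⟩
  refine ⟨c, ⟨hc, fun d hd => hm d hd.2 hd.1⟩, ?_⟩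
  grind [PTree.lt_or_lt]

lemma transGen_edge (h : T.lt a b) : Relation.TransGen T.Edge a b := by
  have : IsTrans _ T.lt := ⟨T.lt_trans⟩
  have : Std.Irrefl T.lt := ⟨T.lt_irrefl⟩
  have hwf := Finite.wellFounded_of_trans_of_irrefl T.lt
  induction b using hwf.induction with
  | _ b ih =>
    obtain ⟨c, hc, rfl | h1⟩ := T.exists_edge h
    · grind
    · exact (ih c hc.1 h1).tail hc

/-- The first of two vertices in preorder. -/
def Pre (a b : Fin n) : Prop := T.lt a b ∨ T.left a b

lemma pre_irrefl a : ¬ T.Pre a a := fun h => h.elim (T.lt_irrefl a) (T.left_irrefl a)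

lemma pre_trans (h : T.Pre a b) (h' : T.Pre b c) : T.Pre a c := by
  rcases h with h | h <;> rcases h' with h' | h'
  · exact Or.inl (T.lt_trans _ _ _ h h')
  · have hac : a ≠ c := by
      grind [PTree.not_lt_of_left']
    rcases T.total a c hac with h1 | h1 | h1 | h1
    · exact Or.inl h1
    · exact (T.not_lt_of_left' h' (T.lt_trans _ _ _ h1 h)).elim
    · exact Or.inr h1
    grind [PTree.left_asymm, PTree.left_of_left_of_lt']
  · exact Or.inr (T.left_of_left_of_lt' _ _ _ h h')
  · exact Or.inr (T.left_trans _ _ _ h h')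

lemma pre_total (h : a ≠ b) : T.Pre a b ∨ T.Pre b a := by
  rcases T.total a b h with h1 | h1 | h1 | h1
  · exact Or.inl (Or.inl h1)
  · exact Or.inr (Or.inl h1)
  · exact Or.inl (Or.inr h1)
  · exact Or.inr (Or.inr h1)

lemma exists_last (S : Finset _) (hS : S.Nonempty) :
    ∃ v ∈ S, ∀ u ∈ S, u ≠ v → T.Pre u v := by
  have : IsTrans _ (fun a b => T.Pre b a) := ⟨fun a b c h h' => T.pre_trans h' h⟩
  have : Std.Irrefl _ := ⟨T.pre_irrefl⟩
  have := Finite.wellFounded_of_trans_of_irrefl (fun a b => T.Pre b a)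
  obtain ⟨v, hv, hm⟩ := this.has_min _ hS
  grind [PTree.pre_total]

end PTree

lemma isTreeColoring_iff T (J : NSOp n) : IsTreeColoring T J ↔ J.tree = T := by
  constructor
  · rintro ⟨h1, h2⟩
    exact PTree.eq_of_le (fun a b h => (h1 a b).1 ((J.lt_iff a b).2 h))
      (fun a b h => (h2 a b).1 ((J.left_iff a b).2 h))
  rintro rfl
  exact ⟨J.lt_iff, J.left_iff⟩

lemma dst_append_dup A B (p : α) : dst (A ++ p :: p :: B) = dst (A ++ p :: B) := by
  induction A with
  | nil => exact dst_self p B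
  | cons a A ih => rw [List.cons_append, ← dst_cons_dst, ih, dst_cons_dst, List.cons_append]

namespace PTree

variable {n : ℕ}

/-- `l` is the walk around the part of `T` on the vertices `S`. -/
structure IsWalk (T : PTree n) (S : Finset (Fin n)) (l : List (Fin n)) : Prop where
  mem : ∀ a, a ∈ l ↔ a ∈ S
  chain : l.IsChain (· ≠ ·)
  no_cross : ∀ u v, u ≠ v → ¬ [u, v, u, v].Sublist l
  length : l.length + 1 = 2 * S.card
  lt : ∀ a ∈ S, ∀ b ∈ S, T.lt a b → [a, b, a].Sublist l
  left : ∀ a ∈ S, ∀ b ∈ S, T.left a b → ¬ [b, a].Sublist l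

lemma IsWalk.insert {T : PTree n}
    (h : T.IsWalk S l) (hv : v ∉ S) (hp : p ∈ S) (he : T.Edge p v) (hS : ∀ u ∈ S, T.Pre u v) :
    ∃ l', T.IsWalk (insert v S) l' := by
  obtain ⟨A, B, rfl, hB⟩ := exists_last_split ((h.mem p).2 hp)
  have hvl := fun hm => hv ((h.mem v).1 hm)
  simp at hvl
  obtain ⟨hvA, hvp, hvB⟩ := hvl
  have hfilter : (A ++ p :: v :: p :: B).filter (fun x => x ≠ v) = A ++ p :: p :: B := by
    grind [List.filter_eq_self]
  have hres : ∀ c : List _, c.IsChain (· ≠ ·) → v ∉ c → c.Sublist (A ++ p :: v :: p :: B) →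
      c.Sublist (A ++ p :: B) := by
    intro c hc hvc hs
    have h1 := hs.filter (fun x => x ≠ v)
    have h2 : c.filter (fun x => x ≠ v) = c := by
      grind [List.filter_eq_self]
    rw [h2, hfilter] at h1
    have h3 := sublist_dst hc h1
    grind [dst_append_dup, List.Sublist.trans, dst_sublist]
  have hcount : (A ++ p :: v :: p :: B).count v = 1 := by
    grind
  have hlast : ∀ u ∈ S, u ∈ p :: B → u = p ∨ T.lt u p := by
    intro u hu hm
    rw [List.mem_cons] at hm
    rcases hm with rfl | hm
    · exact Or.inl rfl
    by_cases hup : u = p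
    · exact Or.inl hup
    · right
      have hpu : [p, u].Sublist (A ++ p :: B) := by
        grind [List.append_cons]
      rcases T.total u p hup with h1 | h1 | h1 | h1
      · exact h1
      · exfalso
        refine h.no_cross p u (Ne.symm hup) ?_
        have h2 := h.lt p hp u hu h1
        rw [List.append_cons] at h2 ⊢
        exact (sublist_left (l := [p, u]) h2 hB).append (List.singleton_sublist.2 hm)
      · grind [PTree.IsWalk.left]
      · exfalso
        have h2 := T.left_of_left_of_lt _ _ _ h1 he.1
        rcases hS u hu with h3 | h3
        · exact T.not_lt_of_left' h2 h3
        · exact T.left_asymm h2 h3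
  refine ⟨A ++ p :: v :: p :: B, ⟨?_, ?_, ?_, ?_, ?_, ?_⟩⟩
  · grind [PTree.IsWalk.mem]
  · have := h.chain
    grind [List.isChain_split]
  · intro x y hxy hs
    by_cases hv' : v ∈ [x, y, x, y]
    · grind
    · exact h.no_cross x y hxy (hres _ (by simp [hxy, hxy.symm]) hv' hs)
  · grind [PTree.IsWalk.length]
  · intro a ha b hb hab
    rw [Finset.mem_insert] at ha hb
    rcases ha with rfl | ha
    · rcases hb with rfl | hb
      · grind [PTree.lt_irrefl]
      · exact (T.pre_irrefl a (T.pre_trans (Or.inl hab) (hS b hb))).elim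
    rcases hb with rfl | hb
    · have hmid : a = p ∨ T.lt a p := by
        by_cases e : a = p
        · exact Or.inl e
        · rcases T.lt_or_lt hab he.1 e with h1 | h1
          · exact Or.inr h1
          · exact (he.2 a ⟨h1, hab⟩).elim
      have hA : a ∈ A ++ [p] ∧ a ∈ p :: B := by
        rcases hmid with rfl | h1
        · simp
        · have hap : a ≠ p := fun e => T.lt_irrefl p (e ▸ h1)
          have h2 := h.lt a ha p hp h1
          have h3 : [a, p].Sublist (A ++ p :: B) :=
            (List.sublist_append_left [a, p] [a]).trans h2
          rw [List.append_cons] at h3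
          have h4 := sublist_left (l := [a]) h3 hB
          refine ⟨h4.subset (by simp), ?_⟩
          by_contra hn
          refine h.no_cross a p hap ?_
          exact (sublist_left (l := [a, p]) h2 hn).append (List.singleton_sublist.2 (by simp))
      have e : A ++ p :: b :: p :: B = (A ++ [p]) ++ ([b] ++ (p :: B)) := by simp
      rw [e]
      grind
    grind [PTree.IsWalk.lt]
  intro a ha b hb hab hs
  rw [Finset.mem_insert] at ha hb
  have hne : a ≠ b := fun e => T.left_irrefl _ (e ▸ hab)
  rcases ha with rfl | ha
  · rcases hb with rfl | hb
    · exact hne rfl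
    · exact T.pre_irrefl a (T.pre_trans (Or.inr hab) (hS b hb))
  · rcases hb with rfl | hb
    · have h1 : a ∈ p :: B := by
        have : A ++ p :: b :: p :: B = (A ++ [p]) ++ b :: p :: B := by simp
        rw [this] at hs
        have h2 := sublist_right hs (by simp [hvA, hvp])
        grind
      rcases hlast a ha h1 with rfl | h2
      · exact T.not_lt_of_left hab he.1
      · exact T.not_lt_of_left hab (T.lt_trans _ _ _ h2 he.1)
    grind [PTree.IsWalk.left]

lemma exists_isWalk (T : PTree n) S (hS : S.Nonempty)
    (hc : ∀ v ∈ S, ∀ u, T.Pre u v → u ∈ S) : ∃ l, T.IsWalk S l := by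
  obtain ⟨N, hN⟩ : ∃ N, S.card = N := ⟨_, rfl⟩
  induction N generalizing S with
  | zero => aesop
  | succ N ih =>
    obtain ⟨v, hv, hm⟩ := T.exists_last S hS
    by_cases hr : ∃ p, T.lt p v
    · obtain ⟨p, hp⟩ := hr
      obtain ⟨c, he, -⟩ := T.exists_edge hp
      have hcS := hc v hv c (Or.inl he.1)
      have hcv : c ≠ v := fun e => T.lt_irrefl v (e ▸ he.1)
      obtain ⟨l, hl⟩ := ih _ ⟨c, Finset.mem_erase.2 ⟨hcv, hcS⟩⟩ (by
        grind [PTree.pre_irrefl, PTree.pre_trans]) (by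
        grind)
      grind [PTree.IsWalk.insert, Finset.insert_erase]
    have hS' : ∀ a, a ∈ S → a = v := by
      intro a ha
      by_contra hne
      obtain ⟨r, hrt⟩ := T.exists_root
      have hvr : v = r := by
        by_contra e
        exact hr ⟨r, hrt v e⟩
      exact T.pre_irrefl a (T.pre_trans (hm a ha hne) (Or.inl (hvr ▸ hrt a (hvr ▸ hne))))
    have hS'' : S = {v} := by
      grind
    subst hS''
    refine ⟨[v], ⟨by simp, List.IsChain.singleton _, ?_, by simp, ?_, ?_⟩⟩
    · grind
    · grind
    grind

lemma exists_coloring T : ∃ J : NSOp n, J.tree = T := by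
  obtain ⟨r, -⟩ := T.exists_root
  obtain ⟨l, hl⟩ := T.exists_isWalk _ ⟨r, Finset.mem_univ r⟩ (by simp)
  have hsub : ∀ c : List _, (c.map some).Sublist (l.map some) ↔ c.Sublist l := by
    intro c
    constructor
    · intro h
      have := h.filterMap id
      simp_all
    grind
  have ht : IsTrav (l.map some) := by
    refine ⟨fun a ha => ?_, fun u v huv hs => hl.no_cross u v huv ((hsub _).1 hs)⟩
    refine isChain_iff_infix.1 hl.chain a ?_
    have := ha.filterMap id
    simp_all
  obtain ⟨J, hJ⟩ := NSOp.exists_list r.pos ht (fun a => by simp [hl.mem]) (by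
    have : nones (l.map some) = 0 := nones_map_some id l
    rw [this, List.length_map, hl.length, Finset.card_univ, Fintype.card_fin, add_zero])
  refine ⟨J, (eq_of_le ?_ ?_).symm⟩
  · intro a b hab
    refine ⟨fun e => T.lt_irrefl _ (e ▸ hab), ?_⟩
    rw [hJ]
    exact (hsub _).2 (hl.lt a (Finset.mem_univ _) b (Finset.mem_univ _) hab)
  intro a b hab
  refine ⟨fun e => T.left_irrefl _ (e ▸ hab), ?_⟩
  rw [hJ]
  intro hs
  exact hl.left a (Finset.mem_univ _) b (Finset.mem_univ _) hab ((hsub [b, a]).1 hs)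

end PTree

section Ext

variable {n m r : ℕ} {h : r + 1 = n + m} {i : Fin n}

lemma reduceOption_con_sublist z :
    (con h i z).reduceOption.Sublist (z.reduceOption.map (contract h i)) := by
  induction z using con_induction (h := h) (i := i) with
  | nil => aesop
  | none z ih => simpa [con] using ih
  | outer c hc z ih => simp_all [con_outer, contract_outer]
  | mid b b' z ih =>
    simp_all [con_inner_of_startsIn, startsIn_cons]
  | fin b z hz ih => simp_all [con_inner, contract_inner]

/-- Patterns of the contraction come from patterns. -/
lemma exists_lift
    (hl : (l.map some).Sublist (con h i z)) :
    ∃ l' : List _, (l'.map some).Sublist z ∧ l'.map (contract h i) = l := by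
  have h1 := hl.filterMap id
  simp at h1
  obtain ⟨l', h2, h3⟩ := List.sublist_map_iff.1 (h1.trans (reduceOption_con_sublist z))
  exact ⟨l', (h2.map some).trans (map_reduceOption_sublist z), h3.symm⟩

lemma map_inner_sublist {l : List _}
    (hl : (l.map some).Sublist (ex h i z)) : ((l.map (inner h i)).map some).Sublist z := by
  have h1 := hl.filterMap id
  simp at h1
  have h2 := h1.map (inner h i)
  have h3 := map_reduceOption_ex (h := h) (i := i) z
  rw [List.reduceOption] at h3
  rw [show (fun x => x) = id from rfl] at h2
  grind [List.Sublist.trans, List.filter_sublist, map_reduceOption_sublist]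

lemma eq_outer_of_contract' hc (hv : contract h i v = c) :
    v = outer h i c hc := eq_outer_of_contract h i hv hc

lemma con_ex_of_lcomp
    (hx : IsTrav x) (hy : FullL y) (hy0 : y ≠ [])
    (hz : LComp h i x y z) : x = con h i z ∧ y = ex h i z := by
  obtain ⟨h1, h2⟩ := con_ex_lc (h := h) (noRep_iff.2 hx.no_rep) hy (Or.inl ⟨hz.1, hy0⟩)
  rw [hz.2]
  grind

namespace PTree

variable {X : NSOp n} {Y : NSOp m} {Z : NSOp r}

lemma lt_contract (hc : LComp h i X.list Y.list Z.list) (huv : Z.tree.lt u v)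
    (hne : contract h i u ≠ contract h i v) : X.tree.lt (contract h i u) (contract h i v) := by
  change LLt _ u v at huv
  rw [hc.2] at huv
  exact huv.contract hne

lemma lt_inner (hc : LComp h i X.list Y.list Z.list) a b :
    Z.tree.lt (inner h i a) (inner h i b) ↔ Y.tree.lt a b := by
  change LLt _ _ _ ↔ LLt _ a b
  rw [hc.2]
  refine ⟨fun h => h.of_inner, fun h => ⟨fun e => h.1 (inner_injective _ i e), pattern_inner (l := [a, b, a]) hc.1 h.2⟩⟩

lemma left_inner (hc : LComp h i X.list Y.list Z.list) a b :
    Z.tree.left (inner h i a) (inner h i b) ↔ Y.tree.left a b := by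
  change LLeft _ _ _ ↔ LLeft _ a b
  rw [hc.2]
  refine ⟨fun h => ⟨fun e => h.1 (by rw [e]), fun hs => h.2 (pattern_inner (l := [b, a]) hc.1 hs)⟩, fun h => h.inner⟩

lemma exists_lt_of_lt (hc : LComp h i X.list Y.list Z.list) (hpq : X.tree.lt p q) :
    ∃ u v u', [some u, some v, some u'].Sublist Z.list ∧ contract h i u = p ∧ contract h i v = q ∧
      contract h i u' = p := by
  obtain ⟨-, hpq'⟩ := hpq
  have e := (con_ex_of_lcomp X.isTrav Y.fullL (Term.enc_ne_nil _) hc).1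
  rw [e] at hpq'
  obtain ⟨l, hl, hl'⟩ := exists_lift (l := [p, q, p]) hpq'
  grind [List.map_eq_cons_iff, List.map_eq_nil_iff]

lemma lt_outer (hc : LComp h i X.list Y.list Z.list) hp hq
    (hpq : X.tree.lt p q) : Z.tree.lt (outer h i p hp) (outer h i q hq) := by
  obtain ⟨u, v, u', hs, hu, hv, hu'⟩ := exists_lt_of_lt hc hpq
  obtain rfl := eq_outer_of_contract' hp hu
  obtain rfl := eq_outer_of_contract' hp hu'
  obtain rfl := eq_outer_of_contract' hq hv
  exact ⟨fun e => hpq.1 (outer_injective h i e), hs⟩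

lemma le_root (hc : LComp h i X.list Y.list Z.list)
    (hr : ∀ b, b ≠ r₀ → Y.tree.lt r₀ b) b :
    b = r₀ ∨ Z.tree.lt (inner h i r₀) (inner h i b) := by
  grind [lt_inner]

lemma lt_outer_inner (hc : LComp h i X.list Y.list Z.list) hp
    (hpi : X.tree.lt p i) b : Z.tree.lt (outer h i p hp) (inner h i b) := by
  obtain ⟨r₀, hr⟩ := Y.tree.exists_root
  obtain ⟨u, v, u', hs, hu, hv, hu'⟩ := exists_lt_of_lt hc hpi
  obtain rfl := eq_outer_of_contract' hp hu
  obtain rfl := eq_outer_of_contract' hp hu'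
  obtain ⟨b', rfl⟩ := eq_inner_of_contract h i hv
  have h1 : Z.tree.lt _ _ := ⟨outer_ne_inner h i p hp b', hs⟩
  have h2 : Z.tree.lt (outer h i p hp) (inner h i r₀) := by
    grind [PTree.le_root, PTree.lt_or_lt, PTree.lt_contract, contract_inner, PTree.lt_asymm]
  rcases le_root hc hr b with rfl | h3
  · exact h2
  · exact Z.tree.lt_trans _ _ _ h2 h3

lemma lt_root_outer (hc : LComp h i X.list Y.list Z.list)
    (hr : ∀ b, b ≠ r₀ → Y.tree.lt r₀ b) hq (hiq : X.tree.lt i q) :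
    Z.tree.lt (inner h i r₀) (outer h i q hq) := by
  obtain ⟨u, v, u', hs, hu, hv, hu'⟩ := exists_lt_of_lt hc hiq
  obtain rfl := eq_outer_of_contract' hq hv
  obtain ⟨b, rfl⟩ := eq_inner_of_contract h i hu
  obtain ⟨b', rfl⟩ := eq_inner_of_contract h i hu'
  have h1 :=
    (List.sublist_append_left [_, _] [_]).trans hs
  have h2 :=
    (List.sublist_cons_self _ _).trans hs
  have h3 : [some (inner h i r₀), some (outer h i q hq)].Sublist Z.list := by
    rcases le_root hc hr b with rfl | h4
    · exact h1
    · exact LLt.pair_right h4 Z.isTrav h1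
  have h4 : [some (outer h i q hq), some (inner h i r₀)].Sublist Z.list := by
    rcases le_root hc hr b' with rfl | h4
    · exact h2
    · exact LLt.pair_left h4 Z.isTrav h2
  have hne := (outer_ne_inner h i q hq r₀).symm
  rcases Term.triple_of_pairs (by simpa using hne) h3 h4 with h5 | h5
  · exact ⟨hne, h5⟩
  · have := lt_contract hc ⟨hne.symm, h5⟩
      (by grind [contract_inner])
    grind [contract_inner, PTree.lt_asymm]

lemma eq_of_contract_eq (hv : contract h i v ≠ i)
    (huv : contract h i u = contract h i v) : u = v := (eq_outer_of_contract' hv huv).trans (eq_outer_of_contract' hv rfl).symm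

lemma isExt_of_lcomp (hc : LComp h i X.list Y.list Z.list) : IsExt h i X.tree Y.tree Z.tree := by
  obtain ⟨r₀, hr⟩ := Y.tree.exists_root
  refine ⟨fun a b => ?_, fun a b => (left_inner hc a b).symm, fun p q hpq => ⟨fun he => ?_, ?_⟩,
    fun u v huv => ?_⟩
  · rw [Edge, Edge, lt_inner hc]
    refine and_congr_right fun hab => ⟨fun hm w hw => ?_, fun hm c hcc => hm (inner h i c) ⟨(lt_inner hc _ _).2 hcc.1, (lt_inner hc _ _).2 hcc.2⟩⟩
    · rcases inner_or_outer h i w with ⟨c, rfl⟩ | ⟨c, hci, rfl⟩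
      · grind [lt_inner]
      have h1 := lt_contract hc hw.1 (by grind [contract_inner, contract_outer])
      grind [PTree.lt_contract, contract_inner, PTree.lt_asymm]
  · have key : ∀ u v, contract h i u = p → contract h i v = q → Z.tree.lt u v →
        (∀ w, Z.tree.lt u w → Z.tree.lt w v → contract h i w = p → False) →
        (∀ w, Z.tree.lt u w → Z.tree.lt w v → contract h i w = q → False) →
        ∃ u v, contract h i u = p ∧ contract h i v = q ∧ Z.tree.Edge u v := by
      rintro u v rfl rfl huv h1 h2
      refine ⟨u, v, rfl, rfl, huv, fun w hw => ?_⟩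
      by_cases e1 : contract h i w = contract h i u
      · exact h1 w hw.1 hw.2 e1
      by_cases e2 : contract h i w = contract h i v
      · exact h2 w hw.1 hw.2 e2
      · exact he.2 _ ⟨lt_contract hc hw.1 (Ne.symm e1), lt_contract hc hw.2 e2⟩
    by_cases hp : p = i
    · subst hp
      obtain ⟨u, ⟨⟨b, rfl⟩, hu⟩, hm⟩ := Z.tree.exists_max_lt
        (fun u => (∃ b, u = inner h p b) ∧ Z.tree.lt u _)
        ⟨_, ⟨r₀, rfl⟩, lt_root_outer hc hr _ he.1⟩
      refine key _ _ (contract_inner h p b) (contract_outer h p q _) hu ?_ ?_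
      · grind [eq_inner_of_contract]
      intro w h1 h2 hw
      rw [eq_outer_of_contract' (Ne.symm hpq) hw] at h2
      exact Z.tree.lt_irrefl _ h2
    have hp1 : ∀ v w, Z.tree.lt (outer h i p hp) w → Z.tree.lt w v → contract h i w = p → False := by
      intro v w h1 _ hw
      rw [eq_outer_of_contract' hp hw] at h1
      exact Z.tree.lt_irrefl _ h1
    by_cases hq : q = i
    · subst hq
      refine key _ (inner h q r₀) (contract_outer h q p hp) (contract_inner h q r₀)
        (lt_outer_inner hc hp he.1 r₀) (hp1 _) ?_
      intro w h1 h2 hw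
      obtain ⟨b, rfl⟩ := eq_inner_of_contract h q hw
      grind [PTree.le_root, PTree.lt_asymm]
    · refine key _ _ (contract_outer h i p hp) (contract_outer h i q hq) (lt_outer hc hp hq he.1)
        (hp1 _) ?_
      intro w h1 h2 hw
      rw [eq_outer_of_contract' hq hw] at h2
      exact Z.tree.lt_irrefl _ h2
  · rintro ⟨u, v, rfl, rfl, he⟩
    refine ⟨lt_contract hc he.1 hpq, fun c hcc => ?_⟩
    have hcu : c ≠ contract h i u := fun e => X.tree.lt_irrefl _ (e ▸ hcc.1)
    have hcv : c ≠ contract h i v := fun e => X.tree.lt_irrefl _ (e ▸ hcc.2)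
    by_cases hci : c = i
    · subst hci
      have h1 := lt_outer_inner hc (Ne.symm hcu) hcc.1 r₀
      have h2 := lt_root_outer hc hr (Ne.symm hcv) hcc.2
      rw [← eq_outer_of_contract' _ rfl] at h1
      rw [← eq_outer_of_contract' _ rfl] at h2
      exact he.2 _ ⟨h1, h2⟩
    have h2 : Z.tree.lt (outer h i c hci) v := by
      by_cases hv : contract h i v = i
      · obtain ⟨b, rfl⟩ := eq_inner_of_contract h i hv
        grind [lt_outer_inner]
      · rw [eq_outer_of_contract' hv rfl]
        grind [lt_outer]
    have hne : u ≠ outer h i c hci := by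
      grind [contract_outer]
    refine he.2 (outer h i c hci) ⟨?_, h2⟩
    rcases Z.tree.lt_or_lt he.1 h2 hne with h1 | h1 <;> grind [PTree.lt_contract, contract_outer, PTree.lt_asymm]
  change LLeft Z.list u v
  rw [hc.2]
  exact LLeft.of_contract huv

variable {T : PTree n} {T' : PTree m}

lemma lt_induction {Q : Fin m → Fin m → Prop} (hQ : ∀ a b c, Q a b → Q b c → Q a c)
    (he : ∀ a b, T'.Edge a b → Q a b) (hab : T'.lt a b) : Q a b := by
  have := T'.transGen_edge hab
  clear hab
  induction this with
  | single h => exact he _ _ h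
  | tail _ h ih => exact hQ _ _ _ ih (he _ _ h)

lemma IsExt.lt_inner (he : IsExt h i T T' U) (hab : T'.lt a b) :
    U.lt (inner h i a) (inner h i b) :=
  lt_induction (Q := fun a b => U.lt (inner h i a) (inner h i b)) (fun _ _ _ => U.lt_trans _ _ _)
    (fun _ _ h => ((he.1 _ _).1 h).1) hab

lemma IsExt.convex (he : IsExt h i T T' U) (hab : T'.lt a b)
    (h1 : U.lt (inner h i a) v) (h2 : U.lt v (inner h i b)) : contract h i v = i := by
  obtain ⟨c, hcb, hac⟩ : ∃ c, T'.Edge c b ∧ (c = a ∨ T'.lt a c) := T'.exists_edge hab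
  have hT : IsTrans _ _ := ⟨T'.lt_trans⟩
  have hI : Std.Irrefl _ := ⟨T'.lt_irrefl⟩
  have hwf := Finite.wellFounded_of_trans_of_irrefl T'.lt
  induction b using hwf.induction generalizing c with
  | _ b ih =>
    have hcb' := (he.1 _ _).1 hcb
    by_cases e : v = inner h i c
    · rw [e, contract_inner]
    rcases U.lt_or_lt h2 hcb'.1 e with h3 | h3
    · rcases hac with rfl | hac
      · grind [PTree.lt_asymm]
      · obtain ⟨d, hd, had⟩ := T'.exists_edge hac
        exact ih c hcb.1 hac h3 d hd had
    · exact (hcb'.2 v ⟨h3, h2⟩).elim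

lemma IsExt.isTrav_con (he : IsExt h i T T' Z.tree) : IsTrav (con h i Z.list) := by
  refine ⟨noRep_iff.1 (noRep_con (noRep_iff.2 Z.isTrav.no_rep)), fun p q hpq hs => ?_⟩
  obtain ⟨r₀, hr⟩ := T'.exists_root
  have hle : ∀ b, b = r₀ ∨ Z.tree.lt (inner h i r₀) (inner h i b) := fun b => by
    grind [PTree.IsExt.lt_inner]
  have hlt : ∀ b b' (v : Fin r) (P Q : List _), contract h i v ≠ i →
      Z.list = P ++ some v :: Q → some (inner h i b) ∈ P → some (inner h i b') ∈ Q →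
      Z.tree.lt (inner h i r₀) v := by
    intro b b' v P Q hv e hb hb'
    refine ⟨?_, ?_⟩
    · grind [contract_inner]
    have e' : Z.list = (P ++ [some v]) ++ Q := by simp [e]
    have h1 : some (inner h i r₀) ∈ P := by
      rcases hle b with rfl | h1
      · exact hb
      · exact LLt.mem_left h1 Z.isTrav e hb
    have h2 : some (inner h i r₀) ∈ Q := by
      rcases hle b' with rfl | h1
      · exact hb'
      · exact LLt.mem_right h1 Z.isTrav e' hb'
    grind
  have hcontra : ∀ b v, contract h i v ≠ i → Z.tree.lt (inner h i r₀) v →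
      Z.tree.lt v (inner h i b) → False := by
    intro b v hv h1 h2
    have hb : b ≠ r₀ := by
      grind [PTree.lt_asymm]
    exact hv (he.convex (hr b hb) h1 h2)
  obtain ⟨l, hl, hl'⟩ := exists_lift (l := [p, q, p, q]) hs
  obtain ⟨u, l, rfl, hu, hl'⟩ := List.map_eq_cons_iff.1 hl'
  obtain ⟨v, l, rfl, hv, hl'⟩ := List.map_eq_cons_iff.1 hl'
  obtain ⟨u', l, rfl, hu', hl'⟩ := List.map_eq_cons_iff.1 hl'
  obtain ⟨v', l, rfl, hv', hl'⟩ := List.map_eq_cons_iff.1 hl'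
  obtain rfl := List.map_eq_nil_iff.1 hl'
  simp at hl
  by_cases hp : p = i
  · subst hp
    obtain rfl : v' = v := eq_of_contract_eq (by rw [hv]; exact hpq.symm) (hv'.trans hv.symm)
    obtain ⟨b, rfl⟩ := eq_inner_of_contract h p hu
    obtain ⟨b', rfl⟩ := eq_inner_of_contract h p hu'
    have hvi : contract h p v' ≠ p := by rw [hv]; exact hpq.symm
    obtain ⟨P, Q, e, h1, h2⟩ := List.cons_sublist_iff.1 hl
    obtain ⟨P', Q', rfl, h3⟩ := exists_pair_split
      ((List.sublist_append_left _ _).trans h2)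
    refine hcontra b' v' hvi
      (hlt b b' v' (P ++ P') Q' hvi (by simp [e]) (List.mem_append_left _ h1) h3) ⟨?_, ?_⟩
    · grind
    grind
  obtain rfl : u' = u := eq_of_contract_eq (by rw [hu]; exact hp) (hu'.trans hu.symm)
  by_cases hq : q = i
  · subst hq
    obtain ⟨b, rfl⟩ := eq_inner_of_contract h q hv
    obtain ⟨b', rfl⟩ := eq_inner_of_contract h q hv'
    have hui : contract h q u' ≠ q := by rw [hu]; exact hp
    have hl2 := (List.sublist_cons_self _ _).trans hl
    obtain ⟨P, Q, e, h1, h2⟩ := List.cons_sublist_iff.1 hl2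
    obtain ⟨P', Q', rfl, h3⟩ := exists_pair_split h2
    refine hcontra b u' hui
      (hlt b b' u' (P ++ P') Q' hui (by simp [e]) (List.mem_append_left _ h1) h3) ⟨?_, ?_⟩
    · grind
    · exact (List.sublist_append_left [_, _, _] [_]).trans hl
  · obtain rfl : v' = v := eq_of_contract_eq (by rw [hv]; exact hq) (hv'.trans hv.symm)
    refine Z.isTrav.no_cross u' v' ?_ hl
    grind

lemma isTrav_ex (hz : IsTrav z) : IsTrav (ex h i z) := by
  refine ⟨noRep_iff.1 (noRep_ex (noRep_iff.2 hz.no_rep)), fun a b hab hs => ?_⟩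
  exact hz.no_cross _ _ (fun e => hab (inner_injective h i e))
    (map_inner_sublist (l := [a, b, a, b]) hs)

lemma some_mem_con (hv : some v ∈ z) :
    some (contract h i v) ∈ con h i z := by
  rw [← mem_wd, wd_con, mem_dst]
  grind [List.reduceOption_mem_iff]

lemma some_mem_ex (hb : some (inner h i b) ∈ z) :
    some b ∈ ex h i z := by
  rw [← List.reduceOption_mem_iff]
  have : inner h i b ∈ (ex h i z).reduceOption.map (inner h i) := by
    grind [map_reduceOption_ex, List.reduceOption_mem_iff, contract_inner]
  grind [inner_injective]

lemma exists_contract (hm : 0 < m) c : ∃ v, contract h i v = c := by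
  by_cases hc : c = i
  · exact ⟨inner h i ⟨0, hm⟩, by rw [contract_inner, hc]⟩
  · exact ⟨outer h i c hc, contract_outer h i c hc⟩

lemma IsExt.exists_lcomp (he : IsExt h i T T' Z.tree) :
    ∃ (X : NSOp n) (Y : NSOp m), LComp h i X.list Y.list Z.list ∧ X.tree = T ∧ Y.tree = T' := by
  obtain ⟨r₀, hr⟩ := T'.exists_root
  have hm := r₀.pos
  have hn := i.pos
  have hmem1 : ∀ c, some c ∈ con h i _ := fun c => by
    obtain ⟨v, rfl⟩ := exists_contract (h := h) (i := i) hm c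
    exact some_mem_con (Z.mem_list v)
  have hmem2 : ∀ b, some b ∈ ex h i _ := fun b => some_mem_ex (Z.mem_list _)
  have ht1 := he.isTrav_con
  have ht2 : IsTrav (ex h i _) := isTrav_ex Z.isTrav
  have hc : (con h i Z.list).count (some i) = nones (ex h i Z.list) + 1 := by
    grind [count_con]
  have h0 := lc_con_ex (h := h) (i := i) Z.list
  have hnn : nones (con h i Z.list) = nones Z.list := by
    grind [nones_lc]
  have hlen := length_lc (h := h) hc
  rw [h0] at hlen
  obtain ⟨X', hX'⟩ := MNSOp.exists_list hn ht1 hmem1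
  obtain ⟨Y', hY'⟩ := MNSOp.exists_list hm ht2 hmem2
  have l1 := X'.length_list_le
  have l2 := Y'.length_list_le
  rw [hX'] at l1
  rw [hY'] at l2
  have l3 := Z.length_list
  obtain ⟨X, hX⟩ := NSOp.exists_list hn ht1 hmem1 (by omega)
  obtain ⟨Y, hY⟩ := NSOp.exists_list hm ht2 hmem2 (by omega)
  have hcomp : LComp h i X.list Y.list Z.list := by
    rw [hX, hY]
    exact ⟨hc, h0.symm⟩
  refine ⟨X, Y, hcomp, (eq_of_le ?_ ?_).symm, (eq_of_le (fun a b hab => (PTree.lt_inner hcomp a b).1 (he.lt_inner hab)) fun a b hab => (left_inner hcomp a b).1 ((he.2.1 a b).1 hab)).symm⟩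
  · refine fun p q => lt_induction X.tree.lt_trans fun a b h1 => ?_
    have hne : a ≠ b := fun e => T.lt_irrefl _ (e ▸ h1.1)
    obtain ⟨u, v, rfl, rfl, h2⟩ := (he.2.2.1 _ _ hne).1 h1
    exact lt_contract hcomp h2.1 hne
  · intro p q hpq
    refine ⟨fun e => T.left_irrefl _ (e ▸ hpq), fun hs => ?_⟩
    rw [hX] at hs
    obtain ⟨l, hl, hl'⟩ := exists_lift (l := [q, p]) hs
    obtain ⟨u, l, rfl, hu, hl'⟩ := List.map_eq_cons_iff.1 hl'
    obtain ⟨v, l, rfl, hv, hl'⟩ := List.map_eq_cons_iff.1 hl'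
    obtain rfl := List.map_eq_nil_iff.1 hl'
    exact (he.2.2.2 v u (by rw [hu, hv]; exact hpq)).2 hl

end PTree

lemma word_isExt_iff (hm : 0 < m)
    (hz : FullL z) (ht : IsTrav z) (hV : wd z = V.1) :
    Word.IsExt h i W W' V ↔ LComp h i (con h i z) (ex h i z) z ∧ FullL (con h i z) ∧
      FullL (ex h i z) ∧ IsTrav (con h i z) ∧ IsTrav (ex h i z) ∧ wd (con h i z) = W.1 ∧
      wd (ex h i z) = W'.1 := by
  have hmem : ∀ v, some v ∈ z := fun v => by rw [← mem_wd, hV]; exact V.2.1 v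
  have e1 : wd (con h i z) = W.1 ↔ (V.1.map (contract h i)).destutter (· ≠ ·) = W.1 := by
    rw [wd_con', destutter_eq_dst, hV]
  have e2 : wd (ex h i z) = W'.1 ↔ (V.1.filter (fun v => contract h i v = i)).destutter (· ≠ ·) =
      W'.1.map (inner h i) := by
    grind [destutter_eq_dst, wd_ex_map, List.map_injective_iff, inner_injective]
  have e3 : ∀ {N M : ℕ}, W.1.length = N → W'.1.length = M →
      (V.deg = W.deg + W'.deg ↔ V.1.length + 1 = N + M) := by
    grind [Word.deg]
  rw [Word.IsExt, ← e1, ← e2]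
  constructor
  · grind [lcomp_of_ext, isTrav_of_wd, noRep_iff]
  rintro ⟨g1, g2, g3, g4, g5, h1, h2⟩
  refine ⟨h2, h1, ?_⟩
  rw [e3 rfl rfl, ← h1, ← h2, ← hV]
  have l1 := length_lc (h := h) g1.1
  rw [← g1.2] at l1
  have l2 := hz.length_wd ht
  have l3 := g2.length_wd g4
  have l4 := g3.length_wd g5
  have hn : nones (con h i z) = nones z := by
    conv_rhs => rw [g1.2]
    rw [nones_lc]
  omega

end Ext

section Weights

variable {α : Type} [DecidableEq α]

/-- The total weight of the letter `a`. -/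
def tot (a : α) (D : List (α × ZMod 2)) : ZMod 2 := (D.map fun p => if p.1 = a then p.2 else 0).sum

/-- The weighted number of pairs of a letter `b` followed by a letter `a`. -/
def prs (b a : α) : List (α × ZMod 2) → ZMod 2
  | [] => 0
  | p :: D => (if p.1 = b then p.2 * tot a D else 0) + prs b a D

lemma tot_nil (a : α) : tot a [] = 0 := rfl

lemma tot_cons (a : α) p D :
    tot a (p :: D) = (if p.1 = a then p.2 else 0) + tot a D := by simp [tot]

lemma tot_append (a : α) D E : tot a (D ++ E) = tot a D + tot a E := by
  simp [tot]

lemma prs_append (b a : α) D E :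
    prs b a (D ++ E) = prs b a D + prs b a E + tot b D * tot a E := by
  induction D with
  | nil => simp [prs, tot_nil]
  | cons p D ih =>
    grind [tot_append, tot_cons, prs]

lemma prs_add_prs {b : α} (hab : a ≠ b) D :
    prs b a D + prs a b D = tot a D * tot b D := by
  induction D with
  | nil => simp [prs, tot_nil]
  | cons p D ih =>
    grind [tot_cons, prs]

/-- The indicator of a proposition. -/
def ind (p : Prop) : ZMod 2 := open Classical in if p then 1 else 0

lemma ind_true (h : p) : ind p = 1 := by simp [ind, h]

lemma ind_false (h : ¬ p) : ind p = 0 := by simp [ind, h]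

lemma zmod_add_self (x : ZMod 2) : x + x = 0 := CharTwo.add_self_eq_zero x

/-- The letters of a traversal with the parity of their weights: a letter counts once if it occurs
again, and once more if the preceding symbol is a letter that occurs again. -/
def dl : ZMod 2 → List (Option α) → List (α × ZMod 2)
  | _, [] => []
  | _, none :: l => dl 0 l
  | κ, some a :: l => (a, ind (some a ∈ l) + κ) :: dl (ind (some a ∈ l)) l

/-- The letters that follow letters which occur again, in reverse order. -/
def fl : ZMod 2 → List (Option α) → List (α × ZMod 2)
  | _, [] => []
  | _, none :: l => fl 0 l
  | κ, some a :: l => fl (ind (some a ∈ l)) l ++ [(a, κ)]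

/-- Whether the first occurrence of `a` follows a letter which occurs again. -/
def itp (a : α) : ZMod 2 → List (Option α) → ZMod 2
  | _, [] => 0
  | _, none :: l => itp a 0 l
  | κ, some c :: l => if c = a then κ else itp a (ind (some c ∈ l)) l

lemma tot_fl_add_tot_dl (a : α) κ l :
    tot a (fl κ l) + tot a (dl κ l) = (l.count (some a) - 1 : ℕ) := by
  induction l generalizing κ with
  | nil => simp [fl, dl, tot_nil]
  | cons s l ih =>
    rcases s with _ | c
    · grind [fl, dl]
    · have := ih (ind (some c ∈ l))
      simp [fl, dl, tot_append, tot_cons, tot_nil]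
      by_cases hc : c = a
      · subst hc
        simp
        by_cases hm : some c ∈ l
        · obtain ⟨q, hq⟩ : ∃ q, l.count _ = q + 1 := ⟨_, (Nat.succ_pred_eq_of_pos (List.count_pos_iff.2 hm)).symm⟩
          rw [ind_true hm, hq] at this ⊢
          grind
        · rw [ind_false hm, List.count_eq_zero_of_not_mem hm] at this ⊢
          grind
      grind [List.count_cons_of_ne]

/-- After a letter `a`, no first occurrence of `a` is left. -/
lemma entries_eq_zero {a : α} (hl : IsTrav l) κ
    (h0 : l.head? = some (some a) → κ = 0)
    (hx : ∀ b, b ≠ a → ¬ [some b, some a, some b].Sublist l) :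
    itp a κ l = 0 ∧ ∀ p ∈ fl κ l, p.1 = a → p.2 = 0 := by
  induction l generalizing κ with
  | nil => exact ⟨rfl, by simp [fl]⟩
  | cons s l ih =>
    have hl' := hl.mono (List.suffix_cons s l).isInfix
    have hx' : ∀ b, b ≠ a → ¬ [some b, some a, some b].Sublist l :=
      fun b hb h => hx b hb (h.cons s)
    rcases s with _ | c
    · exact ih hl' 0 (fun _ => rfl) hx'
    · have h1 := ih hl' (ind (some c ∈ l)) (by
        intro hh
        rcases l with _ | ⟨t, l⟩
        · simp at hh
        · simp at hh
          subst hh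
          by_cases hc : c = a
          · subst hc
            exact (hl.no_rep c ⟨[], l, rfl⟩).elim
          grind [ind_false]) hx'
      grind [itp, fl]

lemma IsTrav.entries {a : α} (hl : IsTrav (some a :: l)) κ :
    itp a κ l = 0 ∧ ∀ p ∈ fl κ l, p.1 = a → p.2 = 0 := by
  refine entries_eq_zero (hl.mono (List.suffix_cons _ l).isInfix) κ ?_ fun b hb h => hl.no_cross a b hb.symm (h.cons_cons _)
  · intro h
    rcases l with _ | ⟨t, l⟩
    · simp at h
    · simp at h
      subst h
      exact (hl.no_rep a ⟨[], l, rfl⟩).elim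

lemma prs_eq_zero {c : α} (hc : c = a ∨ c = b)
    (h : ∀ p ∈ D, p.1 = c → p.2 = 0) : tot c D = 0 ∧ prs b a D = 0 := by
  induction D with
  | nil => exact ⟨rfl, rfl⟩
  | cons p D ih =>
    grind [tot_cons, prs]

lemma tot_fl {a : α} (hl : IsTrav l) κ :
    tot a (fl κ l) = itp a κ l := by
  induction l generalizing κ with
  | nil => rfl
  | cons s l ih =>
    have hl' := hl.mono (List.suffix_cons s l).isInfix
    rcases s with _ | c
    · exact ih hl' 0
    grind [tot_append, tot_cons, tot_nil, IsTrav.entries, fl, itp]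

lemma prs_fl {a : α} (hab : a ≠ b) (hl : IsTrav l) κ :
    prs b a (fl κ l) =
      itp a κ l * itp b κ l * ind (l.idxOf (some a) < l.idxOf (some b)) := by
  induction l generalizing κ with
  | nil => simp [fl, prs, itp]
  | cons s l ih =>
    have hl' := hl.mono (List.suffix_cons s l).isInfix
    have hidx : ∀ x y, s ≠ x → s ≠ y → (((s :: l).idxOf x < (s :: l).idxOf y) ↔
        l.idxOf x < l.idxOf y) := by
      grind
    rcases s with _ | c
    · grind [fl, itp]
    grind [prs_append, tot_cons, prs_eq_zero, IsTrav.entries, tot_fl, ind_true, ind_false, fl, itp, prs]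

lemma itp_append κ u (hu : some a ∉ u) {c : α} (hc : c ≠ a)
    v : itp a κ (u ++ some c :: v) = itp a (ind (some c ∈ v)) v := by
  induction u generalizing κ with
  | nil => simp [itp, hc]
  | cons s u ih =>
    simp at hu
    rcases s with _ | d
    · exact ih 0 hu.2
    grind [itp]

/-- The number of free inputs before the `t`-th occurrence of `a`. -/
def zl (a : α) : ℕ → List (Option α) → ℕ
  | _, [] => 0
  | t, none :: l => zl a t l + 1
  | 0, some c :: l => if c = a then 0 else zl a 0 l
  | t + 1, some c :: l => if c = a then zl a t l else zl a (t + 1) l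

lemma zl_of_ne {a : α} (hc : c ≠ a) t l :
    zl a t (some c :: l) = zl a t l := by cases t <;> simp [zl, hc]

lemma zl_none (a : α) t l : zl a t (none :: l) = zl a t l + 1 := by
  cases t <;> rfl

lemma zl_zero (a : α) l : zl a 0 (some a :: l) = 0 := by simp [zl]

lemma zl_succ (a : α) t l :
    zl a (t + 1) (some a :: l) = zl a t l := by simp [zl]

lemma zl_append_left {a : α} u v (ht : t < u.count (some a)) :
    zl a t (u ++ v) = zl a t u := by
  induction u generalizing t with
  | nil => simp at ht
  | cons s u ih =>
    rcases s with _ | c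
    · grind [zl_none]
    by_cases hc : c = a
    · subst hc
      cases t with
      | zero => simp [zl]
      | succ t => grind [zl_succ]
    grind [zl_of_ne]

lemma zl_append_right {a : α} u v t :
    zl a (u.count (some a) + t) (u ++ v) = nones u + zl a t v := by
  induction u with
  | nil => simp
  | cons s u ih =>
    rcases s with _ | c
    · grind [zl_none, nones_none]
    · by_cases hc : c = a
      · subst hc
        rw [List.cons_append, List.count_cons_self, nones_some, ← ih, show u.count _ + 1 + t = u.count _ + t + 1 by ring, zl_succ]
      grind [zl_of_ne, nones_some]

lemma zl_mono (a : α) l (hst : s ≤ t) (ht : t < l.count (some a)) :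
    zl a s l ≤ zl a t l := by
  induction l generalizing s t with
  | nil => simp at ht
  | cons x l ih =>
    rcases x with _ | c
    · grind [zl_none]
    · by_cases hc : c = a
      · cases s with
        | zero => grind [zl_zero]
        | succ s =>
          obtain ⟨t, rfl⟩ := Nat.exists_eq_succ_of_ne_zero (n := t) (by omega)
          grind [zl_succ]
      grind [zl_of_ne]

lemma exists_letters (ht : t < l.count (some a))
    (h0 : zl a t l = 0) : ∃ (L : List α) (m : List _), l = L.map some ++ some a :: m ∧
      L.count a = t := by
  induction l generalizing t with
  | nil => simp at ht
  | cons s l ih =>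
    rcases s with _ | c
    · grind [zl_none]
    by_cases hc : c = a
    · subst hc
      cases t with
      | zero => exact ⟨[], l, rfl, rfl⟩
      | succ t =>
        rw [zl_succ] at h0
        obtain ⟨L, m, rfl, h⟩ := ih (by simpa using ht) h0
        exact ⟨c :: L, m, rfl, by simp [h]⟩
    · rw [zl_of_ne hc] at h0
      obtain ⟨L, m, rfl, h⟩ := ih (by simpa [hc] using ht) h0
      exact ⟨c :: L, m, rfl, by simp [h, hc]⟩

/-- If every letter occurs twice, then equal letters are separated by free inputs. -/
lemma exists_gap (hl : IsTrav l)
    (h2 : ∀ a, some a ∈ l → 2 ≤ l.count (some a)) (L : List α) c p q :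
    l ≠ p ++ some c :: (L.map some ++ some c :: q) := by
  obtain ⟨N, hN⟩ : ∃ N, L.length ≤ N := ⟨_, le_rfl⟩
  induction N generalizing L c p q with
  | zero =>
    obtain rfl := List.length_eq_zero_iff.1 (by omega : L.length = 0)
    rintro rfl
    exact hl.no_rep c ⟨p, q, by simp⟩
  | succ N ih =>
    intro e
    rcases L with _ | ⟨d, L⟩
    · grind
    · have hcd : c ≠ d := by
        rintro rfl
        exact hl.no_rep c ⟨p, L.map some ++ some c :: q, by simp [e]⟩
      have hmem : some d ∈ p ∨ d ∈ L ∨ some d ∈ q := by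
        grind [List.count_eq_zero_of_not_mem]
      rcases hmem with h | h | h
      · refine hl.no_cross d c hcd.symm ?_
        rw [e]
        grind
      · obtain ⟨L₁, L₂, rfl⟩ := List.append_of_mem h
        refine ih L₁ d (p ++ [some c]) (L₂.map some ++ some c :: q) ?_ ?_
        · simp at hN; omega
        · rw [e]; simp
      refine hl.no_cross c d hcd ?_
      simp_all

/-- The weight of the `t`-th occurrence of `a`. -/
def wt (a : α) (κ : ZMod 2) (l : List (Option α)) (t : ℕ) : ZMod 2 :=
  ind (t + 1 < l.count (some a)) + if t = 0 then itp a κ l else 0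

lemma wt_none (a : α) κ l : wt a κ (none :: l) = wt a 0 l := by
  grind [wt, itp]

lemma wt_of_ne {a : α} (hc : c ≠ a) κ l :
    wt a κ (some c :: l) = wt a (ind (some c ∈ l)) l := by
  funext t
  simp [wt, itp, hc]

lemma wt_zero (a : α) κ l :
    wt a κ (some a :: l) 0 = ind (some a ∈ l) + κ := by
  simp [wt, itp]

lemma wt_succ {a : α} κ κ' (hl : IsTrav (some a :: l)) t :
    wt a κ (some a :: l) (t + 1) = wt a κ' l t := by
  simp [wt, (hl.entries κ').1]

lemma tot_dl {a : α} (hl : IsTrav l) :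
    tot a (dl κ l) = ∑ t ∈ Finset.range (l.count (some a)), wt a κ l t := by
  induction l generalizing κ with
  | nil => simp [dl, tot_nil]
  | cons s l ih =>
    have hl' := hl.mono (List.suffix_cons s l).isInfix
    rcases s with _ | c
    · grind [wt_none, dl]
    grind [tot_cons, List.count_cons_self, Finset.sum_range_succ', wt_zero, wt_succ, wt_of_ne, dl]

/-- Inversions are counted by the positions among the free inputs. -/
lemma prs_dl {a : α} (hab : a ≠ b) (hlf : IsTrav lf)
    (h2 : ∀ a, some a ∈ lf → 2 ≤ lf.count (some a))
    (e : lf = pre ++ l)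
    (hκ : κ ≠ 0 → pre = [] ∨ ∃ pre' c, pre = pre' ++ [some c] ∧ some c ∈ l) :
    prs b a (dl κ l) = ∑ j ∈ Finset.range (l.count (some b)), ∑ i ∈ Finset.range (l.count (some a)),
      wt b κ l j * wt a κ l i * ind (zl b j l < zl a i l) := by
  induction l generalizing pre κ with
  | nil => simp [dl, prs]
  | cons s l ih =>
    have hl : IsTrav (s :: l) := hlf.mono ⟨pre, [], by simp [e]⟩
    have hl' := hl.mono (List.suffix_cons s l).isInfix
    rcases s with _ | c
    · rw [dl, wt_none, wt_none, ih (pre := pre ++ [none]) (by simp [e]) (fun h => (h rfl).elim)]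
      simp_all [zl_none]
    have ih' := ih (pre := pre ++ [some c]) (κ := ind (some c ∈ l)) (by simp [e])
      (fun h => Or.inr ⟨pre, c, rfl, by
        grind [ind_false]⟩)
    rw [dl, prs, ih']
    by_cases hcb : c = b
    · subst hcb
      rw [if_pos rfl, List.count_cons_self, Finset.sum_range_succ',
        List.count_cons_of_ne (by simpa using hab.symm), wt_of_ne hab.symm, wt_zero, add_comm, tot_dl hl',
        Finset.mul_sum]
      refine congrArg₂ (· + ·) ?_ ?_
      · grind [wt_succ, zl_succ, zl_of_ne]
      · refine Finset.sum_congr rfl fun i hi => ?_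
        rw [Finset.mem_range] at hi
        rw [zl_zero, zl_of_ne hab.symm]
        by_cases hb0 : ind (some c ∈ l) + κ = 0
        · rw [hb0]; simp
        by_cases ha0 : wt a (ind (some c ∈ l)) l i = 0
        · rw [ha0]; simp
        suffices hz : 0 < zl a i l by rw [ind_true hz, mul_one]
        by_contra hz
        have hcl : some c ∈ l := by
          by_contra hn
          rw [ind_false hn, zero_add] at hb0
          have hc2 := h2 c (by simp [e])
          have hcp : some c ∈ pre := by
            grind
          rcases hκ hb0 with rfl | ⟨pre', d, rfl, hd⟩
          · simp at hcp
          · have hdc : d ≠ c := by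
              rintro rfl
              exact hlf.no_rep d ⟨pre', l, by simp [e]⟩
            have hdl : some d ∈ l := by simpa [hdc] using hd
            have hcp' : some c ∈ pre' := by grind
            refine hlf.no_cross c d hdc.symm ?_
            rw [e]
            grind [List.singleton_sublist]
        obtain ⟨L, m, rfl, hL⟩ := exists_letters hi (by omega)
        rcases Nat.eq_zero_or_pos i with rfl | hi0
        · have haL : a ∉ L := List.count_eq_zero.1 hL
          have hcL : c ∉ L := fun hcL => by
            obtain ⟨L₁, L₂, rfl⟩ := List.append_of_mem hcL
            grind [exists_gap]
          have hcm : some c ∈ m := by grind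
          have hap : some a ∉ pre := fun hap => by
            refine hlf.no_cross a c hab ?_
            rw [e]
            refine (List.singleton_sublist.2 hap).append (List.Sublist.cons_cons _ ?_)
            refine List.Sublist.append (List.nil_sublist _) (List.Sublist.cons_cons _ ?_)
            grind
          have ha2 := h2 a (by simp [e])
          have ham : 0 < m.count (some a) := by
            grind
          refine ha0 ?_
          have h1 : itp a (ind (some c ∈ L.map some ++ some a :: m)) (L.map some ++ some a :: m)
              = 1 := by
            rcases List.eq_nil_or_concat L with rfl | ⟨L₀, d, rfl⟩
            · grind [ind_true, itp]
            · have hda : d ≠ a := fun e => haL (by simp [e])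
              have hdc : d ≠ c := fun e => hcL (by simp [e])
              have hdm : some d ∈ m := by
                by_contra hdm
                have hd2 := h2 d (by simp [e])
                have hdp : some d ∈ pre ∨ d ∈ L₀ := by
                  grind
                rcases hdp with h | h
                · refine hlf.no_cross d c hdc ?_
                  grind [pair_sublist]
                · obtain ⟨L₁, L₂, rfl⟩ := List.append_of_mem h
                  exact exists_gap hlf h2 L₂ d (pre ++ some c :: L₁.map some) (some a :: m)
                    (by rw [e]; simp)
              grind [itp_append, ind_true, itp]
          grind [ind_true, wt]
        · have haL : a ∈ L := List.count_pos_iff.1 (by omega)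
          obtain ⟨L₁, L₂, rfl⟩ := List.append_of_mem haL
          exact exists_gap hlf h2 L₂ a (pre ++ some c :: L₁.map some) m (by rw [e]; simp)
    · rw [if_neg hcb, zero_add, List.count_cons_of_ne (by simpa using hcb), wt_of_ne hcb]
      by_cases hca : c = a
      · subst hca
        rw [List.count_cons_self]
        refine Finset.sum_congr rfl fun j _ => ?_
        grind [Finset.sum_range_succ', zl_zero, wt_succ, zl_succ, zl_of_ne, ind]
      simp_all [wt_of_ne, zl_of_ne]

end Weights

section Eqv

variable {α : Type}

lemma dl_map {f : α → β} (hf : Function.Injective f) κ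
    l : dl κ (l.map (Option.map f)) = (dl κ l).map (Prod.map f id) := by
  induction l generalizing κ with
  | nil => rfl
  | cons s l ih =>
    rcases s with _ | a
    · exact ih 0
    grind [Option.map_injective, dl]

lemma fl_map {f : α → β} (hf : Function.Injective f) κ
    l : fl κ (l.map (Option.map f)) = (fl κ l).map (Prod.map f id) := by
  induction l generalizing κ with
  | nil => rfl
  | cons s l ih =>
    rcases s with _ | a
    · exact ih 0
    grind [Option.map_injective, fl]

variable [DecidableEq α]

/-- The weighted words have the same total weights and the same numbers of inversions. -/
def Eqv (D E : List (α × ZMod 2)) : Prop :=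
  ∀ a b, tot a D = tot a E ∧ (a ≠ b → prs b a D = prs b a E)

lemma Eqv.refl (D : List (α × ZMod 2)) : Eqv D D := fun _ _ => ⟨rfl, fun _ => rfl⟩

lemma Eqv.symm {E : List (α × ZMod 2)} (h : Eqv D E) : Eqv E D :=
  fun a b => ⟨(h a b).1.symm, fun hab => ((h a b).2 hab).symm⟩

lemma Eqv.trans {E : List (α × ZMod 2)} (h : Eqv D E) (h' : Eqv E F) : Eqv D F :=
  fun a b => ⟨(h a b).1.trans (h' a b).1, fun hab => ((h a b).2 hab).trans ((h' a b).2 hab)⟩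

lemma Eqv.append {E : List (α × ZMod 2)} (h : Eqv D E) (h' : Eqv D' E') :
    Eqv (D ++ D') (E ++ E') := fun a b => by
  refine ⟨by rw [tot_append, tot_append, (h a b).1, (h' a b).1], fun hab => ?_⟩
  rw [prs_append, prs_append, (h a b).2 hab, (h' a b).2 hab, (h b a).1, (h' a b).1]

lemma Eqv.cons (p : α × ZMod 2) (h : Eqv D E) :
    Eqv (p :: D) (p :: E) := (Eqv.refl [p]).append h

lemma eqv_zero (a : α) D : Eqv ((a, 0) :: D) D := fun b c => by
  simp [tot_cons, prs]

lemma eqv_merge (a : α) w w' D :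
    Eqv ((a, w) :: (a, w') :: D) ((a, w + w') :: D) := fun b c => by
  grind [tot_cons, prs]

lemma prs_insert (b c a : α) w D E :
    prs b c (D ++ (a, w) :: E) = prs b c (D ++ E) +
      w * ((if a = b then tot c E else 0) + if a = c then tot b D else 0) := by
  grind [prs_append, tot_cons, prs]

lemma tot_map {β} [DecidableEq β] {f : α → β} (hf : Function.Injective f) a
    D : tot (f a) (D.map (Prod.map f id)) = tot a D := by
  induction D with
  | nil => rfl
  | cons p D ih => grind [tot_cons]

lemma prs_map {β} [DecidableEq β] {f : α → β} (hf : Function.Injective f) b a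
    D : prs (f b) (f a) (D.map (Prod.map f id)) = prs b a D := by
  induction D with
  | nil => rfl
  | cons p D ih => grind [tot_map, prs]

end Eqv

section Inv

variable {n : ℕ}

/-- The total weight. -/
def size (D : List (Fin n × ZMod 2)) : ZMod 2 := ∑ b, tot b D

/-- The total weight of the letters smaller than `a`. -/
def bel (a : Fin n) (D : List (Fin n × ZMod 2)) : ZMod 2 := ∑ b, if b < a then tot b D else 0

/-- The number of inversions of a weighted word. -/
def inv (D : List (Fin n × ZMod 2)) : ZMod 2 := ∑ a, ∑ b, if a < b then prs b a D else 0

lemma Eqv.inv_eq {E : List (Fin n × ZMod 2)} (h : Eqv D E) : inv D = inv E :=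
  Finset.sum_congr rfl fun a _ => Finset.sum_congr rfl fun b _ => by
    split_ifs with hab
    exacts [(h a b).2 hab.ne, rfl]

lemma size_nil : size ([] : List (Fin n × ZMod 2)) = 0 := by simp [size, tot_nil]

lemma size_cons (p : Fin n × ZMod 2) D :
    size (p :: D) = p.2 + size D := by
  simp [size, tot_cons, Finset.sum_add_distrib]

lemma size_append (D E : List (Fin n × ZMod 2)) : size (D ++ E) = size D + size E := by
  simp [size, tot_append, Finset.sum_add_distrib]

lemma bel_append (a : Fin n) D E :
    bel a (D ++ E) = bel a D + bel a E := by
  simp [bel, tot_append, ← Finset.sum_add_distrib]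
  grind

lemma bel_insert (a : Fin n) w D E :
    bel a (D ++ (a, w) :: E) = bel a (D ++ E) := by
  refine Finset.sum_congr rfl fun b _ => ?_
  grind [tot_append, tot_cons]

/-- The effect of a letter on the number of inversions. -/
lemma inv_insert (a : Fin n) w D E :
    inv (D ++ (a, w) :: E) = inv (D ++ E) + w * (size D + tot a D + bel a (D ++ E)) := by
  have h1 : inv (D ++ (a, w) :: E) = inv (D ++ E) + w *
      (∑ c, ∑ b, ((if c < b then if a = b then tot c E else 0 else 0) +
        if c < b then if a = c then tot b D else 0 else 0)) := by
    simp [inv, Finset.mul_sum, ← Finset.sum_add_distrib]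
    grind [prs_insert]
  have h2 : ∑ c, ∑ b, ((if c < b then if a = b then tot c E else 0 else 0) +
        if c < b then if a = c then tot b D else 0 else 0) =
      bel a E + ∑ b, if a < b then tot b D else 0 := by
    simp [Finset.sum_add_distrib, bel]
    congr 1
    · exact Finset.sum_congr rfl fun c _ => by
        rw [Finset.sum_eq_single a (fun b _ hb => by simp [hb.symm]) (by simp)]; simp
    · rw [Finset.sum_eq_single a (fun c _ hc => by simp [hc.symm]) (by simp)]; simp
  have h3 : size D = tot a D + bel a D + ∑ b, if a < b then tot b D else 0 := by
    have : tot a D = ∑ b, if a = b then tot b D else 0 := by simp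
    rw [this, bel, size, ← Finset.sum_add_distrib, ← Finset.sum_add_distrib]
    refine Finset.sum_congr rfl fun b _ => ?_
    grind
  grind [bel_append]

lemma inv_map (σ : Equiv.Perm (Fin n)) D :
    inv (D.map (Prod.map σ id)) =
      inv D + ∑ a, ∑ b, if a < b ∧ σ b < σ a then tot a D * tot b D else 0 := by
  have h1 : inv (D.map (Prod.map σ id)) = ∑ a, ∑ b, if σ a < σ b then prs b a D else 0 := by
    rw [inv, ← Equiv.sum_comp σ]
    refine Finset.sum_congr rfl fun a _ => ?_
    rw [← Equiv.sum_comp σ]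
    grind [prs_map, Equiv.injective]
  have h2 : ∀ a b, (if σ a < σ b then prs b a D else 0) =
      (if a < b ∧ σ a < σ b then prs b a D else 0) + if b < a ∧ σ a < σ b then prs b a D else 0 := by
    grind
  simp [h1, h2, Finset.sum_add_distrib]
  rw [Finset.sum_comm (f := fun a b => if b < a ∧ σ a < σ b then prs b a D else 0), inv,
    ← Finset.sum_add_distrib, ← Finset.sum_add_distrib]
  refine Finset.sum_congr rfl fun a _ => ?_
  rw [← Finset.sum_add_distrib, ← Finset.sum_add_distrib]
  refine Finset.sum_congr rfl fun b _ => ?_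
  grind [Equiv.injective, prs_add_prs]

/-- The weighted word of a pair of traversals. -/
def lam (x y : List (Option (Fin n))) : List (Fin n × ZMod 2) := fl 0 x ++ dl 0 x ++ dl 1 y

end Inv

lemma itp_append_left {α} [DecidableEq α] {a : α} {u} (hu : some a ∈ u) v
    (hd : ∀ b, some b ∈ u → some b ∉ v) κ : itp a κ (u ++ v) = itp a κ u := by
  induction u generalizing κ with
  | nil => simp at hu
  | cons s u ih =>
    rcases s with _ | c
    · exact ih (by simpa using hu) (fun b hb => hd b (List.mem_cons_of_mem _ hb)) 0
    grind [itp]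

lemma Term.Linear.itp_eq_one {α} [DecidableEq α] {t : Term α} (ht : t.Linear)
    (hm : t.NoMul) {a} (ha : some a ∈ t.enc) : itp a 1 t.enc = 1 := by
  induction t with
  | leaf => simp [enc] at ha
  | mul l r => exact hm.elim
  | node x q c ih =>
    by_cases hx : x = a
    · subst hx
      rw [enc, itp, if_pos rfl]
    obtain ⟨j, hj⟩ : ∃ j, some a ∈ (c j).enc := by
      simpa [enc, List.mem_flatten, List.mem_ofFn, Ne.symm hx] using ha
    obtain ⟨_, _, e, -, -, h1, h2, ⟨u, rfl⟩, v, rfl⟩ := enc_node_split (a := x) c j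
    have hd : ∀ b, some b ∈ (c j).enc → b ≠ x := fun b hb e => ht.notMem_child j (e ▸ hb)
    have hu : some a ∉ u := fun h => by
      rcases h1 a (List.mem_append_left _ h) with h | ⟨k, hk, h⟩
      · exact hx h.symm
      · exact hk.ne (ht.eq_of_mem_child h hj)
    rw [e, List.append_assoc, List.append_assoc, List.singleton_append, itp_append _ _ hu hx,
      ind_true (by simp), itp_append_left hj, ih j (ht.child j) (hm j) hj]
    intro b hb hb'
    rcases h2 b hb' with h | ⟨k, hk, h⟩
    · exact hd b hb h
    · exact hk.ne' (ht.eq_of_mem_child h hb)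

lemma NSOp.itp_list (J : NSOp n) a : itp a 1 J.list = 1 :=
  J.2.1.linear.itp_eq_one J.2.2 (J.mem_list a)

lemma NSOp.tot_dl (J : NSOp n) a : tot a (dl 1 J.list) = J.color a - 1 := by
  have := tot_fl_add_tot_dl a 1 J.list
  rw [tot_fl J.isTrav, J.itp_list, J.count_list, Nat.add_sub_cancel] at this
  linear_combination this

lemma MNSOp.tot_dl (X : MNSOp n) a :
    tot a (fl 0 X.list ++ dl 0 X.list) = X.color a := by
  rw [tot_append, tot_fl_add_tot_dl, X.count_list, Nat.add_sub_cancel]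

/-- The weighted word of a pair. -/
def PatchPair.lam {n : ℕ} (Z : PatchPair n) : List (Fin n × ZMod 2) :=
  QuiltPatch.lam Z.1.list Z.2.list

lemma PatchPair.tot_lam (Z : PatchPair n) a : tot a Z.lam = Z.inDeg a := by
  rw [lam, QuiltPatch.lam, tot_append, MNSOp.tot_dl, NSOp.tot_dl, inDeg]
  push_cast
  ring

lemma PatchPair.lam_relabel σ (Z : PatchPair n) :
    (Z.relabel σ).lam = Z.lam.map (Prod.map σ id) := by
  simp [lam, QuiltPatch.lam, relabel, MNSOp.list_relabel, NSOp.list_relabel,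
    fl_map σ.injective, dl_map σ.injective, List.map_append]

lemma PatchPair.inv_relabel σ (Z : PatchPair n) :
    inv (Z.relabel σ).lam = inv Z.lam + Z.koszul σ := by
  rw [lam_relabel, inv_map, koszul]
  simp only [tot_lam]
  push_cast
  rfl

section Runs

variable {α : Type}

open Classical in
/-- The letters satisfying `P` are given two free inputs. -/
def fillL (P : α → Prop) (l : List (Option α)) : List (Option α) :=
  l.flatMap fun s => s.elim [none] fun a => run a (if P a then 2 else 0)

lemma mem_fillL {a : α} :
    some a ∈ fillL P l ↔ some a ∈ l := by
  rw [fillL, List.mem_flatMap]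
  constructor
  · rintro ⟨_ | b, hb, h⟩
    · simp at h
    grind [run]
  grind [run]

lemma fillL_append (P : α → Prop) l m :
    fillL P (l ++ m) = fillL P l ++ fillL P m := List.flatMap_append

open Classical in
lemma fillL_cons P (a : α) l :
    fillL P (some a :: l) = run a (if P a then 2 else 0) ++ fillL P l := rfl

variable [DecidableEq α]

lemma eqv_dl_run (a : α) s κ l :
    Eqv (dl κ (run a s ++ l)) ((a, s + ind (some a ∈ l) + κ) :: dl (ind (some a ∈ l)) l) := by
  induction s generalizing κ with
  | zero => grind [run_zero, Eqv.refl, dl]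
  | succ s ih =>
    have hm : some a ∈ none :: (run a s ++ l) := by
      obtain ⟨w, hw⟩ := run_eq_cons a s
      simp [hw]
    rw [run_succ, List.cons_append, List.cons_append, dl, ind_true hm, dl]
    refine ((ih 0).cons _).trans ((eqv_merge _ _ _ _).trans ?_)
    grind [Eqv.refl, ind]

lemma eqv_fl_run (a : α) s κ l :
    Eqv (fl κ (run a s ++ l)) (fl (ind (some a ∈ l)) l ++ [(a, κ)]) := by
  induction s generalizing κ with
  | zero => grind [run_zero, Eqv.refl, fl]
  | succ s ih =>
    refine ((ih 0).append (Eqv.refl _)).trans ?_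
    rw [List.append_assoc]
    exact (Eqv.refl _).append (eqv_zero _ _)

lemma eqv_fillL (P : α → Prop) κ l :
    Eqv (dl κ (fillL P l)) (dl κ l) ∧ Eqv (fl κ (fillL P l)) (fl κ l) := by
  induction l generalizing κ with
  | nil => exact ⟨Eqv.refl _, Eqv.refl _⟩
  | cons s l ih =>
    rcases s with _ | a
    · exact ih 0
    rw [fillL_cons]
    refine ⟨(eqv_dl_run _ _ _ _).trans ?_, (eqv_fl_run _ _ _ _).trans ?_⟩ <;>
      rw [mem_fillL]
    · have h2 : ∀ (p : Prop) [Decidable p], (((if p then 2 else 0) : ℕ) : ZMod 2) = 0 :=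
        fun p _ => by split_ifs <;> rfl
      rw [h2, zero_add, dl]
      exact (ih _).1.cons _
    · exact (ih _).2.append (Eqv.refl _)

end Runs

namespace Term

variable {α : Type} [DecidableEq α]

lemma zl_walk {a : α} (L : List _) (ha : ∀ E ∈ L, some a ∉ E)
    (hs : s ≤ L.length) : zl a s (some a :: (L.map (· ++ [some a])).flatten) =
      ((L.take s).map nones).sum := by
  induction L generalizing s with
  | nil => grind [zl]
  | cons E L ih =>
    cases s with
    | zero => simp [zl]
    | succ s =>
      have h0 := List.count_eq_zero_of_not_mem (ha E (by simp))
      have := zl_append_right E (some a :: (L.map (· ++ [some a])).flatten) s (a := a)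
      grind [zl_succ]

lemma zl_child {a : α} (hx : x ≠ a) L M
    (ha : ∀ E ∈ L, some a ∉ E) (hs : s < E.count (some a)) :
    zl a s (((L ++ E :: M).map (· ++ [some x])).flatten) = (L.map nones).sum + zl a s E := by
  induction L with
  | nil => grind [zl_append_left]
  | cons F L ih =>
    have h0 : (F ++ [some x]).count (some a) = 0 :=
      List.count_eq_zero_of_not_mem (by grind)
    have := zl_append_right (F ++ [some x]) (((L ++ E :: M).map (· ++ [some x])).flatten) s (a := a)
    grind [nones]

lemma Linear.count_child {c} (ht : (node x q c).Linear) {a : α}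
    (hx : x ≠ a) {j} (hj : some a ∈ (c j).enc) :
    (node x q c).enc.count (some a) = (c j).enc.count (some a) := by
    rw [count_enc, count_enc, arity, count, if_neg hx, if_neg hx, zero_add, zero_add]
    have h0 : ∀ i, i ≠ j → (c i).arity a + (c i).count a = 0 := fun i hi => by
      rw [← count_enc]
      exact List.count_eq_zero_of_not_mem fun h => hi (ht.eq_of_mem_child h hj)
    congr 1
    · exact Finset.sum_eq_single j (fun i _ hi => by have := h0 i hi; omega) (by simp)
    · exact Finset.sum_eq_single j (fun i _ hi => by have := h0 i hi; omega) (by simp)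

lemma Linear.zeta_eq {t : Term α} (ht : t.Linear)
    (hs : s < t.enc.count (some a)) : t.zeta a s = zl a s t.enc := by
  induction t with
  | leaf => simp [enc] at hs
  | mul l r ih1 ih2 =>
    rw [zeta, enc]
    rw [enc, List.count_append] at hs
    by_cases hl : some a ∈ l.enc
    · grind [Term.Linear.disjoint_of_mul, some_mem_enc, Term.Linear.left_of_mul, zl_append_left]
    · have := zl_append_right l.enc r.enc s (a := a)
      grind [some_mem_enc, Term.Linear.right_of_mul, nones_enc]
  | node x q c ih =>
    have hsum : ∀ s, ((List.take s (List.ofFn fun j => (c j).enc)).map nones).sum =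
        ∑ j : Fin q, if j.1 < s then (c j).leaves else 0 := fun s => by
      grind [List.map_take, List.sum_take_ofFn, Finset.sum_filter, nones_enc]
    by_cases hx : x = a
    · subst hx
      have hq : s ≤ q := by
        have h1 := count_enc (node x q c) x
        have h2 := ht x
        have h3 : ∑ j, (c j).arity x = 0 := Finset.sum_eq_zero fun j _ => by
          have := count_enc (c j) x
          rw [List.count_eq_zero_of_not_mem (ht.notMem_child j)] at this
          omega
        grind [arity]
      rw [zeta, if_pos rfl, enc_node, zl_walk _ _ (by simpa using hq), hsum]
      simp_all [Term.Linear.notMem_child]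
    obtain ⟨j, hj⟩ : ∃ j, some a ∈ (c j).enc := by
      grind [List.count_pos_iff, List.mem_flatten, enc]
    have hL : j.1 < (List.ofFn fun j => (c j).enc).length := by simp
    have e : (List.ofFn fun j => (c j).enc) = (List.ofFn fun j => (c j).enc).take j ++
        (c j).enc :: (List.ofFn fun j => (c j).enc).drop (j + 1) := by
      conv_lhs => rw [← List.take_append_drop j (List.ofFn fun j => (c j).enc),
        List.drop_eq_getElem_cons hL]
      simp
    have hlt : s < (c j).enc.count (some a) := ht.count_child hx hj ▸ hs
    rw [zeta, if_neg hx, Finset.sum_eq_single j, if_pos ((some_mem_enc _ _).1 hj),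
      ih j (ht.child j) hlt, enc_node, zl_of_ne hx]
    · conv_rhs => rw [e]
      rw [zl_child hx _ _ _ hlt, hsum]
      · rfl
      · intro E hE
        obtain ⟨i, hi, rfl⟩ := List.mem_take_iff_getElem.1 hE
        simp only [List.getElem_ofFn]
        intro h
        have := congrArg Fin.val (ht.eq_of_mem_child h hj)
        grind
    · intro i _ hi
      rw [if_neg fun h => hi (ht.eq_of_mem_child ((some_mem_enc _ _).2 h) hj)]
    · simp

lemma Linear.enc_fill {t : Term α} (ht : t.Linear)
    (hP : ∀ a, some a ∈ t.enc → (P a ↔ t.enc.count (some a) = 1)) : t.fill.enc = fillL P t.enc := by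
  induction t with
  | leaf => rfl
  | mul l r ih1 ih2 =>
    grind [fillL_append, Term.Linear.left_of_mul, Term.Linear.right_of_mul, Term.Linear.disjoint_of_mul, fill, enc]
  | node x q c ih =>
    rcases Nat.eq_zero_or_pos q with rfl | hq
    · simp [fill, enc, fillL, run, hP x (by simp [enc])]
    have hx' : ¬ P x := by
      grind [count_enc, arity, count]
    rw [fill, if_neg hq.ne', enc, enc, fillL_cons, if_neg hx', run_zero']
    congr 1
    have h1 : ∀ L : List (List (Option α)), fillL P L.flatten = (L.map (fillL P)).flatten := fun L => by
      induction L with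
      | nil => rfl
      | cons E L ihL => grind [fillL_append]
    rw [h1, List.map_ofFn]
    congr 2
    funext j
    rw [Function.comp, fillL_append, ih j (ht.child j)]
    · grind [run_zero, fillL]
    · intro a ha
      have hxa : x ≠ a := fun e => ht.notMem_child j (e ▸ ha)
      rw [← ht.count_child hxa ha]
      exact hP a (by simpa [enc, List.mem_flatten, List.mem_ofFn, hxa.symm] using ⟨j, ha⟩)

end Term

section Sign

variable (k : Type u) [CommRing k]

/-- The sign given by a parity. -/
def sg (x : ZMod 2) : k := if x = 0 then 1 else -1

lemma zmod_cases (x : ZMod 2) : x = 0 ∨ x = 1 := by revert x; decide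

lemma sg_add x y : sg k (x + y) = sg k x * sg k y := by
  have h2 : (1 + 1 : ZMod 2) = 0 := by decide
  rcases zmod_cases x with rfl | rfl <;> rcases zmod_cases y with rfl | rfl <;> simp [sg, h2]

lemma sg_natCast (N : ℕ) : sg k N = (-1) ^ N := by
  induction N with
  | zero => simp [sg]
  | succ N ih => grind [sg_add, sg]

lemma sg_one_add x : sg k (x + 1) = - sg k x := by rw [sg_add]; simp [sg]

lemma sg_mul_self x : sg k x * sg k x = 1 := by grind [sg]

lemma intCast_sg x : (sg ℤ x : k) = sg k x := by simp [sg]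

lemma eps_eq_sg e : eps k e = sg k e := by
  rcases Int.even_or_odd e with h | h
  · simp_all [ZMod.intCast_eq_zero_iff_even, eps, sg]
  · rw [(ZMod.intCast_eq_one_iff_odd).2 h, eps, Int.negOnePow_odd _ h]; simp [sg]

end Sign

lemma natCast_card_filter {ι} (s : Finset ι) p [DecidablePred p] :
    (s.filter p).card = ∑ x ∈ s, ind (p x) := by
  rw [Finset.card_filter, Nat.cast_sum]
  refine Finset.sum_congr rfl fun x _ => ?_
  simp_all [ind]

lemma coe_shuffleSign (s : Fin n → Finset ℕ) pos
    (hm : ∀ a, ∀ i ∈ s a, ∀ j ∈ s a, i < j → pos a i ≤ pos a j) :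
    (shuffleSign (Finset.univ.sigma s) pos : ℤ) = sg ℤ (∑ a, ∑ b, if a < b then
      ∑ j ∈ s b, ∑ i ∈ s a, ind (pos b j < pos a i) else 0) := by
  rw [shuffleSign, Units.val_pow_eq_pow_val, Units.val_neg, Units.val_one, ← sg_natCast,
    natCast_card_filter, Finset.sum_product, Finset.sum_sigma]
  congr 1
  refine Finset.sum_congr rfl fun a _ => ?_
  simp [Finset.sum_sigma]
  rw [Finset.sum_comm]
  refine Finset.sum_congr rfl fun b _ => ?_
  split_ifs with hab
  · rw [Finset.sum_comm]
    simp [hab]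
  grind [Finset.sum_eq_zero, ind_false]

lemma sum_range_wt (hs : s ⊆ Finset.range N) {w v : ℕ → ZMod 2}
    (h0 : ∀ i < N, i ∉ s → w i = 0) (h1 : ∀ i ∈ s, w i = v i) (f : ℕ → ZMod 2) :
    ∑ i ∈ Finset.range N, w i * f i = ∑ i ∈ s, v i * f i := by
  rw [← Finset.sum_subset hs fun i hi hi' => by grind]
  grind [Finset.sum_congr]

section Filled

variable {α : Type} {t : Term α}

lemma Term.count_fill (t : Term α) a : t.fill.count a = t.count a := by
  induction t with
  | leaf => rfl
  | mul l r ih1 ih2 => simp [fill, count, ih1, ih2]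
  | node x q c ih =>
    rcases Nat.eq_zero_or_pos q with rfl | hq
    · simp [fill, count]
    · simp [fill, if_neg hq.ne', count, ih]

lemma Term.Linear.fill (ht : t.Linear) : t.fill.Linear := fun a => by
  rw [count_fill]; exact ht a

variable [DecidableEq α]

lemma count_fillL P l (a : α) : (fillL P l).count (some a) =
    (open Classical in if P a then 3 * l.count (some a) else l.count (some a)) := by
  induction l with
  | nil => simp [fillL]
  | cons s l ih =>
    rcases s with _ | b
    · grind [fillL]
    grind [fillL_cons, run]

lemma Term.Linear.eqv_fill (ht : t.Linear) κ :
    Eqv (dl κ t.fill.enc) (dl κ t.enc) ∧ Eqv (fl κ t.fill.enc) (fl κ t.enc) := by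
  rw [ht.enc_fill fun a _ => Iff.rfl]
  exact eqv_fillL _ _ _

lemma Term.Linear.count_fill_enc (ht : t.Linear) a : t.fill.enc.count (some a) =
    if t.enc.count (some a) = 1 then 3 else t.enc.count (some a) := by
  rw [ht.enc_fill fun a _ => Iff.rfl, count_fillL]
  grind

lemma Term.Linear.prs_dl (ht : t.Linear) (hab : a ≠ b)
    {s : α → Finset ℕ} {v : α → ℕ → ZMod 2} (hs : ∀ c,
      s c ⊆ Finset.range (t.fill.enc.count (some c)) ∧
      (∀ i < t.fill.enc.count (some c), i ∉ s c → wt c κ t.fill.enc i = 0) ∧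
      ∀ i ∈ s c, wt c κ t.fill.enc i = v c i) :
    prs b a (dl κ t.enc) = ∑ j ∈ s b, ∑ i ∈ s a, v b j * v a i *
      ind (t.fill.zeta b j < t.fill.zeta a i) := by
  rw [← ((ht.eqv_fill κ).1 a b).2 hab, QuiltPatch.prs_dl hab ht.fill.isTrav _ rfl
    fun _ => Or.inl rfl]
  · simp [mul_assoc, ← Finset.mul_sum]
    rw [sum_range_wt (hs b).1 (hs b).2.1 (hs b).2.2]
    refine Finset.sum_congr rfl fun j hj => ?_
    rw [sum_range_wt (hs a).1 (hs a).2.1 (hs a).2.2]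
    congr 1
    refine Finset.sum_congr rfl fun i hi => ?_
    rw [ht.fill.zeta_eq (Finset.mem_range.1 ((hs a).1 hi)),
      ht.fill.zeta_eq (Finset.mem_range.1 ((hs b).1 hj))]
  grind [Term.Linear.count_fill_enc]

end Filled

lemma Term.Linear.exists_colors {t : Term _} (ht : t.Linear) {f : Fin n → ℕ}
    (hf : ∀ a, t.enc.count (some a) = f a + 1) :
    ∃ q : Fin n → ℕ, (q = fun a => if f a = 0 then 2 else f a) ∧ (∀ a, 0 < q a) ∧
      (∀ a, t.fill.enc.count (some a) = q a + 1) ∧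
      ∀ a i j, i < j → j < q a → t.fill.zeta a i ≤ t.fill.zeta a j := by
  have hc : ∀ a, t.fill.enc.count (some a) = (if f a = 0 then 2 else f a) + 1 := fun a => by
    grind [Term.Linear.count_fill_enc]
  refine ⟨_, rfl, fun a => ?_, hc, fun a i j hij hj => ?_⟩
  · split_ifs <;> omega
  have h := hc a
  rw [ht.fill.zeta_eq (by omega), ht.fill.zeta_eq (by omega)]
  simp_all [zl_mono, LT.lt.le]

lemma Term.Linear.itp_fill {t : Term (Fin n)} (ht : t.Linear) a κ :
    itp a κ t.fill.enc = itp a κ t.enc := by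
  rw [← tot_fl ht.fill.isTrav, ((ht.eqv_fill κ).2 a a).1, tot_fl ht.isTrav]

lemma coe_treeSign (J : NSOp n) : (treeSign J : ℤ) = sg ℤ (inv (dl 1 J.list)) := by
  have ht := J.2.1.linear
  obtain ⟨p, hp, hp0, hc, hz⟩ := ht.exists_colors J.count_list
  have e : treeSign J = shuffleSign (Finset.univ.sigma fun a => Finset.Ico 1 (p a))
    (fun a i => J.1.fill.zeta a i) := by rw [hp]; rfl
  rw [e, coe_shuffleSign]
  · congr 1
    refine Finset.sum_congr rfl fun a _ => Finset.sum_congr rfl fun b _ => ?_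
    split_ifs with hab
    · rw [NSOp.list, ht.prs_dl hab.ne (s := fun a => Finset.Ico 1 (p a)) (v := fun _ _ => 1)]
      · simp
      · intro c
        have hi := (ht.itp_fill c 1).trans (J.itp_list c)
        grind [ind_true, ind_false, wt]
    · rfl
  grind

lemma itp_eq_one_iff (W : Word n) a :
    itp a 0 (W.1.map some) = 1 ↔ W.Interposed a := by
  obtain ⟨w, h0, h1, h2⟩ := W
  have key : ∀ b p q, w = p ++ b :: a :: q → a ∉ p →
      (itp a 0 (w.map some) = 1 ↔ b ∈ q) := by
    rintro b p q rfl hp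
    have hb : b ≠ a := fun e => h1 a ⟨p, q, by simp [e]⟩
    grind [itp_append, itp, ind]
  constructor
  · intro h
    obtain ⟨p, q, e, hp⟩ := List.eq_append_cons_of_mem (h0 a)
    rcases List.eq_nil_or_concat p with rfl | ⟨p, b, rfl⟩
    · grind [itp]
    · exact ⟨b, p, q, by simp [e], (key b p q (by simp [e]) (by simp at hp; tauto)).1 h⟩
  rintro ⟨b, p, q, e, hb⟩
  refine (key b p q e fun hp => h2 a b (fun e' => h1 a ⟨p, q, by simpa [e'] using e.symm⟩) ?_).2 hb
  grind

lemma mem_unrun {a : α} {σ} : some a ∈ unrun σ ↔ a ∈ σ.map Prod.fst := by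
  rw [← mem_wd, wd_unrun, mem_dst]

lemma eqv_fl_unrun {α} [DecidableEq α] (σ : List (α × ℕ)) κ :
    Eqv (fl κ (unrun σ)) (fl κ ((σ.map Prod.fst).map some)) := by
  induction σ generalizing κ with
  | nil => exact Eqv.refl _
  | cons p σ ih =>
    rw [unrun_cons]
    refine (eqv_fl_run _ _ _ _).trans ?_
    rw [mem_unrun, List.map_cons, List.map_cons, fl]
    simp only [List.mem_map_of_injective (Option.some_injective _)]
    exact (ih _).append (Eqv.refl _)

lemma eqv_fl_wd {l : List (Option (Fin n))} (hl : FullL l) (ht : IsTrav l) κ :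
    Eqv (fl κ l) (fl κ ((wd l).map some)) := by
  grind [fullL_iff, wd_unrun_of_isTrav, eqv_fl_unrun]

lemma isTrav_map_some (W : Word n) : IsTrav (W.1.map some) := by
  have := isTrav_unrun (σ := W.1.map fun a => (a, 0)) (by simpa [Function.comp_def] using W.2)
  grind [run_zero, List.map_eq_flatMap, unrun]

lemma idxOf_map_some {α : Type} [DecidableEq α] a (l : List α) :
    (l.map some).idxOf (some a) = l.idxOf a := by
  induction l with
  | nil => rfl
  | cons b l ih => simp [List.idxOf_cons, ih]

open Classical in
lemma coe_wordSign {W : Word n} {X} (hX : FullL X.list) (hW : wd X.list = W.1) :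
    (wordSign W X : ℤ) = sg ℤ (inv (fl 0 X.list ++ dl 0 X.list)) := by
  obtain ⟨⟨t, hv⟩, rfl⟩ := Quotient.exists_rep X
  set X : MNSOp n := Quotient.mk _ ⟨t, hv⟩ with hXd
  have hl : X.list = t.enc := rfl
  have ht := hv.linear
  obtain ⟨q, hq, hq0, hc, hz⟩ := ht.exists_colors X.count_list
  have e : wordSign W X = shuffleSign (Finset.univ.sigma fun a => Finset.range (q a)) (fun a i =>
      open Classical in if i = 0 ∧ W.Interposed a then -1 - W.1.idxOf a else t.fill.zeta a i) := by
    rw [hq]; rfl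
  have hfl : Eqv (fl 0 t.enc) _ := hW ▸ eqv_fl_wd hX X.isTrav 0
  have hi : ∀ a, itp a 0 _ = 1 ↔ W.Interposed a := fun a => by
    rw [← itp_eq_one_iff, ← tot_fl ht.isTrav, (hfl a a).1, tot_fl (isTrav_map_some W)]
  have hi' : ∀ a, itp a 0 _ = if W.Interposed a then 1 else 0 := fun a => by
    split_ifs with h
    · exact (hi a).2 h
    · exact (zmod_cases _).resolve_right fun h' => h ((hi a).1 h')
  rw [e, coe_shuffleSign, hl]
  · congr 1
    refine Finset.sum_congr rfl fun a _ => Finset.sum_congr rfl fun b _ => ?_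
    split_ifs with hab
    · have h1 : prs b a (fl 0 t.enc) = itp a 0 t.enc * itp b 0 t.enc *
          ind (W.1.idxOf a < W.1.idxOf b) := by
        rw [(hfl a b).2 hab.ne, prs_fl hab.ne (isTrav_map_some W), ← tot_fl (isTrav_map_some W),
          ← tot_fl (isTrav_map_some W), ← (hfl a a).1, ← (hfl b b).1, tot_fl ht.isTrav, tot_fl ht.isTrav,
          idxOf_map_some, idxOf_map_some]
      set v : Fin n → ℕ → ZMod 2 := fun c i => 1 + if i = 0 then itp c 0 t.enc else 0 with hv
      have hs : ∀ c, Finset.range (q c) ⊆ Finset.range (t.fill.enc.count (some c)) ∧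
          (∀ i < t.fill.enc.count (some c), i ∉ Finset.range (q c) → wt c 0 t.fill.enc i = 0) ∧
          ∀ i ∈ Finset.range (q c), wt c 0 t.fill.enc i = v c i := fun c => by
        grind [ind_false, ind_true, Term.Linear.itp_fill, wt]
      have h2 : tot a (dl 0 t.enc) = ∑ i ∈ Finset.range (q a), v a i := by
        rw [← ((ht.eqv_fill 0).1 a a).1, tot_dl ht.fill.isTrav]
        simpa using sum_range_wt (hs a).1 (hs a).2.1 (hs a).2.2 fun _ => 1
      have h3 : ∀ c (f : ℕ → ZMod 2), f 0 = ∑ i ∈ Finset.range (q c), if i = 0 then f i else 0 :=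
        fun c f => by aesop
      rw [prs_append, h1, h2, tot_fl ht.isTrav, ht.prs_dl hab.ne hs,
        h3 b fun j => itp a 0 _ * itp b 0 _ * ind _,
        h3 b fun j => itp b 0 _ * ∑ i ∈ Finset.range _, v a i, ← Finset.sum_add_distrib,
        ← Finset.sum_add_distrib]
      refine Finset.sum_congr rfl fun j hj => ?_
      rw [h3 a fun i => if j = 0 then itp a 0 _ * itp b 0 _ * ind _
        else 0, show (if j = 0 then itp b 0 _ * ∑ i ∈ Finset.range _, v a i else 0) =
        ∑ i ∈ Finset.range (q a), (if j = 0 then itp b 0 t.enc else 0) * v a i by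
          rw [← Finset.mul_sum]; split_ifs <;> simp, ← Finset.sum_add_distrib, ← Finset.sum_add_distrib]
      refine Finset.sum_congr rfl fun i hi => ?_
      have e2 : (1 + 1 : ZMod 2) = 0 := by decide
      simp [hv]
      have f2 : ∀ x z : ℕ, ind ((-1 - x : ℤ) < z) = 1 := fun x z => ind_true (by omega)
      have f3 : ∀ x z : ℕ, ind ((z : ℤ) < -1 - x) = 0 := fun x z => ind_false (by omega)
      by_cases hA : W.Interposed a <;> by_cases hB : W.Interposed b <;> by_cases hi0 : i = 0 <;>
        by_cases hj0 : j = 0 <;> simp [hA, hB, hi0, hj0, hi' a, hi' b, f2, f3, e2]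
    · rfl
  grind

lemma fullL_map (f : α → β) {l} (h : FullL l) :
    FullL (l.map (Option.map f)) := by
  obtain ⟨σ, rfl⟩ := fullL_iff.1 h
  refine fullL_iff.2 ⟨σ.map (Prod.map f id), ?_⟩
  simp_all [List.map_flatMap, List.flatMap_map, unrun, run]

lemma wd_map {f : α → β} (hf : Function.Injective f) l :
    wd (l.map (Option.map f)) = (wd l).map f := by
  simp_all [dst_map_of_injective, wd]

section Coeff

variable {n : ℕ} {k : Type u} [CommRing k]

/-- The word of an operation. -/
def MNSOp.toWord (X : MNSOp n) : Word n := ⟨wd X.list, isFSWord_wd X.isTrav X.mem_list⟩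

/-- The word and the tree of a pair. -/
def PatchPair.shape (Z : PatchPair n) : Word n × PTree n := (Z.1.toWord, Z.2.tree)

lemma inv_lam (Z : PatchPair n) : inv Z.lam = inv (fl 0 Z.1.list ++ dl 0 Z.1.list) +
    inv (dl 1 Z.2.list) + hadamardExp Z := by
  simp only [PatchPair.lam, lam, inv, hadamardExp, Int.cast_sum, ← Finset.sum_add_distrib]
  refine Finset.sum_congr rfl fun a _ => Finset.sum_congr rfl fun b _ => ?_
  split_ifs with hab
  · rw [prs_append _ _ _, MNSOp.tot_dl, NSOp.tot_dl]
    push_cast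
    ring
  · simp

variable (k) in
/-- The colouring map on the underlying modules of coefficients. -/
def phiF : FSBraceObj k n →ₗ[k] PairObj k n := phi k n

open Classical in
lemma phi_apply x (Z : PatchPair n) : phiF k x Z =
    if FullL Z.1.list then sg k (inv Z.lam) * x Z.shape else 0 := by
  have hb : ∀ Q,
      ((hadamardExp Z).negOnePow * (phiBarCoeff Q.1 Z.1 * phiCoeff Q.2 Z.2) : ℤ) =
      if FullL Z.1.list ∧ Z.shape = Q then sg k (inv Z.lam) else 0 := by
    rintro ⟨W, T⟩
    have hs : Z.shape = (W, T) ↔ wd _ = W.1 ∧ Z.2.tree = T :=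
      ⟨fun h => ⟨congrArg (·.1.1) h, congrArg (·.2) h⟩, fun h => Prod.ext (Subtype.ext h.1) h.2⟩
    simp only [phiBarCoeff, phiCoeff, isWordColoring_iff, isTreeColoring_iff, hs]
    by_cases h1 : FullL Z.1.list ∧ wd Z.1.list = W.1
    · by_cases h2 : Z.2.tree = T
      · rw [if_pos h1, if_pos h2, if_pos ⟨h1.1, h1.2, h2⟩, coe_wordSign h1.1 h1.2, coe_treeSign,
          inv_lam, sg_add, sg_add, ← eps_eq_sg, eps]
        grind [intCast_sg]
      · simp [h2]
    · simp only [← and_assoc, h1, if_false]; simp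
  have h1 : phiF k x Z = x.sum fun Q a => a *
      ((hadamardExp Z).negOnePow * (phiBarCoeff Q.1 Z.1 * phiCoeff Q.2 Z.2) : ℤ) := by
    change Finsupp.linearCombination (M := PairObj k n) k _ x Z = _
    rw [Finsupp.linearCombination_apply, Finsupp.sum, Finset.sum_apply]
    rfl
  rw [h1]
  simp [hb]
  split_ifs with hf
  · simp only [hf, true_and, mul_ite, mul_zero]
    rw [Finsupp.sum_ite_eq, mul_comm]
    grind
  · simp [hf]

lemma exists_shape Q : ∃ Z : PatchPair n, FullL Z.1.list ∧ Z.shape = Q := by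
  obtain ⟨W, T⟩ := Q
  obtain ⟨J, rfl⟩ := T.exists_coloring
  obtain ⟨X, hX⟩ := MNSOp.exists_list J.pos (isTrav_map_some W) fun a => by simpa using W.2.1 a
  have hf : FullL X.list := by
    rw [hX]
    exact fullL_iff.2 ⟨W.1.map fun a => (a, 0), by
      simp [unrun, List.flatMap_map, run_zero, ← List.map_eq_flatMap]⟩
  refine ⟨(X, J), hf, Prod.ext (Subtype.ext ?_) rfl⟩
  have hr : (W.1.map some).reduceOption = W.1 := by simp [List.reduceOption]
  simp [PatchPair.shape, MNSOp.toWord, hX, wd, hr]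
  exact dst_of_isChain (isChain_iff_infix.2 W.2.2.1)

lemma phi_injective : Function.Injective (phiF k (n := n)) := by
  rw [injective_iff_map_eq_zero]
  intro x hx
  refine Finsupp.ext fun Q => ?_
  obtain ⟨Z, hZ, rfl⟩ := exists_shape Q
  have h := congrFun hx Z
  rw [phi_apply, if_pos hZ] at h
  have := congrArg (sg k (inv Z.lam) * ·) h
  rw [← mul_assoc, sg_mul_self, one_mul] at this; simp_all

lemma phi_ne_zero_iff x (Z : PatchPair n) :
    phiF k x Z ≠ 0 ↔ FullL Z.1.list ∧ x Z.shape ≠ 0 := by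
  rw [phi_apply]
  grind [sg]

lemma deg_shape {Z : PatchPair n} (hf : FullL Z.1.list) : Z.shape.1.deg = Z.deg := by
  have h1 := hf.length_wd Z.1.isTrav
  have h2 := Z.1.length_list_eq
  have h3 := Z.2.length_list_eq
  have h4 := Z.2.length_list
  rw [MNSOp.nones_list] at h1
  rw [NSOp.nones_list] at h4
  simp [Finset.sum_add_distrib, Finset.sum_const, Finset.card_univ, Fintype.card_fin] at h2 h3
  simp [Word.deg, PatchPair.shape, MNSOp.toWord, PatchPair.deg, PatchPair.inDeg,
    Finset.sum_sub_distrib, Finset.sum_add_distrib, Finset.sum_const, Finset.card_univ,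
    Fintype.card_fin, ← Nat.cast_sum]
  grind

lemma isQuilt_shape {Z : PatchPair n} : IsQuilt Z.shape.1 Z.shape.2 ↔ Z.IsPatch := by
  rw [PatchPair.isPatch_iff]
  have h2 : ∀ {u v}, u ≠ v → ([u, v].Sublist _ ↔ [some u, some v].Sublist Z.1.list) :=
    fun huv => ⟨fun h => map_sublist_of_wd h, fun h => sublist_wd (by simpa using huv) h⟩
  have h3 : ∀ {u v}, u ≠ v → ([u, v, u].Sublist _ ↔
      [some u, some v, some u].Sublist Z.1.list) :=
    fun huv => ⟨fun h => map_sublist_of_wd h, fun h => sublist_wd (by grind) h⟩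
  constructor
  · rintro ⟨q1, q2⟩
    exact ⟨fun a b h => ⟨h.1, fun hs => q1 b a ((h2 h.1.symm).2 hs) h⟩,
      fun a b h => q2 a b h.1 ((h3 h.1).2 h.2)⟩
  rintro ⟨q1, q2⟩
  exact ⟨fun u v h hl => (q1 v u hl).2 ((h2 hl.1.symm).1 h),
    fun u v huv h => q2 u v ⟨huv, (h3 huv).1 h⟩⟩

lemma shape_relabel σ (Z : PatchPair n) :
    Z.shape = ((Z.relabel σ).shape.1.act σ, (Z.relabel σ).shape.2.act σ) := by
  refine Prod.ext (Subtype.ext ?_) (PTree.ext ?_ ?_)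
  · simp [PatchPair.shape, MNSOp.toWord, Word.act, PatchPair.relabel, MNSOp.list_relabel,
      wd_map σ.injective]
  · simp_all [NSOp.list_relabel, LLt.map_iff, PatchPair.shape, NSOp.tree, PTree.act, PatchPair.relabel]
  simp_all [NSOp.list_relabel, LLeft.map_iff, PatchPair.shape, NSOp.tree, PTree.act, PatchPair.relabel]

lemma act_injective σ :
    Function.Injective fun Q : Word n × PTree n => (Q.1.act σ, Q.2.act σ) := by
  rintro ⟨W, T⟩ ⟨W', T'⟩ h
  simp at h
  refine Prod.ext (Subtype.ext (List.map_injective_iff.2 σ.symm.injective (congrArg Subtype.val h.1))) (PTree.ext ?_ ?_)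
  · funext a b
    simpa [PTree.act] using congrFun (congrFun (congrArg PTree.lt h.2) (σ.symm a)) (σ.symm b)
  funext a b
  simpa [PTree.act] using congrFun (congrFun (congrArg PTree.left h.2) (σ.symm a)) (σ.symm b)

lemma phi_act σ (x : FSBraceObj k n) :
    phiF k (x.mapDomain fun Q => (Q.1.act σ, Q.2.act σ)) = pairAct k σ (phiF k x) := by
  funext Z
  have hf : FullL (Z.relabel σ).1.list ↔ FullL Z.1.list := by
    simp [PatchPair.relabel, MNSOp.list_relabel]
    refine ⟨fun h => ?_, fullL_map σ⟩
    simpa using fullL_map σ.symm h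
  have hx : x.mapDomain (fun Q => (Q.1.act σ, Q.2.act σ)) Z.shape = x (Z.relabel σ).shape := by
    rw [shape_relabel σ Z]
    simp_all [act_injective]
  grind [pairAct_apply, phi_apply, PatchPair.inv_relabel, eps_eq_sg, sg_add, sg]

end Coeff

section Filter

variable {n : ℕ}

lemma bel_cons (a : Fin n) p D :
    bel a (p :: D) = (if p.1 < a then p.2 else 0) + bel a D := by
  have h1 : (∑ b, if b < a then if p.1 = b then p.2 else 0 else 0) = if p.1 < a then p.2 else 0 := by
    rw [Finset.sum_eq_single p.1 (fun b _ hb => by simp [hb.symm]) (by simp)]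
    simp
  rw [← h1, bel, bel, ← Finset.sum_add_distrib]
  refine Finset.sum_congr rfl fun b _ => ?_
  rw [tot_cons]
  split_ifs <;> simp

lemma inv_cons (a : Fin n) w D :
    inv ((a, w) :: D) = inv D + w * bel a D := by
  have := inv_insert a w [] D
  rwa [List.nil_append, List.nil_append, size_nil, tot_nil, add_zero, zero_add] at this

/-- The part of a weighted word without the letter `i`. -/
def off (i : Fin n) (D : List (Fin n × ZMod 2)) : List (Fin n × ZMod 2) := D.filter (·.1 ≠ i)

lemma tot_off {a : Fin n} (ha : a ≠ i) D :
    tot a (off i D) = tot a D := by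
  induction D with
  | nil => rfl
  | cons p D ih =>
    by_cases hp : p.1 = i
    · rw [off, List.filter_cons_of_neg (by simp [hp]), tot_cons, if_neg (by rw [hp]; exact ha.symm),
        zero_add]
      exact ih
    rw [off, List.filter_cons_of_pos (by simp [hp]), tot_cons, tot_cons]
    exact congrArg _ ih

lemma eq_sum_ite (a : Fin n) (x : ZMod 2) : x = ∑ c, if a = c then x else 0 := by simp

lemma off_cons (i) (p : Fin n × ZMod 2) (D) :
    off i (p :: D) = if p.1 = i then off i D else p :: off i D := by
  grind [off]

lemma inv_off (i : Fin n) D : inv D = inv (off i D) +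
    (∑ c, if c = i then 0 else prs c i D) + tot i D * bel i D := by
  induction D with
  | nil => simp [off, prs, tot_nil]
  | cons p D ih =>
    obtain ⟨a, w⟩ := p
    by_cases ha : a = i
    · have : (∑ c, if c = a then 0 else prs c a ((a, w) :: D)) = ∑ c, if c = a then 0 else prs c a D :=
        Finset.sum_congr rfl fun c _ => by grind [prs]
      grind [off_cons, inv_cons, bel_cons, tot_cons]
    have h1 : (∑ c, if c = i then 0 else prs c i ((a, w) :: D)) =
        w * tot i D + ∑ c, if c = i then 0 else prs c i D := by
      rw [eq_sum_ite a (w * tot i D), ← Finset.sum_add_distrib]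
      exact Finset.sum_congr rfl fun c _ => by grind [prs]
    have h3 : bel a D = bel a (off i D) + if i < a then tot i D else 0 := by
      clear ih h1
      induction D <;> grind [off_cons, bel_cons, tot_cons, bel, tot_nil, off]
    grind [off_cons, inv_cons, bel_cons, tot_cons]

end Filter

section Sign

variable {n m r : ℕ} {h : r + 1 = n + m} {i : Fin n}

variable (h i) in
/-- The part of a weighted word on the inserted letters. -/
def resL (D : List (Fin r × ZMod 2)) : List (Fin m × ZMod 2) :=
  D.filterMap fun p => ((labelEquiv h i).symm p.1).getLeft?.map (·, p.2)

variable (h i) in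
/-- The contraction of a weighted word. -/
def conL (D : List (Fin r × ZMod 2)) : List (Fin n × ZMod 2) := D.map (Prod.map (contract h i) id)

lemma outer_inj hc hc' :
    outer h i c hc = outer h i c' hc' ↔ c = c' := ⟨outer_injective h i, fun e => by subst e; rfl⟩

lemma resL_inner b w D :
    resL h i ((inner h i b, w) :: D) = (b, w) :: resL h i D := by
  have : (labelEquiv h i).symm (inner h i b) = Sum.inl b := (Equiv.symm_apply_eq _).2 rfl
  simp [resL, this]

lemma resL_outer c hc w D :
    resL h i ((outer h i c hc, w) :: D) = resL h i D := by
  have : (labelEquiv h i).symm (outer h i c hc) = Sum.inr ⟨c, hc⟩ := (Equiv.symm_apply_eq _).2 rfl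
  simp [resL, this]

lemma resL_append D E :
    resL h i (D ++ E) = resL h i D ++ resL h i E := List.filterMap_append

lemma conL_append D E :
    conL h i (D ++ E) = conL h i D ++ conL h i E := List.map_append

lemma conL_inner b w D :
    conL h i ((inner h i b, w) :: D) = (i, w) :: conL h i D := by simp [conL, contract_inner]

lemma conL_outer c hc w D :
    conL h i ((outer h i c hc, w) :: D) = (c, w) :: conL h i D := by simp [conL, contract_outer]

variable (h i) in
lemma weights_induction {P : List (Fin r × ZMod 2) → Prop} (D) (nil : P [])
    (inner : ∀ b w D, P D → P ((QuiltPatch.inner h i b, w) :: D))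
    (outer : ∀ c hc w D, P D → P ((QuiltPatch.outer h i c hc, w) :: D)) : P D := by
  induction D with
  | nil => exact nil
  | cons p D ih =>
    rcases p with ⟨v, w⟩
    rcases inner_or_outer h i v with ⟨b, rfl⟩ | ⟨c, hc, rfl⟩
    exacts [inner b w D ih, outer c hc w D ih]

@[simp] theorem bel_nil (a : Fin n) : bel a [] = 0 := by simp [bel, tot_nil]

@[simp] theorem inv_nil : inv ([] : List (Fin n × ZMod 2)) = 0 := by simp [inv, prs]

@[simp] theorem resL_nil : resL h i [] = [] := rfl

@[simp] theorem conL_nil : conL h i [] = [] := rfl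

attribute [local simp] bel_cons tot_cons inv_cons resL_inner resL_outer conL_inner conL_outer
  outer_lt_inner inner_lt_inner inner_lt_outer prs outer_inj outer_ne_inner
  Finset.sum_add_distrib Finset.mul_sum tot_nil

lemma bel_inner b D :
    bel (inner h i b) D = bel b (resL h i D) + bel i (conL h i D) := by
  induction D using weights_induction h i <;> simp_all <;> grind

lemma bel_outer (hm : 0 < m) c hc D :
    bel (outer h i c hc) D = bel c (conL h i D) := by
  induction D using weights_induction h i <;> simp_all [outer_lt_outer h i hm]

lemma inv_eq_add (hm : 0 < m) D :
    inv D = inv (resL h i D) + inv (conL h i D) := by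
  induction D using weights_induction h i <;> simp_all [bel_inner, bel_outer hm] <;> grind

lemma tot_inner b D :
    tot (inner h i b) D = tot b (resL h i D) := by
  induction D using weights_induction h i <;> simp_all [(inner_injective h i).eq_iff]

lemma tot_conL_of_ne c hc D :
    tot c (conL h i D) = tot (outer h i c hc) D := by
  induction D using weights_induction h i <;> simp_all [hc.symm, (outer_ne_inner h i c hc _).symm]

lemma tot_conL D :
    tot i (conL h i D) = ∑ b, tot (inner h i b) D := by
  induction D using weights_induction h i <;> simp_all [(inner_injective h i).eq_iff]

lemma prs_conL c hc D :
    prs c i (conL h i D) = ∑ b, prs (outer h i c hc) (inner h i b) D := by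
  induction D using weights_induction h i <;> simp_all [hc.symm, (outer_ne_inner h i c hc _).symm, tot_conL]

end Sign

section Sign

variable {n m r : ℕ} {h : r + 1 = n + m} {i : Fin n}

lemma mem_con hc :
    some c ∈ con h i z ↔ some (outer h i c hc) ∈ z := by
  refine ⟨fun hz => ?_, fun hz => by simpa [contract_outer] using PTree.some_mem_con (h := h) (i := i) hz⟩
  rw [← mem_wd, wd_con, mem_dst] at hz
  obtain ⟨v, hv, e⟩ := List.mem_map.1 hz
  rw [← eq_outer_of_contract h i e hc]
  exact List.reduceOption_mem_iff.1 hv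

lemma mem_ex :
    some b ∈ ex h i z ↔ some (inner h i b) ∈ z :=
  ⟨fun hz => List.singleton_sublist.1 (map_inner_sublist (l := [b]) (List.singleton_sublist.2 hz)),
    PTree.some_mem_ex⟩

lemma self_mem_con : some i ∈ con h i z ↔ ex h i z ≠ [] := by
  rw [← List.count_pos_iff, count_con]
  split_ifs with he <;> simp [he]

/-- The cases of an induction along a traversal of a composition with an operation in which equal
letters are separated by single gaps. -/
lemma ex_induction {P : ∀ z, FullL (ex h i z) → Prop}
    (nil : ∀ {hf}, P [] hf) (none : ∀ z {hf hf'}, P z hf → P (none :: z) hf')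
    (outer : ∀ c hc z {hf hf'}, P z hf → P (some (QuiltPatch.outer h i c hc) :: z) hf')
    (mid : ∀ b b' z w {hf hf'}, con h i (some (inner h i b') :: z) = some i :: w →
      con h i (some (inner h i b) :: some (inner h i b') :: z) = some i :: w →
      ex h i (some (inner h i b) :: some (inner h i b') :: z) =
        some b :: ex h i (some (inner h i b') :: z) →
      P (some (inner h i b') :: z) hf → P (some (inner h i b) :: some (inner h i b') :: z) hf')
    (last : ∀ b z {hf hf'}, some (inner h i b) ∉ z → some i ∉ con h i z → ex h i z = [] →
      con h i (some (inner h i b) :: z) = some i :: con h i z →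
      ex h i (some (inner h i b) :: z) = [some b] → P z hf → P (some (inner h i b) :: z) hf')
    (gap : ∀ b z w {hf hf'}, some (inner h i b) ∈ z → some i ∈ con h i z → ex h i z = some b :: w →
      con h i (some (inner h i b) :: z) = some i :: con h i z →
      ex h i (some (inner h i b) :: z) = some b :: Option.none :: some b :: w → P z hf →
      P (some (inner h i b) :: z) hf')
    z hz : P z hz := by
  induction z using con_induction (h := h) (i := i) with
  | nil => exact nil
  | none z ih => exact none z (ih hz)
  | outer c hc z ih => exact outer c hc z (ih (by rwa [ex_outer] at hz))
  | mid b b' z ih =>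
    obtain ⟨w, hw⟩ := (startsIn_cons b' z).con
    have h1 := ex_inner_of_startsIn b (startsIn_cons (h := h) (i := i) b' z)
    refine mid b b' z w hw ?_ h1 (ih ?_)
    · rw [con_inner_of_startsIn b (startsIn_cons b' z), hw]
    obtain ⟨u, hu⟩ := ex_inner_aux (h := h) (i := i) b' z
    rw [h1, hu] at hz
    rw [hu]
    cases hz with
    | letter _ _ h => exact h
  | fin b z hb ih =>
    by_cases he : ex h i z = []
    · refine last b z ?_ ?_ he (con_inner b hb) (ex_inner_of_eq_nil b he) (ih (by rw [he]; exact .nil))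
      · rw [← mem_ex, he]; simp
      · rw [self_mem_con]; simp [he]
    have h1 := ex_inner b hb he
    have h2 : ∃ w, ex h i z = some b :: w ∧ FullL (some b :: w) := by
      rw [h1] at hz
      generalize ex h i z = y at hz
      cases hz with
      | letter _ _ h => cases h
      | gap _ l h => exact ⟨l, rfl, h⟩
    obtain ⟨l, e, h3⟩ := h2
    rw [e] at h1
    refine gap b z l ?_ ?_ e (con_inner b hb) h1 (ih (e ▸ h3))
    · rw [← mem_ex, e]; simp
    · rw [self_mem_con, e]; simp

lemma resL_weights (hf : FullL (ex h i z)) (hz : IsTrav (con h i z))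
    κ : resL h i (dl κ z) = dl (itp i κ (con h i z)) (ex h i z) ∧
      resL h i (fl κ z) = fl (itp i κ (con h i z)) (ex h i z) := by
  have hz' (v) (y : List (Option (Fin n))) (H : IsTrav _) := H.mono (List.suffix_cons v y).isInfix
  induction z, hf using ex_induction generalizing κ with
  | nil => exact ⟨rfl, rfl⟩
  | none z ih => exact ih (hz' _ _ hz) 0
  | outer c hc z ih =>
    simp [con_outer, ex_outer] at hz ⊢
    have := ih (hz' _ _ hz)
    simp [dl, fl, resL_outer, resL_append, itp, hc, mem_con hc, this]
  | mid b b' z w hw h1 h2 ih =>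
    rw [h1] at hz ⊢
    rw [hw] at ih
    generalize some _ :: z = y at *
    simp_all [dl, fl, resL_inner, resL_append, itp, mem_ex]
  | last b z hb hi he h1 h2 ih =>
    rw [h1] at hz ⊢
    have := ih (hz' _ _ hz)
    simp_all [dl, fl, resL_inner, resL_append, itp]
  | gap b z w hb hi he h1 h2 ih =>
    rw [h1] at hz ⊢
    have := ih (hz' _ _ hz)
    simp_all [(hz.entries _).1]
    simp_all [ dl, fl, resL_inner, resL_append, itp]

lemma conL_weights (hf : FullL (ex h i z)) κ :
    Eqv (conL h i (dl κ z)) (dl κ (con h i z)) ∧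
      off i (conL h i (fl κ z)) = off i (fl κ (con h i z)) := by
  have happ : ∀ (D E : List _), off i _ = off i D ++ off i E :=
    fun _ _ => List.filter_append ..
  have hoff : ∀ (w : ZMod 2), off i [(i, w)] = [] := by simp [off]
  induction z, hf using ex_induction generalizing κ with
  | nil => exact ⟨Eqv.refl _, rfl⟩
  | none z ih => exact ih 0
  | outer c hc z ih =>
    simp [dl, fl, conL_outer, conL_append, happ, mem_con hc, con_outer, ih, (ih _).1.cons]
  | mid b b' z w hw h1 h2 ih =>
    obtain ⟨h3, h4⟩ := ih (ind (some (inner h i b) ∈ some _ :: z))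
    rw [hw] at h3 h4
    generalize some _ :: z = y at *
    have := (h3.cons (i, ind (some (inner h i b) ∈ y) + κ)).trans (eqv_merge _ _ _ _)
    have e : ∀ x y, x + κ + (y + x) = y + κ := by grind
    simp_all [dl, fl, conL_inner, conL_append]
  | last b z hb hi he h1 h2 ih =>
    simp [h1, dl, fl, conL_inner, conL_append, happ, hb, hi, ih, (ih _).1.cons]
  | gap b z w hb hi he h1 h2 ih =>
    simp [h1, dl, fl, conL_inner, conL_append, happ, hb, hi, ih, (ih _).1.cons]

lemma idxOf_con_lt hc
    (he : ex h i z = some b :: w) (hf : FullL (ex h i z)) :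
    z.idxOf (some (inner h i b)) < z.idxOf (some (outer h i c hc)) ↔
      (con h i z).idxOf (some i) < (con h i z).idxOf (some c) := by
  induction z, hf using ex_induction generalizing w with
  | nil => simp [ex] at he
  | none z ih => simpa [con] using ih he
  | outer d hd z ih =>
    rw [ex_outer] at he
    by_cases hcd : d = c <;> simp_all [con_outer, outer_inj, outer_ne_inner]
  | _ =>
    simp_all [hc.symm, (outer_ne_inner h i c hc _).symm]

end Sign

section Sign

variable {n m r : ℕ} {h : r + 1 = n + m} {i : Fin n}

lemma off_append D E : off i (D ++ E) = off i D ++ off i E :=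
  List.filter_append ..

lemma bel_off D : bel i (off i D) = bel i D :=
  Finset.sum_congr rfl fun c _ => by
    grind [tot_off]

lemma itp_inner (ht : IsTrav z) (hy : IsTrav (ex h i z))
    (hf : FullL (ex h i z)) (hx : IsTrav (con h i z)) κ b :
    itp (inner h i b) κ z = itp b (itp i κ (con h i z)) (ex h i z) := by
  rw [← tot_fl ht, tot_inner, (resL_weights hf hx κ).2, tot_fl hy]

lemma itp_outer (ht : IsTrav z) (hf : FullL (ex h i z))
    (hx : IsTrav (con h i z)) κ c hc :
    itp (outer h i c hc) κ z = itp c κ (con h i z) := by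
  rw [← tot_fl ht, ← tot_conL_of_ne, ← tot_off hc, (conL_weights hf κ).2, tot_off hc, tot_fl hx]

/-- The sign of a composition of traversals. -/
lemma inv_lam_con (ht : IsTrav z) (hx : IsTrav (con h i z))
    (hy : IsTrav (ex h i z)) (hf : FullL (ex h i z)) (h0 : ex h i z ≠ []) (hx' : IsTrav (con h i z'))
    (hf' : FullL (ex h i z')) (h1 : itp i 1 (con h i z') = 1) :
    inv (lam z z') = inv (lam (con h i z) (con h i z')) + inv (lam (ex h i z) (ex h i z')) +
      (∑ c, if hc : c = i then 0 else ∑ b, itp c 0 (con h i z) * itp b 0 (ex h i z) *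
        ind (z.idxOf (some (inner h i b)) < z.idxOf (some (outer h i c hc)))) +
      (∑ b, itp b 0 (ex h i z)) * bel i (lam (con h i z) (con h i z')) := by
  obtain ⟨b₀, w, hw⟩ := (ex_head z).resolve_left h0
  have hlam : ∀ {p : ℕ} (x x' : List (Option (Fin p))), lam x x' = fl 0 x ++ (dl 0 x ++ dl 1 x') :=
    fun _ _ => List.append_assoc ..
  obtain ⟨r1, r2⟩ := resL_weights hf hx 0
  obtain ⟨r3, -⟩ := resL_weights hf' hx' 1
  obtain ⟨c1, c2⟩ := conL_weights hf 0
  obtain ⟨c3, -⟩ := conL_weights hf' 1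
  have hA : inv (resL h i (lam z z')) = inv (lam (ex h i z) (ex h i z')) := by
    rw [hlam, hlam, resL_append, resL_append, r1, r2, r3, h1, ← List.append_assoc, ← List.append_assoc]
    refine Eqv.inv_eq (Eqv.append ?_ (Eqv.refl _))
    rw [hw]
    simp [fl, List.append_assoc]
    refine (Eqv.refl _).append ((eqv_merge _ _ _ _).trans (Eqv.symm ((eqv_merge _ _ _ _).trans ?_)))
    grind [Eqv.refl, ind]
  set x := con h i z
  set x' := con h i z'
  set y := ex h i z
  set P := conL h i (fl 0 z)
  have hB : inv (conL h i (lam z z')) = inv (P ++ (dl 0 x ++ dl 1 x')) := by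
    grind [conL_append, Eqv.inv_eq, Eqv.refl, Eqv.append]
  have htot : ∀ c, c ≠ i → tot c P = tot c (fl 0 x) := fun c hc => by
    rw [← tot_off hc, c2, tot_off hc]
  have hoff : off i (P ++ (dl 0 x ++ dl 1 x')) = off i (lam x x') := by
    grind [off_append]
  have hin : ∀ b, itp b (itp i 0 x) y = itp b 0 y + if b₀ = b then itp i 0 x else 0 := by
    grind [itp]
  have hti : tot i P = tot i (fl 0 x) + ∑ b, itp b 0 y := by
    rw [tot_conL, tot_fl hx]
    simp [tot_fl ht, itp_inner ht hy hf hx]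
    simp [x, y] at hin
    simp [hin, Finset.sum_add_distrib, Finset.sum_ite_eq, Finset.mem_univ, if_true]
    ring
  have hprs : ∀ c (hc : c ≠ i), prs c i P = prs c i (fl 0 x) + ∑ b, itp c 0 x * itp b 0 y *
      ind (z.idxOf (some (inner h i b)) < z.idxOf (some (outer h i c hc))) := by
    intro c hc
    rw [prs_conL c hc, prs_fl hc.symm hx, ← idxOf_con_lt hc hw hf]
    simp [prs_fl (outer_ne_inner h i c hc _).symm ht, itp_inner ht hy hf hx, itp_outer ht hf hx]
    simp [x, y] at hin
    simp only [hin, add_mul, Finset.sum_add_distrib]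
    rw [add_comm]
    congr 1
    · simp [x]
    grind
  have hsum : (∑ c, if c = i then 0 else prs c i (P ++ (dl 0 x ++ dl 1 x'))) =
      (∑ c, if c = i then 0 else prs c i (lam x x')) + ∑ c, if hc : c = i then 0 else
        ∑ b, itp c 0 x * itp b 0 y *
          ind (z.idxOf (some (inner h i b)) < z.idxOf (some (outer h i c hc))) := by
    rw [← Finset.sum_add_distrib]
    grind [prs_append]
  have he : tot i (lam x x') = tot i (fl 0 x) + tot i (dl 0 x ++ dl 1 x') := by rw [hlam, tot_append]
  rw [inv_eq_add (h := h) b₀.pos, hA, hB, inv_off i _, hsum, hoff, inv_off i (lam x x'),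
    ← bel_off _, hoff, bel_off, tot_append, hti, he]
  ring

lemma size_fl_map_some {α} [DecidableEq α] [Fintype α] (w : List α) (hw : w ≠ []) κ :
    ∑ a, tot a (fl κ (w.map some)) = κ + w.length + w.toFinset.card := by
  induction w generalizing κ with
  | nil => exact (hw rfl).elim
  | cons a w ih =>
    have h1 : ∀ κ, (∑ b, tot b [(a, κ)]) = κ := fun κ => by simp [tot_cons, tot_nil]
    have h2 : (1 + 1 : ZMod 2) = 0 := by decide
    simp only [List.map_cons, fl, tot_append, Finset.sum_add_distrib, h1]
    rcases eq_or_ne w [] with rfl | hw'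
    · simp [fl, tot_nil]
      linear_combination -h2
    rw [ih hw', List.toFinset_cons]
    by_cases ha : a ∈ w
    · rw [ind_true (by simpa using ha), Finset.insert_eq_of_mem (by simpa using ha), List.length_cons]
      push_cast
      ring
    · rw [ind_false (by simpa using ha), Finset.card_insert_of_notMem (by simpa using ha),
        List.length_cons]
      grind

/-- The number of interposed letters is the degree. -/
lemma Word.sum_itp (hn : 0 < n) (W : Word n) : ∑ a, itp a 0 (W.1.map some) = W.deg := by
  have h2 : W.1.toFinset = Finset.univ := Finset.eq_univ_of_forall fun a => by simpa using W.2.1 a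
  have h3 := size_fl_map_some W.1 (List.ne_nil_of_mem (W.2.1 ⟨0, hn⟩)) 0
  simp [tot_fl (isTrav_map_some W)] at h3
  rw [h3, h2, Word.deg, Finset.card_univ, Fintype.card_fin]
  push_cast
  grind

lemma itp_wd (hl : FullL l) (ht : IsTrav l) {W : Word n}
    (hW : wd l = W.1) a : itp a 0 l = itp a 0 (W.1.map some) := by
  rw [← tot_fl ht, ((eqv_fl_wd hl ht 0) a a).1, hW, tot_fl (isTrav_map_some W)]

lemma ind_interposed (W : Word n) a : ind (W.Interposed a) = itp a 0 (W.1.map some) := by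
  rw [← itp_eq_one_iff]
  rcases zmod_cases (itp a 0 (W.1.map some)) with e | e
  · grind [ind_false]
  · rw [e, ind_true rfl]

lemma idxOf_unrun_lt {α} [DecidableEq α] {a b : α} (hab : a ≠ b) σ :
    (unrun σ).idxOf (some a) < (unrun σ).idxOf (some b) ↔
      (σ.map Prod.fst).idxOf a < (σ.map Prod.fst).idxOf b := by
  induction σ with
  | nil => simp [unrun]
  | cons p σ ih =>
    obtain ⟨c, s⟩ := p
    rw [unrun_cons, List.map_cons]
    obtain ⟨t, ht⟩ : ∃ t, run c s = some c :: t := run_eq_cons c s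
    by_cases hca : c = a
    · grind
    by_cases hcb : c = b
    · grind
    · have h1 : ∀ d, c ≠ d → some d ∉ run c s := fun d hd hm => by
        have := (mem_unrun (σ := [(c, s)])).1 (by simpa [unrun] using hm)
        simp [hd.symm] at this
      grind

lemma idxOf_wd_lt {α} [DecidableEq α] {a b : α} (hab : a ≠ b) {l}
    (hl : FullL l) (ht : IsTrav l) :
    l.idxOf (some a) < l.idxOf (some b) ↔ (wd l).idxOf a < (wd l).idxOf b := by
  grind [fullL_iff, wd_unrun_of_isTrav, idxOf_unrun_lt]

lemma idxOf_map_contract_outer hc (V : List _) :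
    (V.map (contract h i)).idxOf c = V.idxOf (outer h i c hc) := by
  induction V with
  | nil => rfl
  | cons v V ih =>
    grind [contract_outer, eq_outer_of_contract]

lemma idxOf_map_contract_self_le b (V : List _) :
    (V.map (contract h i)).idxOf i ≤ V.idxOf (inner h i b) := by
  induction V with
  | nil => rfl
  | cons v V ih =>
    grind [contract_inner]

/-- The sign of an extension of words. -/
lemma coe_extSign {k} [CommRing k] W W' V {z} (hz : FullL z)
    (ht : IsTrav z) (hV : wd z = V.1) : (Word.extSign h i W W' V : k) =
    sg k (∑ c, if hc : c = i then 0 else ∑ b, itp c 0 (W.1.map some) * itp b 0 (W'.1.map some) *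
      ind (z.idxOf (some (inner h i b)) < z.idxOf (some (outer h i c hc)))) := by
  rw [Word.extSign]
  push_cast
  rw [← sg_natCast, natCast_card_filter, Fintype.sum_prod_type]
  congr 1
  refine Finset.sum_congr rfl fun c _ => ?_
  grind [ind_interposed, Finset.sum_eq_zero, idxOf_map_contract_self_le, idxOf_map_contract_outer, idxOf_wd_lt, ind]

end Sign

section Comp

variable {n m r : ℕ} {h : r + 1 = n + m} {i : Fin n}

lemma PatchPair.IsComp.con_ex
    (hc : IsComp h i X Y Z) (hY : FullL Y.1.list) :
    (X.1.list = con h i Z.1.list ∧ Y.1.list = ex h i Z.1.list) ∧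
      X.2.list = con h i Z.2.list ∧ Y.2.list = ex h i Z.2.list := by
  rw [isComp_iff] at hc
  exact ⟨con_ex_of_lcomp X.1.isTrav hY (List.ne_nil_of_mem (Y.1.mem_list ⟨0, Y.pos⟩)) hc.1,
    con_ex_of_lcomp X.2.isTrav Y.2.fullL (List.ne_nil_of_mem (Y.2.mem_list ⟨0, Y.pos⟩)) hc.2⟩

lemma isExt_shape_iff (hZ : FullL Z.1.list)
    :
    Word.IsExt h i Q.1 Q'.1 Z.shape.1 ∧ PTree.IsExt h i Q.2 Q'.2 Z.shape.2 ↔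
      ∃ X Y, PatchPair.IsComp h i X Y Z ∧ FullL X.1.list ∧ FullL Y.1.list ∧ X.shape = Q ∧
        Y.shape = Q' := by
  constructor
  · rintro ⟨hw, ht⟩
    have hm : 0 < m := by
      obtain ⟨b, -⟩ := Q'.2.exists_root
      exact b.pos
    rw [word_isExt_iff hm hZ Z.1.isTrav rfl] at hw
    obtain ⟨h1, h2, h3, h4, h5, h6, h7⟩ := hw
    obtain ⟨X₂, Y₂, h8, h9, h10⟩ := ht.exists_lcomp
    obtain ⟨X₁, hX⟩ := MNSOp.exists_list i.pos h4 fun a => by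
      rw [← mem_wd, h6]; exact Q.1.2.1 a
    obtain ⟨Y₁, hY⟩ := MNSOp.exists_list hm h5 fun a => by
      rw [← mem_wd, h7]; exact Q'.1.2.1 a
    rw [← hX, ← hY] at h1
    rw [← hX] at h2 h6
    rw [← hY] at h3 h7
    exact ⟨(X₁, X₂), (Y₁, Y₂), (PatchPair.isComp_iff ..).2 ⟨h1, h8⟩, h2, h3,
      Prod.ext (Subtype.ext h6) h9, Prod.ext (Subtype.ext h7) h10⟩
  rintro ⟨X, Y, hc, hX, hY, rfl, rfl⟩
  obtain ⟨⟨h1, h2⟩, -⟩ := hc.con_ex hY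
  rw [PatchPair.isComp_iff] at hc
  refine ⟨(word_isExt_iff Y.pos hZ Z.1.isTrav rfl).2 ?_, PTree.isExt_of_lcomp hc.2⟩
  rw [← h1, ← h2]
  exact ⟨hc.1, hX, hY, X.1.isTrav, Y.1.isTrav, rfl, rfl⟩

/-- The sign of a composition. -/
lemma sg_inv_lam_mul_extSign {k : Type u} [CommRing k] {X} {Y} {Z} (hc : PatchPair.IsComp h i X Y Z)
    (hX : FullL X.1.list) (hY : FullL Y.1.list) (hZ : FullL Z.1.list) :
    sg k (inv Z.lam) * (Word.extSign h i X.shape.1 Y.shape.1 Z.shape.1 : k) =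
      eps k (Y.deg * below i X) * (sg k (inv X.lam) * sg k (inv Y.lam)) := by
  obtain ⟨⟨h1, h2⟩, h3, h4⟩ := hc.con_ex hY
  have h5 := inv_lam_con Z.1.isTrav
    (by rw [← h1]; exact X.1.isTrav) (by rw [← h2]; exact Y.1.isTrav) (by rwa [← h2])
    (by rw [← h2]; exact List.ne_nil_of_mem (Y.1.mem_list ⟨0, Y.pos⟩))
    (by rw [← h3]; exact X.2.isTrav) (by rw [← h4]; exact Y.2.fullL) (by rw [← h3, X.2.itp_list])
  have h6 : (∑ b, itp b 0 Y.1.list) = Y.deg := by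
    rw [← deg_shape hY, ← Word.sum_itp Y.pos]
    exact Finset.sum_congr rfl fun b _ => itp_wd hY Y.1.isTrav rfl b
  have h7 : bel i X.lam = below i X := by
    rw [bel, below, Int.cast_sum]
    refine Finset.sum_congr rfl fun j _ => ?_
    rw [X.tot_lam]
    split_ifs <;> simp
  rw [coe_extSign _ _ _ hZ Z.1.isTrav rfl, ← sg_add, ← sg_add, eps_eq_sg, ← sg_add]
  have h8 : ∀ c, itp c 0 (X.shape.1.1.map some) = itp c 0 _ := fun c =>
    (itp_wd hX X.1.isTrav rfl c).symm
  have h9 : ∀ c, itp c 0 (Y.shape.1.1.map some) = itp c 0 _ := fun c =>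
    (itp_wd hY Y.1.isTrav rfl c).symm
  grind [PatchPair.lam]

variable {k : Type u} [CommRing k]

variable (h i) in
/-- The composition of `F₂S ⊗ Brace` on coefficients. -/
def fsComp (x : FSBraceObj k n) (y : FSBraceObj k m) : FSBraceObj k r :=
  x.sum fun Q a => y.sum fun Q' b => (a * b) • fsBraceCompBasis k h i Q Q'

open Classical in
lemma fsComp_apply x y P :
    fsComp h i x y P = ∑ Q, ∑ Q', if Word.IsExt h i Q.1 Q'.1 P.1 ∧ PTree.IsExt h i Q.2 Q'.2 P.2 then
      x Q * y Q' * (Word.extSign h i Q.1 Q'.1 P.1 : k) else 0 := by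
  obtain ⟨V, U⟩ := P
  rw [fsComp, Finsupp.sum_fintype _ _ (by simp), Finsupp.finsetSum_apply]
  refine Finset.sum_congr rfl fun Q _ => ?_
  rw [Finsupp.sum_fintype _ _ (by simp), Finsupp.finsetSum_apply]
  refine Finset.sum_congr rfl fun Q' _ => ?_
  rw [Finsupp.smul_apply, fsBraceCompBasis, Finsupp.finsetSum_apply, Finset.sum_filter,
    Finset.sum_eq_single V ?_ (by simp)]
  · by_cases hV : Word.IsExt h i Q.1 Q'.1 V
    · rw [if_pos hV, Finsupp.finsetSum_apply, Finset.sum_filter, Finset.sum_eq_single U ?_ (by simp)]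
      · by_cases hU : PTree.IsExt h i Q.2 Q'.2 U
        · simp_all [Units.smul_def]
        grind [smul_zero]
      grind [Units.smul_def, Finsupp.smul_apply]
    grind [smul_zero]
  simp_all

lemma phi_comp x y :
    phiF k (fsComp h i x y) = pairComp k h i (phiF k x) (phiF k y) := by
  classical
  funext Z
  rw [pairComp_apply, phi_apply]
  by_cases hex : ∃ X Y, PatchPair.IsComp h i X Y Z ∧ FullL X.1.list ∧ FullL Y.1.list
  · obtain ⟨X, Y, hc, hX, hY⟩ := hex
    have hZ : FullL Z.1.list := by
      rw [hc.list_fst]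
      exact fullL_lc hX hY hc.matches.1.le
    have huniq : ∀ X' Y', PatchPair.IsComp h i X' Y' Z → FullL Y'.1.list → X' = X ∧ Y' = Y := by
      intro X' Y' hc' hY'
      obtain ⟨⟨h1, h2⟩, h3, h4⟩ := hc.con_ex hY
      grind [PatchPair.IsComp.con_ex, PatchPair.ext_list]
    have hQ : ∀ Q Q', Word.IsExt h i Q.1 Q'.1 Z.shape.1 ∧ PTree.IsExt h i Q.2 Q'.2 Z.shape.2 ↔
        Q = X.shape ∧ Q' = Y.shape := by
      intro Q Q'
      grind [isExt_shape_iff]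
    rw [if_pos hZ, fsComp_apply, Finset.sum_eq_single _, Finset.sum_eq_single _,
      if_pos ((hQ _ _).2 ⟨rfl, rfl⟩), Finset.sum_eq_single (X, Y), phi_apply, phi_apply, if_pos hX,
      if_pos hY]
    · grind [sg_inv_lam_mul_extSign]
    · grind [mem_decomp, phi_apply]
    · grind [mem_decomp]
    · exact fun Q' _ hne => if_neg fun hh => hne ((hQ _ _).1 hh).2
    · simp
    · exact fun Q _ hne => Finset.sum_eq_zero fun Q' _ => if_neg fun hh => hne ((hQ _ _).1 hh).1
    · simp
  rw [Finset.sum_eq_zero]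
  · refine ite_eq_right_iff.2 fun hZ => ?_
    rw [fsComp_apply, Finset.sum_eq_zero, mul_zero]
    refine fun Q _ => Finset.sum_eq_zero fun Q' _ => if_neg fun hh => hex ?_
    grind [isExt_shape_iff]
  grind [mem_decomp, phi_apply]

end Comp

section Prefix

variable {α : Type}

/-- The part of `dl κ (u ++ r)` that belongs to `u`. -/
def dlw (r : List (Option α)) : ZMod 2 → List (Option α) → List (α × ZMod 2)
  | _, [] => []
  | _, none :: u => dlw r 0 u
  | κ, some a :: u => (a, ind (some a ∈ u ++ r) + κ) :: dlw r (ind (some a ∈ u ++ r)) u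

/-- The part of `fl κ (u ++ r)` that belongs to `u`. -/
def flw (r : List (Option α)) : ZMod 2 → List (Option α) → List (α × ZMod 2)
  | _, [] => []
  | _, none :: u => flw r 0 u
  | κ, some a :: u => flw r (ind (some a ∈ u ++ r)) u ++ [(a, κ)]

/-- The parity transmitted to the symbols after `u`. -/
def kap (r : List (Option α)) : ZMod 2 → List (Option α) → ZMod 2
  | κ, [] => κ
  | _, none :: u => kap r 0 u
  | _, some a :: u => kap r (ind (some a ∈ u ++ r)) u

lemma dl_append κ (u r : List (Option α)) :
    dl κ (u ++ r) = dlw r κ u ++ dl (kap r κ u) r := by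
  induction u generalizing κ with
  | nil => rfl
  | cons s u ih =>
    rcases s with _ | a
    · exact ih 0
    · exact congrArg _ (ih _)

lemma fl_append κ (u r : List (Option α)) :
    fl κ (u ++ r) = fl (kap r κ u) r ++ flw r κ u := by
  induction u generalizing κ with
  | nil => exact (List.append_nil _).symm
  | cons s u ih =>
    rcases s with _ | a
    · exact ih 0
    · rw [List.cons_append, fl, ih, List.append_assoc]; rfl

lemma prefix_append κ (u v r : List (Option α)) :
    dlw r κ (u ++ v) = dlw (v ++ r) κ u ++ dlw r (kap (v ++ r) κ u) v ∧
    flw r κ (u ++ v) = flw r (kap (v ++ r) κ u) v ++ flw (v ++ r) κ u ∧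
    kap r κ (u ++ v) = kap r (kap (v ++ r) κ u) v := by
  induction u generalizing κ with
  | nil => exact ⟨rfl, (List.append_nil _).symm, rfl⟩
  | cons s u ih =>
    rcases s with _ | a
    · exact ih 0
    grind [dlw, flw, kap]

lemma prefix_congr {r : List (Option α)}
    (hr : ∀ a, some a ∈ u → (some a ∈ r ↔ some a ∈ r')) κ :
    dlw r κ u = dlw r' κ u ∧ flw r κ u = flw r' κ u ∧ kap r κ u = kap r' κ u := by
  induction u generalizing κ with
  | nil => aesop
  | cons s u ih =>
    rcases s with _ | a
    · exact (ih fun a h => hr a (List.mem_cons_of_mem _ h)) 0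
    grind [dlw, flw, kap]

variable [DecidableEq α]

lemma tot_prefix {a : α} (hu : some a ∉ u) r κ :
    tot a (dlw r κ u) = 0 ∧ tot a (flw r κ u) = 0 := by
  induction u generalizing κ with
  | nil => exact ⟨rfl, rfl⟩
  | cons s u ih =>
    simp at hu
    rcases s with _ | b
    · exact ih hu.2 0
    grind [tot_append, tot_cons, tot_nil, dlw, flw]

lemma tot_dlw {a : α} u v (ht : IsTrav (u ++ some a :: v)) κ :
    tot a (dlw (some a :: v) κ u) + itp a κ (u ++ some a :: v) + kap (some a :: v) κ u =
      u.count (some a) := by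
  induction u generalizing κ with
  | nil => simp [tot_nil, zmod_add_self, dlw, kap, itp]
  | cons s u ih =>
    have ht' := ht.mono (List.suffix_cons s _).isInfix
    rcases s with _ | b
    · aesop
    rw [List.cons_append, dlw, kap, itp, tot_cons]
    by_cases hb : b = a
    · subst hb
      have h1 := ih ht' 1
      rw [(IsTrav.entries (by simpa using ht) 1).1] at h1
      rw [ind_true (by simp), if_pos rfl, if_pos rfl, List.count_cons_self]
      grind
    simp_all

end Prefix

section Toggle

variable {n : ℕ}

lemma size_dlw (hl : FullL l) {a : Fin n}
    (he : l = u ++ some a :: v) κ :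
    size (dlw (some a :: v) κ u) = nones u + kap (some a :: v) κ u + κ := by
  induction hl generalizing u κ with
  | nil => simp at he
  | letter b l hl ih =>
    rcases u with _ | ⟨s, u⟩
    · simp [dlw, kap, size_nil, zmod_add_self]
    grind [size_cons, nones_some, dlw, kap]
  | gap b l hl ih =>
    rcases u with _ | ⟨s, _ | ⟨s', u⟩⟩
    · simp [dlw, kap, size_nil, zmod_add_self]
    · simp at he
    · simp at he
      obtain ⟨rfl, rfl, he⟩ := he
      have h2 : some b ∈ none :: u ++ some a :: v := by grind
      have h3 : dlw _ κ (some b :: none :: u) =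
        (b, ind _ + κ) :: dlw (some a :: v) 0 u := rfl
      have h4 : kap (some a :: v) κ (some b :: none :: u) = kap _ 0 u := rfl
      rw [h3, h4, size_cons, ih he 0, nones_some, nones_none, ind_true h2]
      push_cast
      ring

/-- The weighted word of a pair of traversals with the weight of one letter changed. -/
def tog (u : List (Option (Fin n))) (a : Fin n) (v y : List (Option (Fin n))) : List (Fin n × ZMod 2) :=
  fl 0 (u ++ some a :: v) ++ (dlw (some a :: v) 0 u ++
    (a, ind (some a ∈ v) + kap (some a :: v) 0 u + 1) :: (dl (ind (some a ∈ v)) v ++ dl 1 y))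

lemma inv_tog {a : Fin n} (hl : FullL (u ++ some a :: v))
    (ht : IsTrav (u ++ some a :: v)) : inv (tog u a v y) + nones u =
      inv (lam (u ++ some a :: v) y) + (u.count (some a) + bel a (lam (u ++ some a :: v) y) +
        size (fl 0 (u ++ some a :: v))) := by
  grind [dl_append, size_dlw, tot_dlw, tot_fl, inv_insert, bel_insert, size_append, tot_append, lam, dl, tog]

/-- The number of letters of `u`, followed by letters, that occur again. -/
lemma size_flw_add_kap (r u : List (Option (Fin n))) κ :
    size (flw r κ u) + kap r κ u = match u with
      | [] => κ
      | none :: u => size (flw r 0 u) + kap r 0 u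
      | some a :: u => κ + (size (flw r (ind (some a ∈ u ++ r)) u) + kap r (ind (some a ∈ u ++ r)) u) := by
  grind [size_nil, size_append, size_cons, flw, kap]

end Toggle

section Coloring

variable {α : Type}

/-- `l` is the traversal of a colouring of the word `w`. -/
inductive Col : List α → List (Option α) → Prop
  | nil : Col [] []
  | letter (a : α) (w : List α) (l : List (Option α)) : Col w l → Col (a :: w) (some a :: l)
  | gap (a : α) (w : List α) (l : List (Option α)) : Col (a :: w) (some a :: l) →
      Col (a :: w) (some a :: none :: some a :: l)

lemma Col.fullL {w : List α} (h : Col w l) : FullL l := by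
  induction h with
  | nil => exact .nil
  | letter a w l _ ih => exact .letter a l ih
  | gap a w l _ ih => exact .gap a l ih

lemma col_unrun (σ : List (α × ℕ)) : Col (σ.map Prod.fst) (unrun σ) := by
  induction σ with
  | nil => exact .nil
  | cons p σ ih =>
    obtain ⟨a, s⟩ := p
    induction s with
    | zero => exact .letter a _ _ ih
    | succ s ih' =>
      obtain ⟨w, hw⟩ := run_eq_cons a s
      exact .gap a _ _ ih'

lemma Col.exists_unrun (h : Col w l) :
    ∃ σ : List (α × ℕ), l = unrun σ ∧ σ.map Prod.fst = w := by
  induction h with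
  | nil => aesop
  | letter a w l _ ih =>
    obtain ⟨σ, rfl, rfl⟩ := ih
    exact ⟨(a, 0) :: σ, by aesop, rfl⟩
  | gap a w l _ ih =>
    obtain ⟨σ, h1, h2⟩ := ih
    rcases σ with _ | ⟨⟨b, s⟩, σ⟩
    · cases h2
    obtain ⟨rfl, rfl⟩ := List.cons.inj h2
    exact ⟨(b, s + 1) :: σ, by grind [unrun_cons, run_succ], rfl⟩

lemma Col.mem_iff (h : Col w l) (a : α) : some a ∈ l ↔ a ∈ w := by
  obtain ⟨σ, rfl, rfl⟩ := h.exists_unrun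
  exact mem_unrun

lemma col_iff {w : List (Fin n)} (hw : IsFSWord w) {l} :
    Col w l ↔ IsTrav l ∧ FullL l ∧ wd l = w := by
  constructor
  · intro h
    obtain ⟨σ, rfl, rfl⟩ := h.exists_unrun
    grind [isTrav_unrun, Col.fullL, wd_unrun_of_isTrav]
  grind [fullL_iff, wd_unrun_of_isTrav, col_unrun]

lemma Col.insert {c : α} (h : Col w (p ++ some c :: q)) :
    Col w (p ++ some c :: none :: some c :: q) := by
  generalize hl : p ++ some c :: q = l at h
  induction h generalizing p with
  | nil => simp at hl
  | letter a w l h ih =>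
    rcases p with _ | ⟨s, p⟩
    · obtain ⟨h1, rfl⟩ := List.cons.inj hl
      cases h1
      exact .gap _ _ _ (.letter _ _ _ h)
    obtain ⟨rfl, rfl⟩ := List.cons.inj hl
    exact .letter _ _ _ (ih rfl)
  | gap a w l h ih =>
    rcases p with _ | ⟨s, _ | ⟨s', p⟩⟩
    · obtain ⟨h1, rfl⟩ := List.cons.inj hl
      cases h1
      exact .gap _ _ _ (.gap _ _ _ h)
    · simp at hl
    · simp at hl
      obtain ⟨rfl, rfl, hl⟩ := hl
      have h1 := ih hl
      rcases p with _ | ⟨s, p⟩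
      · cases hl
        exact .gap _ _ _ h1
      obtain ⟨rfl, -⟩ := List.cons.inj hl
      exact .gap _ _ _ h1

lemma Col.remove {c : α}
    (h : Col w (p ++ some c :: none :: some c :: q)) : Col w (p ++ some c :: q) := by
  generalize hl : p ++ some c :: none :: some c :: q = l at h
  induction h generalizing p with
  | nil => simp at hl
  | letter a w l h ih =>
    rcases p with _ | ⟨s, p⟩
    · obtain ⟨h1, rfl⟩ := List.cons.inj hl
      cases h
    obtain ⟨rfl, rfl⟩ := List.cons.inj hl
    exact .letter _ _ _ (ih rfl)
  | gap a w l h ih =>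
    rcases p with _ | ⟨s, _ | ⟨s', p⟩⟩
    · grind
    · simp at hl
    · simp at hl
      obtain ⟨rfl, rfl, hl⟩ := hl
      rcases p with _ | ⟨s, p⟩
      · grind
      · obtain ⟨rfl, -⟩ := List.cons.inj hl
        exact .gap _ _ _ (ih hl)

/-- A traversal with a free input that does not lie between two occurrences of a letter. -/
lemma exists_bad {l : List (Option α)} (h : ¬ FullL l) : ∃ p q, l = p ++ none :: q ∧
    (p = [] ∨ ∃ p' c, p = p' ++ [some c] ∧ ∀ q', q ≠ some c :: q') := by
  induction hn : l.length using Nat.strong_induction_on generalizing l with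
  | _ N ih =>
  rcases l with _ | ⟨_ | a, l⟩
  · exact (h .nil).elim
  · grind
  by_cases h3 : ∃ q, l = none :: some a :: q
  · obtain ⟨q, rfl⟩ := h3
    obtain ⟨p, q', h1, h2⟩ := ih _ (by rw [← hn]; simp) (fun h' => h (.gap a q h')) rfl
    grind
  · obtain ⟨p, q, rfl, h2⟩ := ih _ (by rw [← hn]; simp) (fun h' => h (.letter a l h')) rfl
    rcases h2 with rfl | ⟨p', c, rfl, h2⟩
    · exact ⟨[some a], q, rfl, .inr ⟨[], a, rfl, fun q' e => h3 ⟨q', by rw [e]; rfl⟩⟩⟩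
    grind

lemma ins_append (p q : List (Option α)) j :
    ins (nones p + (j + 1)) (p ++ q) = p ++ ins (j + 1) q := by
  induction p with
  | nil => grind [nones_nil]
  | cons s p ih =>
    rcases s with _ | a
    · grind [nones, ins]
    grind [nones, ins]

lemma ins_split (l : List (Option α)) i : ∃ l₁ l₂, l = l₁ ++ l₂ ∧ ins i l = l₁ ++ none :: l₂ ∧
    (i = 0 ∧ l₁ = [] ∨ (∃ l', l₁ = l' ++ [none]) ∨ l₂ = []) := by
  induction l generalizing i with
  | nil => grind [ins_nil]
  | cons s l ih =>
    rcases i with _ | i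
    · grind [ins_zero]
    rcases s with _ | a
    · obtain ⟨l₁, l₂, rfl, h2, h3⟩ := ih i
      grind [ins]
    · obtain ⟨l₁, l₂, rfl, h2, h3⟩ := ih (i + 1)
      grind [ins]

lemma FullL.not_ins {l : List (Option α)} (h0 : l ≠ []) i : ¬ FullL (ins i l) := by
  intro h
  obtain ⟨l₁, l₂, rfl, h2, h3⟩ := ins_split l i
  rw [h2] at h
  obtain ⟨a, u', v', e1, e2⟩ := h.eq_of_split
  grind [List.append_inj_right']

lemma FullL.ins_inj {l : List (Option α)} (h : FullL l) (hi : i ≤ nones l + 1)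
    (hj : j ≤ nones l + 1) (h0 : l ≠ []) (e : ins i l = ins j l) : i = j := by
  induction h generalizing i j with
  | nil => exact (h0 rfl).elim
  | letter a l h ih =>
    rw [nones_some] at hi hj
    rcases i with _ | i <;> rcases j with _ | j
    · rfl
    · grind [ins]
    · grind [ins]
    grind [nones_nil, ins]
  | gap a l h ih =>
    rw [nones_some, nones_none] at hi hj
    rcases i with _ | i <;> rcases j with _ | j
    · rfl
    · grind [ins]
    · grind [ins]
    grind [ins]

/-- Insertion of a free input into a colouring never separates different letters. -/
lemma FullL.ins_eq {q : List (Option α)} (h : FullL l) (e : ins i l = p ++ none :: q)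
    (hb : p = [] ∨ ∃ p' c, p = p' ++ [some c] ∧ ∀ q', q ≠ some c :: q') :
    l = p ++ q ∧ (p ≠ [] → ∀ d q', q ≠ some d :: q') := by
  have hp : ∀ r, p ≠ r ++ [none] := by
    grind [List.append_inj_right']
  have hq : ∀ r c v, p = r ++ [some c] → q ≠ some c :: v := by
    grind [List.append_inj_right']
  obtain ⟨l₁, l₂, rfl, h2, h3⟩ := ins_split l i
  rw [h2] at e
  rcases List.append_eq_append_iff.1 e with ⟨r, rfl, h4⟩ | ⟨r, rfl, h4⟩
  · rcases r with _ | ⟨s, r⟩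
    · grind
    · obtain rfl : none = s := (List.cons.inj h4).1
      obtain rfl : l₂ = r ++ none :: q := (List.cons.inj h4).2
      rw [← List.append_assoc] at h
      obtain ⟨a, u', v', e1, e2⟩ := h.eq_of_split
      rcases List.eq_nil_or_concat' r with rfl | ⟨r', c, rfl⟩
      · grind
      grind [List.append_inj_right']
  rcases r with _ | ⟨s, r⟩
  · grind
  · obtain ⟨rfl, rfl⟩ := List.cons.inj h4
    rw [List.append_assoc] at h
    obtain ⟨a, u', v', e1, e2⟩ := h.eq_of_split
    rcases r with _ | ⟨s, r⟩
    · grind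
    aesop

end Coloring

section Erase

variable {α : Type} [DecidableEq α] {M : Type*} [AddCommMonoid M]

lemma sum_er (a : α) l z (G : ℕ → M) :
    (∑ t ∈ Finset.range (l.count (some a)), if er a t l = z then G t else 0) =
      ∑ p ∈ Finset.range (z.length + 1), if l = z.take p ++ some a :: z.drop p then
        G ((z.take p).count (some a)) else 0 := by
  induction l generalizing z G with
  | nil => simp
  | cons s l ih =>
    rw [Finset.sum_range_succ']
    by_cases hs : s = some a
    · subst hs
      rw [List.count_cons_self, Finset.sum_range_succ']
      simp only [er_self_succ, er_self_zero]
      congr 1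
      · rcases z with _ | ⟨s', z⟩
        · simp
        by_cases h : some a = s'
        · simp_all
        · simp [h]
      · simp
    · simp only [er_of_ne hs]
      have h0 : (if s :: l = z.take 0 ++ some a :: z.drop 0 then G ((z.take 0).count (some a)) else 0) = 0 :=
        if_neg (by simp [hs])
      rw [h0, add_zero]
      rcases z with _ | ⟨s', z⟩
      · simp
      by_cases h : s = s'
      · simp_all
      · simp [h]

end Erase

section Sign

variable {n : ℕ}

/-- The number of inversions between the letters of two weighted words. -/
def cr (D E : List (Fin n × ZMod 2)) : ZMod 2 := ∑ a, ∑ b, if a < b then tot b D * tot a E else 0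

lemma inv_append (D E : List (Fin n × ZMod 2)) : inv (D ++ E) = inv D + inv E + cr D E := by
  simp [inv, cr, ← Finset.sum_add_distrib, prs_append]
  grind

lemma cr_append_right (D E E' : List (Fin n × ZMod 2)) : cr D (E ++ E') = cr D E + cr D E' := by
  simp [cr, ← Finset.sum_add_distrib, tot_append]
  grind

lemma cr_cons_right (p : Fin n × ZMod 2) D E :
    cr D (p :: E) = cr D E + p.2 * (size D + tot p.1 D + bel p.1 D) := by
  have h1 := inv_append D (p :: E)
  have h2 := inv_append D E
  have h3 := inv_insert p.1 p.2 D E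
  have h4 := inv_cons p.1 p.2 E
  grind [bel_append]

attribute [local simp] inv_append inv_cons cr_append_right
  cr_cons_right bel_append bel_cons tot_append tot_cons size_append size_cons size_nil

lemma inv_tog_left p q y (a : Fin n) :
    inv (tog p a (none :: some a :: q) y) = inv (lam (p ++ some a :: q) y) := by
  have hc : ∀ b, some b ∈ some a :: none :: some a :: q ↔ some b ∈ some a :: q := by simp
  obtain ⟨h1, h2, h3⟩ := prefix_congr (u := p) (fun b _ => hc b) 0
  simp [tog, lam, dl_append, fl_append, h2, fl, dl]
  grind [ind]

lemma inv_tog_right p q y (a : Fin n) :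
    inv (tog (p ++ [some a, none]) a q y) = inv (lam (p ++ some a :: q) y) := by
  have hc : ∀ b, some b ∈ [some a, none] ++ some a :: q ↔ some b ∈ some a :: q := by simp
  obtain ⟨h1, h2, h3⟩ := prefix_congr (u := p) (fun b _ => hc b) 0
  obtain ⟨h5, h6, h7⟩ := prefix_append 0 p [some a, none] (some a :: q)
  simp [tog, lam, dl_append, fl_append, h5, h7, fl, dl, dlw, kap]
  grind [ind]

/-- The parity of the number of caesurae in `u`, followed by `r`. -/
def cae (r u : List (Option (Fin n))) : ZMod 2 := size (flw r 0 u) + kap r 0 u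

lemma FullL.eq_concat {l : List (Option (Fin n))} (h : FullL l) (h0 : l ≠ []) :
    ∃ l' e, l = l' ++ [some e] := by
  rcases List.eq_nil_or_concat' l with rfl | ⟨l', _ | e, rfl⟩
  · exact (h0 rfl).elim
  · obtain ⟨_, _, v', _, h2⟩ := FullL.eq_of_split h
    cases h2
  grind

lemma FullL.eq_cons {l : List (Option (Fin n))} (h : FullL l) (h0 : l ≠ []) :
    ∃ e l', l = some e :: l' := by
  cases h with
  | nil => exact (h0 rfl).elim
  | letter a l _ => exact ⟨a, l, rfl⟩
  | gap a l _ => exact ⟨a, _, rfl⟩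

lemma kap_concat r u (e : Fin n) κ :
    kap r κ (u ++ [some e]) = ind (some e ∈ r) :=
  (prefix_append κ u _ r).2.2

lemma sublist_of_mem {a : Fin n} (hu : some a ∈ u)
    (hv : some b ∈ v) (hw : some a ∈ w) (hz : some b ∈ z) :
    [some a, some b, some a, some b].Sublist (u ++ (v ++ (w ++ z))) :=
  (List.singleton_sublist.2 hu).append ((List.singleton_sublist.2 hv).append
    ((List.singleton_sublist.2 hw).append (List.singleton_sublist.2 hz)))

lemma inv_tog_caesura {a : Fin n} (hX : FullL (u ++ some a :: v))
    (ht : IsTrav (u ++ some a :: v)) (hu : FullL u) (hv : FullL v) (ha : some a ∈ v) :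
    inv (tog u a v y) + nones u = inv (lam (u ++ v) y) + cae (some a :: v) u := by
  obtain ⟨d, v, rfl⟩ := hv.eq_cons (List.ne_nil_of_mem ha)
  have hda : d ≠ a := by
    rintro rfl
    exact ht.no_rep d ⟨u, v, by simp⟩
  have ha' : some a ∈ v := by grind
  obtain ⟨h1, h2, h3⟩ := prefix_congr (r := some a :: some d :: v) (r' := some d :: v) (u := u)
    (fun b _ => by grind) 0
  have hκ : kap (some a :: some d :: v) 0 u = 0 ∧ some d ∉ u ∨
      kap (some a :: some d :: v) 0 u = 1 ∧ some a ∉ u := by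
    by_cases hu0 : u = []
    · aesop
    · obtain ⟨u', e, rfl⟩ := hu.eq_concat hu0
      rw [kap_concat]
      have hea : e ≠ a := by
        rintro rfl
        exact ht.no_rep e ⟨u', some d :: v, by simp⟩
      by_cases he : some e ∈ some a :: some d :: v
      · refine .inr ⟨ind_true he, fun hau => ?_⟩
        have h4 : some a ∈ u' := by grind
        have h5 : some e ∈ some d :: v := by simpa [hea] using he
        exact ht.no_cross a e hea.symm
          (by simpa using sublist_of_mem h4 (List.mem_singleton_self _) (List.mem_singleton_self _) h5)
      · refine .inl ⟨ind_false he, fun hdu => ?_⟩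
        refine ht.no_cross d a hda ?_
        grind
  have t1 := fun b hb => tot_prefix (a := b) (u := u) hb (some a :: some d :: v) 0
  have i1 : ind (a = d ∨ some a ∈ v) = 1 := ind_true (.inr ha')
  simp [tog, lam, dl_append, fl_append, cae, ← h1, fl, dl, size_dlw hX rfl 0]
  grind

lemma inv_tog_last {a : Fin n}
    (hX : FullL (p ++ some a :: (u ++ some a :: v))) (ht : IsTrav (p ++ some a :: (u ++ some a :: v)))
    (hu : FullL u) (hv : FullL v) (hu0 : u ≠ []) (hau : some a ∉ u) (hav : some a ∉ v) :
    inv (tog (p ++ some a :: u) a v y) + nones (p ++ some a :: u) =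
      inv (lam (p ++ some a :: (u ++ v)) y) + cae (some a :: (u ++ some a :: v)) p + 1 := by
  have hkd : ∀ r, (∀ b, some b ∈ u → (some b ∈ r ↔ b = a)) → ∀ κ, kap r κ u = 0 := by
    obtain ⟨u', e, rfl⟩ := hu.eq_concat hu0
    grind [kap_concat, ind_false]
  have hcr : ∀ b, some b ∈ u → some b ∉ v := by
    intro b hb hv
    have := sublist_of_mem (List.mem_append_right p (List.mem_singleton_self (some a))) hb
      (List.mem_singleton_self _) hv
    grind [IsTrav.no_cross]
  have hs2 := size_dlw (hu.append (.letter a v hv)) rfl 0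
  have hs1 := size_dlw hX rfl 0
  obtain ⟨e, u, rfl⟩ := hu.eq_cons hu0
  have hea : e ≠ a := by rintro rfl; simp at hau
  have hep : some e ∉ p := by
    intro h
    have := sublist_of_mem h (List.mem_singleton_self (some a)) (List.mem_cons_self (l := u))
      (List.mem_cons_self (l := v))
    grind [IsTrav.no_cross]
  have k1 := hkd (some a :: v) (fun b hb => by simp [hcr b hb]) 0
  obtain ⟨h1, h2, h3⟩ := prefix_append 0 p (some a :: some e :: u) (some a :: v)
  obtain ⟨c1, c2, c3⟩ := prefix_congr (r := some a :: some e :: u ++ some a :: v)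
    (r' := some a :: (some e :: u ++ v)) (u := p) (fun b _ => by simp; tauto) 0
  obtain ⟨d1, d2, d3⟩ := prefix_congr (r := some a :: v) (r' := v) (u := u)
    (fun b hb => by
      grind) (ind (some e ∈ u ++ v))
  have t1 := tot_prefix hep (some a :: some e :: u ++ some a :: v) 0
  have t2 := tot_prefix (fun h => hau (List.mem_cons_of_mem _ h)) (some a :: v) (ind (some e ∈ u ++ v))
  have i1 := ind_true trivial
  have i0 := ind_false id
  simp [dlw, kap, i1] at h1 h2 h3 c1 c2 c3 d1 d2 d3 t1 t2 hs1 hs2 k1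
  simp [tog, lam, dl_append, fl_append, cae, fl, dl, *]
  grind

end Sign

section Rank

variable {n : ℕ}

/-- The parity of the number of caesurae among the first letters of a word. -/
def caew (r : List (Option (Fin n))) : List (Fin n) → ZMod 2
  | [] => 0
  | a :: w => ind (some a ∈ w.map some ++ r) + caew r w

lemma caew_eq_sum (w r : List (Fin n)) : caew (r.map some) w = ∑ c ∈ Finset.range w.length,
    ind (∃ l, c < l ∧ l < (w ++ r).length ∧ (w ++ r)[l]? = (w ++ r)[c]?) := by
  induction w with
  | nil => rfl
  | cons a w ih =>
    rw [List.length_cons, Finset.sum_range_succ', caew, ih, add_comm]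
    congr 1
    · refine Finset.sum_congr rfl fun c _ => congrArg ind (propext ⟨?_, ?_⟩)
      · rintro ⟨l, h1, h2, h3⟩
        exact ⟨l + 1, by omega, by simpa using h2, by simpa using h3⟩
      grind
    refine congrArg ind (propext ?_)
    rw [← List.map_append, List.mem_map_of_injective (Option.some_injective _), List.mem_iff_getElem?]
    constructor
    · rintro ⟨l, h⟩
      exact ⟨l + 1, by omega, by grind, by simpa using h⟩
    grind

lemma cae_unrun (σ : List (Fin n × ℕ)) r κ :
    size (flw r κ (unrun σ)) + kap r κ (unrun σ) = κ + caew r (σ.map Prod.fst) := by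
  induction σ generalizing κ with
  | nil => rw [unrun_nil, size_flw_add_kap]; aesop
  | cons p σ ih =>
    obtain ⟨a, s⟩ := p
    induction s generalizing κ with
    | zero =>
      grind [unrun_cons, run_zero', size_flw_add_kap, mem_unrun, caew]
    | succ s ih' =>
      grind [unrun_cons, run_succ, size_flw_add_kap]

lemma cast_caesuraRank (W : Word n) (h : W.1 = w ++ r) (hw : w ≠ []) :
    W.caesuraRank (w.length - 1) = caew (r.map some) w := by
  classical
  rw [Word.caesuraRank, natCast_card_filter, Nat.sub_add_cancel (List.length_pos_iff.2 hw), caew_eq_sum]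
  simp_all [Word.IsCaesura]

end Rank

section DelSign

variable {n : ℕ}

lemma caew_append r (w w' : List (Fin n)) :
    caew r (w ++ w') = caew (w'.map some ++ r) w + caew r w' := by
  induction w <;> simp_all [caew, add_assoc]

lemma caew_congr (h : ∀ a, some a ∈ r ↔ some a ∈ r')
    (w : List (Fin n)) : caew r w = caew r' w := by
  induction w <;> simp_all [caew]

lemma cae_concat r u (a : Fin n) :
    cae r (u ++ [some a]) = cae (some a :: r) u + ind (some a ∈ r) := by
  obtain ⟨-, h1, h2⟩ := prefix_append 0 u _ r
  have h3 : kap r (kap ([some a] ++ r) 0 u) [some a] = ind _ := rfl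
  have h4 : flw r _ [some a] = [(a, kap ([some a] ++ r) 0 u)] := rfl
  rw [cae, cae, h1, h2, h3, h4, size_append, size_cons, size_nil]
  simp
  ring

lemma exists_last {σ : List (Fin n × ℕ)} (h : a ∈ σ.map Prod.fst) :
    ∃ σ₁ s σ₂, σ = σ₁ ++ (a, s) :: σ₂ ∧ a ∉ σ₂.map Prod.fst := by
  induction σ with
  | nil => simp at h
  | cons p σ ih =>
    by_cases h1 : a ∈ σ.map Prod.fst
    · obtain ⟨σ₁, s, σ₂, rfl, h2⟩ := ih h1
      exact ⟨p :: σ₁, s, σ₂, rfl, h2⟩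
    obtain ⟨b, s⟩ := p
    obtain rfl : a = b := by simpa [h1] using h
    exact ⟨[], s, σ, rfl, h1⟩

lemma run_eq_concat (a : Fin n) s : ∃ w, run a s = w ++ [some a] := by
  rcases s with _ | s
  · exact ⟨[], run_zero a⟩
  · exact ⟨run a s ++ [none], by simp [run, List.replicate_succ']⟩

lemma sg_tog_eq (k : Type u) [CommRing k] {W : Word n} {σ τ} {a}
    (hW : W.1 = σ.map Prod.fst ++ a :: τ.map Prod.fst) (ha : some a ∈ unrun σ ++ unrun τ)
    y :
    sg k (inv (tog (unrun σ) a (unrun τ) y) + nones (unrun σ)) =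
      - ((W.delSign σ.length : ℤ) : k) * sg k (inv (lam (unrun σ ++ unrun τ) y)) := by
  have hX : unrun (σ ++ (a, 0) :: τ) = unrun σ ++ some a :: unrun τ := by
    rw [unrun_append, unrun_cons, run_zero']
  have hX' : (σ ++ (a, 0) :: τ).map Prod.fst = W.1 := by rw [hW]; simp
  have hcol := col_unrun (σ ++ (a, 0) :: τ)
  rw [hX, hX'] at hcol
  obtain ⟨ht, hf, -⟩ := (col_iff W.2).1 hcol
  by_cases hv : some a ∈ unrun τ
  · have hc : W.IsCaesura σ.length := by
      obtain ⟨l, hl⟩ := List.mem_iff_getElem?.1 (mem_unrun.1 hv)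
      refine ⟨σ.length + 1 + l, by omega, ?_, ?_⟩ <;> grind
    have hr := cast_caesuraRank W (w := σ.map Prod.fst ++ [a]) (r := τ.map Prod.fst) (by rw [hW]; simp)
      (by simp)
    have h1 : (σ.map Prod.fst ++ [a]).length - 1 = σ.length := by simp
    rw [h1, caew_append, caew_congr (r' := some a :: unrun τ) (by simp [mem_unrun])] at hr
    have h2 : caew ((τ.map Prod.fst).map some) [a] = 1 := by
      rw [caew, caew, add_zero]
      exact ind_true (by simpa [mem_unrun] using hv)
    have h3 : cae _ _ = 0 + caew _ _ :=
      cae_unrun σ (some a :: unrun τ) 0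
    rw [h2, ← zero_add (caew _ _), ← h3] at hr
    rw [inv_tog_caesura hf ht (fullL_iff.2 ⟨σ, rfl⟩) (fullL_iff.2 ⟨τ, rfl⟩) hv, Word.delSign, if_pos hc]
    have h4 : (((-1) ^ W.caesuraRank σ.length : ℤˣ) : k) = sg k (cae (some a :: unrun τ) (unrun σ) + 1) := by
      rw [← hr, sg_natCast]; push_cast; rfl
    rw [h4, sg_one_add, sg_add]
    ring
  have hu : some a ∈ unrun σ := by simpa [hv] using ha
  obtain ⟨σ₁, s, σ₂, rfl, h2⟩ := exists_last (mem_unrun.1 hu)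
  have h2' : some a ∉ unrun σ₂ := fun h => h2 (mem_unrun.1 h)
  obtain ⟨w, hw⟩ := run_eq_concat a s
  have e1 : unrun (σ₁ ++ (a, s) :: σ₂) = (unrun σ₁ ++ w) ++ some a :: unrun σ₂ := by
    rw [unrun_append, unrun_cons, hw]; simp
  have e2 : unrun (σ₁ ++ [(a, s)]) = (unrun σ₁ ++ w) ++ [some a] := by
    rw [unrun_append, unrun_cons, hw]; simp [unrun_nil]
  have e0 : unrun (σ₁ ++ (a, s) :: σ₂) ++ some a :: unrun τ =
      (unrun σ₁ ++ w) ++ some a :: (unrun σ₂ ++ some a :: unrun τ) := by rw [e1]; simp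
  have hne : unrun σ₂ ≠ [] := by
    intro h
    rw [e0, h] at ht
    exact ht.no_rep a ⟨unrun σ₁ ++ w, unrun τ, by simp⟩
  have hk := inv_tog_last (y := y) (e0 ▸ hf) (e0 ▸ ht) (fullL_iff.2 ⟨σ₂, rfl⟩) (fullL_iff.2 ⟨τ, rfl⟩) hne h2' hv
  have hWe : W.1 = σ₁.map Prod.fst ++ a :: (σ₂.map Prod.fst ++ a :: τ.map Prod.fst) := by
    rw [hW]; simp
  have hc : ¬ W.IsCaesura (σ₁ ++ (a, s) :: σ₂).length := by
    rintro ⟨l, h3, h4, h5⟩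
    refine hv (mem_unrun.2 (List.mem_iff_getElem?.2 ⟨l - ((σ₁ ++ (a, s) :: σ₂).length + 1), ?_⟩))
    grind
  have hp : W.prevOcc (σ₁ ++ (a, s) :: σ₂).length = σ₁.length := by
    rw [Word.prevOcc, Nat.findGreatest_eq_iff]
    grind
  have hr := cast_caesuraRank W (w := σ₁.map Prod.fst ++ [a])
    (r := σ₂.map Prod.fst ++ a :: τ.map Prod.fst) (by rw [hWe]; simp) (by simp)
  have h1 : (σ₁.map Prod.fst ++ [a]).length - 1 = σ₁.length := by simp
  rw [h1, caew_congr (r' := unrun σ₂ ++ some a :: unrun τ) (by simp [mem_unrun])] at hr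
  have h3 : cae (unrun σ₂ ++ some a :: unrun τ) (unrun (σ₁ ++ [(a, s)])) =
      0 + caew (unrun σ₂ ++ some a :: unrun τ) ((σ₁ ++ [(a, s)]).map Prod.fst) := cae_unrun _ _ 0
  rw [e2, cae_concat, ind_true (by simp), zero_add, List.map_append] at h3
  have h4 : ((((-1) ^ (W.caesuraRank σ₁.length + 1) : ℤˣ) : ℤ) : k) =
      - sg k (W.caesuraRank σ₁.length : ZMod 2) := by
    rw [sg_natCast]; push_cast; ring
  rw [Word.delSign, if_neg hc, hp, h4, hr]
  have h5 : caew (unrun σ₂ ++ some a :: unrun τ) (σ₁.map Prod.fst ++ [a]) =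
    cae (some a :: (unrun σ₂ ++ some a :: unrun τ)) (unrun σ₁ ++ w) + 1 := h3.symm
  have h6 : unrun σ₁ ++ w ++ some a :: unrun σ₂ ++ unrun τ =
      unrun σ₁ ++ w ++ some a :: (unrun σ₂ ++ unrun τ) := by simp
  rw [h5, e1, hk, h6, neg_neg, ← sg_add]
  congr 1
  ring

end DelSign

section Boundary

variable {n : ℕ} (k : Type u) [CommRing k] (w : List (Fin n)) (y : List (Option (Fin n)))

open Classical in
/-- The sign of a colouring of `W`. -/
def colS (l : List (Option (Fin n))) : k := if Col w l then sg k (inv (lam l y)) else 0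

open Classical in
/-- The sign of the deletion of a letter from a colouring of `W`. -/
def delS (u : List (Option (Fin n))) (a : Fin n) (v : List (Option (Fin n))) : k :=
  if Col w (u ++ some a :: v) then sg k (inv (tog u a v y) + nones u) else 0

variable {p q : List (Option (Fin n))}

lemma delS_eq_zero (h : ¬ FullL (u ++ some a :: v)) :
    delS k w y u a v = 0 := if_neg fun h' => h h'.fullL

lemma sum_delS_left_letter b : ∑ a, delS k w y p a (none :: some b :: q) =
    sg k (nones p) * colS k w y (p ++ some b :: q) := by
  rw [Finset.sum_eq_single b, delS, colS, inv_tog_left]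
  · by_cases h : Col w (p ++ some b :: q)
    · grind [Col.insert, sg_add]
    · rw [if_neg (fun h' => h h'.remove), if_neg h, mul_zero]
  · intro a _ hab
    refine delS_eq_zero k w y fun h => hab ?_
    obtain ⟨c, u', v', h1, h2⟩ := FullL.eq_of_split (u := p ++ [some a]) (by simpa using h)
    grind [List.append_inj_right']
  · simp

lemma sum_delS_left (hq : ∀ b q', q ≠ some b :: q') : ∑ a, delS k w y p a (none :: q) = 0 := by
  refine Finset.sum_eq_zero fun a _ => delS_eq_zero k w y fun h => ?_
  obtain ⟨c, u', v', h1, h2⟩ := FullL.eq_of_split (u := p ++ [some a]) (by simpa using h)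
  exact hq c v' h2

lemma sum_delS_right_letter b : ∑ a, delS k w y (p ++ [some b, none]) a q =
    - sg k (nones (p ++ [some b])) * colS k w y (p ++ some b :: q) := by
  have hn : nones (p ++ [some b, none]) = nones (p ++ [some b]) + 1 := by
    aesop
  rw [Finset.sum_eq_single b, delS, colS, inv_tog_right, hn]
  · have : p ++ [some b, none] ++ some b :: q = p ++ some b :: none :: some b :: q := by simp
    rw [this]
    by_cases h : Col w (p ++ some b :: q)
    · grind [Col.insert, sg_add, sg_one_add]
    · rw [if_neg (fun h' => h h'.remove), if_neg h, mul_zero]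
  · intro a _ hab
    refine delS_eq_zero k w y fun h => hab ?_
    obtain ⟨c, u', v', h1, h2⟩ := FullL.eq_of_split (u := p ++ [some b]) (by simpa using h)
    grind [List.append_inj_right']
  · simp

lemma sum_delS_bad (hb : p = [] ∨ ∃ p' c, p = p' ++ [some c] ∧ ∀ q', q ≠ some c :: q') :
    ∑ m ∈ Finset.range ((p ++ none :: q).length + 1),
      ∑ a, delS k w y ((p ++ none :: q).take m) a ((p ++ none :: q).drop m) =
    ∑ a, delS k w y p a (none :: q) + ∑ a, delS k w y (p ++ [none]) a q := by
  have hbad : ∀ {r c v}, p = r ++ [some c] → q = some c :: v → False := by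
    grind [List.append_inj_right']
  rw [Finset.sum_eq_add p.length (p.length + 1) (by omega)]
  · have h1 : (p ++ none :: q).take (p.length + 1) = p ++ [none] := by simp [List.take_append]
    aesop
  · intro m hm hne
    refine Finset.sum_eq_zero fun a _ => delS_eq_zero k w y fun h => ?_
    rcases lt_or_ge m _ with hlt | hge
    · rw [List.take_append_of_le_length hlt.le, List.drop_append_of_le_length hlt.le] at h
      obtain ⟨c, u', v', h1, h2⟩ := FullL.eq_of_split (u := p.take m ++ some a :: p.drop m)
        (by simpa using h)
      rcases List.eq_nil_or_concat' (p.drop m) with h3 | ⟨r, s, h3⟩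
      · simp at h3; omega
      · rw [h3, ← List.cons_append, ← List.append_assoc] at h1
        have h4 := List.append_inj_right' h1 rfl
        refine hbad (r := p.take m ++ r) ?_ h2
        grind [List.take_append_drop]
    · have hlt : p.length + 1 < m := by omega
      obtain ⟨i, rfl⟩ := Nat.exists_eq_add_of_lt hlt
      have e1 : (p ++ none :: q).take (p.length + 1 + i + 1) = p ++ none :: q.take (i + 1) := by
        rw [List.take_append, List.take_of_length_le (by omega)]
        simp [show p.length + 1 + i + 1 - p.length = i + 1 + 1 by omega]
      have e2 : (p ++ none :: q).drop (p.length + 1 + i + 1) = q.drop (i + 1) := by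
        rw [List.drop_append, List.drop_eq_nil_of_le (by omega)]
        simp [show p.length + 1 + i + 1 - p.length = i + 1 + 1 by omega]
      rw [e1, e2] at h
      obtain ⟨c, u', v', h1, h2⟩ := FullL.eq_of_split
        (by simpa using h)
      rcases q with _ | ⟨s, q⟩
      · simp at hm; omega
      aesop
  · intro h
    simp at h
  grind

open Classical in
/-- The contribution of the insertions of a free input. -/
lemma sum_ins_bad (hb : p = [] ∨ ∃ p' c, p = p' ++ [some c] ∧ ∀ q', q ≠ some c :: q')
    (h0 : p ++ q ≠ []) :
    (∑ i ∈ Finset.range (nones (p ++ q) + 2), if ins i (p ++ q) = p ++ none :: q then (-1) ^ i else 0) *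
      colS k w y (p ++ q) = ∑ m ∈ Finset.range ((p ++ none :: q).length + 1),
      ∑ a, delS k w y ((p ++ none :: q).take m) a ((p ++ none :: q).drop m) := by
  rw [sum_delS_bad k w y hb]
  by_cases hc : Col w (p ++ q)
  · have hf := hc.fullL
    have hone : ∀ i, i < nones (p ++ q) + 2 → ins i (p ++ q) = p ++ none :: q →
        (∑ i ∈ Finset.range (nones (p ++ q) + 2), if ins i (p ++ q) = p ++ none :: q then (-1 : k) ^ i else 0) =
          (-1) ^ i := by
      intro i hi he
      rw [Finset.sum_eq_single i, if_pos he]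
      · grind [FullL.ins_inj]
      grind
    rcases hb with rfl | ⟨p', c, rfl, hq⟩
    · obtain ⟨b, q', rfl⟩ := hf.eq_cons h0
      have h2 : ∑ a, delS k w y ([] ++ [none]) a (some b :: q') = 0 :=
        Finset.sum_eq_zero fun a _ => delS_eq_zero k w y fun h => by cases h
      rw [hone 0 (by omega) (ins_zero _), sum_delS_left_letter, h2, nones_nil, Nat.cast_zero]
      simp [sg]
    · have hr := sum_delS_right_letter k w y (p := p') (q := q) c
      have e1 : p' ++ [some c, none] = p' ++ [some c] ++ [none] := by simp
      have e2 : p' ++ some c :: q = p' ++ [some c] ++ q := by simp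
      rw [e1, e2] at hr
      rw [hr]
      by_cases hq' : ∃ b q', q = some b :: q'
      · obtain ⟨b, q', rfl⟩ := hq'
        rw [sum_delS_left_letter, Finset.sum_eq_zero]
        · ring
        · intro i _
          refine if_neg fun he => (hf.ins_eq he (.inr ⟨p', c, rfl, hq⟩)).2 (by simp) b q' rfl
      · rw [sum_delS_left k w y fun b q' e => hq' ⟨b, q', e⟩, hone (nones _ + (0 + 1)), sg_natCast]
        · ring
        · grind [nones_append]
        · rw [ins_append]
          rcases q with _ | ⟨_ | b, q⟩
          · rfl
          · rw [ins, ins_zero]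
          grind
  have hz : colS k w y (p ++ q) = 0 := if_neg hc
  rw [hz, mul_zero]
  have h1 : ∑ a, delS k w y p a (none :: q) = 0 := by
    by_cases hq' : ∃ b q', q = some b :: q'
    · obtain ⟨b, q', rfl⟩ := hq'
      rw [sum_delS_left_letter, hz, mul_zero]
    simp_all [sum_delS_left]
  have h2 : ∑ a, delS k w y (p ++ [none]) a q = 0 := by
    rcases hb with rfl | ⟨p', c, rfl, hq⟩
    · exact Finset.sum_eq_zero fun a _ => delS_eq_zero k w y fun h => by cases h
    simp_all [sum_delS_right_letter]
  rw [h1, h2, add_zero]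

end Boundary

section Good

variable {n : ℕ} (k : Type u) [CommRing k]

lemma run_split {a : Fin n} (h : run a s = u ++ v)
    (hu : u ≠ []) (hv : v ≠ []) : (∃ u', u = u' ++ [none]) ∨ ∃ v', v = none :: v' := by
  induction s generalizing u with
  | zero =>
    rw [run_zero] at h
    have h1 := congrArg List.length h
    grind [List.length_pos_iff]
  | succ s ih =>
    rw [run_succ] at h
    rcases u with _ | ⟨s1, _ | ⟨s2, u⟩⟩
    · exact (hu rfl).elim
    · grind
    · simp at h
      obtain ⟨rfl, rfl, h⟩ := h
      by_cases hu' : u = []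
      · subst hu'
        exact .inl ⟨[some a], rfl⟩
      grind

lemma unrun_split {σ : List (Fin n × ℕ)} (h : unrun σ = u ++ v)
    (hu : ∀ u', u ≠ u' ++ [none]) (hv : ∀ v', v ≠ none :: v') :
    ∃ j ≤ σ.length, u = unrun (σ.take j) := by
  induction σ generalizing u with
  | nil => exact ⟨0, le_rfl, (List.append_eq_nil_iff.1 h.symm).1⟩
  | cons p σ ih =>
    obtain ⟨a, s⟩ := p
    by_cases hu0 : u = []
    · exact ⟨0, by simp, hu0⟩
    · rcases List.append_eq_append_iff.1 h with ⟨r, rfl, h4⟩ | ⟨r, h3, h4⟩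
      · obtain ⟨j, hj, rfl⟩ := ih h4 fun u' e => hu (run a s ++ u') (by aesop)
        exact ⟨j + 1, by simpa using hj, by aesop⟩
      · by_cases hr : r = []
        · exact ⟨1, by simp, by grind [unrun_cons, unrun_nil]⟩
        grind [run_split]

lemma length_unrun_take_lt {σ : List (Fin n × ℕ)} (hij : i < j) (hj : j ≤ σ.length) :
    (unrun (σ.take i)).length < (unrun (σ.take j)).length := by
  grind [Nat.exists_eq_add_of_lt, length_unrun, unrun_append]

open Classical in
lemma Word.boundary_apply (W V : Word n) : W.boundary k V = ∑ j ∈ Finset.range W.1.length,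
    ((W.delSign j : ℤ) : k) * if W.1.eraseIdx j = V.1 then 1 else 0 := by
  have h1 : W.boundary k V = ∑ j ∈ Finset.range _, (W.delSign j • W.del k j) V :=
    Finsupp.finsetSum_apply _ _ _
  have h2 : ∀ j, W.del k j V = if W.1.eraseIdx j = V.1 then 1 else 0 := by
    intro j
    rw [Word.del]
    split_ifs with h3 h4 h4
    · have : ⟨W.1.eraseIdx j, h3⟩ = V := Subtype.ext h4
      grind
    · grind
    · grind
    · rfl
  grind [Units.smul_def, Finsupp.smul_apply]

variable {W V : Word n} {σ : List (Fin n × ℕ)} (y : List (Option (Fin n)))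

lemma sum_delS_unrun : ∑ m ∈ Finset.range ((unrun σ).length + 1),
    ∑ a, delS k W.1 y ((unrun σ).take m) a ((unrun σ).drop m) = ∑ j ∈ Finset.range (σ.length + 1),
      ∑ a, delS k W.1 y (unrun (σ.take j)) a (unrun (σ.drop j)) := by
  have hs : ∀ j, unrun σ = unrun _ ++ unrun (σ.drop j) := fun j => by
    rw [← unrun_append, List.take_append_drop]
  symm
  refine Finset.sum_of_injOn (fun j => (unrun (σ.take j)).length) ?_ ?_ ?_ ?_
  · intro i hi j hj e
    simp at hi hj e
    rcases lt_trichotomy i j with h | h | h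
    · exact absurd e (length_unrun_take_lt h (by omega)).ne
    · exact h
    · exact absurd e (length_unrun_take_lt h (by omega)).ne'
  · intro j _
    grind
  · intro m hm hm'
    refine Finset.sum_eq_zero fun a _ => if_neg fun h => hm' ?_
    obtain ⟨hX, hf, -⟩ := (col_iff W.2).1 h
    have hz : unrun σ = (unrun σ).take m ++ (unrun σ).drop m := (List.take_append_drop _ _).symm
    have hzf : FullL ((unrun σ).take m ++ (unrun σ).drop m) := by
      grind [fullL_iff]
    obtain ⟨j, hj, hj'⟩ := unrun_split hz
      (by
        intro u' hu
        rw [hu, List.append_assoc] at hzf hf hX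
        obtain ⟨c, u₁, v₁, h1, h2⟩ := hzf.eq_of_split
        obtain ⟨c', u₂, v₂, h3, h4⟩ := FullL.eq_of_split (v := some a :: (unrun σ).drop m) hf
        have h5 := List.append_inj_right' (h1.symm.trans h3) rfl
        have h2' : (unrun σ).drop m = some c :: v₁ := h2
        refine hX.no_rep a ⟨u' ++ [none], v₁, ?_⟩
        grind)
      (by
        intro v' hv
        rw [hv] at hzf hf hX
        obtain ⟨c, u₁, v₁, h1, h2⟩ := hzf.eq_of_split
        obtain ⟨c', u₂, v₂, h3, h4⟩ := FullL.eq_of_split (u := (unrun σ).take m ++ [some a])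
          (by simpa using hf)
        have h5 := List.append_inj_right' h3 rfl
        refine hX.no_rep a ⟨u₁, none :: v', ?_⟩
        grind)
    grind
  grind

open Classical in
lemma sum_delS_eq (hm : ∀ a, some a ∈ unrun σ) j (hj : j ≤ σ.length)
    (hl : W.1.length = σ.length + 1) :
    ∑ a, delS k W.1 y (unrun (σ.take j)) a (unrun (σ.drop j)) =
      - sg k (inv (lam (unrun σ) y)) * (((W.delSign j : ℤ) : k) * if W.1.eraseIdx j = σ.map Prod.fst then 1 else 0) := by
  have hcol : ∀ a, Col W.1 (unrun (σ.take j) ++ some a :: unrun (σ.drop j)) ↔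
      W.1 = (σ.take j).map Prod.fst ++ a :: (σ.drop j).map Prod.fst := by
    intro a
    have e : unrun (σ.take j) ++ some a :: unrun (σ.drop j) = unrun (σ.take j ++ (a, 0) :: σ.drop j) := by
      rw [unrun_append, unrun_cons, run_zero']
    grind [col_iff, wd_unrun_of_isTrav, col_unrun]
  have hjl : ((σ.take j).map Prod.fst).length = j := by simp [hj]
  have hs : σ.map Prod.fst = (σ.take j).map Prod.fst ++ (σ.drop j).map Prod.fst := by
    aesop
  have hu : unrun σ = unrun (σ.take j) ++ unrun (σ.drop j) := by
    rw [← unrun_append, List.take_append_drop]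
  by_cases he : W.1.eraseIdx j = σ.map Prod.fst
  · have hW : W.1 = (σ.take j).map Prod.fst ++ W.1[j] :: (σ.drop j).map Prod.fst := by
      grind [List.getElem_cons_drop, List.take_append_drop, List.append_inj]
    rw [Finset.sum_eq_single _, delS, if_pos ((hcol _).2 hW)]
    · grind [sg_tog_eq]
    · intro a _ hne
      refine if_neg fun h => hne ?_
      grind
    · simp
  rw [Finset.sum_eq_zero]
  · grind
  · intro a _
    refine if_neg fun h => he ?_
    rw [(hcol a).1 h, hs, List.eraseIdx_append_of_length_le hjl.le, hjl, Nat.sub_self]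
    rfl

/-- The contribution of the colourings whose free inputs lie between occurrences of a letter. -/
lemma sum_delS_good (hm : ∀ a, some a ∈ unrun σ)
    (hV : V.1 = σ.map Prod.fst) : ∑ m ∈ Finset.range ((unrun σ).length + 1),
    ∑ a, delS k W.1 y ((unrun σ).take m) a ((unrun σ).drop m) =
      - sg k (inv (lam (unrun σ) y)) * W.boundary k V := by
  rw [sum_delS_unrun k y, Word.boundary_apply, hV]
  by_cases hl : W.1.length = σ.length + 1
  · rw [hl, Finset.mul_sum]
    grind [Finset.sum_congr, sum_delS_eq]
  · rw [Finset.sum_eq_zero, Finset.sum_eq_zero, mul_zero]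
    · grind [List.length_eraseIdx_of_lt]
    · intro j hj
      refine Finset.sum_eq_zero fun a _ => if_neg fun h => hl ?_
      have e : unrun (σ.take j) ++ some a :: unrun (σ.drop j) = unrun (σ.take j ++ (a, 0) :: σ.drop j) := by
        rw [unrun_append, unrun_cons, run_zero']
      grind [col_iff, wd_unrun_of_isTrav]

end Good

section Differential

variable {n : ℕ} {k : Type u} [CommRing k]

lemma phi_single W (J : NSOp n) X :
    phiF k (Finsupp.single (W, J.tree) 1) (X, J) = colS k W.1 J.list X.list := by
  classical
  rw [phi_apply]
  by_cases h : Col W.1 X.list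
  · obtain ⟨h1, h2, h3⟩ := (col_iff W.2).1 h
    have hs : PatchPair.shape (X, J) = (W, J.tree) := Prod.ext (Subtype.ext h3) rfl
    rw [if_pos h2, hs, Finsupp.single_eq_same, mul_one, colS, if_pos h]
    rfl
  rw [colS, if_neg h]
  refine ite_eq_right_iff.2 fun h2 => ?_
  rw [Finsupp.single_eq_of_ne, mul_zero]
  intro hs
  exact h ((col_iff W.2).2 ⟨X.isTrav, h2, congrArg (·.1.1) hs⟩)

lemma phi_single_of_ne (W : Word n) (h : Z.2.tree ≠ T) :
    phiF k (Finsupp.single (W, T) 1) Z = 0 := by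
  classical
  rw [phi_apply]
  refine ite_eq_right_iff.2 fun h2 => ?_
  rw [Finsupp.single_eq_of_ne, mul_zero]
  intro hs
  exact h (congrArg (·.2) hs)

lemma count_er {a : Fin n} (ht : t < l.count (some a)) :
    (er a t l).count (some a) + 1 = l.count (some a) := by
  induction l generalizing t with
  | nil => simp at ht
  | cons s l ih =>
    by_cases hs : s = some a
    · subst hs
      rcases t with _ | t
      · rw [er_self_zero, List.count_cons_self]
      grind [er_self_succ]
    grind [er_of_ne]

lemma bel_lam Z (a : Fin n) : bel a Z.lam = below a Z := by
  rw [bel, below, Int.cast_sum]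
  refine Finset.sum_congr rfl fun j _ => ?_
  rw [Z.tot_lam]
  split_ifs <;> simp

/-- The right part of the differential of a colouring. -/
lemma sum_rightD_phi_single (W : Word n) Z :
    (∑ a, rightD k a (hat (phiF k (Finsupp.single (W, Z.2.tree) 1)))) Z =
      ∑ m ∈ Finset.range (Z.1.list.length + 1), ∑ a,
        delS k W.1 Z.2.list (Z.1.list.take m) a (Z.1.list.drop m) := by
  classical
  rw [Finset.sum_apply, Finset.sum_comm]
  refine Finset.sum_congr rfl fun a _ => ?_
  have h1 : rightD k a (hat (phiF k (Finsupp.single (W, Z.2.tree) 1))) Z = _ :=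
    comp_pairD rfl a _ Z
  rw [h1]
  have h2 : ∀ X ∈ ofLength n (Z.1.list.length + 1), (∑ t ∈ Finset.range (X.color a + 1),
      if 0 < X.color a ∧ er a t X.list = Z.1.list then (-1) ^ t * (eps k (below a (X, Z.2)) *
        hat (phiF k (Finsupp.single (W, Z.2.tree) 1)) (X, Z.2)) else 0) =
      ∑ m ∈ Finset.range (Z.1.list.length + 1),
        if X.list = Z.1.list.take m ++ some a :: Z.1.list.drop m then
          (-1) ^ (Z.1.list.take m).count (some a) * (eps k (below a (X, Z.2)) *
            hat (phiF k (Finsupp.single (W, Z.2.tree) 1)) (X, Z.2)) else 0 := by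
    intro X _
    rw [← X.count_list, ← sum_er (G := fun t =>
      (-1) ^ t * (eps k _ * hat _ _))]
    grind [Finset.sum_congr, count_er, MNSOp.count_list]
  rw [Finset.sum_congr rfl h2, Finset.sum_comm]
  refine Finset.sum_congr rfl fun m hm => ?_
  generalize hu : Z.1.list.take m = u
  generalize hv : Z.1.list.drop m = v
  by_cases hX : Col W.1 (u ++ some a :: v)
  · obtain ⟨ht, hf, hw⟩ := (col_iff W.2).1 hX
    obtain ⟨X, hXl⟩ := MNSOp.exists_list Z.2.pos ht fun b => (hX.mem_iff b).2 (W.2.1 b)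
    rw [Finset.sum_eq_single X, if_pos hXl, delS, if_pos hX, hat_apply, phi_single, colS, hXl, if_pos hX]
    · have hs : PatchPair.shape (X, Z.2) = (W, Z.2.tree) :=
        Prod.ext (Subtype.ext ((congrArg wd hXl).trans hw)) rfl
      have h3 : PatchPair.deg (X, Z.2) = W.deg := by
        grind [deg_shape]
      have h4 : W.deg = size (fl 0 (u ++ some a :: v)) := by
        rw [← Word.sum_itp Z.2.pos, size]
        grind [tot_fl, itp_wd]
      have h5 : below a (X, Z.2) = bel a (lam (u ++ some a :: v) Z.2.list) := by
        rw [← bel_lam, PatchPair.lam, hXl]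
      grind [eps_eq_sg, sg_natCast, sg_add, inv_tog]
    · grind [MNSOp.list_injective]
    grind [mem_ofLength]
  grind [Finset.sum_eq_zero, hat_apply, phi_single, delS, colS]

lemma leftD_phi_single W Z :
    leftD k n (phiF k (Finsupp.single (W, Z.2.tree) 1)) Z =
      ∑ Y ∈ ofLength n (Z.1.list.length - 1), ∑ i ∈ Finset.range (Y.out + 2),
        if ins i Y.list = Z.1.list then (-1) ^ i * colS k W.1 Z.2.list Y.list else 0 := by
  have h1 : leftD k n (phiF k (Finsupp.single (W, Z.2.tree) 1)) Z = _ := pairD_comp _ _ Z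
  grind [phi_single]

lemma pairDiff_phi_single W Z :
    pairDiff k n (phiF k (Finsupp.single (W, Z.2.tree) 1)) Z = open Classical in
      if FullL Z.1.list then sg k (inv Z.lam) * W.boundary k Z.shape.1 else 0 := by
  classical
  rw [pairDiff_apply, Pi.sub_apply, sum_rightD_phi_single, leftD_phi_single]
  by_cases hf : FullL Z.1.list
  · rw [if_pos hf, Finset.sum_eq_zero]
    · obtain ⟨σ, hσ⟩ := fullL_iff.1 hf
      have ht := Z.1.isTrav
      have hm := Z.1.mem_list
      have hV : Z.shape.1.1 = σ.map Prod.fst := by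
        rw [hσ] at ht
        rw [← wd_unrun_of_isTrav ht, ← hσ]
        rfl
      grind [sum_delS_good, PatchPair.lam]
    · intro Y hY
      have hY0 := List.ne_nil_of_mem (Y.mem_list ⟨0, Z.2.pos⟩)
      grind [Finset.sum_eq_zero, FullL.not_ins]
  rw [if_neg hf, sub_eq_zero]
  obtain ⟨p, q, hz, hb⟩ := exists_bad hf
  by_cases h0 : p ++ q = []
  · obtain ⟨rfl, rfl⟩ := List.append_eq_nil_iff.1 h0
    have := Z.1.mem_list ⟨0, Z.2.pos⟩
    grind
  · rw [hz, ← sum_ins_bad k W.1 Z.2.list hb h0, ← hz]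
    have hcol : ∀ Y : MNSOp n, ∀ i, ins i Y.list = Z.1.list → colS k W.1 Z.2.list Y.list ≠ 0 →
        Y.list = p ++ q := by
      intro Y i h1 h2
      have h3 : Col W.1 Y.list := by
        by_contra h3
        exact h2 (if_neg h3)
      exact (h3.fullL.ins_eq (h1.trans hz) hb).1
    by_cases hY : ∃ Y : MNSOp n, Y.list = p ++ q
    · obtain ⟨Y, hY⟩ := hY
      rw [Finset.sum_eq_single Y]
      · rw [← Y.nones_list, hY, Finset.sum_mul]
        grind
      · intro Y' _ hne
        refine Finset.sum_eq_zero fun i _ => ?_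
        by_contra h
        refine hne (MNSOp.list_injective ((hcol Y' i ?_ ?_).trans hY.symm))
        · grind
        grind
      grind [mem_ofLength]
    · have h1 : colS k W.1 Z.2.list (p ++ q) = 0 := by
        refine if_neg fun h => hY ?_
        exact MNSOp.exists_list Z.2.pos ((col_iff W.2).1 h).1 fun a => (h.mem_iff a).2 (W.2.1 a)
      grind [Finset.sum_eq_zero]

/-- The differential of `F₂S ⊗ Brace`. -/
def fsD (x : FSBraceObj k n) : FSBraceObj k n :=
  x.sum fun Q a => a • (Q.1.boundary k).mapDomain fun W => (W, Q.2)

lemma phi_mapDomain (x : Word n →₀ k) T Z :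
    phiF k (x.mapDomain fun W => (W, T)) Z = open Classical in
      if FullL Z.1.list ∧ Z.2.tree = T then sg k (inv Z.lam) * x Z.shape.1 else 0 := by
  classical
  rw [phi_apply]
  by_cases hf : FullL Z.1.list
  · rw [if_pos hf]
    by_cases hT : Z.2.tree = T
    · subst hT
      rw [if_pos ⟨hf, rfl⟩]
      congr 1
      exact Finsupp.mapDomain_apply
        (fun _ _ h => (Prod.mk.inj h).1) x _
    rw [if_neg fun h => hT h.2, Finsupp.mapDomain_of_notMem_range, mul_zero]
    rintro ⟨W, hW⟩
    exact hT (congrArg (·.2) hW).symm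
  grind

lemma phi_d x : phiF k (fsD x) = pairDiff k n (phiF k x) := by
  classical
  induction x using Finsupp.induction_linear with
  | zero => simp [fsD]
  | add x y hx hy =>
    simp_all [Finsupp.sum_add_index', add_smul, fsD]
  | single Q a =>
    obtain ⟨W, T⟩ := Q
    have h1 : fsD (Finsupp.single (W, T) a) = a • (W.boundary k).mapDomain _ :=
      Finsupp.sum_single_index (zero_smul k _)
    have h2 : Finsupp.single (W, T) a = a • Finsupp.single (W, T) 1 := by
      aesop
    rw [h1, h2, map_smul, map_smul, map_smul]
    congr 1
    funext Z
    by_cases hT : Z.2.tree = T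
    · subst hT
      rw [pairDiff_phi_single, phi_mapDomain]
      simp
    rw [phi_mapDomain, if_neg fun h => hT h.2, pairDiff_apply, Pi.sub_apply, Finset.sum_apply]
    have h3 : leftD k n (phiF k (Finsupp.single (W, T) 1)) Z = _ := pairD_comp _ _ Z
    have h4 : ∀ a, rightD k a (hat (phiF k (Finsupp.single (W, T) 1))) Z = _ :=
      fun a => comp_pairD rfl a _ Z
    grind [hat_apply, phi_single_of_ne, Finset.sum_const_zero]

end Differential

section Quilts

variable {k : Type u} [CommRing k] {n m r : ℕ}

lemma mem_quilt_iff {x : FSBraceObj k n} :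
    x ∈ Quilt k n ↔ ∀ Z, phiF k x Z ≠ 0 → Z.IsPatch := by
  have h1 : Quilt k n = Finsupp.supported k k {Q : Word n × PTree n | IsQuilt Q.1 Q.2} := by
    rw [Finsupp.supported_eq_span_single, Quilt]
    congr 1
    ext x
    constructor
    · rintro ⟨W, T, h, rfl⟩
      exact ⟨(W, T), h, rfl⟩
    rintro ⟨⟨W, T⟩, h, rfl⟩
    grind
  have h2 : x ∈ Quilt k n ↔ ∀ Q, x Q ≠ 0 → IsQuilt Q.1 Q.2 := by
    rw [h1]
    refine (Finsupp.mem_supported k x).trans ⟨fun h Q hQ => h (Finsupp.mem_support_iff.2 hQ),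
      fun h Q hQ => h Q (Finsupp.mem_support_iff.1 hQ)⟩
  rw [h2]
  constructor
  · grind [isQuilt_shape, phi_ne_zero_iff]
  intro h Q hQ
  obtain ⟨Z, hZ, rfl⟩ := exists_shape Q
  grind [isQuilt_shape, phi_ne_zero_iff]

lemma mem_fsGr_iff {x : FSBraceObj k n} :
    x ∈ (FSBrace k).gr n e ↔ ∀ Z, phiF k x Z ≠ 0 → Z.deg = e := by
  constructor
  · intro h Z hZ
    obtain ⟨h1, h2⟩ := (phi_ne_zero_iff x Z).1 hZ
    rw [← deg_shape h1]
    exact h _ h2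
  intro h Q hQ
  obtain ⟨Z, hZ, rfl⟩ := exists_shape Q
  grind [deg_shape, phi_ne_zero_iff]

lemma quilt_le_iSup : Quilt k n ≤ ⨆ e, (Quilt k n ⊓ (FSBrace k).gr n e) := by
  refine Submodule.span_le.2 ?_
  rintro _ ⟨W, T, h, rfl⟩
  refine le_iSup (fun e => Quilt k n ⊓ (FSBrace k).gr n e) W.deg ⟨Submodule.subset_span ⟨W, T, h, rfl⟩, ?_⟩
  intro Q hQ
  grind [Finsupp.single_eq_of_ne]

lemma phi_mem {x : FSBraceObj k n} (hx : x ∈ Quilt k n) : phiF k x ∈ patchSub k n := by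
  have h : Quilt k n ≤ (patchSub k n).comap (phiF k) := by
    refine quilt_le_iSup.trans (iSup_le fun e => ?_)
    rintro x ⟨h1, h2⟩
    exact mem_patchS_of (mem_quilt_iff.1 h1) (mem_fsGr_iff.1 h2)
  exact h hx

lemma NSOp.isId_of_one (J : NSOp 1) : J.IsId := by
  have key : ∀ t : Term (Fin 1), t.NoMul → t.count 0 = 0 → t = .leaf := by
    intro t
    cases t with
    | leaf => exact fun _ _ => rfl
    | node a q c =>
      grind [Term.count]
    | mul l r => exact fun h => h.elim
  obtain ⟨t, ⟨h1, h2⟩, h3⟩ := J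
  cases t with
  | leaf => exact (h1 rfl).elim
  | node a q c =>
    obtain rfl : a = 0 := Subsingleton.elim a 0
    have h4 := h2 0
    rw [Term.count, if_pos rfl] at h4
    have h6 : c = fun _ => .leaf := by
      aesop
    subst h6
    exact ⟨q, rfl⟩
  | mul l r => exact h3.elim

lemma word_one_eq {w : List (Fin 1)} (h : IsFSWord w) : w = [0] := by
  rcases w with _ | ⟨a, _ | ⟨b, w⟩⟩
  · exact absurd (h.1 0) (by simp)
  · aesop
  rw [Subsingleton.elim a b] at h
  exact (h.2.1 b ⟨[], w, rfl⟩).elim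

lemma MNSOp.isId_iff_fullL (X : MNSOp 1) : X.IsId ↔ FullL X.list := by
  rw [MNSOp.isId_iff]
  constructor
  · rintro ⟨q, hq⟩
    exact fullL_iff.2 ⟨[(0, q)], by rw [hq, unrun_cons, unrun_nil, List.append_nil]⟩
  intro h
  have ht := X.isTrav
  have hw := isFSWord_wd X.isTrav X.mem_list
  obtain ⟨σ, hσ⟩ := fullL_iff.1 h
  rw [hσ] at hw ht
  rw [wd_unrun_of_isTrav ht] at hw
  have := word_one_eq hw
  rcases σ with _ | ⟨⟨a, s⟩, _ | ⟨p, σ⟩⟩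
  · simp at this
  · grind [unrun_cons, unrun_nil]
  · simp at this

lemma phi_one : phiF k (Finsupp.single (Word.one, PTree.one) 1) = pairOne k := by
  classical
  funext Z
  rw [phi_apply, pairOne]
  have h1 : Z.shape = (Word.one, PTree.one) := by
    refine Prod.ext (Subtype.ext ?_) (PTree.ext ?_ ?_)
    · grind [word_one_eq]
    · funext a b
      refine propext ⟨fun h => ?_, fun h => h.elim⟩
      rw [Subsingleton.elim b a] at h
      exact (Z.shape.2.lt_irrefl a h).elim
    funext a b
    refine propext ⟨fun h => ?_, fun h => h.elim⟩
    rw [Subsingleton.elim b a] at h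
    exact (Z.shape.2.left_irrefl a h).elim
  have h2 : inv Z.lam = 0 := by simp [inv]
  rw [h1, h2, Finsupp.single_eq_same]
  by_cases hf : FullL Z.1.list
  · rw [if_pos hf, if_pos ⟨Z.1.isId_iff_fullL.2 hf, Z.2.isId_of_one⟩]
    simp [sg]
  · rw [if_neg hf, if_neg fun h => hf (Z.1.isId_iff_fullL.1 h.1)]

lemma phi_units_smul (e : ℤ) (x : FSBraceObj k n) :
    phiF k (e.negOnePow • x) = e.negOnePow • phiF k x := by
  grind [Units.smul_def]

/-- The action of the symmetric groups on `F₂S ⊗ Brace`. -/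
def fsAct (σ : Equiv.Perm (Fin n)) (x : FSBraceObj k n) : FSBraceObj k n :=
  x.mapDomain fun Q => (Q.1.act σ, Q.2.act σ)

lemma phi_fsAct σ (x : FSBraceObj k n) :
    phiF k (fsAct σ x) = pairAct k σ (phiF k x) := phi_act σ x

lemma phi_fsComp (h : r + 1 = n + m) i x y :
    phiF k (fsComp h i x y) = compL k h i (phiF k x) (phiF k y) := phi_comp x y

section Laws

variable (h : r + 1 = n + m) (i : Fin n) (σ : Equiv.Perm (Fin n)) (a : k) (x x' : FSBraceObj k n)
  (y y' : FSBraceObj k m)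

lemma fsComp_linear_left : fsComp h i (a • x + x') y = a • fsComp h i x y + fsComp h i x' y :=
  phi_injective (by
    simp only [phi_fsComp, map_smul_add _]
    simp_all)

lemma fsComp_linear_right : fsComp h i x (a • y + y') = a • fsComp h i x y + fsComp h i x y' :=
  phi_injective (by grind [phi_fsComp, map_smul_add])

lemma fsAct_linear : fsAct σ (a • x + x') = a • fsAct σ x + fsAct σ x' :=
  phi_injective (by grind [phi_fsAct, map_smul_add])

lemma fsD_linear : fsD (a • x + x') = a • fsD x + fsD x' :=
  phi_injective (by grind [phi_d, map_smul_add])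

lemma fsAct_one : fsAct 1 x = x := phi_injective (by rw [phi_fsAct, pairAct_one])

lemma fsAct_mul τ : fsAct (σ * τ) x = fsAct τ (fsAct σ x) :=
  phi_injective (by grind [phi_fsAct, pairAct_mul])

lemma fsD_fsD : fsD (fsD x) = 0 :=
  phi_injective (by grind [phi_d, pairDiff_pairDiff])

lemma fsD_fsAct : fsD (fsAct σ x) = fsAct σ (fsD x) :=
  phi_injective (by grind [phi_d, phi_fsAct, pairDiff_pairAct])

lemma fsOne_comp h : fsComp h 0 (Finsupp.single (Word.one, PTree.one) 1) y = y :=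
  phi_injective (by grind [phi_comp, phi_one, pairOne_comp])

lemma fsComp_one h : fsComp h i x (Finsupp.single (Word.one, PTree.one) 1) = x :=
  phi_injective (by grind [phi_comp, phi_one, comp_pairOne])

lemma fsComp_assoc (h₂ : t + 1 = r + l) (h₃ : s + 1 = m + l) h₄
    j z :
    fsComp h₂ (inner h i j) (fsComp h i x y) z = fsComp h₄ i x (fsComp h₃ j y z) :=
  phi_injective (by grind [phi_fsComp, compL_assoc])

end Laws

section Membership

variable {x : FSBraceObj k n} {y : FSBraceObj k m} {e f : ℤ}

lemma fsComp_mem h i (hx : x ∈ Quilt k n) (hy : y ∈ Quilt k m) :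
    fsComp h i x y ∈ Quilt k r :=
  mem_quilt_iff.2 (by
    rw [phi_comp]; grind [comp_isPatch, mem_quilt_iff])

lemma fsComp_gr h i (hx : x ∈ (FSBrace k).gr n e)
    (hy : y ∈ (FSBrace k).gr m f) : fsComp h i x y ∈ (FSBrace k).gr r (e + f) :=
  mem_fsGr_iff.2 (by
    rw [phi_comp]; grind [comp_homogeneous, mem_fsGr_iff])

lemma fsAct_mem σ (hx : x ∈ Quilt k n) : fsAct σ x ∈ Quilt k n :=
  mem_quilt_iff.2 (by
    rw [phi_fsAct]; exact (patchS_le (pairAct_mem σ (phi_mem hx))).1)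

lemma fsAct_gr σ (hx : x ∈ (FSBrace k).gr n e) :
    fsAct σ x ∈ (FSBrace k).gr n e :=
  mem_fsGr_iff.2 (by
    rw [phi_fsAct]; exact pairAct_homogeneous (mem_fsGr_iff.1 hx))

lemma fsD_mem (hx : x ∈ Quilt k n) : fsD x ∈ Quilt k n :=
  mem_quilt_iff.2 (by
    rw [phi_d]; exact (patchS_le (pairDiff_mem (phi_mem hx))).1)

lemma fsD_gr (hx : x ∈ (FSBrace k).gr n e) : fsD x ∈ (FSBrace k).gr n (e - 1) :=
  mem_fsGr_iff.2 (by
    rw [phi_d]; exact pairDiff_homogeneous (mem_fsGr_iff.1 hx))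

lemma fsOne_gr : Finsupp.single (Word.one, PTree.one) 1 ∈ (FSBrace k).gr 1 0 :=
  mem_fsGr_iff.2 (by rw [phi_one]; exact pairOne_homogeneous)

end Membership

lemma fsComp_assoc_par h₁ (h₂ : t + 1 = r + l) (h₃ : s + 1 = n + l)
    h₄ i j hij x {y : FSBraceObj k m}
    (hy : y ∈ (FSBrace k).gr m e) {z : FSBraceObj k l} (hz : z ∈ (FSBrace k).gr l f) :
    fsComp h₂ (outer h₁ i j hij.symm) (fsComp h₁ i x y) z =
      (e * f).negOnePow • fsComp h₄ (outer h₃ j i hij) (fsComp h₃ j x z) y :=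
  phi_injective (by
    grind [phi_units_smul, phi_fsComp, compL_comm, mem_fsGr_iff])

lemma fsComp_fsAct (h : r + 1 = n + m) i σ τ
    ρ (h1 : ∀ b, ρ (inner h i b) = inner h (σ i) (τ b))
    (h2 : ∀ c hc, ρ (outer h i c hc) = outer h (σ i) (σ c) (fun e => hc (σ.injective e)))
    (x : FSBraceObj k n) y :
    fsComp h i (fsAct σ x) (fsAct τ y) = fsAct ρ (fsComp h (σ i) x y) :=
  phi_injective (by
    grind [phi_fsComp, phi_fsAct, compL_act])

lemma fsD_fsComp (h : r + 1 = n + m) i {x : FSBraceObj k n}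
    (hx : x ∈ (FSBrace k).gr n e) y :
    fsD (fsComp h i x y) = fsComp h i (fsD x) y + e.negOnePow • fsComp h i x (fsD y) :=
  phi_injective (by
    grind [phi_units_smul, phi_fsComp, phi_d, pairDiff_comp_homogeneous, mem_fsGr_iff])

lemma isDGOperad_quilt : IsDGOperad (FSBrace k) (Quilt k) where
  iSup_gr n := le_antisymm (iSup_le fun _ => inf_le_left) quilt_le_iSup
  indep_gr n := iSupIndep_of_support (k := k) (M := FSBraceObj k n) (fun Q => Finsupp.lapply Q)
    (fun x hx => Finsupp.ext hx) (fun Q => Q.1.deg) _ fun e x hx Q hQ => hx.2 Q hQ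
  one_mem := mem_quilt_iff.2 fun Z _ => isPatch_one Z
  one_gr := fsOne_gr
  comp_mem h i x hx y hy := fsComp_mem h i hx hy
  comp_gr h i e f x hx y hy := fsComp_gr h i hx.2 hy.2
  comp_linear_left h i a x _ x' _ y _ := fsComp_linear_left h i a x x' y
  comp_linear_right h i a x _ y _ y' _ := fsComp_linear_right h i a x y y'
  one_comp h x _ := fsOne_comp x h
  comp_one h i x _ := fsComp_one i x h
  assoc_seq h₁ h₂ h₃ h₄ i j x _ y _ z _ := fsComp_assoc h₁ i x y h₂ h₃ h₄ j z
  assoc_par h₁ h₂ h₃ h₄ i j hij e f x _ y hy z hz :=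
    fsComp_assoc_par h₁ h₂ h₃ h₄ i j hij x hy.2 hz.2
  act_mem σ x hx := fsAct_mem σ hx
  act_gr σ e x hx := fsAct_gr σ hx.2
  act_linear σ a x _ x' _ := fsAct_linear σ a x x'
  act_one x _ := fsAct_one x
  act_mul σ τ x _ := fsAct_mul σ x τ
  comp_act h i σ τ ρ h1 h2 x _ y _ := fsComp_fsAct h i σ τ ρ h1 h2 x y
  d_mem x hx := fsD_mem hx
  d_gr e x hx := fsD_gr hx.2
  d_linear a x _ x' _ := fsD_linear a x x'
  d_d x _ := fsD_fsD x
  d_act σ x _ := fsD_fsAct σ x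
  d_comp h i e x hx y _ := fsD_fsComp h i hx.2 y

/-- The colouring map is a morphism of dg operads. -/
lemma isDGOperadHom_phi : IsDGOperadHom (FSBrace k) (Quilt k) (PairOp k) (PatchS k) (phi k) where
  map_mem n x hx := phi_mem hx
  map_gr n e x hx := mem_fsGr_iff.1 hx.2
  map_one := phi_one
  map_comp h i x _ y _ := phi_comp x y
  map_act σ x _ := phi_act σ x
  map_d x _ := phi_d x

end Quilts

end QuiltPatch

end

theorem mainTheorem6 (k : Type*) [CommRing k] :
    QuiltPatch.IsDGOperad (QuiltPatch.FSBrace k) (QuiltPatch.Quilt k) ∧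
    QuiltPatch.IsDGOperad (QuiltPatch.PairOp k) (QuiltPatch.PatchS k) ∧
    QuiltPatch.IsDGOperadHom (QuiltPatch.FSBrace k) (QuiltPatch.Quilt k)
      (QuiltPatch.PairOp k) (QuiltPatch.PatchS k) (QuiltPatch.phi k) :=
  ⟨QuiltPatch.isDGOperad_quilt, QuiltPatch.isDGOperad_patchS, QuiltPatch.isDGOperadHom_phi⟩
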